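/- **Theorem (Poisson reduction via $b$-minimal coupling).** Let $(G,H)$ be a $b$-Lie group: $G$ is a finite-dimensional (Hausdorff, second countable) real Lie group and $H\subset G$ is a closed subgroup that is an embedded hypersurface. Let $\mathfrak h$ be the Lie algebra of $H$. For a manifold $M$ with a closed hypersurface $Z$, let ${}^bTM$ be the vector bundle whose sections are the vector fields tangent to $Z$ (the $b$-vector fields), let ${}^bT^*M$ be its dual, with critical hypersurface ${}^bT^*M|_Z$, bundle projection $\tau$, $b$-Liouville form $\langle\lambda_p,v\rangle=\langle p,\tau_*v\rangle$ and canonical form $\omega=-d\lambda$; a $b$-form of degree $2$ is $b$-symplectic if it is closed and nondegenerate on ${}^bTM$, and its Poisson bracket is $\{F,K\}=\omega(X_F,X_K)$ with $\iota_{X_F}\omega=dF$. Let $H$ act on $G$ by left translations, write $\pi:G\to G/H$ for the projection onto the space of orbits $Hg$, regarded as a one-dimensional $b$-manifold with critical hypersurface the point $[e]$, and let $H$ act on ${}^bT^*G$ by $h\cdot\alpha_g=(L_{h^{-1}})^*\alpha_g$. Let $\zeta_g(X)=\frac{d}{dt}|_{t=0}e^{tX}g$ for $X\in\mathfrak h$,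 and let $\mathcal H^\circ=\{\alpha_g\in{}^bT^*G:\alpha_g\circ\zeta_g=0\}$ be the annihilator of the vertical bundle. A principal $H$-$b$-connection is an $\mathfrak h$-valued $b$-form $\theta$ of degree one on $G$ with $\theta(\zeta_g(X))=X$ and $\theta((L_h)_*v)=\mathrm{Ad}_h\theta(v)$. Then: 1. $({}^bT^*G)/H$ is a smooth manifold of dimension $\dim G+1$, and principal $H$-$b$-connections exist. 2. The formula $(\overline\pi\alpha_g)(\pi_*v_g)=\alpha_g(v_g)$ gives a well-defined map $\overline\pi:\mathcal H^\circ\to{}^bT^*(G/H)$ that is a principal $H$-bundle over the two-dimensional manifold ${}^bT^*(G/H)$. Hence the $b$-coadjoint bundle $\mathcal H^\circ\times_H\mathfrak h^*=(\mathcal H^\circ\times\mathfrak h^*)/H$, for the action $h\cdot(\beta,\mu)=((L_{h^{-1}})^*\beta,\mu\circ\mathrm{Ad}_{h^{-1}})$, is an associated bundle over ${}^bT^*(G/H)$. 3. The $b$-Liouville forms of ${}^bT^*G$ and ${}^bT^*(G/H)$ exist, and the canonical forms $\omega_G$ and $\omega_{G/H}$ are $b$-symplectic. 4. There is a Poisson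 structure $P$ on $({}^bT^*G)/H$ for which the projection from ${}^bT^*G$, with the Poisson structure of $\omega_G$, is a Poisson map and such that, for every principal $H$-$b$-connection $\theta$: * the map $\psi_\theta:{}^bT^*G\to\mathcal H^\circ\times\mathfrak h^*$, $\alpha_g\mapsto(\alpha_g-\alpha_g\circ\zeta_g\circ\theta_g,\ \alpha_g\circ\zeta_g)$, is an $H$-equivariant diffeomorphism, and it induces a diffeomorphism $[\psi_\theta]:({}^bT^*G)/H\to\mathcal H^\circ\times_H\mathfrak h^*$; * the form $\omega_\theta=\overline\pi^*\omega_{G/H}-d\lambda^\theta$ on $\mathcal H^\circ\times\mathfrak h^*$, where $\lambda^\theta_{(\alpha_g,\mu)}(v)=\mu(\theta(\tau_*v))$ with $\tau(\alpha_g,\mu)=g$, is $b$-symplectic with critical hypersurface the points over $H$, and $\psi_\theta^*\omega_\theta=\omega_G$; * the Poisson structure of $\omega_\theta$ descends to $\mathcal H^\circ\times_H\mathfrak h^*$, and $P$ is the one and only Poisson structure on $({}^bT^*G)/H$ that is the pull-back of the descended structure along $[\psi_\theta]$. In particular $P$ does not depend on the connection $\theta$. -/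

import Mathlib

open scoped Manifold ContDiff

noncomputable section

namespace BGeom

universe u v w

/-! ### Function algebras

A smooth structure on a set `X` is recorded by the algebra of its smooth real functions. For a
(Hausdorff, second countable) smooth manifold this algebra determines the topology, the atlas, the
vector fields (its derivations) and the smooth maps. -/

section FunctionAlgebras

variable {X : Type u} {Y : Type v}

/-- An algebra of real functions on `X` (the "smooth functions"). -/
abbrev FunAlg (X : Type u) := Subalgebra ℝ (X → ℝ)

/-- The ring of smooth functions `C^∞(X)`. -/
def Fn (C : FunAlg X) : Type u := C

instance (C : FunAlg X) : CommRing (Fn C) := inferInstanceAs (CommRing C)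

instance (C : FunAlg X) : Algebra ℝ (Fn C) := inferInstanceAs (Algebra ℝ C)

instance (C : FunAlg X) : CoeFun (Fn C) (fun _ => X → ℝ) := ⟨fun f => Subtype.val f⟩

/-- A member of the algebra, as a smooth function. -/
def Fn.mk {C : FunAlg X} (f : X → ℝ) (hf : f ∈ C) : Fn C := ⟨f, hf⟩

lemma Fn.mem {C : FunAlg X} (f : Fn C) : (f : X → ℝ) ∈ C := Subtype.property f

@[ext] lemma Fn.ext {C : FunAlg X} {f g : Fn C} (h : ∀ x, f x = g x) : f = g :=
  Subtype.ext (funext h)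

@[simp] lemma Fn.mk_apply {C : FunAlg X} (f : X → ℝ) (hf : f ∈ C) (x : X) : Fn.mk f hf x = f x :=
  rfl

@[simp] lemma Fn.zero_apply {C : FunAlg X} (x : X) : (0 : Fn C) x = 0 := rfl

@[simp] lemma Fn.one_apply {C : FunAlg X} (x : X) : (1 : Fn C) x = 1 := rfl

@[simp] lemma Fn.add_apply {C : FunAlg X} (f g : Fn C) (x : X) : (f + g) x = f x + g x := rfl

@[simp] lemma Fn.sub_apply {C : FunAlg X} (f g : Fn C) (x : X) : (f - g) x = f x - g x := rfl

@[simp] lemma Fn.neg_apply {C : FunAlg X} (f : Fn C) (x : X) : (-f) x = -f x := rfl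

@[simp] lemma Fn.mul_apply {C : FunAlg X} (f g : Fn C) (x : X) : (f * g) x = f x * g x := rfl

@[simp] lemma Fn.smul_apply {C : FunAlg X} (c : ℝ) (f : Fn C) (x : X) : (c • f) x = c * f x := rfl

/-- `φ` is smooth: it pulls smooth functions back to smooth functions. -/
def IsSmooth (CX : FunAlg X) (CY : FunAlg Y) (φ : X → Y) : Prop :=
  ∀ f ∈ CY, f ∘ φ ∈ CX

/-- The pull-back `φ^*` of smooth functions along a smooth map. -/
def pull {CX : FunAlg X} {CY : FunAlg Y} {φ : X → Y} (hφ : IsSmooth CX CY φ) : Fn CY →ₐ[ℝ] Fn CX where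
  toFun f := Fn.mk (f ∘ φ) (hφ f f.mem)
  map_one' := rfl
  map_mul' _ _ := rfl
  map_zero' := rfl
  map_add' _ _ := rfl
  commutes' _ := rfl

/-- `φ` is a diffeomorphism: a bijection that identifies the smooth functions. -/
def IsDiffeo (CX : FunAlg X) (CY : FunAlg Y) (φ : X → Y) : Prop :=
  Function.Bijective φ ∧ ∀ f : Y → ℝ, f ∈ CY ↔ f ∘ φ ∈ CX

/-- The functions that, near each point, are smooth functions of finitely many members of `S`;
the neighbourhoods are those of the coarsest topology that makes the members of `S` continuous. -/
def generated (S : Set (X → ℝ)) : FunAlg X where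
  carrier := {F | ∀ p : X, ∃ (ι : Type) (_ : Fintype ι) (g : ι → X → ℝ) (Φ : (ι → ℝ) → ℝ) (ε : ℝ),
    (∀ i, g i ∈ S) ∧ ContDiff ℝ ∞ Φ ∧ 0 < ε ∧
      ∀ x, (∀ i, |g i x - g i p| < ε) → F x = Φ fun i => g i x}
  mul_mem' := by
    intro a b ha hb p
    obtain ⟨ι, _, g, Φ, ε, hg, hΦ, hε, h⟩ := ha p
    obtain ⟨κ, _, g', Φ', ε', hg', hΦ', hε', h'⟩ := hb p
    refine ⟨ι ⊕ κ, inferInstance, Sum.elim g g',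
      fun v => Φ (fun i => v (Sum.inl i)) * Φ' (fun j => v (Sum.inr j)), min ε ε', ?_, ?_,
      lt_min hε hε', ?_⟩
    · rintro (i | j)
      · exact hg i
      · exact hg' j
    · exact (hΦ.comp (by fun_prop)).mul (hΦ'.comp (by fun_prop))
    · intro x hx
      have h1 := h x fun i => (hx (Sum.inl i)).trans_le (min_le_left _ _)
      have h2 := h' x fun j => (hx (Sum.inr j)).trans_le (min_le_right _ _)
      simp [h1, h2]
  add_mem' := by
    intro a b ha hb p
    obtain ⟨ι, _, g, Φ, ε, hg, hΦ, hε, h⟩ := ha p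
    obtain ⟨κ, _, g', Φ', ε', hg', hΦ', hε', h'⟩ := hb p
    refine ⟨ι ⊕ κ, inferInstance, Sum.elim g g',
      fun v => Φ (fun i => v (Sum.inl i)) + Φ' (fun j => v (Sum.inr j)), min ε ε', ?_, ?_,
      lt_min hε hε', ?_⟩
    · rintro (i | j)
      · exact hg i
      · exact hg' j
    · exact (hΦ.comp (by fun_prop)).add (hΦ'.comp (by fun_prop))
    · intro x hx
      have h1 := h x fun i => (hx (Sum.inl i)).trans_le (min_le_left _ _)
      have h2 := h' x fun j => (hx (Sum.inr j)).trans_le (min_le_right _ _)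
      simp [h1, h2]
  algebraMap_mem' := by
    intro r p
    exact ⟨PEmpty, inferInstance, PEmpty.elim, fun _ => r, 1, fun i => i.elim, contDiff_const,
      one_pos, fun x _ => rfl⟩

/-- The smooth functions on an embedded submanifold, or on an open subset. -/
def restrAlg (C : FunAlg X) (S : Set X) : FunAlg S :=
  generated {F | ∃ f ∈ C, F = fun x : S => f x}

/-- The smooth functions on a product. -/
def prodAlg (CX : FunAlg X) (CY : FunAlg Y) : FunAlg (X × Y) :=
  generated ({F | ∃ f ∈ CX, F = f ∘ Prod.fst} ∪ {F | ∃ f ∈ CY, F = f ∘ Prod.snd})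

/-- The smooth functions on the dual of a finite-dimensional vector space. -/
def dualAlg (V : Type u) [AddCommGroup V] [Module ℝ V] : FunAlg (Module.Dual ℝ V) :=
  generated (Set.range fun (v : V) (μ : Module.Dual ℝ V) => μ v)

/-- The orbit projection of a group action. -/
def orbitMk (K : Type v) [Group K] [MulAction K X] (x : X) : MulAction.orbitRel.Quotient K X :=
  Quotient.mk _ x

/-- The smooth functions on an orbit space: those whose pull-back is smooth. -/
def quotAlg (K : Type v) [Group K] [MulAction K X] (C : FunAlg X) :
    FunAlg (MulAction.orbitRel.Quotient K X) where
  carrier := {f | f ∘ orbitMk K ∈ C}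
  mul_mem' ha hb := C.mul_mem ha hb
  add_mem' ha hb := C.add_mem ha hb
  algebraMap_mem' r := C.algebraMap_mem r

/-- `C` is the algebra of all smooth functions of a Hausdorff, second countable smooth manifold
of dimension `n` with underlying set `X`. -/
def IsManifoldAlg (n : ℕ) (C : FunAlg X) : Prop :=
  ∃ (_ : TopologicalSpace X) (_ : ChartedSpace (EuclideanSpace ℝ (Fin n)) X),
    IsManifold (𝓡 n) ∞ X ∧ T2Space X ∧ SecondCountableTopology X ∧
      ∀ f : X → ℝ, f ∈ C ↔ ContMDiff (𝓡 n) 𝓘(ℝ, ℝ) ∞ f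

/-- `p : P → B` is a (left) principal `K`-bundle: `p` is smooth, surjective and `K`-invariant, and
over a neighbourhood `{u ≠ 0}` of each point of `B` there is an equivariant diffeomorphism of `P`
with `{u ≠ 0} × K`. -/
def IsPrincipalBundle (K : Type w) [Group K] [MulAction K X] (CK : FunAlg K) (CP : FunAlg X)
    (CB : FunAlg Y) (p : X → Y) : Prop :=
  IsSmooth CP CB p ∧ Function.Surjective p ∧ (∀ (k : K) (x : X), p (k • x) = p x) ∧
  ∀ b : Y, ∃ u ∈ CB, u b ≠ 0 ∧ ∃ Ψ : {x : X | u (p x) ≠ 0} → K,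
    (∀ (k : K) (x y : {x : X | u (p x) ≠ 0}), y.1 = k • x.1 → Ψ y = k * Ψ x) ∧
    IsDiffeo (restrAlg CP {x : X | u (p x) ≠ 0}) (prodAlg (restrAlg CB {y : Y | u y ≠ 0}) CK)
      (fun x => ((⟨p x.1, x.2⟩ : {y : Y | u y ≠ 0}), Ψ x))

end FunctionAlgebras

/-! ### `b`-vector fields and `b`-forms, algebraically

`A` is the algebra of smooth functions and `I` the ideal of functions vanishing on the critical
hypersurface. -/

section Algebra

variable (A : Type u) [CommRing A] [Algebra ℝ A] (I : Ideal A)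

/-- The derivations that preserve `I`. For `A = C^∞(M)` and `I` the ideal of the hypersurface `Z`
these are the vector fields tangent to `Z`, that is, the `b`-vector fields. -/
def tangentDer : Submodule A (Derivation ℝ A A) where
  carrier := {D | ∀ f ∈ I, D f ∈ I}
  add_mem' ha hb f hf := I.add_mem (ha f hf) (hb f hf)
  zero_mem' _ _ := I.zero_mem
  smul_mem' c _ hD f hf := I.mul_mem_left c (hD f hf)

/-- The module of `b`-vector fields, i.e. of sections of the `b`-tangent bundle. -/
def BField : Type u := tangentDer A I

instance : AddCommGroup (BField A I) := inferInstanceAs (AddCommGroup (tangentDer A I))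

instance : Module A (BField A I) := inferInstanceAs (Module A (tangentDer A I))

instance : Module ℝ (BField A I) := inferInstanceAs (Module ℝ (tangentDer A I))

variable {A I}

/-- The vector field underlying a `b`-vector field, as a derivation. -/
def BField.der (V : BField A I) : Derivation ℝ A A := V.1

/-- A derivation that preserves `I`, as a `b`-vector field. -/
def BField.mk (D : Derivation ℝ A A) (h : ∀ f ∈ I, D f ∈ I) : BField A I := ⟨D, h⟩

lemma BField.der_mem (V : BField A I) {f : A} (hf : f ∈ I) : V.der f ∈ I := V.2 f hf

@[ext] lemma BField.ext {V W : BField A I} (h : ∀ f, V.der f = W.der f) : V = W :=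
  Subtype.ext (Derivation.ext h)

@[simp] lemma BField.mk_der (D : Derivation ℝ A A) (h : ∀ f ∈ I, D f ∈ I) (f : A) :
    (BField.mk D h).der f = D f := rfl

@[simp] lemma BField.smul_der (c : A) (V : BField A I) (f : A) : (c • V).der f = c * V.der f := rfl

@[simp] lemma BField.rsmul_der (c : ℝ) (V : BField A I) (f : A) : (c • V).der f = c • V.der f := rfl

@[simp] lemma BField.add_der (V W : BField A I) (f : A) : (V + W).der f = V.der f + W.der f := rfl

@[simp] lemma BField.sub_der (V W : BField A I) (f : A) : (V - W).der f = V.der f - W.der f := rfl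

/-- The Lie bracket of `b`-vector fields. -/
def bBr (V W : BField A I) : BField A I :=
  BField.mk ⁅V.der, W.der⁆ fun _ hf =>
    I.sub_mem (V.der_mem (W.der_mem hf)) (W.der_mem (V.der_mem hf))

lemma bBr_der (V W : BField A I) (f : A) :
    (bBr V W).der f = V.der (W.der f) - W.der (V.der f) := rfl

lemma bBr_add_left (V V' W : BField A I) : bBr (V + V') W = bBr V W + bBr V' W := by
  ext f
  simp only [bBr_der, BField.add_der, map_add]
  ring

lemma bBr_add_right (V W W' : BField A I) : bBr V (W + W') = bBr V W + bBr V W' := by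
  ext f
  simp only [bBr_der, BField.add_der, map_add]
  ring

lemma bBr_smul_left (c : A) (V W : BField A I) : bBr (c • V) W = c • bBr V W - W.der c • V := by
  ext f
  simp only [bBr_der, BField.smul_der, BField.sub_der, Derivation.leibniz, smul_eq_mul]
  ring

lemma bBr_smul_right (c : A) (V W : BField A I) : bBr V (c • W) = c • bBr V W + V.der c • W := by
  ext f
  simp only [bBr_der, BField.smul_der, BField.add_der, Derivation.leibniz, smul_eq_mul]
  ring

variable (A I)

/-- `b`-forms of degree one. -/
abbrev BForm1 := BField A I →ₗ[A] A

/-- Bilinear forms on `b`-vector fields; the `b`-forms of degree two are the alternating ones. -/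
abbrev BForm2 := BField A I →ₗ[A] BField A I →ₗ[A] A

variable {A I}

/-- The exterior derivative of a `b`-form of degree one:
`dη(V, W) = V η(W) - W η(V) - η([V, W])`. -/
def extD (η : BForm1 A I) : BForm2 A I :=
  LinearMap.mk₂ A (fun V W => V.der (η W) - W.der (η V) - η (bBr V W))
    (by
      intro V V' W
      simp only [bBr_add_left, map_add, BField.add_der]
      ring)
    (by
      intro c V W
      simp only [bBr_smul_left, map_sub, map_smul, BField.smul_der, smul_eq_mul,
        Derivation.leibniz]
      ring)
    (by
      intro V W W'
      simp only [bBr_add_right, map_add, BField.add_der]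
      ring)
    (by
      intro c V W
      simp only [bBr_smul_right, map_add, map_smul, BField.smul_der, smul_eq_mul,
        Derivation.leibniz]
      ring)

/-- `Ω` is alternating and `dΩ = 0`. -/
def IsClosedForm2 (Ω : BForm2 A I) : Prop :=
  (∀ V, Ω V V = 0) ∧ ∀ U V W, U.der (Ω V W) + V.der (Ω W U) + W.der (Ω U V)
    - Ω (bBr U V) W - Ω (bBr V W) U - Ω (bBr W U) V = 0

variable (A) in
/-- A Poisson structure: a Lie bracket on the smooth functions that is a derivation in each
argument. -/
@[ext] structure PoissonStr where
  /-- the Poisson bracket -/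
  br : A →ₗ[ℝ] A →ₗ[ℝ] A
  self : ∀ f, br f f = 0
  jacobi : ∀ f g h, br f (br g h) + br g (br h f) + br h (br f g) = 0
  leibniz : ∀ f g h, br f (g * h) = br f g * h + g * br f h

/-- `V` is the Hamiltonian `b`-vector field of `F`: `Ω(V, ·) = dF`. -/
def IsHam (Ω : BForm2 A I) (F : A) (V : BField A I) : Prop := ∀ W, Ω V W = W.der F

/-- `P` is the Poisson structure dual to the `b`-symplectic form `Ω`: `{F, K} = Ω(X_F, X_K)`, where
`X_F` is the Hamiltonian `b`-vector field of `F`. -/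
def IsPoissonOf (Ω : BForm2 A I) (P : PoissonStr A) : Prop :=
  ∀ F K, ∃ V W, IsHam Ω F V ∧ IsHam Ω K W ∧ P.br F K = Ω V W

end Algebra

/-! ### `b`-geometry of a pair `(X, Z)` -/

section BObjects

variable {X : Type u} (C : FunAlg X) (Z : Set X)

/-- The ideal of smooth functions vanishing on `Z`. -/
def vanIdeal : Ideal (Fn C) where
  carrier := {f | ∀ z ∈ Z, f z = 0}
  add_mem' := by
    intro a b ha hb z hz
    simp [ha z hz, hb z hz]
  zero_mem' _ _ := rfl
  smul_mem' := by
    intro c a ha z hz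
    simp [ha z hz]

/-- The `b`-vector fields of `(X, Z)`, the sections of `ᵇTX`. -/
abbrev BDer := BField (Fn C) (vanIdeal C Z)

/-- The total space of the `b`-cotangent bundle: a covector at `pt` is a linear functional on the
fibre of `ᵇTX` at `pt`, and this fibre is the quotient of the module of `b`-vector fields by the
multiples of functions vanishing at `pt`. -/
@[ext] structure BCot where
  /-- the base point -/
  pt : X
  /-- the covector, evaluated on (the value at `pt` of) a `b`-vector field -/
  form : BDer C Z →ₗ[ℝ] ℝ
  form_smul : ∀ (f : Fn C) (D : BDer C Z), form (f • D) = f pt * form D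

/-- The smooth functions on the `b`-cotangent bundle, generated by the functions on the base and
the fibrewise linear functions of `b`-vector fields. -/
def cotAlg : FunAlg (BCot C Z) :=
  generated ({F | ∃ f ∈ C, F = fun α => f α.pt} ∪
    {F | ∃ D : BDer C Z, F = fun α => α.form D})

/-- The critical hypersurface `ᵇT^*X|_Z` of the `b`-cotangent bundle. -/
def cotCrit : Set (BCot C Z) := {α | α.pt ∈ Z}

variable {C Z}

/-- A `b`-symplectic form: a closed `b`-form of degree two that is nondegenerate on each fibre
of `ᵇTX`. -/
def IsBSymplectic (Ω : BForm2 (Fn C) (vanIdeal C Z)) : Prop :=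
  IsClosedForm2 Ω ∧ ∀ (p : X) (V : BDer C Z), (∀ W, (Ω V W : Fn C) p = 0) →
    ∀ α : BCot C Z, α.pt = p → α.form V = 0

end BObjects

section BMaps

variable {X : Type u} {Y : Type v}

/-- `φ` is a Poisson map. -/
def IsPoissonMap {CX : FunAlg X} {CY : FunAlg Y} (PX : PoissonStr (Fn CX)) (PY : PoissonStr (Fn CY))
    (φ : X → Y) : Prop :=
  ∃ hφ : IsSmooth CX CY φ, ∀ f g : Fn CY, PX.br (pull hφ f) (pull hφ g) = pull hφ (PY.br f g)

variable {CX : FunAlg X} {ZX : Set X} {CY : FunAlg Y} {ZY : Set Y}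

/-- The `b`-differential of `φ`: the value at `φ x` of the `b`-vector field `W` is `φ_*` of the
value at `x` of the `b`-vector field `V`. Precisely, near `x`, the section `φ_* V - φ^* W` of the
pulled-back bundle `φ^* ᵇTY` is a combination of sections `φ^* D` whose coefficients vanish
at `x`. -/
def BPush (φ : X → Y) (x : X) (V : BDer CX ZX) (W : BDer CY ZY) : Prop :=
  ∃ (hφ : IsSmooth CX CY φ) (s : BDer CY ZY →₀ Fn CX) (u : Fn CX),
    (∀ D, s D x = 0) ∧ u x ≠ 0 ∧
      ∀ f : Fn CY, u * (V.der (pull hφ f) - pull hφ (W.der f)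
        - s.sum fun D c => c * pull hφ (D.der f)) = 0

/-- `Ω' = φ^* Ω` for `b`-forms of degree two. -/
def IsPullback2 (φ : X → Y) (Ω : BForm2 (Fn CY) (vanIdeal CY ZY)) (Ω' : BForm2 (Fn CX) (vanIdeal CX ZX)) : Prop :=
  ∀ (x : X) (V V' : BDer CX ZX), (∃ W : BDer CY ZY, BPush φ x V W) ∧
    ∀ W W' : BDer CY ZY, BPush φ x V W → BPush φ x V' W' →
      Ω' V V' x = Ω W W' (φ x)

/-- `lam` is the `b`-Liouville form on the `b`-cotangent bundle: `⟨lam_α, v⟩ = ⟨α, τ_* v⟩`, where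
`τ` is the bundle projection. The canonical `b`-symplectic form is `-d lam`. -/
def IsBLiouville (lam : BForm1 (Fn (cotAlg CX ZX)) (vanIdeal (cotAlg CX ZX) (cotCrit CX ZX))) : Prop :=
  ∀ (α : BCot CX ZX) (V : BDer (cotAlg CX ZX) (cotCrit CX ZX)),
    (∃ W : BDer CX ZX, BPush BCot.pt α V W) ∧
      ∀ W : BDer CX ZX, BPush BCot.pt α V W → lam V α = α.form W

end BMaps

/-! ### `b`-Lie groups -/

section Hypersurface

variable {E : Type u} [NormedAddCommGroup E] [NormedSpace ℝ E]
  {M : Type v} [TopologicalSpace M] [ChartedSpace E M]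

/-- `Z` is an embedded hypersurface: near each of its points it is the zero set of a smooth
function with nonzero differential at that point. -/
def IsHypersurface (E : Type u) [NormedAddCommGroup E] [NormedSpace ℝ E]
    {M : Type v} [TopologicalSpace M] [ChartedSpace E M] (Z : Set M) : Prop :=
  ∀ p ∈ Z, ∃ (U : Set M) (f : M → ℝ), IsOpen U ∧ p ∈ U ∧ ContMDiffOn 𝓘(ℝ, E) 𝓘(ℝ, ℝ) ∞ f U ∧
    mfderiv 𝓘(ℝ, E) 𝓘(ℝ, ℝ) f p ≠ 0 ∧ ∀ x ∈ U, x ∈ Z ↔ f x = 0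

/-- The algebra of smooth functions on a manifold. -/
def smoothAlg (E : Type u) [NormedAddCommGroup E] [NormedSpace ℝ E]
    (M : Type v) [TopologicalSpace M] [ChartedSpace E M] : FunAlg M where
  carrier := {f | ContMDiff 𝓘(ℝ, E) 𝓘(ℝ, ℝ) ∞ f}
  mul_mem' ha hb := ContMDiff.mul ha hb
  add_mem' ha hb := ContMDiff.add ha hb
  algebraMap_mem' _ := contMDiff_const

lemma smoothAlg_mdiff (f : Fn (smoothAlg E M)) : MDifferentiable 𝓘(ℝ, E) 𝓘(ℝ, ℝ) f :=
  ContMDiff.mdifferentiable (n := ∞) f.mem (by simp)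

end Hypersurface

/-- `(G, H)` is a `b`-Lie group: `H` is a closed subgroup and an embedded hypersurface. -/
structure IsBLieGroup (E : Type u) [NormedAddCommGroup E] [NormedSpace ℝ E]
    {G : Type v} [TopologicalSpace G] [ChartedSpace E G] [Group G] (H : Subgroup G) : Prop where
  closed : IsClosed (H : Set G)
  hypersurface : IsHypersurface E (H : Set G)

set_option linter.unusedSectionVars false

section LieGroups

variable (E : Type u) [NormedAddCommGroup E] [NormedSpace ℝ E]
  {G : Type v} [TopologicalSpace G] [ChartedSpace E G] [Group G]
  (H : Subgroup G)

/-- The Lie algebra `𝔥` of `H`, as the tangent space of `H` at the identity. -/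
def lieSub : Submodule ℝ (GroupLieAlgebra 𝓘(ℝ, E) G) where
  carrier := {X | ∀ f : Fn (smoothAlg E G), (∀ h ∈ H, f h = 0) →
    mfderiv 𝓘(ℝ, E) 𝓘(ℝ, ℝ) f 1 X = 0}
  add_mem' := by
    intro a b ha hb f hf
    rw [map_add, ha f hf, hb f hf, add_zero]
  zero_mem' := by
    intro f _
    rw [map_zero]
  smul_mem' := by
    intro c a ha f hf
    rw [map_smul, ha f hf, smul_zero]

variable [LieGroup 𝓘(ℝ, E) ∞ G]

/-- The `b`-vector fields of the `b`-manifold `(G, H)`. -/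
abbrev BDerG := BDer (smoothAlg E G) (H : Set G)

/-- The `b`-cotangent bundle `ᵇT^*G` of the `b`-manifold `(G, H)`. -/
abbrev CotG := BCot (smoothAlg E G) (H : Set G)

/-- `L_g^*` on smooth functions. -/
def leftPull (g : G) : Fn (smoothAlg E G) →ₐ[ℝ] Fn (smoothAlg E G) :=
  pull (φ := fun x => g * x) fun _ hf => ContMDiff.comp (n := ∞) hf contMDiff_mul_left

/-- `R_g^*` on smooth functions. -/
def rightPull (g : G) : Fn (smoothAlg E G) →ₐ[ℝ] Fn (smoothAlg E G) :=
  pull (φ := fun x => x * g) fun _ hf => ContMDiff.comp (n := ∞) hf contMDiff_mul_right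

/-- Conjugation `x ↦ g x g⁻¹`, on smooth functions. -/
def conjPull (g : G) : Fn (smoothAlg E G) →ₐ[ℝ] Fn (smoothAlg E G) :=
  (leftPull E g).comp (rightPull E g⁻¹)

/-- The differential of a smooth function at the identity. -/
def dOne (f : Fn (smoothAlg E G)) : GroupLieAlgebra 𝓘(ℝ, E) G →ₗ[ℝ] ℝ where
  toFun X := mfderiv 𝓘(ℝ, E) 𝓘(ℝ, ℝ) f 1 X
  map_add' X Y := map_add _ X Y
  map_smul' c X := map_smul _ c X

variable {E}

lemma dOne_add (f g : Fn (smoothAlg E G)) (X : GroupLieAlgebra 𝓘(ℝ, E) G) :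
    dOne E (f + g) X = dOne E f X + dOne E g X := by
  have h := mfderiv_add (smoothAlg_mdiff f 1) (smoothAlg_mdiff g 1)
  exact congrArg (fun T => T X) h

lemma dOne_smul (c : ℝ) (f : Fn (smoothAlg E G)) (X : GroupLieAlgebra 𝓘(ℝ, E) G) :
    dOne E (c • f) X = c * dOne E f X := by
  have h := const_smul_mfderiv (smoothAlg_mdiff f 1) c
  exact congrArg (fun T => T X) h

lemma dOne_mul (f g : Fn (smoothAlg E G)) (X : GroupLieAlgebra 𝓘(ℝ, E) G) :
    dOne E (f * g) X = f 1 * dOne E g X + g 1 * dOne E f X := by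
  have h := ((smoothAlg_mdiff f 1).hasMFDerivAt.mul (smoothAlg_mdiff g 1).hasMFDerivAt).mfderiv
  exact congrArg (fun T => T X) h

lemma contMDiff_dOne (f : Fn (smoothAlg E G)) (X : GroupLieAlgebra 𝓘(ℝ, E) G) :
    ContMDiff 𝓘(ℝ, E) 𝓘(ℝ, ℝ) ∞ fun g : G => dOne E (rightPull E g f) X := by
  have : IsManifold 𝓘(ℝ, E) (∞ + 1) G := inferInstanceAs (IsManifold 𝓘(ℝ, E) ∞ G)
  have hF : ContMDiff (𝓘(ℝ, E).prod 𝓘(ℝ, E)) 𝓘(ℝ, ℝ) ∞ (fun p : G × G => f (p.1 * p.2)) :=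
    ContMDiff.comp (n := ∞) f.mem (contMDiff_mul 𝓘(ℝ, E) ∞)
  have h1 : ContMDiff 𝓘(ℝ, E) 𝓘(ℝ, E).tangent ∞
      (fun g : G => (⟨g, 0⟩ : TangentBundle 𝓘(ℝ, E) G)) :=
    Bundle.contMDiff_zeroSection ℝ (TangentSpace 𝓘(ℝ, E) (M := G))
  have h2 : ContMDiff 𝓘(ℝ, E) 𝓘(ℝ, E).tangent ∞
      (fun _ : G => (⟨1, X⟩ : TangentBundle 𝓘(ℝ, E) G)) := contMDiff_const
  have h3 := hF.contMDiff_tangentMap (m := ∞) le_rfl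
  have h4 := contMDiff_equivTangentBundleProd_symm (I := 𝓘(ℝ, E)) (I' := 𝓘(ℝ, E)) (M := G)
    (M' := G) (n := ∞)
  have h5 := (contMDiff_snd_tangentBundle_modelSpace ℝ 𝓘(ℝ, ℝ) (n := ∞)).comp
    ((h3.comp h4).comp (h2.prodMk h1))
  refine h5.congr fun g => ?_
  have h6 := mfderiv_prod_eq_add_apply (I := 𝓘(ℝ, E)) (I' := 𝓘(ℝ, E)) (p := ((1 : G), g))
    (v := (X, (0 : E))) (ContMDiff.mdifferentiable hF (by simp) ((1 : G), g))
  refine Eq.trans ?_ h6.symm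
  have h7 : (mfderiv 𝓘(ℝ, E) 𝓘(ℝ, ℝ) (fun z => f (1 * z)) g (0 : TangentSpace 𝓘(ℝ, E) g) : ℝ)
      = 0 := map_zero _
  exact (add_zero _).symm.trans
    (congrArg (fun t : ℝ => dOne E (rightPull E g f) X + t) h7.symm)

/-- The fundamental vector field `ζ^X` of the action of `H` on `G` by left translations: its value
at `g` is `d/dt e^{tX} g = (R_g)_* X`. -/
def zeta (X : lieSub E H) : BDerG E H :=
  BField.mk
    (Derivation.mk'
      { toFun := fun f => Fn.mk (fun g => dOne E (rightPull E g f) X.1) (contMDiff_dOne f X.1)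
        map_add' := fun f f' => Fn.ext (fun g => by
          change dOne E (rightPull E g (f + f')) X.1 = _
          rw [map_add, dOne_add]
          rfl)
        map_smul' := fun c f => Fn.ext (fun g => by
          change dOne E (rightPull E g (c • f)) X.1 = _
          rw [map_smul, dOne_smul]
          rfl) }
      fun f f' => Fn.ext (fun g => by
        change dOne E (rightPull E g (f * f')) X.1 = _
        rw [map_mul, dOne_mul]
        change f (1 * g) * _ + f' (1 * g) * _ = _
        rw [one_mul]
        rfl))
    (by
      intro f hf g hg
      exact X.2 (rightPull E g f) fun h hh => hf (h * g) (H.mul_mem hh hg))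

lemma zeta_apply (X : lieSub E H) (f : Fn (smoothAlg E G)) (g : G) :
    (zeta H X).der f g = dOne E (rightPull E g f) X.1 := rfl

variable (E)

/-- The adjoint representation of `G` on its Lie algebra: `Ad_g` is the differential at the
identity of the conjugation `x ↦ g x g⁻¹`. -/
def adG (g : G) : GroupLieAlgebra 𝓘(ℝ, E) G →ₗ[ℝ] GroupLieAlgebra 𝓘(ℝ, E) G where
  toFun X := mfderiv 𝓘(ℝ, E) 𝓘(ℝ, E) (fun x : G => g * x * g⁻¹) 1 X
  map_add' X Y := map_add _ X Y
  map_smul' c X := map_smul _ c X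

lemma contMDiff_conj (g : G) : ContMDiff 𝓘(ℝ, E) 𝓘(ℝ, E) ∞ (fun x : G => g * x * g⁻¹) :=
  ContMDiff.comp (n := ∞) (g := fun x : G => x * g⁻¹) contMDiff_mul_right contMDiff_mul_left

variable {E}

lemma mdiff_conj (g : G) : MDifferentiable 𝓘(ℝ, E) 𝓘(ℝ, E) (fun x : G => g * x * g⁻¹) :=
  ContMDiff.mdifferentiable (contMDiff_conj E g) (by simp)

lemma dOne_adG (g : G) (f : Fn (smoothAlg E G)) (X : GroupLieAlgebra 𝓘(ℝ, E) G) :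
    dOne E f (adG E g X) = dOne E (conjPull E g f) X := by
  have h := mfderiv_comp_apply_of_eq (x := (1 : G)) (f := fun x : G => g * x * g⁻¹) (g := f)
    (smoothAlg_mdiff f 1) (mdiff_conj g 1) (by simp) X
  exact h.symm

lemma adG_one (X : GroupLieAlgebra 𝓘(ℝ, E) G) : adG E 1 X = X := by
  have h : (fun x : G => 1 * x * 1⁻¹) = id := by
    funext x
    simp
  change mfderiv 𝓘(ℝ, E) 𝓘(ℝ, E) (fun x : G => 1 * x * 1⁻¹) 1 X = X
  rw [h, mfderiv_id]
  rfl

lemma adG_mul (g k : G) (X : GroupLieAlgebra 𝓘(ℝ, E) G) :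
    adG E (g * k) X = adG E g (adG E k X) := by
  have h : (fun x : G => g * k * x * (g * k)⁻¹)
      = (fun x : G => g * x * g⁻¹) ∘ (fun x : G => k * x * k⁻¹) := by
    funext x
    simp [mul_assoc]
  have h2 := mfderiv_comp_apply_of_eq (x := (1 : G)) (f := fun x : G => k * x * k⁻¹)
    (g := fun x : G => g * x * g⁻¹) (mdiff_conj g 1) (mdiff_conj k 1) (by simp) X
  change mfderiv 𝓘(ℝ, E) 𝓘(ℝ, E) (fun x : G => g * k * x * (g * k)⁻¹) 1 X = _
  rw [h]
  exact h2

/-- The adjoint representation of `H` on its Lie algebra `𝔥`. -/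
def adH (h : H) : lieSub E H →ₗ[ℝ] lieSub E H :=
  (adG E h.1).restrict fun X hX f hf => by
    change dOne E f (adG E h.1 X) = 0
    rw [dOne_adG]
    refine hX (conjPull E h.1 f) fun k hk => hf _ ?_
    exact H.mul_mem (H.mul_mem h.2 hk) (H.inv_mem h.2)

lemma adH_one (X : lieSub E H) : adH H 1 X = X := Subtype.ext (adG_one X.1)

lemma adH_mul (h k : H) (X : lieSub E H) : adH H (h * k) X = adH H h (adH H k X) :=
  Subtype.ext (adG_mul h.1 k.1 X.1)

/-- The coadjoint action of `H` on `𝔥^*`: `h • μ = μ ∘ Ad_{h⁻¹}`. -/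
instance coadjointAction : MulAction H (Module.Dual ℝ (lieSub E H)) where
  smul h μ := μ ∘ₗ adH H h⁻¹
  one_smul μ := by
    change μ ∘ₗ adH H 1⁻¹ = μ
    ext X
    simp [adH_one]
  mul_smul h k μ := by
    change μ ∘ₗ adH H (h * k)⁻¹ = (μ ∘ₗ adH H k⁻¹) ∘ₗ adH H h⁻¹
    ext X
    simp [adH_mul]

lemma coad_apply (h : H) (μ : Module.Dual ℝ (lieSub E H)) (X : lieSub E H) :
    (h • μ) X = μ (adH H h⁻¹ X) := rfl

lemma leftPull_leftPull (g k : G) (f : Fn (smoothAlg E G)) :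
    leftPull E g (leftPull E k f) = leftPull E (k * g) f :=
  Fn.ext (fun x => congrArg (f : G → ℝ) (mul_assoc k g x).symm)

lemma leftPull_one (f : Fn (smoothAlg E G)) : leftPull E 1 f = f :=
  Fn.ext (fun x => congrArg (f : G → ℝ) (one_mul x))

/-- The push-forward `(L_h)_* D` of a `b`-vector field under left translation by `h ∈ H`. -/
def leftPush (h : H) (D : BDerG E H) : BDerG E H :=
  BField.mk
    (Derivation.mk'
      { toFun := fun f => leftPull E (h : G)⁻¹ (D.der (leftPull E (h : G) f))
        map_add' := fun f f' => by rw [map_add, map_add, map_add]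
        map_smul' := fun c f => by rw [map_smul, D.der.map_smul, map_smul]; rfl }
      fun f f' => by
        have hh : ∀ f, leftPull E (h : G)⁻¹ (leftPull E (h : G) f) = f := fun f => by
          rw [leftPull_leftPull, mul_inv_cancel, leftPull_one]
        change leftPull E (h : G)⁻¹ (D.der (leftPull E (h : G) (f * f'))) = _
        rw [map_mul, Derivation.leibniz, map_add, smul_eq_mul, smul_eq_mul, map_mul, map_mul, hh,
          hh]
        rfl)
    (by
      intro f hf g hg
      refine D.der_mem (f := leftPull E (h : G) f) (fun k hk => ?_) ((h : G)⁻¹ * g)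
        (H.mul_mem (H.inv_mem h.2) hg)
      exact hf (h * k) (H.mul_mem h.2 hk))

lemma leftPush_der (h : H) (D : BDerG E H) (f : Fn (smoothAlg E G)) :
    (leftPush H h D).der f = leftPull E (h : G)⁻¹ (D.der (leftPull E (h : G) f)) := rfl

lemma leftPush_add (h : H) (D D' : BDerG E H) :
    leftPush H h (D + D') = leftPush H h D + leftPush H h D' := by
  ext f
  simp [leftPush_der]

lemma leftPush_smul (h : H) (c : Fn (smoothAlg E G)) (D : BDerG E H) :
    leftPush H h (c • D) = leftPull E (h : G)⁻¹ c • leftPush H h D := by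
  apply BField.ext
  intro f
  simp only [leftPush_der, BField.smul_der, map_mul]

lemma leftPush_rsmul (h : H) (c : ℝ) (D : BDerG E H) :
    leftPush H h (c • D) = c • leftPush H h D := by
  apply BField.ext
  intro f
  rw [leftPush_der, BField.rsmul_der, map_smul, BField.rsmul_der, leftPush_der]

lemma leftPush_one (D : BDerG E H) : leftPush H 1 D = D := by
  apply BField.ext
  intro f
  simp only [leftPush_der, OneMemClass.coe_one, inv_one, leftPull_one]

lemma leftPush_mul (h k : H) (D : BDerG E H) :
    leftPush H (h * k) D = leftPush H h (leftPush H k D) := by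
  apply BField.ext
  intro f
  simp only [leftPush_der, leftPull_leftPull, Subgroup.coe_mul, mul_inv_rev]

lemma leftPush_zeta (h : H) (X : lieSub E H) : leftPush H h (zeta H X) = zeta H (adH H h X) := by
  apply BField.ext
  intro f
  refine Fn.ext (fun g => ?_)
  change dOne E (rightPull E ((h : G)⁻¹ * g) (leftPull E (h : G) f)) X.1
    = dOne E (rightPull E g f) (adG E h.1 X.1)
  rw [dOne_adG]
  refine congrArg (fun F => dOne E F X.1) (Fn.ext (fun x => ?_))
  exact congrArg (f : G → ℝ) (by simp [mul_assoc])

/-- The `b`-cotangent lift of the action of `H` on `G` by left translations: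
`h • α_g = (L_{h⁻¹})^* α_g`, a covector at `h g`. -/
instance cotangentLift : MulAction H (CotG E H) where
  smul h α :=
    { pt := h * α.pt
      form :=
        { toFun := fun D => α.form (leftPush H h⁻¹ D)
          map_add' := fun D D' => by rw [leftPush_add, map_add]
          map_smul' := fun c D => by rw [leftPush_rsmul, map_smul]; rfl }
      form_smul := fun f D => by
        change α.form (leftPush H h⁻¹ (f • D)) = _
        rw [leftPush_smul, α.form_smul, Subgroup.coe_inv, inv_inv]
        rfl }
  one_smul α := by
    refine BCot.ext (one_mul α.pt) (LinearMap.ext fun D => ?_)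
    change α.form (leftPush H 1⁻¹ D) = _
    rw [inv_one, leftPush_one]
  mul_smul h k α := by
    refine BCot.ext (mul_assoc (h : G) k α.pt) (LinearMap.ext fun D => ?_)
    change α.form (leftPush H (h * k)⁻¹ D) = α.form (leftPush H k⁻¹ (leftPush H h⁻¹ D))
    rw [mul_inv_rev, leftPush_mul]

lemma lift_pt (h : H) (α : CotG E H) : (h • α).pt = h * α.pt := rfl

lemma lift_form (h : H) (α : CotG E H) (D : BDerG E H) :
    (h • α).form D = α.form (leftPush H h⁻¹ D) := rfl

variable (E)

/-- The annihilator `𝓗° ⊂ ᵇT^*G` of the vertical bundle. -/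
abbrev Ann := {α : CotG E H // ∀ X : lieSub E H, α.form (zeta H X) = 0}

variable {E}

/-- The action of `H` on `𝓗°` induced by the `b`-cotangent lift. -/
instance annAction : MulAction H (Ann E H) where
  smul h α := ⟨h • α.1, fun X => by rw [lift_form, leftPush_zeta, α.2]⟩
  one_smul α := Subtype.ext (one_smul H α.1)
  mul_smul h k α := Subtype.ext (mul_smul h k α.1)

variable (E)

/-- The smooth functions on `𝓗°`. -/
abbrev annAlg : FunAlg (Ann E H) :=
  restrAlg (cotAlg (smoothAlg E G) (H : Set G)) {α | ∀ X : lieSub E H, α.form (zeta H X) = 0}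

/-- The product `𝓗° × 𝔥^*`, with the diagonal action of `H`. -/
abbrev MC := Ann E H × Module.Dual ℝ (lieSub E H)

/-- The smooth functions on `𝓗° × 𝔥^*`. -/
abbrev mcAlg : FunAlg (MC E H) := prodAlg (annAlg E H) (dualAlg (lieSub E H))

/-- The critical hypersurface of `𝓗° × 𝔥^*`: the points over `H`. -/
abbrev mcCrit : Set (MC E H) := {x | x.1.1.pt ∈ H}

/-- The reduced space `(ᵇT^*G)/H`. -/
abbrev RedSpace := MulAction.orbitRel.Quotient H (CotG E H)

/-- The smooth functions on `(ᵇT^*G)/H`. -/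
abbrev redAlg : FunAlg (RedSpace E H) := quotAlg H (cotAlg (smoothAlg E G) (H : Set G))

/-- The `b`-coadjoint bundle `𝓗° ×_H 𝔥^*`. -/
abbrev CoadjBundle := MulAction.orbitRel.Quotient H (MC E H)

/-- The smooth functions on `𝓗° ×_H 𝔥^*`. -/
abbrev coadjAlg : FunAlg (CoadjBundle E H) := quotAlg H (mcAlg E H)

/-- The smooth functions on `G/H`, the space of orbits `H g` of `H` acting on `G` by left
translations. -/
abbrev baseAlg : FunAlg (MulAction.orbitRel.Quotient H G) := quotAlg H (smoothAlg E G)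

/-- The critical hypersurface of `G/H`: the class of the identity. -/
abbrev baseCrit : Set (MulAction.orbitRel.Quotient H G) := {orbitMk H (1 : G)}

/-- The `b`-cotangent bundle `ᵇT^*(G/H)`. -/
abbrev CotBase := BCot (baseAlg E H) (baseCrit H)

/-- The smooth functions on `ᵇT^*(G/H)`. -/
abbrev cotBaseAlg : FunAlg (CotBase E H) := cotAlg (baseAlg E H) (baseCrit H)

/-- `b`-forms of degree one on `ᵇT^*G`. -/
abbrev Form1CotG :=
  BForm1 (Fn (cotAlg (smoothAlg E G) (H : Set G))) (vanIdeal (cotAlg (smoothAlg E G) (H : Set G))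
    (cotCrit (smoothAlg E G) (H : Set G)))

/-- `b`-forms of degree one on `ᵇT^*(G/H)`. -/
abbrev Form1CotBase :=
  BForm1 (Fn (cotBaseAlg E H)) (vanIdeal (cotBaseAlg E H) (cotCrit (baseAlg E H) (baseCrit H)))

/-- `b`-forms of degree one on `𝓗° × 𝔥^*`. -/
abbrev Form1MC := BForm1 (Fn (mcAlg E H)) (vanIdeal (mcAlg E H) (mcCrit E H))

/-- Bilinear `b`-forms on `𝓗° × 𝔥^*`. -/
abbrev Form2MC := BForm2 (Fn (mcAlg E H)) (vanIdeal (mcAlg E H) (mcCrit E H))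

variable {E}

/-- `pbar` is the bundle map `π̄ : 𝓗° → ᵇT^*(G/H)`, `(π̄ α_g)(π_* v_g) = α_g(v_g)`. -/
def IsPiBar (pbar : Ann E H → CotBase E H) : Prop :=
  ∀ α : Ann E H, (pbar α).pt = orbitMk H α.1.pt ∧
    ∀ W : BDer (baseAlg E H) (baseCrit H),
      (∃ D : BDerG E H, BPush (orbitMk H) α.1.pt D W) ∧
      ∀ D : BDerG E H, BPush (orbitMk H) α.1.pt D W → (pbar α).form W = α.1.form D

variable (E)

/-- A principal `H`-`b`-connection for `π : G → G/H`: an `𝔥`-valued `b`-form of degree one on `G`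
with `θ(ζ^X) = X` and `θ((L_h)_* v) = Ad_h (θ(v))`. -/
structure BConnection where
  /-- the value of the form on a `b`-vector field, at a point of `G` -/
  val : BDerG E H → G → lieSub E H
  smooth : ∀ (D : BDerG E H) (μ : Module.Dual ℝ (lieSub E H)),
    (fun g => μ (val D g)) ∈ smoothAlg E G
  map_add : ∀ (D D' : BDerG E H) (g : G), val (D + D') g = val D g + val D' g
  map_smul : ∀ (f : Fn (smoothAlg E G)) (D : BDerG E H) (g : G), val (f • D) g = f g • val D g
  vertical : ∀ (X : lieSub E H) (g : G), val (zeta H X) g = X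
  equivariant : ∀ (h : H) (D : BDerG E H) (g : G),
    val (leftPush H h D) (h * g) = adH H h (val D g)

variable {E H}

lemma BConnection.map_rsmul (θ : BConnection E H) (c : ℝ) (D : BDerG E H) (g : G) :
    θ.val (c • D) g = c • θ.val D g := by
  have h : c • D = algebraMap ℝ (Fn (smoothAlg E G)) c • D := by
    apply BField.ext
    intro f
    rw [BField.rsmul_der, BField.smul_der, Algebra.smul_def]
  rw [h, θ.map_smul]
  rfl

lemma zeta_add (X Y : lieSub E H) : zeta H (X + Y) = zeta H X + zeta H Y := by
  apply BField.ext
  intro f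
  exact Fn.ext (fun g => map_add (dOne E (rightPull E g f)) X.1 Y.1)

lemma zeta_smul (c : ℝ) (X : lieSub E H) : zeta H (c • X) = c • zeta H X := by
  apply BField.ext
  intro f
  exact Fn.ext (fun g => map_smul (dOne E (rightPull E g f)) c X.1)

/-- The component `α_g ∘ ζ_g ∈ 𝔥^*` of a covector `α_g`. -/
def vertPart (α : CotG E H) : Module.Dual ℝ (lieSub E H) where
  toFun X := α.form (zeta H X)
  map_add' X Y := by rw [zeta_add, map_add]
  map_smul' c X := by rw [zeta_smul, map_smul]; rfl

/-- The component `α_g - α_g ∘ ζ_g ∘ θ_g ∈ 𝓗°` of a covector `α_g`. -/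
def horPart (θ : BConnection E H) (α : CotG E H) : Ann E H :=
  ⟨{ pt := α.pt
     form :=
      { toFun := fun D => α.form D - α.form (zeta H (θ.val D α.pt))
        map_add' := fun D D' => by
          rw [θ.map_add, zeta_add, _root_.map_add, _root_.map_add]
          ring
        map_smul' := fun c D => by
          rw [θ.map_rsmul, zeta_smul, _root_.map_smul, _root_.map_smul, smul_eq_mul, smul_eq_mul,
            RingHom.id_apply, smul_eq_mul]
          ring }
     form_smul := fun f D => by
      change α.form (f • D) - α.form (zeta H (θ.val (f • D) α.pt)) =
        f α.pt * (α.form D - α.form (zeta H (θ.val D α.pt)))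
      rw [θ.map_smul, zeta_smul, α.form_smul, _root_.map_smul, smul_eq_mul]
      ring },
    fun X => by
      change α.form (zeta H X) - α.form (zeta H (θ.val (zeta H X) α.pt)) = 0
      rw [θ.vertical, sub_self]⟩

lemma horPart_form (θ : BConnection E H) (α : CotG E H) (D : BDerG E H) :
    (horPart θ α).1.form D = α.form D - α.form (zeta H (θ.val D α.pt)) := rfl

lemma vertPart_apply (α : CotG E H) (X : lieSub E H) : vertPart α X = α.form (zeta H X) := rfl

lemma ann_form (h : H) (β : Ann E H) (D : BDerG E H) :
    (h • β).1.form D = β.1.form (leftPush H h⁻¹ D) := rfl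

lemma ann_pt (h : H) (β : Ann E H) : (h • β).1.pt = h * β.1.pt := rfl

lemma horPart_pt (θ : BConnection E H) (α : CotG E H) : (horPart θ α).1.pt = α.pt := rfl

lemma horPart_smul (θ : BConnection E H) (h : H) (α : CotG E H) :
    horPart θ (h • α) = h • horPart θ α := by
  apply Subtype.ext
  apply BCot.ext
  · rw [horPart_pt, ann_pt, horPart_pt, lift_pt]
  · apply LinearMap.ext
    intro D
    have h1 := θ.equivariant h⁻¹ D (h * α.pt)
    rw [Subgroup.coe_inv, inv_mul_cancel_left] at h1
    rw [horPart_form, ann_form, horPart_form, lift_form, lift_form, lift_pt, leftPush_zeta, h1]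

lemma vertPart_smul (h : H) (α : CotG E H) : vertPart (h • α) = h • vertPart α := by
  apply LinearMap.ext
  intro X
  rw [vertPart_apply, coad_apply, vertPart_apply, lift_form, leftPush_zeta]

/-- The map `ψ_θ : ᵇT^*G → 𝓗° × 𝔥^*`, `α_g ↦ (α_g - α_g ∘ ζ_g ∘ θ_g, α_g ∘ ζ_g)`. -/
def psi (θ : BConnection E H) (α : CotG E H) : MC E H := (horPart θ α, vertPart α)

lemma psi_smul (θ : BConnection E H) (h : H) (α : CotG E H) : psi θ (h • α) = h • psi θ α :=
  Prod.ext (horPart_smul θ h α) (vertPart_smul h α)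

/-- The map `[ψ_θ] : (ᵇT^*G)/H → 𝓗° ×_H 𝔥^*` induced by `ψ_θ`. -/
def psiBar (θ : BConnection E H) : RedSpace E H → CoadjBundle E H :=
  Quotient.map (psi θ) (by
    rintro _ α ⟨h, rfl⟩
    exact ⟨h, (psi_smul θ h α).symm⟩)

/-- `lam` is the `b`-form `λ^θ` on `𝓗° × 𝔥^*`: at `(α, μ)` it sends `v` to `μ(θ(τ_* v))`, where
`τ(α_g, μ) = g`. -/
def IsLambdaTheta (θ : BConnection E H) (lam : Form1MC E H) : Prop :=
  ∀ (x : MC E H) (V : BDer (mcAlg E H) (mcCrit E H)),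
    (∃ W : BDerG E H, BPush (fun y : MC E H => y.1.1.pt) x V W) ∧
      ∀ W : BDerG E H, BPush (fun y : MC E H => y.1.1.pt) x V W →
        lam V x = x.2 (θ.val W x.1.1.pt)

/-- `Ω` is the minimal coupling form `π̄^* ω_{G/H} - dλ^θ` on `𝓗° × 𝔥^*`, where
`ω_{G/H} = -dλ_{G/H}` is the canonical `b`-symplectic form on `ᵇT^*(G/H)`. -/
def IsMinimalCoupling (θ : BConnection E H) (pbar : Ann E H → CotBase E H)
    (lamB : Form1CotBase E H) (Ω : Form2MC E H) : Prop :=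
  ∃ (Ω₀ : Form2MC E H) (lamT : Form1MC E H),
    IsPullback2 (fun x : MC E H => pbar x.1) (-extD lamB) Ω₀ ∧ IsLambdaTheta θ lamT ∧
      Ω = Ω₀ - extD lamT

/-- The Poisson structure `P` on `(ᵇT^*G)/H` is induced by `θ` through minimal coupling: the form
`π̄^* ω_{G/H} - dλ^θ` is `b`-symplectic, its Poisson structure on `𝓗° × 𝔥^*` descends to the
`b`-coadjoint bundle `𝓗° ×_H 𝔥^*`, and `[ψ_θ]` pulls the latter back to `P`. -/
def IsInducedBy (θ : BConnection E H) (pbar : Ann E H → CotBase E H) (lamB : Form1CotBase E H)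
    (P : PoissonStr (Fn (redAlg E H))) : Prop :=
  ∃ (Ω : Form2MC E H) (PM : PoissonStr (Fn (mcAlg E H))) (PC : PoissonStr (Fn (coadjAlg E H))),
    IsMinimalCoupling θ pbar lamB Ω ∧ IsBSymplectic Ω ∧ IsPoissonOf Ω PM ∧
    IsPoissonMap PM PC (orbitMk H) ∧
    IsDiffeo (redAlg E H) (coadjAlg E H) (psiBar θ) ∧ IsPoissonMap P PC (psiBar θ)

end LieGroups

end BGeom

end

open BGeom

open scoped Manifold ContDiff Topology
open Filter

noncomputable section

set_option linter.unusedSectionVars false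

namespace BGeom

universe u v w

/-! ### Smooth dependence of integrals on parameters, and Hadamard's lemma -/

section Hadamard

/-! The statement reduces to an identity between one-forms. A covector splits as `α = (α - α ∘ ζ ∘
θ) + (α ∘ ζ) ∘ θ`; evaluated on `τ_* v`, this says that the Liouville form of `ᵇT^*G` is the
pull-back along `ψ_θ` of `lamAnn + λ^θ`, where `lamAnn` is the tautological form of `𝓗°`
(`isPullback1_psi`). By the definition of `π̄` and the chain rule, `lamAnn` is the pull-back along
`π̄` of the Liouville form of `ᵇT^*(G/H)` (`isPullback1_piBar`). The exterior derivative commutes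
with pull-back (`IsBMap.isPullback2_extD`), so `ψ_θ^* ω_θ = ω_G`, and since `ψ_θ` is a
diffeomorphism, `ω_θ` inherits nondegeneracy and Poisson structure from `ω_G`. The former follows
from local Darboux frames (`IsBMfd.exists_darboux`).

The Liouville form is `H`-invariant, and a closed form has at most one Poisson structure
(`IsPoissonOf.unique`). Hence brackets of invariant functions are invariant and define `P` on the
orbit space. By equivariance of `ψ_θ`, the same bracket, seen on `𝓗° × 𝔥^*`, descends to the
coadjoint bundle and returns `P` along `[ψ_θ]`, whatever `θ` is. Conversely all the data attached to
`θ` are unique and pull-back along the orbit projection is injective, so no other structure is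
induced (`isInducedBy_iff`).

Since `b`-fields are global derivations, everything local rests on cut-off functions and on
Hadamard's lemma: a derivation at a point is determined by its values on coordinates (`FChart.det`).
At the critical hypersurface the `b`-differential exists because `V (φ^* x)` can be divided by the
pulled-back defining function `x` (`IsBMap.exists_rep`), and it is well defined because this
function is not a zero divisor (`IsBMap.sum_form_eq_zero`). These two properties make up `IsBMap`.

The geometry of `G → G/H` comes from a slice. If `F` defines `H` near `1`, the equation `F (x
c(s)⁻¹) = 0` is solved for the parameter `s` of the coset of `x` on a transverse curve `c`
(`exists_slice`). This yields charts of `G` in which the projection is the first coordinate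
(`exists_adapted`). In them a dimension count identifies the fundamental fields with the remaining
directions, so that elements of `𝓗°` factor through the projection (`ann_frame`). Local sections of
`G → G/H` trivialise `𝓗°` and the reduced space. A connection is the right-invariant Maurer-Cartan
form projected to `𝔥` along a transverse vector whose line is `H`-equivariant
(`exists_bConnection`). -/

lemma hasFDerivAt_integral_unit {V F : Type} [NormedAddCommGroup V] [NormedSpace ℝ V]
    [FiniteDimensional ℝ V] [NormedAddCommGroup F] [NormedSpace ℝ F]
    {g : V × ℝ → F} (hg : ContDiff ℝ 1 g) (y : V) :
    HasFDerivAt (fun y => ∫ s in (0 : ℝ)..1, g (y, s))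
      (∫ s in (0 : ℝ)..1, (fderiv ℝ g (y, s)).comp (ContinuousLinearMap.inl ℝ V ℝ)) y := by
  have hd : Continuous fun p : V × ℝ => (fderiv ℝ g p).comp (ContinuousLinearMap.inl ℝ V ℝ) :=
    (hg.continuous_fderiv (by simp)).clm_comp continuous_const
  -- Compactness of a closed ball times the unit interval provides a constant dominating function.
  obtain ⟨B, hB⟩ := ((isCompact_closedBall y 1).prod (isCompact_Icc (a := (0 : ℝ))
    (b := 1))).exists_bound_of_continuousOn hd.continuousOn
  have hcont : ∀ x : V, Continuous fun s : ℝ => g (x, s) := fun x =>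
    hg.continuous.comp (by fun_prop)
  refine (intervalIntegral.hasFDerivAt_integral_of_dominated_of_fderiv_le (𝕜 := ℝ)
    (F := fun x s => g (x, s))
    (F' := fun x s => (fderiv ℝ g (x, s)).comp (ContinuousLinearMap.inl ℝ V ℝ))
    (bound := fun _ => B) (Metric.closedBall_mem_nhds y one_pos)
    (Eventually.of_forall fun x => (hcont x).aestronglyMeasurable)
    ((hcont y).intervalIntegrable _ _)
    (hd.comp (by fun_prop : Continuous fun s : ℝ => (y, s))).aestronglyMeasurable ?_
    intervalIntegrable_const ?_)
  · refine Eventually.of_forall fun s hs x hx => hB (x, s) ⟨hx, ?_⟩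
    rw [Set.uIoc_of_le zero_le_one] at hs
    exact ⟨hs.1.le, hs.2⟩
  · refine Eventually.of_forall fun s _ x _ => ?_
    have h1 : HasFDerivAt (fun x : V => (x, s)) (ContinuousLinearMap.inl ℝ V ℝ) x :=
      hasFDerivAt_prodMk_left x s
    exact ((hg.differentiable (by simp) (x, s)).hasFDerivAt).comp x h1

/-- Induction on the order: the derivative of the integral is an integral of the same kind with
values in another space, so the target space is generalised. -/
lemma contDiff_integral_unit {V F : Type} [NormedAddCommGroup V] [NormedSpace ℝ V]
    [FiniteDimensional ℝ V] [NormedAddCommGroup F] [NormedSpace ℝ F]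
    {g : V × ℝ → F} (hg : ContDiff ℝ ∞ g) :
    ContDiff ℝ ∞ (fun y => ∫ s in (0 : ℝ)..1, g (y, s)) := by
  refine contDiff_infty.2 fun n => ?_
  induction n generalizing F with
  | zero =>
    refine contDiff_zero.2 (continuous_iff_continuousAt.2 fun y => ?_)
    exact (hasFDerivAt_integral_unit (hg.of_le (by simp)) y).continuousAt
  | succ n ih =>
    refine contDiff_succ_iff_hasFDerivAt.2 ⟨_, ?_, fun y =>
      hasFDerivAt_integral_unit (hg.of_le (by simp)) y⟩
    exact ih (g := fun p => (fderiv ℝ g p).comp (ContinuousLinearMap.inl ℝ V ℝ))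
      ((hg.fderiv_right (m := ∞) (by simp)).clm_comp contDiff_const)

variable {ι : Type} [Fintype ι] [DecidableEq ι]

/-- Hadamard's lemma along segments issuing from a smoothly varying point. -/
lemma hadamard_segment {Φ : (ι → ℝ) → ℝ} (hΦ : ContDiff ℝ ∞ Φ) {r : (ι → ℝ) → ι → ℝ}
    (hr : ContDiff ℝ ∞ r) :
    ∃ Ψ : ι → (ι → ℝ) → ℝ, (∀ i, ContDiff ℝ ∞ (Ψ i)) ∧
      (∀ y, Φ y = Φ (r y) + ∑ i, (y i - r y i) * Ψ i y) ∧
      ∀ y, r y = y → ∀ i, Ψ i y = fderiv ℝ Φ y (Pi.single i 1) := by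
  have hseg : ContDiff ℝ ∞ fun p : (ι → ℝ) × ℝ => r p.1 + p.2 • (p.1 - r p.1) :=
    (hr.comp contDiff_fst).add (contDiff_snd.smul (contDiff_fst.sub (hr.comp contDiff_fst)))
  have hg : ∀ i, ContDiff ℝ ∞ fun p : (ι → ℝ) × ℝ =>
      fderiv ℝ Φ (r p.1 + p.2 • (p.1 - r p.1)) (Pi.single i 1) := fun i =>
    ((hΦ.fderiv_right (m := ∞) (by simp)).comp hseg).clm_apply contDiff_const
  -- The quotients are the averages of the partial derivatives over the segment from `r y` to `y`.
  -- At a fixed point of `r` the segment is constant.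
  refine ⟨fun i y => ∫ s in (0 : ℝ)..1, fderiv ℝ Φ (r y + s • (y - r y)) (Pi.single i 1),
    fun i => contDiff_integral_unit (hg i), fun y => ?_, fun y hy i => ?_⟩
  · have hder : ∀ s : ℝ, HasDerivAt (fun s : ℝ => Φ (r y + s • (y - r y)))
        (fderiv ℝ Φ (r y + s • (y - r y)) (y - r y)) s := fun s => by
      have h1 : HasDerivAt (fun s : ℝ => r y + s • (y - r y)) (y - r y) s := by
        simpa using ((hasDerivAt_id s).smul_const (y - r y)).const_add (r y)
      exact ((hΦ.differentiable (by simp) _).hasFDerivAt).comp_hasDerivAt s h1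
    have hci : ∀ i, Continuous fun s : ℝ =>
        fderiv ℝ Φ (r y + s • (y - r y)) (Pi.single i 1) := fun i =>
      (hg i).continuous.comp (by fun_prop : Continuous fun s : ℝ => (y, s))
    have hsum : ∀ s : ℝ, fderiv ℝ Φ (r y + s • (y - r y)) (y - r y)
        = ∑ i, (y i - r y i) * fderiv ℝ Φ (r y + s • (y - r y)) (Pi.single i 1) := fun s => by
      generalize fderiv ℝ Φ (r y + s • (y - r y)) = A
      conv_lhs => rw [pi_eq_sum_univ' (y - r y)]
      simp only [map_sum, map_smul, smul_eq_mul, Pi.sub_apply]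
    have hint : IntervalIntegrable (fun s => fderiv ℝ Φ (r y + s • (y - r y)) (y - r y))
        MeasureTheory.volume 0 1 := by
      simp only [hsum]
      exact (continuous_finsetSum _ fun i _ => (hci i).const_mul _).intervalIntegrable _ _
    have h := intervalIntegral.integral_eq_sub_of_hasDerivAt (fun s _ => hder s) hint
    simp only [hsum] at h
    rw [intervalIntegral.integral_finsetSum fun i _ =>
      ((hci i).const_mul _).intervalIntegrable _ _] at h
    simp only [intervalIntegral.integral_const_mul, one_smul, zero_smul, add_zero,
      add_sub_cancel] at h
    linarith
  · simp [hy]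

lemma hadamard {Φ : (ι → ℝ) → ℝ} (hΦ : ContDiff ℝ ∞ Φ) (a : ι → ℝ) :
    ∃ Ψ : ι → (ι → ℝ) → ℝ, (∀ i, ContDiff ℝ ∞ (Ψ i)) ∧
      (∀ y, Φ y = Φ a + ∑ i, (y i - a i) * Ψ i y) ∧
      ∀ i, Ψ i a = fderiv ℝ Φ a (Pi.single i 1) := by
  obtain ⟨Ψ, h1, h2, h3⟩ := hadamard_segment hΦ (r := fun _ => a) contDiff_const
  exact ⟨Ψ, h1, h2, h3 a rfl⟩

/-- Take for `r` the projection to the hyperplane `y j = 0`: only the `j`-th difference survives.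
This is the source of division by the defining function of a hypersurface. -/
lemma exists_div_coordinate {Φ : (ι → ℝ) → ℝ} (hΦ : ContDiff ℝ ∞ Φ) (j : ι) :
    ∃ Ψ : (ι → ℝ) → ℝ, ContDiff ℝ ∞ Ψ ∧ ∀ y, Φ y = Φ (Function.update y j 0) + y j * Ψ y := by
  have hr : ContDiff ℝ ∞ fun y : ι → ℝ => Function.update y j (0 : ℝ) := by
    refine contDiff_pi.2 fun i => ?_
    by_cases h : i = j
    · subst h
      simpa using contDiff_const
    · simpa [Function.update_of_ne h] using contDiff_apply ℝ ℝ i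
  obtain ⟨Ψ, h1, h2, -⟩ := hadamard_segment hΦ hr
  refine ⟨Ψ j, h1 j, fun y => ?_⟩
  rw [h2 y, Finset.sum_eq_single j]
  · simp
  · intro i _ hi
    simp [Function.update_of_ne hi]
  · simp

/-- A function that is smooth on a neighbourhood agrees near a point with a smooth function. -/
lemma exists_contDiff_eqOn {V : Type} [NormedAddCommGroup V] [NormedSpace ℝ V]
    [FiniteDimensional ℝ V] {Φ : V → ℝ} {O : Set V} (hO : IsOpen O)
    (hΦ : ContDiffOn ℝ ∞ Φ O) {a : V} (ha : a ∈ O) :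
    ∃ Φ' : V → ℝ, ContDiff ℝ ∞ Φ' ∧ Φ' =ᶠ[𝓝 a] Φ := by
  obtain ⟨r, hr, hrO⟩ := Metric.isOpen_iff.1 hO a ha
  -- A point outside `O` is at distance at least `r` from `a`, so the outer radius `r / 2` leaves it
  -- a neighbourhood on which the bump vanishes.
  let b : ContDiffBump a := ⟨r / 4, r / 2, by positivity, by linarith⟩
  refine ⟨fun y => b y * Φ y, contDiff_iff_contDiffAt.2 fun y => ?_, ?_⟩
  · by_cases hy : y ∈ O
    · exact b.contDiffAt.mul (hΦ.contDiffAt (hO.mem_nhds hy))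
    · have h0 : (fun y => b y * Φ y) =ᶠ[𝓝 y] fun _ => 0 := by
        have hy' : r ≤ dist y a := by
          by_contra h
          exact hy (hrO (Metric.mem_ball.2 (not_le.1 h)))
        filter_upwards [Metric.ball_mem_nhds y (half_pos hr)] with z hz
        have h1 : b.rOut ≤ dist z a := by
          have h2 := dist_triangle_left y a z
          have h3 := Metric.mem_ball.1 hz
          change r / 2 ≤ dist z a
          linarith
        rw [b.zero_of_le_dist h1, zero_mul]
      exact contDiffAt_const.congr_of_eventuallyEq h0
  · filter_upwards [b.eventuallyEq_one] with y hy
    simp [hy]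

end Hadamard

/-! ### Germs of functions in a function algebra -/

section Germs

variable {X : Type u} {Y : Type v} {C : FunAlg X} {D : FunAlg Y}

/-- The filter of neighbourhoods of `p` in the topology whose basic open sets are `{u ≠ 0}`,
`u ∈ C`. -/
def Near (C : FunAlg X) (p : X) : Filter X where
  sets := {s | ∃ u : Fn C, u p ≠ 0 ∧ ∀ x, u x ≠ 0 → x ∈ s}
  univ_sets := ⟨1, by simp, fun _ _ => trivial⟩
  sets_of_superset := by
    rintro s t ⟨u, hu, h⟩ hst
    exact ⟨u, hu, fun x hx => hst (h x hx)⟩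
  inter_sets := by
    rintro s t ⟨u, hu, h⟩ ⟨v, hv, h'⟩
    refine ⟨u * v, mul_ne_zero hu hv, fun x hx => ?_⟩
    rw [Fn.mul_apply] at hx
    exact ⟨h x (left_ne_zero_of_mul hx), h' x (right_ne_zero_of_mul hx)⟩

lemma eventually_near {p : X} {P : X → Prop} :
    (∀ᶠ x in Near C p, P x) ↔ ∃ u : Fn C, u p ≠ 0 ∧ ∀ x, u x ≠ 0 → P x := Iff.rfl

lemma near_of_ne {p : X} (u : Fn C) (hu : u p ≠ 0) : ∀ᶠ x in Near C p, u x ≠ 0 :=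
  ⟨u, hu, fun _ h => h⟩

lemma near_self {p : X} {P : X → Prop} (h : ∀ᶠ x in Near C p, P x) : P p := by
  obtain ⟨u, hu, h⟩ := h
  exact h p hu

lemma near_near {p : X} {P : X → Prop} (h : ∀ᶠ x in Near C p, P x) :
    ∀ᶠ x in Near C p, ∀ᶠ y in Near C x, P y := by
  obtain ⟨u, hu, h⟩ := h
  exact ⟨u, hu, fun x hx => ⟨u, hx, h⟩⟩

lemma IsSmooth.tendsto {φ : X → Y} (hφ : IsSmooth C D φ) (x : X) :
    Tendsto φ (Near C x) (Near D (φ x)) := by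
  rintro s ⟨u, hu, h⟩
  exact ⟨pull hφ u, hu, fun y hy => h (φ y) hy⟩

@[simp] lemma pull_apply {φ : X → Y} (hφ : IsSmooth C D φ) (f : Fn D) (x : X) :
    pull hφ f x = f (φ x) := rfl

lemma Fn.sum_apply {ι : Type*} (s : Finset ι) (f : ι → Fn C) (x : X) :
    (∑ i ∈ s, f i : Fn C) x = ∑ i ∈ s, f i x := by
  classical
  induction s using Finset.induction_on with
  | empty => simp
  | insert i s hi ih => rw [Finset.sum_insert hi, Finset.sum_insert hi, Fn.add_apply, ih]

/-- `F` agrees near `p` with a member of `C`. -/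
def SmAt (C : FunAlg X) (F : X → ℝ) (p : X) : Prop :=
  ∃ F' : Fn C, ∀ᶠ x in Near C p, F x = F' x

lemma Fn.smAt (f : Fn C) (p : X) : SmAt C f p := ⟨f, Eventually.of_forall fun _ => rfl⟩

lemma smAt_of_mem {f : X → ℝ} (hf : f ∈ C) (p : X) : SmAt C f p := Fn.smAt (Fn.mk f hf) p

lemma SmAt.congr {F G : X → ℝ} {p : X} (hF : SmAt C F p) (h : ∀ᶠ x in Near C p, G x = F x) :
    SmAt C G p := by
  obtain ⟨F', h'⟩ := hF
  exact ⟨F', by filter_upwards [h, h'] with x h1 h2 using h1.trans h2⟩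

lemma SmAt.near {F : X → ℝ} {p : X} (hF : SmAt C F p) : ∀ᶠ q in Near C p, SmAt C F q := by
  obtain ⟨F', h⟩ := hF
  filter_upwards [near_near h] with q hq
  exact ⟨F', hq⟩

lemma SmAt.add {F G : X → ℝ} {p : X} (hF : SmAt C F p) (hG : SmAt C G p) :
    SmAt C (fun x => F x + G x) p := by
  obtain ⟨F', h⟩ := hF
  obtain ⟨G', h'⟩ := hG
  refine ⟨F' + G', ?_⟩
  filter_upwards [h, h'] with x h1 h2
  rw [h1, h2, Fn.add_apply]

lemma SmAt.mul {F G : X → ℝ} {p : X} (hF : SmAt C F p) (hG : SmAt C G p) :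
    SmAt C (fun x => F x * G x) p := by
  obtain ⟨F', h⟩ := hF
  obtain ⟨G', h'⟩ := hG
  refine ⟨F' * G', ?_⟩
  filter_upwards [h, h'] with x h1 h2
  rw [h1, h2, Fn.mul_apply]

lemma smAt_const (c : ℝ) (p : X) : SmAt C (fun _ => c) p :=
  ⟨algebraMap ℝ (Fn C) c, Eventually.of_forall fun _ => rfl⟩

lemma SmAt.sum {ι : Type*} {s : Finset ι} {F : ι → X → ℝ} {p : X}
    (h : ∀ i ∈ s, SmAt C (F i) p) : SmAt C (fun x => ∑ i ∈ s, F i x) p := by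
  classical
  induction s using Finset.induction_on with
  | empty => simpa using smAt_const 0 p
  | insert i s hi ih =>
    simp only [Finset.sum_insert hi]
    exact (h i (by simp)).add (ih fun j hj => h j (by simp [hj]))

lemma SmAt.comp_smooth {φ : X → Y} (hφ : IsSmooth C D φ) {F : Y → ℝ} {x : X}
    (hF : SmAt D F (φ x)) : SmAt C (fun z => F (φ z)) x := by
  obtain ⟨F', h⟩ := hF
  exact ⟨pull hφ F', (hφ.tendsto x).eventually h⟩

/-- `C` contains every function that is locally a smooth function of finitely many members. -/
def IsComplete (C : FunAlg X) : Prop := ∀ F ∈ generated (C : Set (X → ℝ)), F ∈ C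

lemma IsComplete.mem_of_smAt (hC : IsComplete C) {F : X → ℝ} (h : ∀ p, SmAt C F p) : F ∈ C := by
  refine hC F fun p => ?_
  obtain ⟨F', u, hu, h⟩ := h p
  -- The generator `u` serves only to cut out the neighbourhood: `|u x - u p| < |u p|` forces `u x ≠
  -- 0`.
  refine ⟨Bool, inferInstance, fun b => if b then (u : X → ℝ) else F', fun v => v false, |u p|,
    ?_, contDiff_apply ℝ ℝ false, abs_pos.2 hu, fun x hx => ?_⟩
  · rintro (_ | _)
    · exact F'.mem
    · exact u.mem
  · have h1 : |u x - u p| < |u p| := hx true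
    refine h x fun h0 => ?_
    rw [h0, zero_sub, abs_neg] at h1
    exact lt_irrefl _ h1

lemma IsComplete.comp_mem (hC : IsComplete C) {ι : Type} [Fintype ι] {g : ι → X → ℝ}
    (hg : ∀ i, g i ∈ C) {Φ : (ι → ℝ) → ℝ} (hΦ : ContDiff ℝ ∞ Φ) : (fun x => Φ fun i => g i x) ∈ C :=
  hC _ fun _ => ⟨ι, inferInstance, g, Φ, 1, hg, hΦ, one_pos, fun _ _ => rfl⟩

lemma IsComplete.comp_real (hC : IsComplete C) {f : X → ℝ} (hf : f ∈ C) {Φ : ℝ → ℝ}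
    (hΦ : ContDiff ℝ ∞ Φ) : (fun x => Φ (f x)) ∈ C :=
  hC.comp_mem (ι := Unit) (g := fun _ => f) (fun _ => hf) (Φ := fun v => Φ (v ()))
    (hΦ.comp (contDiff_apply ℝ ℝ ()))

/-- Composing `f` with a bump function of the line turns the preimage of a ball into a basic open
set `{u ≠ 0}`. -/
lemma IsComplete.tendsto (hC : IsComplete C) (f : Fn C) (p : X) :
    Tendsto f (Near C p) (𝓝 (f p)) := by
  refine Metric.nhds_basis_ball.tendsto_right_iff.2 fun ε hε => ?_
  let b : ContDiffBump (f p) := ⟨ε / 2, ε, by positivity, by linarith⟩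
  refine ⟨Fn.mk (fun x => b (f x)) (hC.comp_real f.mem b.contDiff), ?_, fun x hx => ?_⟩
  · exact (b.pos_of_mem_ball (Metric.mem_ball_self hε)).ne'
  · have : f x ∈ Function.support b := hx
    rwa [b.support_eq] at this

lemma SmAt.tendsto (hC : IsComplete C) {F : X → ℝ} {p : X} (hF : SmAt C F p) :
    Tendsto F (Near C p) (𝓝 (F p)) := by
  obtain ⟨F', h⟩ := hF
  rw [near_self h]
  exact (hC.tendsto F' p).congr' (h.mono fun _ h => h.symm)

lemma SmAt.tendsto_pi (hC : IsComplete C) {ι : Type} {g : ι → X → ℝ} {p : X}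
    (hg : ∀ i, SmAt C (g i) p) : Tendsto (fun x i => g i x) (Near C p) (𝓝 fun i => g i p) :=
  tendsto_pi_nhds.2 fun i => (hg i).tendsto hC

lemma SmAt.comp (hC : IsComplete C) {ι : Type} [Fintype ι] {g : ι → X → ℝ} {p : X}
    (hg : ∀ i, SmAt C (g i) p) {Φ : (ι → ℝ) → ℝ} {O : Set (ι → ℝ)} (hO : IsOpen O)
    (hp : (fun i => g i p) ∈ O) (hΦ : ContDiffOn ℝ ∞ Φ O) :
    SmAt C (fun x => Φ fun i => g i x) p := by
  have ht := SmAt.tendsto_pi hC hg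
  choose g' hg' using hg
  obtain ⟨Φ', h1, h2⟩ := exists_contDiff_eqOn hO hΦ hp
  refine ⟨Fn.mk _ (hC.comp_mem (fun i => (g' i).mem) h1), ?_⟩
  filter_upwards [ht.eventually h2, eventually_all.2 hg'] with x hx hx'
  rw [← hx, Fn.mk_apply]
  exact congrArg Φ' (funext hx')

lemma SmAt.inv (hC : IsComplete C) {F : X → ℝ} {p : X} (hF : SmAt C F p) (hp : F p ≠ 0) :
    SmAt C (fun x => (F x)⁻¹) p :=
  SmAt.comp hC (ι := Unit) (g := fun _ => F) (fun _ => hF) (Φ := fun v => (v ())⁻¹)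
    (O := {v | v () ≠ 0}) (isOpen_ne_fun (continuous_apply ()) continuous_const) hp
    (ContDiffOn.inv (contDiff_apply ℝ ℝ ()).contDiffOn fun _ h => h)

/-- A cut-off function at `p` subordinate to `{u ≠ 0}`. -/
lemma IsComplete.exists_cutoff (hC : IsComplete C) {p : X} (u : Fn C) (hu : u p ≠ 0) :
    ∃ χ : Fn C, (∀ᶠ q in Near C p, χ q = 1) ∧
      ∀ q, u q ≠ 0 ∨ ∀ᶠ z in Near C q, χ z = 0 := by
  have hup : 0 < |u p| := abs_pos.2 hu
  -- Zero is at distance `|u p|` from the centre, twice the outer radius; hence the cut-off vanishes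
  -- near every zero of `u`.
  let b : ContDiffBump (u p) := ⟨|u p| / 4, |u p| / 2, by positivity, by linarith⟩
  refine ⟨Fn.mk (fun x => b (u x)) (hC.comp_real u.mem b.contDiff), ?_, fun q => ?_⟩
  · exact (hC.tendsto u p).eventually b.eventuallyEq_one
  · by_cases hq : u q = 0
    · right
      have h1 : ∀ᶠ t in 𝓝 (u q), b t = 0 := by
        rw [hq]
        filter_upwards [Metric.ball_mem_nhds (0 : ℝ) (half_pos hup)] with t ht
        refine b.zero_of_le_dist ?_
        change |u p| / 2 ≤ dist t (u p)
        have h2 := dist_triangle_left (0 : ℝ) (u p) t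
        have h3 := Metric.mem_ball.1 ht
        rw [dist_zero_left, Real.norm_eq_abs] at h2
        linarith
      exact (hC.tendsto u q).eventually h1
    · exact Or.inl hq

/-- Extension by zero: the values of `g` off `{u ≠ 0}` are irrelevant, since the cut-off vanishes
near those points. -/
lemma IsComplete.mul_cutoff_mem (hC : IsComplete C) {u χ : Fn C}
    (h : ∀ q, u q ≠ 0 ∨ ∀ᶠ z in Near C q, χ z = 0) {g : X → ℝ}
    (hg : ∀ q, u q ≠ 0 → SmAt C g q) : (fun q => χ q * g q) ∈ C := by
  refine hC.mem_of_smAt fun q => ?_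
  rcases h q with hq | hq
  · exact (χ.smAt q).mul (hg q hq)
  · refine (smAt_const 0 q).congr ?_
    filter_upwards [hq] with z hz
    rw [hz, zero_mul]

/-! #### Generated algebras -/

lemma subset_generated (S : Set (X → ℝ)) {g : X → ℝ} (hg : g ∈ S) : g ∈ generated S := fun _ =>
  ⟨Unit, inferInstance, fun _ => g, fun v => v (), 1, fun _ => hg, contDiff_apply ℝ ℝ (),
    one_pos, fun _ _ => rfl⟩

/-- Compositions of local expressions are local expressions. The radius for the inner generators
must be small enough both for every inner expression to be valid and to keep the outer arguments
within `ε`. -/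
lemma isComplete_generated (S : Set (X → ℝ)) : IsComplete (generated S) := by
  intro F hF p
  obtain ⟨ι, _, g, Φ, ε, hg, hΦ, hε, h⟩ := hF p
  choose κ hκ k Ψ η hk hΨ hη h' using fun i => hg i p
  let K : ι → (Σ i, κ i) → X → ℝ := fun _ j => k j.1 j.2
  have hcont : ∀ i, ∃ δ > 0, ∀ y : κ i → ℝ, (∀ j, |y j - k i j p| < δ) →
      |Ψ i y - Ψ i (fun j => k i j p)| < ε := fun i => by
    obtain ⟨δ, hδ, hd⟩ := Metric.continuous_iff.1 (hΨ i).continuous (fun j => k i j p) ε hε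
    refine ⟨δ, hδ, fun y hy => ?_⟩
    have := hd y ((dist_pi_lt_iff hδ).2 fun j => by rw [Real.dist_eq]; exact hy j)
    rwa [Real.dist_eq] at this
  choose δ hδ hd using hcont
  obtain ⟨ρ, hρ, hρ'⟩ : ∃ ρ : ℝ, 0 < ρ ∧ ∀ i, ρ ≤ δ i ∧ ρ ≤ η i := by
    cases isEmpty_or_nonempty ι
    · exact ⟨1, one_pos, fun i => isEmptyElim i⟩
    · refine ⟨Finset.univ.inf' Finset.univ_nonempty fun i => min (δ i) (η i), ?_, fun i => ?_⟩
      · exact (Finset.lt_inf'_iff _).2 fun i _ => lt_min (hδ i) (hη i)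
      · have := Finset.inf'_le (fun i => min (δ i) (η i)) (Finset.mem_univ i)
        exact ⟨this.trans (min_le_left _ _), this.trans (min_le_right _ _)⟩
  refine ⟨Σ i, κ i, inferInstance, fun j => k j.1 j.2, fun v => Φ fun i => Ψ i fun j => v ⟨i, j⟩,
    ρ, fun j => hk j.1 j.2, hΦ.comp (contDiff_pi.2 fun i => (hΨ i).comp (by fun_prop)), hρ,
    fun x hx => ?_⟩
  have e1 : ∀ i, g i x = Ψ i fun j => k i j x := fun i =>
    h' i x fun j => (hx ⟨i, j⟩).trans_le (hρ' i).2
  have e2 : ∀ i, g i p = Ψ i fun j => k i j p := fun i =>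
    h' i p fun j => by simpa using hη i
  rw [h x fun i => ?_]
  · exact congrArg Φ (funext e1)
  · rw [e1, e2]
    exact hd i _ fun j => (hx ⟨i, j⟩).trans_le (hρ' i).1

/-- A function in a generated algebra pulls back to a smooth germ if the generators do. -/
lemma SmAt.generated_comp (hC : IsComplete C) {S : Set (Y → ℝ)} {φ : X → Y} {x : X}
    (h : ∀ g ∈ S, SmAt C (fun z => g (φ z)) x) {F : Y → ℝ} (hF : F ∈ generated S) :
    SmAt C (fun z => F (φ z)) x := by
  obtain ⟨ι, _, g, Φ, ε, hg, hΦ, hε, hF⟩ := hF (φ x)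
  have h1 : ∀ i, ∀ᶠ z in Near C x, |g i (φ z) - g i (φ x)| < ε := fun i =>
    (((h _ (hg i)).tendsto hC).eventually (Metric.ball_mem_nhds _ hε)).mono fun x hx => hx
  refine (SmAt.comp hC (fun i => h _ (hg i)) isOpen_univ trivial hΦ.contDiffOn).congr ?_
  filter_upwards [eventually_all.2 h1] with z hz using hF _ hz

lemma isSmooth_generated (hC : IsComplete C) {S : Set (Y → ℝ)} {φ : X → Y}
    (h : ∀ g ∈ S, (fun z => g (φ z)) ∈ C) : IsSmooth C (generated S) φ := fun _ hF =>
  hC.mem_of_smAt fun x => SmAt.generated_comp hC (fun g hg => smAt_of_mem (h g hg) x) hF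

lemma contDiffOn_generated {V : Type} [NormedAddCommGroup V] [NormedSpace ℝ V]
    {S : Set (Y → ℝ)} {σ : V → Y} {O : Set V} (hO : IsOpen O)
    (h : ∀ g ∈ S, ContDiffOn ℝ ∞ (fun z => g (σ z)) O) {F : Y → ℝ} (hF : F ∈ generated S) :
    ContDiffOn ℝ ∞ (fun z => F (σ z)) O := by
  intro y hy
  obtain ⟨ι, _, g, Φ, ε, hg, hΦ, hε, hF⟩ := hF (σ y)
  have hgy : ∀ i, ContDiffAt ℝ ∞ (fun z => g i (σ z)) y := fun i =>
    (h _ (hg i)).contDiffAt (hO.mem_nhds hy)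
  have h1 : ∀ i, ∀ᶠ z in 𝓝 y, |g i (σ z) - g i (σ y)| < ε := fun i =>
    ((hgy i).continuousAt.eventually (Metric.ball_mem_nhds _ hε)).mono fun x hx => hx
  refine ContDiffAt.contDiffWithinAt ?_
  have h2 : ContDiffAt ℝ ∞ (fun z => Φ fun i => g i (σ z)) y :=
    hΦ.contDiffAt.comp y (contDiffAt_pi.2 hgy)
  refine h2.congr_of_eventuallyEq ?_
  filter_upwards [eventually_all.2 h1] with z hz using hF _ hz

lemma isComplete_quotAlg (K : Type w) [Group K] [MulAction K X] (hC : IsComplete C) :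
    IsComplete (quotAlg K C) := by
  intro F hF
  exact hC.mem_of_smAt fun x =>
    SmAt.generated_comp hC (φ := orbitMk K) (fun g hg => smAt_of_mem (C := C) (f := g ∘ orbitMk K) hg x) hF

lemma isSmooth_orbitMk (K : Type w) [Group K] [MulAction K X] :
    IsSmooth C (quotAlg K C) (orbitMk K) := fun _ hf => hf

lemma IsSmooth.comp {Z : Type w} {E : FunAlg Z} {φ : X → Y} {ψ : Y → Z} (hψ : IsSmooth D E ψ)
    (hφ : IsSmooth C D φ) : IsSmooth C E (fun x => ψ (φ x)) := fun f hf => hφ _ (hψ f hf)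

lemma isDiffeo_of_inverse {φ : X → Y} {ψ : Y → X} (hφ : IsSmooth C D φ) (hψ : IsSmooth D C ψ)
    (h1 : ∀ x, ψ (φ x) = x) (h2 : ∀ y, φ (ψ y) = y) : IsDiffeo C D φ := by
  refine ⟨Function.bijective_iff_has_inverse.2 ⟨ψ, h1, h2⟩, fun f => ⟨fun hf => hφ f hf,
    fun hf => ?_⟩⟩
  have := hψ _ hf
  rwa [Function.comp_assoc, show φ ∘ ψ = id from funext h2, Function.comp_id] at this

/-! #### Derivations at a point -/

/-- `δ` is a derivation at `p`. -/
def IsPtDer (C : FunAlg X) (p : X) (δ : Fn C →ₗ[ℝ] ℝ) : Prop :=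
  ∀ f g, δ (f * g) = f p * δ g + g p * δ f

lemma IsPtDer.one {p : X} {δ : Fn C →ₗ[ℝ] ℝ} (h : IsPtDer C p δ) : δ 1 = 0 := by
  have := h 1 1
  simp only [mul_one, Fn.one_apply, one_mul] at this
  linarith

/-- If `{u ≠ 0}` is the neighbourhood, then `u * (f - g) = 0`, and the Leibniz rule leaves `u p * δ
(f - g) = 0`. -/
lemma IsPtDer.local {p : X} {δ : Fn C →ₗ[ℝ] ℝ} (h : IsPtDer C p δ) {f g : Fn C}
    (hfg : ∀ᶠ x in Near C p, f x = g x) : δ f = δ g := by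
  obtain ⟨u, hu, hfg⟩ := hfg
  have h1 : u * (f - g) = 0 := Fn.ext fun x => by
    by_cases hx : u x = 0
    · simp [hx]
    · simp [show f x = g x from hfg x hx]
  have h2 := h u (f - g)
  rw [h1, map_zero, Fn.sub_apply, hfg p hu, sub_self, zero_mul, add_zero, map_sub] at h2
  exact sub_eq_zero.1 ((mul_eq_zero.1 h2.symm).resolve_left hu)

lemma IsPtDer.const {p : X} {δ : Fn C →ₗ[ℝ] ℝ} (h : IsPtDer C p δ) (c : ℝ) :
    δ (algebraMap ℝ (Fn C) c) = 0 := by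
  rw [Algebra.algebraMap_eq_smul_one, map_smul, h.one, smul_zero]

/-- Hadamard's lemma writes `f` near `p` as a constant plus a sum of products `(g i - g i p) * k i`.
On such a product the Leibniz rule leaves `k i p * δ (g i)`, and `k i p` is the partial derivative.
-/
lemma IsPtDer.chain (hC : IsComplete C) {p : X} {δ : Fn C →ₗ[ℝ] ℝ} (h : IsPtDer C p δ)
    {ι : Type} [Fintype ι] [DecidableEq ι] {g : ι → Fn C} {Φ : (ι → ℝ) → ℝ} {O : Set (ι → ℝ)}
    (hO : IsOpen O) (hp : (fun i => g i p) ∈ O) (hΦ : ContDiffOn ℝ ∞ Φ O) {f : Fn C}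
    (hf : ∀ᶠ x in Near C p, f x = Φ fun i => g i x) :
    δ f = ∑ i, fderiv ℝ Φ (fun i => g i p) (Pi.single i 1) * δ (g i) := by
  obtain ⟨Φ', h1, h2⟩ := exists_contDiff_eqOn hO hΦ hp
  obtain ⟨Ψ, hΨ, hΨ1, hΨ2⟩ := hadamard h1 (fun i => g i p)
  rw [← h2.fderiv_eq]
  simp only [← hΨ2]
  let k : ι → Fn C := fun i => Fn.mk _ (hC.comp_mem (fun i => (g i).mem) (hΨ i))
  have ht := SmAt.tendsto_pi hC fun i => (g i).smAt p
  have hf' : δ f = δ (algebraMap ℝ (Fn C) (Φ' fun i => g i p)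
      + ∑ i, (g i - algebraMap ℝ (Fn C) (g i p)) * k i) := by
    refine h.local ?_
    filter_upwards [hf, ht.eventually h2] with x hx hx'
    rw [hx, ← hx', hΨ1, Fn.add_apply, Fn.sum_apply]
    rfl
  rw [hf', map_add, h.const, zero_add, map_sum]
  refine Finset.sum_congr rfl fun i _ => ?_
  have h0 : (algebraMap ℝ (Fn C) (g i p) : Fn C) p = g i p := rfl
  rw [h, map_sub, h.const, sub_zero, Fn.sub_apply, h0, sub_self, zero_mul, zero_add]
  rfl

/-- The value at `x` of a vector field along a smooth map. -/
def derAlong {φ : X → Y} (hφ : IsSmooth C D φ) (V : Derivation ℝ (Fn C) (Fn C)) (x : X) :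
    Fn D →ₗ[ℝ] ℝ where
  toFun f := V (pull hφ f) x
  map_add' f g := by rw [map_add, map_add, Fn.add_apply]
  map_smul' c f := by rw [map_smul, V.map_smul, Fn.smul_apply]; rfl

lemma derAlong_apply {φ : X → Y} (hφ : IsSmooth C D φ) (V : Derivation ℝ (Fn C) (Fn C)) (x : X)
    (f : Fn D) : derAlong hφ V x f = V (pull hφ f) x := rfl

lemma isPtDer_derAlong {φ : X → Y} (hφ : IsSmooth C D φ) (V : Derivation ℝ (Fn C) (Fn C))
    (x : X) : IsPtDer D (φ x) (derAlong hφ V x) := fun f g => by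
  rw [derAlong_apply, map_mul, Derivation.leibniz]
  rfl

/-- The value at `x` of a vector field. -/
def derAt (V : Derivation ℝ (Fn C) (Fn C)) (x : X) : Fn C →ₗ[ℝ] ℝ where
  toFun f := V f x
  map_add' f g := by rw [map_add, Fn.add_apply]
  map_smul' c f := by rw [V.map_smul, Fn.smul_apply]; rfl

lemma derAt_apply (V : Derivation ℝ (Fn C) (Fn C)) (x : X) (f : Fn C) : derAt V x f = V f x := rfl

lemma isPtDer_derAt (V : Derivation ℝ (Fn C) (Fn C)) (x : X) : IsPtDer C x (derAt V x) :=
  fun f g => by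
    rw [derAt_apply, Derivation.leibniz]
    rfl

lemma der_near (V : Derivation ℝ (Fn C) (Fn C)) {p : X} {f g : Fn C}
    (h : ∀ᶠ x in Near C p, f x = g x) : ∀ᶠ x in Near C p, V f x = V g x :=
  (near_near h).mono fun x hx => (isPtDer_derAt V x).local hx

end Germs

/-! ### Charts of function algebras, and charts adapted to a hypersurface -/

section Charts

variable {X : Type u} {C : FunAlg X} {Z : Set X} {ι : Type} [Fintype ι] [DecidableEq ι]

/-- A chart: a diffeomorphism between `{u ≠ 0}` and an open subset of `ℝ^ι`. -/
structure Chart (C : FunAlg X) (ι : Type) [Fintype ι] where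
  u : Fn C
  x : X → ι → ℝ
  O : Set (ι → ℝ)
  σ : (ι → ℝ) → X
  isOpen : IsOpen O
  mem : ∀ q, u q ≠ 0 → x q ∈ O
  left : ∀ q, u q ≠ 0 → σ (x q) = q
  ne : ∀ y ∈ O, u (σ y) ≠ 0
  right : ∀ y ∈ O, x (σ y) = y
  smooth_inv : ∀ f : Fn C, ContDiffOn ℝ ∞ (fun y => f (σ y)) O
  smooth : ∀ q, u q ≠ 0 → ∀ i, SmAt C (fun z => x z i) q

/-- Continuity of an inverse chart for the topology given by the algebra, because `u ∘ σ` is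
continuous for each `u`. -/
lemma eventually_inv {O : Set (ι → ℝ)} {σ : (ι → ℝ) → X} (hO : IsOpen O)
    (hσ : ∀ f : Fn C, ContDiffOn ℝ ∞ (fun y => f (σ y)) O) {y : ι → ℝ} (hy : y ∈ O)
    {P : X → Prop} (h : ∀ᶠ q in Near C (σ y), P q) : ∀ᶠ z in 𝓝 y, P (σ z) := by
  obtain ⟨u, hu, h⟩ := h
  have h1 : ContinuousAt (fun y => u (σ y)) y :=
    ((hσ u).continuousOn.continuousAt (hO.mem_nhds hy))
  exact (h1.eventually_ne hu).mono fun z hz => h _ hz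

lemma Chart.smAt_comp (hC : IsComplete C) (φ : Chart C ι) {q : X} (hq : φ.u q ≠ 0)
    {Φ : (ι → ℝ) → ℝ} (hΦ : ContDiffOn ℝ ∞ Φ φ.O) : SmAt C (fun z => Φ (φ.x z)) q :=
  SmAt.comp hC (φ.smooth q hq) φ.isOpen (φ.mem q hq) hΦ

lemma Chart.tendsto (hC : IsComplete C) (φ : Chart C ι) {q : X} (hq : φ.u q ≠ 0) :
    Tendsto φ.x (Near C q) (𝓝 (φ.x q)) :=
  SmAt.tendsto_pi hC (φ.smooth q hq)

/-- `r` generates the ideal of `Z` near `p`, and is not a zero divisor. -/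
structure IsGen (C : FunAlg X) (Z : Set X) (p : X) (r : Fn C) : Prop where
  vanish : ∀ᶠ z in Near C p, z ∈ Z → r z = 0
  div : ∀ F ∈ vanIdeal C Z, ∃ G : Fn C, ∀ᶠ z in Near C p, F z = r z * G z
  cancel : ∀ G : Fn C, (∀ᶠ z in Near C p, r z * G z = 0) → G p = 0

lemma Chart.isGen_one (φ : Chart C ι) {q : X} (hq : φ.u q ≠ 0) (hZ : ∀ q, φ.u q ≠ 0 → q ∉ Z) :
    IsGen C Z q 1 := by
  refine ⟨?_, fun F _ => ⟨F, ?_⟩, fun G hG => ?_⟩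
  · filter_upwards [near_of_ne φ.u hq] with z hz hz'
    exact absurd hz' (hZ z hz)
  · exact Eventually.of_forall fun z => by rw [Fn.one_apply, one_mul]
  · have := (near_self hG :)
    rwa [Fn.one_apply, one_mul] at this

/-- Where `e` is nonzero it is invertible and nothing is at stake. At a zero of `e`, divisibility is
`exists_div_coordinate`, the value on the hyperplane being zero, and cancellation follows by
continuity along the coordinate line. -/
lemma Chart.isGen_coord (hC : IsComplete C) (φ : Chart C ι) {q : X} (hq : φ.u q ≠ 0) {i0 : ι}
    {e : Fn C} (hex : ∀ q, φ.u q ≠ 0 → e q = φ.x q i0)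
    (hZ : ∀ q, φ.u q ≠ 0 → (q ∈ Z ↔ e q = 0)) : IsGen C Z q e := by
  refine ⟨?_, fun F hF => ?_, fun G hG => ?_⟩
  · filter_upwards [near_of_ne φ.u hq] with z hz hz'
    exact (hZ z hz).1 hz'
  · by_cases h0 : e q = 0
    · obtain ⟨Φ, h1, h2⟩ := exists_contDiff_eqOn φ.isOpen (φ.smooth_inv F) (φ.mem q hq)
      obtain ⟨Ψ, h3, h4⟩ := exists_div_coordinate h1 i0
      -- The retraction to the hyperplane fixes the image of `q`, so it keeps nearby points within
      -- the chart.
      have hup : Tendsto (fun y : ι → ℝ => Function.update y i0 (0 : ℝ)) (𝓝 (φ.x q))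
          (𝓝 (φ.x q)) := by
        have hc : Continuous fun y : ι → ℝ => Function.update y i0 (0 : ℝ) :=
          continuous_id.update i0 continuous_const
        have := hc.tendsto (φ.x q)
        rwa [show Function.update (φ.x q) i0 0 = φ.x q by
          rw [show (0 : ℝ) = φ.x q i0 by rw [← hex q hq, h0], Function.update_eq_self]] at this
      obtain ⟨G, hG⟩ := φ.smAt_comp hC hq h3.contDiffOn
      refine ⟨G, ?_⟩
      have ht := φ.tendsto hC hq
      filter_upwards [hG, ht.eventually h2, ht.eventually (hup.eventually h2),
        ht.eventually (hup.eventually (φ.isOpen.mem_nhds (φ.mem q hq))),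
        near_of_ne φ.u hq] with z k1 k2 k3 k4 k5
      rw [← k1, hex z k5, ← φ.left z k5, ← k2, h4, k3, φ.left z k5]
      have hz : φ.σ (Function.update (φ.x z) i0 0) ∈ Z := by
        rw [hZ _ (φ.ne _ k4), hex _ (φ.ne _ k4), φ.right _ k4, Function.update_self]
      rw [hF _ hz, zero_add]
    · obtain ⟨G, hG⟩ := (F.smAt q).mul ((e.smAt q).inv hC h0)
      refine ⟨G, ?_⟩
      filter_upwards [hG, near_of_ne e h0] with z h1 h2
      rw [← h1]
      field_simp
  · by_cases h0 : e q = 0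
    · have hO := φ.mem q hq
      have h1 : ∀ᶠ z in 𝓝 (φ.x q), e (φ.σ z) * G (φ.σ z) = 0 := by
        refine eventually_inv (P := fun z => e z * G z = 0) φ.isOpen φ.smooth_inv hO ?_
        rwa [φ.left q hq]
      have hc : ContinuousAt (fun y => G (φ.σ y)) (φ.x q) :=
        (φ.smooth_inv G).continuousOn.continuousAt (φ.isOpen.mem_nhds hO)
      -- On the punctured line in direction `i0` the coordinate is nonzero, so `G` vanishes there
      -- and its limit at `q` is zero.
      have hs : Tendsto (fun s : ℝ => φ.x q + s • Pi.single i0 1) (𝓝[≠] 0)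
          (𝓝 (φ.x q)) := by
        have hc : Continuous fun s : ℝ => φ.x q + s • (Pi.single i0 1 : ι → ℝ) := by fun_prop
        have := hc.tendsto 0
        rw [zero_smul, add_zero] at this
        exact this.mono_left nhdsWithin_le_nhds
      have h2 : Tendsto (fun s : ℝ => G (φ.σ (φ.x q + s • Pi.single i0 1))) (𝓝[≠] 0)
          (𝓝 (G q)) := by
        have := hc.tendsto.comp hs
        rwa [φ.left q hq] at this
      refine tendsto_nhds_unique h2 (tendsto_const_nhds.congr' ?_)
      filter_upwards [hs.eventually h1, hs.eventually (φ.isOpen.mem_nhds hO),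
        self_mem_nhdsWithin] with s k1 k2 k3
      rw [hex _ (φ.ne _ k2), φ.right _ k2] at k1
      have h4 : φ.x q i0 = 0 := by rw [← hex q hq, h0]
      simp only [Pi.add_apply, h4, Pi.smul_apply, Pi.single_eq_same, smul_eq_mul, mul_one,
        zero_add] at k1
      exact ((mul_eq_zero.1 k1).resolve_left k3).symm
    · exact (mul_eq_zero.1 (near_self hG :)).resolve_left h0

/-- Away from `p` the function may be nonzero on `Z`; a cut-off places it in the ideal without
changing its germ. -/
lemma IsGen.div_of_near (hC : IsComplete C) {p : X} {r : Fn C} (h : IsGen C Z p r) {F : Fn C}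
    (hF : ∀ᶠ z in Near C p, z ∈ Z → F z = 0) :
    ∃ G : Fn C, ∀ᶠ z in Near C p, F z = r z * G z := by
  obtain ⟨u, hu, hF⟩ := hF
  obtain ⟨χ, h1, h2⟩ := hC.exists_cutoff u hu
  obtain ⟨G, hG⟩ := h.div (χ * F) fun z hz => by
    rcases h2 z with h3 | h3
    · rw [Fn.mul_apply, show F z = 0 from hF z h3 hz, mul_zero]
    · rw [Fn.mul_apply, near_self h3, zero_mul]
  refine ⟨G, ?_⟩
  filter_upwards [hG, h1] with z hz hz'
  rw [← hz, Fn.mul_apply, hz', one_mul]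

/-- Two local generators differ by a unit. -/
lemma IsGen.exists_unit (hC : IsComplete C) {p : X} {r s : Fn C} (hr : IsGen C Z p r)
    (hs : IsGen C Z p s) :
    ∃ G H : Fn C, G p * H p = 1 ∧ (∀ᶠ z in Near C p, r z = s z * G z) ∧
      ∀ᶠ z in Near C p, s z = r z * H z := by
  obtain ⟨G, hG⟩ := hs.div_of_near hC hr.vanish
  obtain ⟨H, hH⟩ := hr.div_of_near hC hs.vanish
  refine ⟨G, H, ?_, hG, hH⟩
  -- Substituting one division in the other gives `r = r * H * G` near `p`, and `r` cancels.
  have h1 := hr.cancel (G * H - 1) (by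
    filter_upwards [hG, hH] with z h1 h2
    rw [Fn.sub_apply, Fn.mul_apply, Fn.one_apply]
    have h3 : r z = r z * H z * G z := by rw [← h2]; exact h1
    linarith)
  rw [Fn.sub_apply, Fn.mul_apply, Fn.one_apply] at h1
  linarith

variable (C Z ι) in
/-- A chart by globally defined coordinates that is adapted to `Z`, with a local frame of
`b`-vector fields. -/
structure FChart extends Chart C ι where
  i0 : ι
  e : Fn C
  xf : ι → Fn C
  x_eq : ∀ q i, x q i = xf i q
  W : ι → BDer C Z
  W_apply : ∀ q, u q ≠ 0 → ∀ i j,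
    (W i).der (xf j) q = if i = j then (if i = i0 then e q else 1) else 0
  crit : (e = 1 ∧ ∀ q, u q ≠ 0 → q ∉ Z) ∨
    (e = xf i0 ∧ e ∈ vanIdeal C Z ∧ ∀ q, u q ≠ 0 → (q ∈ Z ↔ xf i0 q = 0))

/-- The scaling of the coordinate field `∂_i`. -/
def FChart.ec (φ : FChart C Z ι) (i : ι) : Fn C := if i = φ.i0 then φ.e else 1

lemma FChart.W_apply' (φ : FChart C Z ι) {q : X} (hq : φ.u q ≠ 0) (i j : ι) :
    (φ.W i).der (φ.xf j) q = if i = j then φ.ec i q else 0 := by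
  rw [φ.W_apply q hq, FChart.ec]
  split_ifs <;> rfl

/-- By the chain rule, a derivation at a point of the chart sees a function only through the
coordinates. -/
lemma FChart.det (hC : IsComplete C) (φ : FChart C Z ι) {q : X} (hq : φ.u q ≠ 0)
    {δ δ' : Fn C →ₗ[ℝ] ℝ} (hδ : IsPtDer C q δ) (hδ' : IsPtDer C q δ')
    (h : ∀ i, δ (φ.xf i) = δ' (φ.xf i)) (f : Fn C) : δ f = δ' f := by
  have hx : ∀ z, (fun i => φ.xf i z) = φ.x z := fun z => funext fun i => (φ.x_eq z i).symm
  have hf : ∀ᶠ z in Near C q, f z = (fun y => f (φ.σ y)) fun i => φ.xf i z := by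
    filter_upwards [near_of_ne φ.u hq] with z hz
    rw [hx, φ.left z hz]
  have hm : (fun i => φ.xf i q) ∈ φ.O := by
    rw [hx]
    exact φ.mem q hq
  rw [hδ.chain hC φ.isOpen hm (φ.smooth_inv f) hf, hδ'.chain hC φ.isOpen hm (φ.smooth_inv f) hf]
  simp only [h]

lemma FChart.isGen (hC : IsComplete C) (φ : FChart C Z ι) {q : X} (hq : φ.u q ≠ 0) :
    IsGen C Z q φ.e := by
  rcases φ.crit with ⟨he, hZ⟩ | ⟨he, -, hZ⟩
  · rw [he]
    exact φ.toChart.isGen_one hq hZ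
  · refine φ.toChart.isGen_coord hC hq (i0 := φ.i0) (fun z _ => by rw [he, φ.x_eq]) ?_
    rwa [he]

lemma FChart.ec_cancel (hC : IsComplete C) (φ : FChart C Z ι) {q : X} (hq : φ.u q ≠ 0) (i : ι)
    {G : Fn C} (hG : ∀ᶠ z in Near C q, φ.ec i z * G z = 0) : G q = 0 := by
  unfold FChart.ec at hG
  split_ifs at hG
  · exact (φ.isGen hC hq).cancel G hG
  · have := near_self hG
    rwa [Fn.one_apply, one_mul] at this

variable (C Z ι) in
/-- The germ at `p` of a chart adapted to `Z`. -/
structure RawChart (p : X) where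
  x : X → ι → ℝ
  O : Set (ι → ℝ)
  σ : (ι → ℝ) → X
  isOpen : IsOpen O
  mem : x p ∈ O
  left : ∀ᶠ q in Near C p, σ (x q) = q
  right : ∀ y ∈ O, x (σ y) = y
  smooth_inv : ∀ f : Fn C, ContDiffOn ℝ ∞ (fun y => f (σ y)) O
  smooth : ∀ i, SmAt C (fun z => x z i) p
  i0 : ι
  crit : (∀ᶠ q in Near C p, q ∉ Z) ∨ (p ∈ Z ∧ ∀ᶠ q in Near C p, (q ∈ Z ↔ x q i0 = 0))

/-- The vector field `χ a ∂_i` of a chart, cut off outside the chart. -/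
def cutoffDer {u χ : Fn C} (hC : IsComplete C) (hχ : ∀ q, u q ≠ 0 ∨ ∀ᶠ z in Near C q, χ z = 0)
    {x : X → ι → ℝ} {O : Set (ι → ℝ)} {σ : (ι → ℝ) → X} (hO : IsOpen O)
    (hu : ∀ q, u q ≠ 0 → x q ∈ O ∧ σ (x q) = q ∧ ∀ i, SmAt C (fun z => x z i) q)
    (hσ : ∀ f : Fn C, ContDiffOn ℝ ∞ (fun y => f (σ y)) O) (a : Fn C) (i : ι) :
    Derivation ℝ (Fn C) (Fn C) :=
  have hd : ∀ q, u q ≠ 0 → ∀ f : Fn C, DifferentiableAt ℝ (fun y => f (σ y)) (x q) := fun q hq f =>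
    ((hσ f).contDiffAt (hO.mem_nhds (hu q hq).1)).differentiableAt (by simp)
  -- The cut-off vanishes where `u` does, so all identities need checking only inside the chart,
  -- where `f ∘ σ` is differentiable.
  have hz : ∀ q, u q = 0 → χ q = 0 := fun q hq => (near_self ((hχ q).resolve_left fun h => h hq) :)
  Derivation.mk'
    { toFun := fun f => Fn.mk
        (fun q => χ q * (a q * fderiv ℝ (fun y => f (σ y)) (x q) (Pi.single i 1)))
        (hC.mul_cutoff_mem hχ fun q hq => (a.smAt q).mul <|
          SmAt.comp hC (hu q hq).2.2 hO (hu q hq).1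
            (((hσ f).fderiv_of_isOpen hO (m := ∞) (by simp)).clm_apply contDiffOn_const))
      map_add' := fun f g => Fn.ext fun q => by
        by_cases hq : u q = 0
        · simp [hz q hq]
        · simp only [Fn.mk_apply, Fn.add_apply]
          rw [fderiv_fun_add (hd q hq f) (hd q hq g), add_apply]
          ring
      map_smul' := fun c f => Fn.ext fun q => by
        by_cases hq : u q = 0
        · simp [hz q hq]
        · simp only [Fn.mk_apply, Fn.smul_apply, RingHom.id_apply]
          rw [fderiv_const_mul (hd q hq f), smul_apply, smul_eq_mul]
          ring }
    fun f g => Fn.ext fun q => by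
      by_cases hq : u q = 0
      · simp [hz q hq]
      · simp only [LinearMap.coe_mk, AddHom.coe_mk, Fn.mk_apply, Fn.add_apply, smul_eq_mul,
          Fn.mul_apply]
        rw [fderiv_fun_mul (hd q hq f) (hd q hq g), add_apply, smul_apply, smul_apply, smul_eq_mul, smul_eq_mul, (hu q hq).2.1]
        ring

/-- Two nested cut-offs turn a germ of a chart into global data. The function `χ` makes coordinates
and frame global. The final domain is the preimage of a coordinate ball over which `χ = 1`, so that
inside it the cut-off is invisible. -/
lemma RawChart.exists_fchart (hC : IsComplete C) {p : X} (ρ : RawChart C Z ι p) :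
    ∃ φ : FChart C Z ι, φ.u p ≠ 0 ∧ φ.i0 = ρ.i0 ∧
      (∀ q, φ.u q ≠ 0 → ∀ i, φ.xf i q = ρ.x q i) ∧ (p ∉ Z → φ.e = 1) := by
  have hcr : ∀ᶠ q in Near C p, (p ∉ Z ∧ q ∉ Z) ∨ (p ∈ Z ∧ (q ∈ Z ↔ ρ.x q ρ.i0 = 0)) := by
    rcases ρ.crit with h | ⟨h, h'⟩
    · exact h.mono fun q hq => Or.inl ⟨(near_self h :), hq⟩
    · exact h'.mono fun q hq => Or.inr ⟨h, hq⟩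
  have hsm : ∀ᶠ q in Near C p, ∀ i, SmAt C (fun z => ρ.x z i) q :=
    eventually_all.2 fun i => (ρ.smooth i).near
  have hO : ∀ᶠ q in Near C p, ρ.x q ∈ ρ.O :=
    (SmAt.tendsto_pi hC ρ.smooth).eventually (ρ.isOpen.mem_nhds ρ.mem)
  obtain ⟨u, hup, hu⟩ := hcr.and (hsm.and (hO.and ρ.left))
  have hu' : ∀ q, u q ≠ 0 → ρ.x q ∈ ρ.O ∧ ρ.σ (ρ.x q) = q ∧ ∀ i, SmAt C (fun z => ρ.x z i) q :=
    fun q hq => ⟨(hu q hq).2.2.1, (hu q hq).2.2.2, (hu q hq).2.1⟩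
  obtain ⟨χ, hχ1, hχ⟩ := hC.exists_cutoff u hup
  have hχu : ∀ q, χ q ≠ 0 → u q ≠ 0 := fun q hq =>
    (hχ q).resolve_right fun h => hq (near_self h :)
  let xf : ι → Fn C := fun i => Fn.mk (fun q => χ q * ρ.x q i)
    (hC.mul_cutoff_mem hχ fun q hq => (hu' q hq).2.2 i)
  have hev : ∀ᶠ y in 𝓝 (ρ.x p), y ∈ ρ.O ∧ χ (ρ.σ y) = 1 := by
    refine (ρ.isOpen.mem_nhds ρ.mem |> fun h => (h : ∀ᶠ y in 𝓝 (ρ.x p), y ∈ ρ.O)).and ?_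
    refine eventually_inv (P := fun q => χ q = 1) ρ.isOpen ρ.smooth_inv ρ.mem ?_
    rwa [near_self ρ.left]
  obtain ⟨r, hr, hball⟩ := Metric.eventually_nhds_iff_ball.1 hev
  let b : ContDiffBump (ρ.x p) := ⟨r / 2, r, by positivity, by linarith⟩
  have hb : ∀ y, b y ≠ 0 ↔ y ∈ Metric.ball (ρ.x p) r := fun y => by
    have := b.support_eq
    rw [Set.ext_iff] at this
    exact this y
  let uu : Fn C := Fn.mk (fun q => χ q * b (ρ.x q)) (hC.mul_cutoff_mem hχ fun q hq =>
    SmAt.comp hC (hu' q hq).2.2 isOpen_univ trivial b.contDiff.contDiffOn)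
  have huu : ∀ q, uu q ≠ 0 → ρ.x q ∈ Metric.ball (ρ.x p) r ∧ u q ≠ 0 ∧ χ q = 1 := fun q hq => by
    have h1 : χ q * b (ρ.x q) ≠ 0 := hq
    have h2 := (hb _).1 (right_ne_zero_of_mul h1)
    have h3 := hχu q (left_ne_zero_of_mul h1)
    refine ⟨h2, h3, ?_⟩
    have := (hball _ h2).2
    rwa [(hu' q h3).2.1] at this
  have hxf : ∀ q, uu q ≠ 0 → ∀ i, xf i q = ρ.x q i := fun q hq i => by
    change χ q * ρ.x q i = _
    rw [(huu q hq).2.2, one_mul]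
  have huσ : ∀ y ∈ Metric.ball (ρ.x p) r, uu (ρ.σ y) ≠ 0 := fun y hy => by
    change χ (ρ.σ y) * b (ρ.x (ρ.σ y)) ≠ 0
    rw [(hball y hy).2, one_mul, ρ.right y (hball y hy).1]
    exact (hb y).2 hy
  have hup' : uu p ≠ 0 := by
    have := huσ _ (Metric.mem_ball_self hr)
    rwa [near_self ρ.left] at this
  have hZu : ∀ q, u q ≠ 0 → (p ∉ Z ∧ q ∉ Z) ∨ (p ∈ Z ∧ (q ∈ Z ↔ ρ.x q ρ.i0 = 0)) :=
    fun q hq => (hu q hq).1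
  -- The kind of the chart is decided at its centre: `p ∈ Z` makes the distinguished coordinate
  -- critical, and otherwise the domain avoids `Z`.
  obtain ⟨e, he⟩ : ∃ e : Fn C, (p ∉ Z ∧ e = 1) ∨ (p ∈ Z ∧ e = xf ρ.i0) := by
    by_cases hp : p ∈ Z
    · exact ⟨xf ρ.i0, Or.inr ⟨hp, rfl⟩⟩
    · exact ⟨1, Or.inl ⟨hp, rfl⟩⟩
  have hvan : p ∈ Z → xf ρ.i0 ∈ vanIdeal C Z := fun hp z hz => by
    change χ z * ρ.x z ρ.i0 = 0
    by_cases h0 : χ z = 0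
    · rw [h0, zero_mul]
    · rcases hZu z (hχu z h0) with h | h
      · exact absurd hp h.1
      · rw [h.2.1 hz, mul_zero]
  let W : ι → BDer C Z := fun i => BField.mk
    (cutoffDer hC hχ ρ.isOpen hu' ρ.smooth_inv (if i = ρ.i0 then e else 1) i) fun f hf z hz => by
      change χ z * ((if i = ρ.i0 then e else 1 : Fn C) z *
        fderiv ℝ (fun y => f (ρ.σ y)) (ρ.x z) (Pi.single i 1)) = 0
      by_cases h0 : χ z = 0
      · rw [h0, zero_mul]
      have hzu := hχu z h0
      rcases hZu z hzu with h | ⟨hp, h⟩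
      · exact absurd hz h.2
      · by_cases hi : i = ρ.i0
        · rw [if_pos hi]
          rcases he with h' | h'
          · exact absurd hp h'.1
          · rw [h'.2, hvan hp z hz, zero_mul, mul_zero]
        -- For `i ≠ i0` the line in direction `i` through a point of `Z` stays in `Z`, where `f`
        -- vanishes; hence so does the derivative of `f` along it.
        · have hx0 := h.1 hz
          have hzO := (hu' z hzu).1
          have hdf : DifferentiableAt ℝ (fun y => f (ρ.σ y)) (ρ.x z) :=
            ((ρ.smooth_inv f).contDiffAt (ρ.isOpen.mem_nhds hzO)).differentiableAt (by simp)
          have hl : HasDerivAt (fun s : ℝ => ρ.x z + s • (Pi.single i 1 : ι → ℝ))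
              (Pi.single i 1) 0 := by
            simpa using ((hasDerivAt_id (0 : ℝ)).smul_const
              (Pi.single i 1 : ι → ℝ)).const_add (ρ.x z)
          have hdf' : HasFDerivAt (fun y => f (ρ.σ y)) (fderiv ℝ (fun y => f (ρ.σ y)) (ρ.x z))
              (ρ.x z + (0 : ℝ) • (Pi.single i 1 : ι → ℝ)) := by
            rw [zero_smul, add_zero]
            exact hdf.hasFDerivAt
          have h1 := hdf'.comp_hasDerivAt (0 : ℝ) hl
          have hs : Tendsto (fun s : ℝ => ρ.x z + s • (Pi.single i 1 : ι → ℝ)) (𝓝 0)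
              (𝓝 (ρ.x z)) := by
            have hc : Continuous fun s : ℝ => ρ.x z + s • (Pi.single i 1 : ι → ℝ) := by fun_prop
            have := hc.tendsto 0
            rwa [zero_smul, add_zero] at this
          have h2 : ∀ᶠ s in 𝓝 (0 : ℝ), f (ρ.σ (ρ.x z + s • (Pi.single i 1 : ι → ℝ))) = 0 := by
            have h3 : ∀ᶠ y in 𝓝 (ρ.x z), u (ρ.σ y) ≠ 0 := by
              refine eventually_inv (P := fun q => u q ≠ 0) ρ.isOpen ρ.smooth_inv hzO ?_
              rw [(hu' z hzu).2.1]
              exact near_of_ne u hzu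
            filter_upwards [hs.eventually h3, hs.eventually (ρ.isOpen.mem_nhds hzO)] with s k1 k2
            refine hf _ ?_
            rcases hZu _ k1 with k | k
            · exact absurd hp k.1
            · rw [k.2, ρ.right _ k2]
              simp [hx0, Ne.symm hi]
          have h4 := h1.unique ((hasDerivAt_const (0 : ℝ) (0 : ℝ)).congr_of_eventuallyEq h2)
          rw [h4, mul_zero, mul_zero]
  refine ⟨{ u := uu, x := fun q i => xf i q, O := Metric.ball (ρ.x p) r, σ := ρ.σ,
            isOpen := Metric.isOpen_ball, mem := fun q hq => ?_, left := fun q hq => ?_,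
            ne := huσ, right := fun y hy => ?_,
            smooth_inv := fun f => (ρ.smooth_inv f).mono fun y hy => (hball y hy).1,
            smooth := fun q hq i => (xf i).smAt q, i0 := ρ.i0, e := e, xf := xf,
            x_eq := fun q i => rfl, W := W, W_apply := fun q hq i j => ?_, crit := ?_ },
          hup', rfl, hxf, fun h => (he.resolve_right fun h' => h h'.1).2⟩
  · rw [show (fun i => xf i q) = ρ.x q from funext (hxf q hq)]
    exact (huu q hq).1
  · rw [show (fun i => xf i q) = ρ.x q from funext (hxf q hq)]
    exact (hu' q (huu q hq).2.1).2.1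
  · funext i
    rw [hxf _ (huσ y hy), ρ.right y (hball y hy).1]
  · obtain ⟨h1, h2, h3⟩ := huu q hq
    change χ q * ((if i = ρ.i0 then e else 1 : Fn C) q *
        fderiv ℝ (fun y => xf j (ρ.σ y)) (ρ.x q) (Pi.single i 1)) = _
    have h4 : (fun y => xf j (ρ.σ y)) =ᶠ[𝓝 (ρ.x q)] fun y => y j := by
      filter_upwards [Metric.isOpen_ball.mem_nhds h1] with y hy
      rw [hxf _ (huσ y hy), ρ.right y (hball y hy).1]
    rw [h4.fderiv_eq, h3, one_mul]
    have h5 : fderiv ℝ (fun y : ι → ℝ => y j) (ρ.x q) = ContinuousLinearMap.proj j :=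
      (ContinuousLinearMap.proj (R := ℝ) (φ := fun _ : ι => ℝ) j).hasFDerivAt.fderiv
    rw [h5, ContinuousLinearMap.proj_apply]
    by_cases hij : i = j
    · subst hij
      rw [if_pos rfl, Pi.single_eq_same, mul_one]
      split_ifs <;> rfl
    · rw [if_neg hij, Pi.single_eq_of_ne (Ne.symm hij), mul_zero]
  · rcases he with ⟨h1, h2⟩ | ⟨h1, h2⟩
    · refine Or.inl ⟨h2, fun q hq => ?_⟩
      rcases hZu q (huu q hq).2.1 with h | h
      · exact h.2
      · exact absurd h.1 h1
    · refine Or.inr ⟨h2, h2 ▸ hvan h1, fun q hq => ?_⟩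
      rcases hZu q (huu q hq).2.1 with h | h
      · exact absurd h1 h.1
      · rw [h.2, hxf q hq]

end Charts

/-! ### Push-forward of `b`-vector fields and pull-back of `b`-covectors -/

section BMaps

variable {X : Type u} {Y : Type v} {S : Type w} {CX : FunAlg X} {ZX : Set X} {CY : FunAlg Y}
  {ZY : Set Y} {CS : FunAlg S} {ZS : Set S} {ι κ : Type} [Fintype ι] [DecidableEq ι]
  [Fintype κ] [DecidableEq κ]

/-- The algebra `C` and the set `Z` are those of a manifold with a hypersurface. -/
structure IsBMfd (C : FunAlg X) (Z : Set X) (ι : Type) [Fintype ι] [DecidableEq ι] : Prop where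
  complete : IsComplete C
  chart : ∀ p, ∃ φ : FChart C Z ι, φ.u p ≠ 0 ∧ (p ∉ Z → φ.e = 1)

/-- A smooth map that pulls back the hypersurface, with its ideal. -/
structure IsBMap (CX : FunAlg X) (ZX : Set X) (CY : FunAlg Y) (ZY : Set Y) (φ : X → Y) :
    Prop where
  smooth : IsSmooth CX CY φ
  maps : ∀ x ∈ ZX, φ x ∈ ZY
  gen : ∀ x r, IsGen CY ZY (φ x) r → IsGen CX ZX x (pull smooth r)

lemma IsBMap.id : IsBMap CX ZX CX ZX (fun x => x) :=
  ⟨fun _ hf => hf, fun _ h => h, fun _ _ h => h⟩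

lemma IsBMap.comp {φ : X → Y} {ψ : Y → S} (hψ : IsBMap CY ZY CS ZS ψ)
    (hφ : IsBMap CX ZX CY ZY φ) : IsBMap CX ZX CS ZS (fun x => ψ (φ x)) :=
  ⟨hψ.smooth.comp hφ.smooth, fun x hx => hψ.maps _ (hφ.maps x hx),
    fun x r hr => hφ.gen x _ (hψ.gen (φ x) r hr)⟩

/-- One local generator at each point suffices. -/
lemma isBMap_of_exists (hY : IsComplete CY) {φ : X → Y} (hφ : IsSmooth CX CY φ)
    (hm : ∀ x ∈ ZX, φ x ∈ ZY)
    (h : ∀ x, ∃ r, IsGen CY ZY (φ x) r ∧ IsGen CX ZX x (pull hφ r)) : IsBMap CX ZX CY ZY φ := by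
  refine ⟨hφ, hm, fun x s hs => ?_⟩
  obtain ⟨r, hr, hr'⟩ := h x
  obtain ⟨G, K, hGK, hG, hK⟩ := hr.exists_unit hY hs
  have hG' : ∀ᶠ z in Near CX x, r (φ z) = s (φ z) * G (φ z) := (hφ.tendsto x).eventually hG
  have hK' : ∀ᶠ z in Near CX x, s (φ z) = r (φ z) * K (φ z) := (hφ.tendsto x).eventually hK
  refine ⟨?_, fun F hF => ?_, fun F hF => ?_⟩
  · filter_upwards [hr'.vanish, hK'] with z h1 h2 hz
    rw [pull_apply] at h1
    rw [pull_apply, h2, h1 hz, zero_mul]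
  · obtain ⟨F', hF'⟩ := hr'.div F hF
    refine ⟨pull hφ G * F', ?_⟩
    filter_upwards [hF', hG'] with z h1 h2
    rw [h1, Fn.mul_apply, pull_apply, pull_apply, pull_apply, h2, mul_assoc]
  · have h1 := hr'.cancel (pull hφ K * F) (by
      filter_upwards [hF, hK'] with z h1 h2
      rw [Fn.mul_apply, pull_apply, pull_apply, ← mul_assoc, ← h2]
      exact h1)
    rw [Fn.mul_apply, pull_apply] at h1
    refine (mul_eq_zero.1 h1).resolve_left fun h0 => ?_
    rw [h0, mul_zero] at hGK
    exact zero_ne_one hGK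

/-- A smooth map is a `b`-map if its composition with a `b`-map is. -/
lemma IsBMap.of_comp (hY : IsComplete CY) (hS : IsBMfd CS ZS κ) {φ : X → Y} {ψ : Y → S}
    (hψ : IsBMap CY ZY CS ZS ψ) (hφ : IsSmooth CX CY φ) (hm : ∀ x ∈ ZX, φ x ∈ ZY)
    (h : IsBMap CX ZX CS ZS (fun x => ψ (φ x))) : IsBMap CX ZX CY ZY φ := by
  refine isBMap_of_exists hY hφ hm fun x => ?_
  obtain ⟨c, hc, -⟩ := hS.chart (ψ (φ x))
  exact ⟨_, hψ.gen _ _ (c.isGen hS.complete hc), h.gen _ _ (c.isGen hS.complete hc)⟩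

/-- Near `x`, `φ_* V` is the combination of the fields `D k` with coefficients `c k`. -/
def Rep {φ : X → Y} (hφ : IsSmooth CX CY φ) (x : X) (V : BDer CX ZX) {K : Type*} [Fintype K]
    (c : K → Fn CX) (D : K → BDer CY ZY) : Prop :=
  ∀ᶠ z in Near CX x, ∀ f : Fn CY, V.der (pull hφ f) z = ∑ k, c k z * (D k).der f (φ z)

/-- The coefficients are the derivatives `V (φ^* x_i)`, except that for `i0` one divides by the
pulled-back scaling factor. This is possible because `φ^* x_{i0}` vanishes on `ZX`, hence so does
its derivative along the tangent field `V`. Both sides are then derivations along `φ` with the same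
values on coordinates. -/
lemma IsBMap.exists_rep {φ : X → Y} (hφ : IsBMap CX ZX CY ZY φ) (hY : IsComplete CY)
    (c : FChart CY ZY ι) {x : X} (hx : c.u (φ x) ≠ 0) (V : BDer CX ZX) :
    ∃ a : ι → Fn CX, Rep hφ.smooth x V a c.W := by
  have h : ∀ i, ∃ a : Fn CX, ∀ᶠ z in Near CX x,
      V.der (pull hφ.smooth (c.xf i)) z = c.ec i (φ z) * a z := fun i => by
    unfold FChart.ec
    split_ifs with hi
    · rcases c.crit with ⟨he, -⟩ | ⟨he, he', -⟩
      · exact ⟨_, Eventually.of_forall fun z => by rw [he, Fn.one_apply, one_mul]⟩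
      · refine (hφ.gen x c.e (c.isGen hY hx)).div _ (V.der_mem ?_)
        intro z hz
        rw [hi, ← he]
        exact he' _ (hφ.maps z hz)
    · exact ⟨_, Eventually.of_forall fun z => by rw [Fn.one_apply, one_mul]⟩
  choose a ha using h
  refine ⟨a, ?_⟩
  filter_upwards [eventually_all.2 ha, near_of_ne (pull hφ.smooth c.u) hx] with z hz hz' f
  let δ : Fn CY →ₗ[ℝ] ℝ := ∑ i, a i z • derAt (c.W i).der (φ z)
  have hδ : ∀ f, δ f = ∑ i, a i z * (c.W i).der f (φ z) := fun f => by
    simp [δ, derAt_apply]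
  have hpt : IsPtDer CY (φ z) δ := fun f g => by
    simp only [hδ, Finset.mul_sum, ← Finset.sum_add_distrib]
    refine Finset.sum_congr rfl fun i _ => ?_
    have := isPtDer_derAt (c.W i).der (φ z) f g
    simp only [derAt_apply] at this
    rw [this]
    ring
  rw [← hδ]
  refine c.det hY hz' (isPtDer_derAlong hφ.smooth V.der z) hpt (fun j => ?_) f
  rw [derAlong_apply, hz, hδ, Finset.sum_eq_single j]
  · rw [c.W_apply' hz', if_pos rfl, mul_comm]
  · intro i _ hi
    rw [c.W_apply' hz', if_neg hi, mul_zero]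
  · simp

lemma FChart.exists_coef (hC : IsComplete CX) (c : FChart CX ZX ι) {x : X} (hx : c.u x ≠ 0)
    (V : BDer CX ZX) : ∃ a : ι → Fn CX, ∀ᶠ z in Near CX x, ∀ f : Fn CX,
      V.der f z = ∑ i, a i z * (c.W i).der f z :=
  IsBMap.id.exists_rep hC c hx V

lemma BCot.form_local (β : BCot CX ZX) {D D' : BDer CX ZX}
    (h : ∀ᶠ z in Near CX β.pt, ∀ f, D.der f z = D'.der f z) : β.form D = β.form D' := by
  obtain ⟨u, hu, h⟩ := h
  have h1 : u • D = u • D' := BField.ext fun f => Fn.ext fun z => by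
    rw [BField.smul_der, BField.smul_der, Fn.mul_apply, Fn.mul_apply]
    by_cases hz : u z = 0
    · rw [hz, zero_mul, zero_mul]
    · rw [show D.der f z = D'.der f z from h z hz f]
  have h2 := congrArg β.form h1
  rw [β.form_smul, β.form_smul] at h2
  exact mul_left_cancel₀ hu h2

lemma BField.sum_der {A : Type u} [CommRing A] [Algebra ℝ A] {I : Ideal A} {K : Type*}
    (s : Finset K) (D : K → BField A I) (f : A) :
    (∑ k ∈ s, D k).der f = ∑ k ∈ s, (D k).der f := by
  classical
  induction s using Finset.induction_on with
  | empty => simp only [Finset.sum_empty]; rfl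
  | insert k s hk ih => rw [Finset.sum_insert hk, Finset.sum_insert hk, BField.add_der, ih]

lemma BCot.form_sum_near (β : BCot CX ZX) {K : Type*} [Fintype K] {D : BDer CX ZX}
    {a : K → Fn CX} {E : K → BDer CX ZX}
    (h : ∀ᶠ z in Near CX β.pt, ∀ f, D.der f z = ∑ k, a k z * (E k).der f z) :
    β.form D = ∑ k, a k β.pt * β.form (E k) := by
  rw [β.form_local (D' := ∑ k, a k • E k), map_sum]
  · simp only [β.form_smul]
  · filter_upwards [h] with z hz f
    rw [hz, BField.sum_der, Fn.sum_apply]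
    rfl

/-- Vanishing combinations of pulled-back fields are killed by the covectors. -/
lemma IsBMap.sum_form_eq_zero {φ : X → Y} (hφ : IsBMap CX ZX CY ZY φ) (hY : IsBMfd CY ZY ι)
    {x : X} {K : Type*} [Fintype K] {c : K → Fn CX} {D : K → BDer CY ZY}
    (h : ∀ᶠ z in Near CX x, ∀ f : Fn CY, ∑ k, c k z * (D k).der f (φ z) = 0)
    {β : BCot CY ZY} (hβ : β.pt = φ x) : ∑ k, c k x * β.form (D k) = 0 := by
  obtain ⟨χ, hχ, -⟩ := hY.chart (φ x)
  choose a ha using fun k => χ.exists_coef hY.complete hχ (D k)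
  have ha' : ∀ᶠ z in Near CX x, ∀ k, ∀ f : Fn CY,
      (D k).der f (φ z) = ∑ i, a k i (φ z) * (χ.W i).der f (φ z) :=
    (hφ.smooth.tendsto x).eventually (eventually_all.2 ha)
  -- In the frame of the chart, each total coefficient times its scaling factor vanishes near `x`.
  -- As the factor is no zero divisor, the coefficient itself vanishes at `x`, even over the
  -- critical hypersurface.
  have key : ∀ j, ∑ k, c k x * a k j (φ x) = 0 := fun j => by
    have h1 : ∀ᶠ z in Near CX x, χ.ec j (φ z) * ∑ k, c k z * a k j (φ z) = 0 := by
      filter_upwards [h, ha', near_of_ne (pull hφ.smooth χ.u) hχ] with z h1 h2 h3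
      rw [← h1 (χ.xf j), Finset.mul_sum]
      refine Finset.sum_congr rfl fun k _ => ?_
      rw [h2 k, Finset.sum_eq_single j]
      · rw [χ.W_apply' h3, if_pos rfl]
        ring
      · intro i _ hi
        rw [χ.W_apply' h3, if_neg hi, mul_zero]
      · simp
    have h2 : ∀ z, (∑ k, c k * pull hφ.smooth (a k j) : Fn CX) z = ∑ k, c k z * a k j (φ z) :=
      fun z => Fn.sum_apply _ _ z
    rw [← h2]
    unfold FChart.ec at h1
    split_ifs at h1
    · refine (hφ.gen x χ.e (χ.isGen hY.complete hχ)).cancel _ ?_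
      filter_upwards [h1] with z hz
      rw [h2]
      exact hz
    · rw [h2]
      have := (near_self h1 :)
      rwa [Fn.one_apply, one_mul] at this
  have h2 : ∀ k, β.form (D k) = ∑ i, a k i (φ x) * β.form (χ.W i) := fun k => by
    rw [β.form_sum_near (E := χ.W) (a := a k) (by rw [hβ]; exact ha k), hβ]
  simp only [h2, Finset.mul_sum, ← mul_assoc]
  rw [Finset.sum_comm]
  refine Finset.sum_eq_zero fun j _ => ?_
  rw [← Finset.sum_mul, key, zero_mul]

/-- The difference of two representations is a vanishing combination indexed by the disjoint union.
-/
lemma IsBMap.rep_unique {φ : X → Y} (hφ : IsBMap CX ZX CY ZY φ) (hY : IsBMfd CY ZY ι)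
    {x : X} {V : BDer CX ZX} {K L : Type*} [Fintype K] [Fintype L] {c : K → Fn CX}
    {D : K → BDer CY ZY} {c' : L → Fn CX} {D' : L → BDer CY ZY} (h : Rep hφ.smooth x V c D)
    (h' : Rep hφ.smooth x V c' D') {β : BCot CY ZY} (hβ : β.pt = φ x) :
    ∑ k, c k x * β.form (D k) = ∑ k, c' k x * β.form (D' k) := by
  have := hφ.sum_form_eq_zero hY (x := x) (c := Sum.elim c fun k => -c' k) (D := Sum.elim D D')
    (by
      filter_upwards [h, h'] with z h1 h2 f
      simp only [Fintype.sum_sum_type, Sum.elim_inl, Sum.elim_inr, Fn.neg_apply, neg_mul,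
        Finset.sum_neg_distrib]
      rw [← h1, ← h2, add_neg_cancel]) hβ
  simp only [Fintype.sum_sum_type, Sum.elim_inl, Sum.elim_inr, Fn.neg_apply, neg_mul,
        Finset.sum_neg_distrib] at this
  linarith

/-- Freezing the coefficients at `x` changes the combination by terms with coefficients `c k - c k
x`, which vanish at `x`, as `BPush` allows. -/
lemma Rep.bPush {φ : X → Y} {hφ : IsSmooth CX CY φ} {x : X} {V : BDer CX ZX} {K : Type*}
    [Fintype K] {c : K → Fn CX} {D : K → BDer CY ZY} (h : Rep hφ x V c D) :
    BPush φ x V (∑ k, c k x • D k) := by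
  classical
  obtain ⟨u, hu, h⟩ := h
  -- The fields `D k` may coincide, so the finitely supported sum is evaluated through additivity in
  -- the coefficient.
  have hs : ∀ (g : BDer CY ZY → Fn CX → Fn CX), (∀ D, g D 0 = 0) →
      (∀ D a b, g D (a + b) = g D a + g D b) →
      (∑ k, Finsupp.single (D k) (c k - algebraMap ℝ (Fn CX) (c k x))).sum g
        = ∑ k, g (D k) (c k - algebraMap ℝ (Fn CX) (c k x)) := fun g h0 ha => by
    rw [← Finsupp.sum_finsetSum_index h0 ha]
    exact Finset.sum_congr rfl fun k _ => Finsupp.sum_single_index (h0 _)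
  refine ⟨hφ, ∑ k, Finsupp.single (D k) (c k - algebraMap ℝ (Fn CX) (c k x)), u, fun E => ?_, hu,
    fun f => Fn.ext fun z => ?_⟩
  · rw [Finsupp.finsetSum_apply, Fn.sum_apply]
    refine Finset.sum_eq_zero fun k _ => ?_
    rw [Finsupp.single_apply]
    split_ifs
    · rw [Fn.sub_apply]
      exact sub_self _
    · rfl
  · rw [Fn.mul_apply, Fn.zero_apply]
    by_cases hz : u z = 0
    · rw [hz, zero_mul]
    rw [hs (fun D c => c * pull hφ (D.der f)) (fun D => zero_mul _) (fun D a b => add_mul _ _ _),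
      Fn.sub_apply, Fn.sub_apply,
      h z hz f, pull_apply, BField.sum_der, Fn.sum_apply, Fn.sum_apply, ← Finset.sum_sub_distrib,
      ← Finset.sum_sub_distrib, Finset.sum_eq_zero, mul_zero]
    intro k _
    rw [BField.rsmul_der, Fn.smul_apply, Fn.mul_apply, Fn.sub_apply, pull_apply]
    change _ - (c k z - c k x) * _ = 0
    ring

/-- The converse of `Rep.bPush`: the field `W` with coefficient `1`, indexed by `none`, together
with the correction terms, which are invisible at `x`. -/
lemma BPush.exists_rep {φ : X → Y} {x : X} {V : BDer CX ZX} {W : BDer CY ZY}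
    (h : BPush φ x V W) : ∃ (hφ : IsSmooth CX CY φ) (K : Type v) (_ : Fintype K) (c : K → Fn CX)
      (D : K → BDer CY ZY), Rep hφ x V c D ∧
      ∀ β : BCot CY ZY, ∑ k, c k x * β.form (D k) = β.form W := by
  obtain ⟨hφ, s, u, hs, hu, h⟩ := h
  refine ⟨hφ, Option s.support, inferInstance, fun k => k.elim 1 fun D => s D.1,
    fun k => k.elim W fun D => D.1, ⟨u, hu, fun z hz f => ?_⟩, fun β => ?_⟩
  · have h1 := congrArg (fun F : Fn CX => F z) (h f)
    simp only [Fn.mul_apply, Fn.sub_apply, Fn.zero_apply, mul_eq_zero, hz, false_or] at h1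
    rw [Fintype.sum_option, sub_sub, sub_eq_zero] at *
    rw [h1, Finsupp.sum, Fn.sum_apply, ← Finset.sum_coe_sort]
    change _ = (1 : Fn CX) z * W.der f (φ z) + _
    rw [Fn.one_apply, one_mul]
    rfl
  · rw [Fintype.sum_option]
    simp [hs]

lemma IsBMap.form_eq {φ : X → Y} (hφ : IsBMap CX ZX CY ZY φ) (hY : IsBMfd CY ZY ι) {x : X}
    {V : BDer CX ZX} {W : BDer CY ZY} (h : BPush φ x V W) {K : Type*} [Fintype K]
    {c : K → Fn CX} {D : K → BDer CY ZY} (h' : Rep hφ.smooth x V c D) {β : BCot CY ZY}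
    (hβ : β.pt = φ x) : β.form W = ∑ k, c k x * β.form (D k) := by
  obtain ⟨_, K, _, c, D, hr, he⟩ := h.exists_rep
  rw [← he, hφ.rep_unique hY hr h' hβ]

lemma IsBMap.exists_bPush {φ : X → Y} (hφ : IsBMap CX ZX CY ZY φ) (hY : IsBMfd CY ZY ι) (x : X)
    (V : BDer CX ZX) : ∃ W : BDer CY ZY, BPush φ x V W := by
  obtain ⟨χ, hχ, -⟩ := hY.chart (φ x)
  obtain ⟨a, ha⟩ := hφ.exists_rep hY.complete χ hχ V
  exact ⟨_, ha.bPush⟩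

lemma IsBMap.bPush_unique {φ : X → Y} (hφ : IsBMap CX ZX CY ZY φ) (hY : IsBMfd CY ZY ι) {x : X}
    {V : BDer CX ZX} {W W' : BDer CY ZY} (h : BPush φ x V W) (h' : BPush φ x V W')
    {β : BCot CY ZY} (hβ : β.pt = φ x) : β.form W = β.form W' := by
  obtain ⟨_, K, _, c, D, hr, he⟩ := h'.exists_rep
  rw [← he, hφ.form_eq hY h hr hβ]

lemma Rep.single {φ : X → Y} {hφ : IsSmooth CX CY φ} {x : X} {V : BDer CX ZX} {W : BDer CY ZY}
    (h : ∀ᶠ z in Near CX x, ∀ f, V.der (pull hφ f) z = W.der f (φ z)) :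
    Rep hφ x V (fun _ : Unit => 1) (fun _ => W) := by
  filter_upwards [h] with z hz f
  simp [hz]

lemma BPush.of_near {φ : X → Y} {hφ : IsSmooth CX CY φ} {x : X} {V : BDer CX ZX} {W : BDer CY ZY}
    (h : ∀ᶠ z in Near CX x, ∀ f, V.der (pull hφ f) z = W.der f (φ z)) : BPush φ x V W := by
  have := (Rep.single h).bPush
  simpa using this

/-- The pull-back of a `b`-covector along a `b`-map. -/
def IsBMap.cotPull {φ : X → Y} (hφ : IsBMap CX ZX CY ZY φ) (hY : IsBMfd CY ZY ι) (x : X)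
    (β : BCot CY ZY) (hβ : β.pt = φ x) : BCot CX ZX :=
  -- Every representation computes the value, so the choice of the push-forward is harmless and
  -- linearity can be read off in a common frame.
  have key : ∀ {V : BDer CX ZX} {K : Type} [Fintype K] {c : K → Fn CX} {D : K → BDer CY ZY},
      Rep hφ.smooth x V c D →
      β.form (hφ.exists_bPush hY x V).choose = ∑ k, c k x * β.form (D k) := fun h =>
    hφ.form_eq hY (hφ.exists_bPush hY x _).choose_spec h hβ
  { pt := x
    form :=
    { toFun := fun V => β.form (hφ.exists_bPush hY x V).choose
      map_add' := fun V V' => by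
        obtain ⟨χ, hχ, -⟩ := hY.chart (φ x)
        obtain ⟨a, ha⟩ := hφ.exists_rep hY.complete χ hχ V
        obtain ⟨a', ha'⟩ := hφ.exists_rep hY.complete χ hχ V'
        have h : Rep hφ.smooth x (V + V') (fun i => a i + a' i) χ.W := by
          filter_upwards [ha, ha'] with z h1 h2 f
          rw [BField.add_der, Fn.add_apply, h1, h2, ← Finset.sum_add_distrib]
          simp only [Fn.add_apply, add_mul]
        rw [key ha, key ha', key h, ← Finset.sum_add_distrib]
        simp only [Fn.add_apply, add_mul]
      map_smul' := fun r V => by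
        obtain ⟨χ, hχ, -⟩ := hY.chart (φ x)
        obtain ⟨a, ha⟩ := hφ.exists_rep hY.complete χ hχ V
        have h : Rep hφ.smooth x (r • V) (fun i => r • a i) χ.W := by
          filter_upwards [ha] with z h1 f
          rw [BField.rsmul_der, Fn.smul_apply, h1, Finset.mul_sum]
          simp only [Fn.smul_apply, mul_assoc]
        rw [key ha, key h, RingHom.id_apply, smul_eq_mul, Finset.mul_sum]
        simp only [Fn.smul_apply, mul_assoc] }
    form_smul := fun f V => by
      obtain ⟨χ, hχ, -⟩ := hY.chart (φ x)
      obtain ⟨a, ha⟩ := hφ.exists_rep hY.complete χ hχ V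
      have h : Rep hφ.smooth x (f • V) (fun i => f * a i) χ.W := by
        filter_upwards [ha] with z h1 g
        rw [BField.smul_der, Fn.mul_apply, h1, Finset.mul_sum]
        simp only [Fn.mul_apply, mul_assoc]
      change β.form (hφ.exists_bPush hY x (f • V)).choose
        = f x * β.form (hφ.exists_bPush hY x V).choose
      rw [key ha, key h, Finset.mul_sum]
      simp only [Fn.mul_apply, mul_assoc] }

lemma IsBMap.cotPull_bPush {φ : X → Y} (hφ : IsBMap CX ZX CY ZY φ) (hY : IsBMfd CY ZY ι) {x : X}
    {β : BCot CY ZY} (hβ : β.pt = φ x) {V : BDer CX ZX} {W : BDer CY ZY} (h : BPush φ x V W) :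
    (hφ.cotPull hY x β hβ).form V = β.form W :=
  hφ.bPush_unique hY (hφ.exists_bPush hY x V).choose_spec h hβ

lemma IsBMap.cotPull_rep {φ : X → Y} (hφ : IsBMap CX ZX CY ZY φ) (hY : IsBMfd CY ZY ι) {x : X}
    {β : BCot CY ZY} (hβ : β.pt = φ x) {V : BDer CX ZX} {K : Type*} [Fintype K]
    {c : K → Fn CX} {D : K → BDer CY ZY} (h : Rep hφ.smooth x V c D) :
    (hφ.cotPull hY x β hβ).form V = ∑ k, c k x * β.form (D k) :=
  hφ.form_eq hY (hφ.exists_bPush hY x V).choose_spec h hβ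

/-- The `b`-differential of a composition. -/
lemma IsBMap.cotPull_comp {φ : X → Y} {ψ : Y → S} (hφ : IsBMap CX ZX CY ZY φ)
    (hψ : IsBMap CY ZY CS ZS ψ) (hY : IsBMfd CY ZY ι) (hS : IsBMfd CS ZS κ) {x : X}
    {β : BCot CS ZS} (hβ : β.pt = ψ (φ x)) :
    hφ.cotPull hY x (hψ.cotPull hS (φ x) β hβ) rfl = (hψ.comp hφ).cotPull hS x β hβ := by
  refine BCot.ext rfl (LinearMap.ext fun V => ?_)
  obtain ⟨χ, hχ, -⟩ := hY.chart (φ x)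
  obtain ⟨a, ha⟩ := hφ.exists_rep hY.complete χ hχ V
  obtain ⟨η, hη, -⟩ := hS.chart (ψ (φ x))
  choose d hd using fun i => hψ.exists_rep hS.complete η hη (χ.W i)
  have h : Rep (hψ.comp hφ).smooth x V (fun j => ∑ i, a i * pull hφ.smooth (d i j)) η.W := by
    filter_upwards [ha, (hφ.smooth.tendsto x).eventually (eventually_all.2 hd)] with z h1 h2 f
    have h3 := h1 (pull hψ.smooth f)
    refine h3.trans ?_
    simp only [h2, Fn.sum_apply, Fn.mul_apply, pull_apply, Finset.mul_sum, Finset.sum_mul]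
    rw [Finset.sum_comm]
    simp only [mul_assoc]
  rw [hφ.cotPull_rep hY rfl ha, (hψ.comp hφ).cotPull_rep hS hβ h]
  simp only [hψ.cotPull_rep hS hβ (hd _), Fn.sum_apply, Fn.mul_apply, pull_apply, Finset.mul_sum,
    Finset.sum_mul]
  rw [Finset.sum_comm]
  simp only [mul_assoc]

/-- The chain rule in the form used below. Push-forwards are not unique as fields, only their values
on covectors at the image point are, so the conclusion is tested on `β`. -/
lemma IsBMap.bPush_comp {φ : X → Y} {ψ : Y → S} (hφ : IsBMap CX ZX CY ZY φ)
    (hψ : IsBMap CY ZY CS ZS ψ) (hY : IsBMfd CY ZY ι) (hS : IsBMfd CS ZS κ) {x : X}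
    {V : BDer CX ZX} {W : BDer CY ZY} {U U' : BDer CS ZS} (h : BPush φ x V W)
    (h' : BPush ψ (φ x) W U) (h'' : BPush (fun x => ψ (φ x)) x V U') {β : BCot CS ZS}
    (hβ : β.pt = ψ (φ x)) : β.form U' = β.form U := by
  rw [← (hψ.comp hφ).cotPull_bPush hS hβ h'', ← hφ.cotPull_comp hψ hY hS hβ,
    hφ.cotPull_bPush hY rfl h, hψ.cotPull_bPush hS hβ h']

end BMaps

/-! ### The `b`-cotangent bundle -/

section Cotangent

variable {X : Type u} {C : FunAlg X} {Z : Set X} {ι : Type} [Fintype ι] [DecidableEq ι]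

/-- Evaluation on the `j`-th coordinate isolates the `j`-th coefficient, up to a scaling factor that
cancels. -/
lemma FChart.coef_unique (hC : IsComplete C) (φ : FChart C Z ι) {q : X} (hq : φ.u q ≠ 0)
    {a b : ι → Fn C} (h : ∀ᶠ z in Near C q, ∀ f : Fn C,
      ∑ i, a i z * (φ.W i).der f z = ∑ i, b i z * (φ.W i).der f z) (j : ι) : a j q = b j q := by
  have h1 : (a j - b j) q = 0 := by
    refine φ.ec_cancel hC hq j ?_
    filter_upwards [h, near_of_ne φ.u hq] with z hz hz'
    have h2 := hz (φ.xf j)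
    rw [Finset.sum_eq_single j, Finset.sum_eq_single j, φ.W_apply' hz', if_pos rfl] at h2
    · rw [Fn.sub_apply]
      linarith
    · intro i _ hi
      rw [φ.W_apply' hz', if_neg hi, mul_zero]
    · simp
    · intro i _ hi
      rw [φ.W_apply' hz', if_neg hi, mul_zero]
    · simp
  rw [Fn.sub_apply] at h1
  linarith

open Classical in
/-- The coefficients at `q` of a `b`-vector field in the frame of a chart. -/
def FChart.coef (hC : IsComplete C) (φ : FChart C Z ι) (D : BDer C Z) (q : X) (i : ι) : ℝ :=
  -- With the default value zero, `covector` is the zero functional off the chart and stays linear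
  -- there.
  if hq : φ.u q ≠ 0 then (φ.exists_coef hC hq D).choose i q else 0

lemma FChart.coef_eq (hC : IsComplete C) (φ : FChart C Z ι) {q : X} (hq : φ.u q ≠ 0)
    {D : BDer C Z} {a : ι → Fn C} (h : ∀ᶠ z in Near C q, ∀ f : Fn C,
      D.der f z = ∑ i, a i z * (φ.W i).der f z) (i : ι) : φ.coef hC D q i = a i q := by
  rw [coef, dif_pos hq]
  refine φ.coef_unique hC hq ?_ i
  filter_upwards [h, (φ.exists_coef hC hq D).choose_spec] with z h1 h2 f
  rw [← h1, ← h2]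

/-- The definition chooses an expansion separately at each point; by uniqueness a single expansion
serves a whole neighbourhood, so the coefficients are smooth. -/
lemma FChart.coef_near (hC : IsComplete C) (φ : FChart C Z ι) {q : X} (hq : φ.u q ≠ 0)
    (D : BDer C Z) : ∃ a : ι → Fn C, (∀ᶠ z in Near C q, ∀ f : Fn C,
      D.der f z = ∑ i, a i z * (φ.W i).der f z) ∧
      ∀ᶠ z in Near C q, ∀ i, φ.coef hC D z i = a i z := by
  obtain ⟨a, ha⟩ := φ.exists_coef hC hq D
  refine ⟨a, ha, ?_⟩
  filter_upwards [near_near ha, near_of_ne φ.u hq] with z hz hz' i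
  exact φ.coef_eq hC hz' hz i

lemma FChart.coef_W (hC : IsComplete C) (φ : FChart C Z ι) {q : X} (hq : φ.u q ≠ 0) (i j : ι) :
    φ.coef hC (φ.W i) q j = if i = j then 1 else 0 := by
  rw [φ.coef_eq hC hq (a := fun j => if i = j then 1 else 0)]
  · split_ifs <;> rfl
  · refine Eventually.of_forall fun z f => ?_
    rw [Finset.sum_eq_single i]
    · rw [if_pos rfl, Fn.one_apply, one_mul]
    · intro j _ hj
      rw [if_neg hj.symm, Fn.zero_apply, zero_mul]
    · simp

lemma BCot.form_coef (hC : IsComplete C) (φ : FChart C Z ι) (β : BCot C Z) (hβ : φ.u β.pt ≠ 0)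
    (D : BDer C Z) : β.form D = ∑ i, φ.coef hC D β.pt i * β.form (φ.W i) := by
  obtain ⟨a, ha, ha'⟩ := φ.coef_near hC hβ D
  rw [β.form_sum_near ha]
  exact Finset.sum_congr rfl fun i _ => by rw [(near_self ha' :)]

/-- The covector at `q` with components `v` in the frame of a chart. -/
def FChart.covector (hC : IsComplete C) (φ : FChart C Z ι) (q : X) (v : ι → ℝ) : BCot C Z where
  pt := q
  form :=
    { toFun := fun D => ∑ i, φ.coef hC D q i * v i
      map_add' := fun D D' => by
        by_cases hq : φ.u q = 0
        · simp [coef, hq]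
        obtain ⟨a, ha, ha'⟩ := φ.coef_near hC hq D
        obtain ⟨b, hb, hb'⟩ := φ.coef_near hC hq D'
        rw [← Finset.sum_add_distrib]
        refine Finset.sum_congr rfl fun i _ => ?_
        rw [(near_self ha' :), (near_self hb' :), φ.coef_eq hC hq (a := fun i => a i + b i),
          Fn.add_apply, add_mul]
        filter_upwards [ha, hb] with z h1 h2 f
        rw [BField.add_der, Fn.add_apply, h1, h2, ← Finset.sum_add_distrib]
        simp only [Fn.add_apply, add_mul]
      map_smul' := fun r D => by
        by_cases hq : φ.u q = 0
        · simp [coef, hq]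
        obtain ⟨a, ha, ha'⟩ := φ.coef_near hC hq D
        rw [RingHom.id_apply, smul_eq_mul, Finset.mul_sum]
        refine Finset.sum_congr rfl fun i _ => ?_
        rw [(near_self ha' :), φ.coef_eq hC hq (a := fun i => r • a i), Fn.smul_apply, mul_assoc]
        filter_upwards [ha] with z h1 f
        rw [BField.rsmul_der, Fn.smul_apply, h1, Finset.mul_sum]
        simp only [Fn.smul_apply, mul_assoc] }
  form_smul f D := by
    by_cases hq : φ.u q = 0
    · simp [coef, hq]
    obtain ⟨a, ha, ha'⟩ := φ.coef_near hC hq D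
    change ∑ i, φ.coef hC (f • D) q i * v i = f q * ∑ i, φ.coef hC D q i * v i
    rw [Finset.mul_sum]
    refine Finset.sum_congr rfl fun i _ => ?_
    rw [(near_self ha' :), φ.coef_eq hC hq (a := fun i => f * a i), Fn.mul_apply, mul_assoc]
    filter_upwards [ha] with z h1 g
    rw [BField.smul_der, Fn.mul_apply, h1, Finset.mul_sum]
    simp only [Fn.mul_apply, mul_assoc]

lemma FChart.covector_form (hC : IsComplete C) (φ : FChart C Z ι) (q : X) (v : ι → ℝ)
    (D : BDer C Z) : (φ.covector hC q v).form D = ∑ i, φ.coef hC D q i * v i := rfl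

/-- The pull-back of a function to the `b`-cotangent bundle. -/
lemma isSmooth_pt : IsSmooth (cotAlg C Z) C BCot.pt := fun f hf =>
  subset_generated _ (Or.inl ⟨f, hf, rfl⟩)

/-- The fibrewise linear function of a `b`-vector field. -/
def linFn (D : BDer C Z) : Fn (cotAlg C Z) :=
  Fn.mk (fun α => α.form D) (subset_generated _ (Or.inr ⟨D, rfl⟩))

lemma isComplete_cotAlg : IsComplete (cotAlg C Z) := isComplete_generated _

/-- A map into the `b`-cotangent bundle is smooth if the functions on the base and the linear
functions pull back to smooth functions. -/
lemma isSmooth_cot {Y : Type v} {D : FunAlg Y} (hD : IsComplete D) {φ : Y → BCot C Z}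
    (h1 : ∀ f : Fn C, (fun y => f (φ y).pt) ∈ D) (h2 : ∀ V, (fun y => (φ y).form V) ∈ D) :
    IsSmooth D (cotAlg C Z) φ := by
  refine isSmooth_generated hD ?_
  rintro g (⟨f, hf, rfl⟩ | ⟨V, rfl⟩)
  · exact h1 (Fn.mk f hf)
  · exact h2 V

/-- The chart of the `b`-cotangent bundle over a chart of the base. -/
def FChart.cotChart (hC : IsComplete C) (φ : FChart C Z ι) : Chart (cotAlg C Z) (ι ⊕ ι) where
  u := pull isSmooth_pt φ.u
  x α := Sum.elim (fun i => φ.xf i α.pt) fun i => α.form (φ.W i)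
  O := {y | (fun i => y (Sum.inl i)) ∈ φ.O}
  σ y := φ.covector hC (φ.σ fun i => y (Sum.inl i)) fun i => y (Sum.inr i)
  isOpen := φ.isOpen.preimage (by fun_prop)
  mem α hα := by
    have := φ.mem α.pt hα
    rwa [show φ.x α.pt = fun i => φ.xf i α.pt from funext (φ.x_eq _)] at this
  left α hα := by
    have h1 : φ.σ (fun i => φ.xf i α.pt) = α.pt := by
      have := φ.left α.pt hα
      rwa [show φ.x α.pt = fun i => φ.xf i α.pt from funext (φ.x_eq _)] at this
    refine BCot.ext h1 (LinearMap.ext fun D => ?_)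
    rw [φ.covector_form, α.form_coef hC φ hα]
    simp only [Sum.elim_inl, Sum.elim_inr, h1]
  ne y hy := φ.ne _ hy
  right y hy := by
    funext i
    rcases i with i | i
    · have := congrFun (φ.right _ hy) i
      rw [φ.x_eq] at this
      exact this
    · change (φ.covector hC _ _).form (φ.W i) = _
      rw [φ.covector_form, Finset.sum_eq_single i]
      · rw [φ.coef_W hC (φ.ne _ hy), if_pos rfl, one_mul]
      · intro j _ hj
        rw [φ.coef_W hC (φ.ne _ hy), if_neg hj.symm, zero_mul]
      · simp
  smooth_inv F := by
    refine contDiffOn_generated (φ.isOpen.preimage (by fun_prop)) ?_ F.mem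
    have hl : ContDiff ℝ ∞ fun (y : ι ⊕ ι → ℝ) (i : ι) => y (Sum.inl i) := by fun_prop
    rintro g (⟨f, hf, rfl⟩ | ⟨D, rfl⟩)
    · exact (φ.smooth_inv (Fn.mk f hf)).comp hl.contDiffOn fun y hy => hy
    · simp only [φ.covector_form]
      refine ContDiffOn.sum fun i _ => ContDiffOn.mul ?_ (by fun_prop)
      refine ContDiffOn.comp (g := fun y => φ.coef hC D (φ.σ y) i) (t := φ.O) ?_ hl.contDiffOn
        fun y hy => hy
      intro y hy
      obtain ⟨a, -, ha⟩ := φ.coef_near hC (φ.ne y hy) D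
      refine (((φ.smooth_inv (a i)).contDiffAt (φ.isOpen.mem_nhds hy)).congr_of_eventuallyEq
        ?_).contDiffWithinAt
      exact (eventually_inv φ.isOpen φ.smooth_inv hy ha).mono fun z hz => hz i
  smooth α _ i := by
    rcases i with i | i
    · exact Fn.smAt (pull isSmooth_pt (φ.xf i)) α
    · exact Fn.smAt (linFn (φ.W i)) α

/-- The chart of the `b`-cotangent bundle, as an adapted germ. -/
def FChart.cotRaw (hC : IsComplete C) (φ : FChart C Z ι) (α : BCot C Z) (hα : φ.u α.pt ≠ 0) :
    RawChart (cotAlg C Z) (cotCrit C Z) (ι ⊕ ι) α where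
  x := (φ.cotChart hC).x
  O := (φ.cotChart hC).O
  σ := (φ.cotChart hC).σ
  isOpen := (φ.cotChart hC).isOpen
  mem := (φ.cotChart hC).mem α hα
  left := by
    filter_upwards [near_of_ne (φ.cotChart hC).u hα] with β hβ using (φ.cotChart hC).left β hβ
  right := (φ.cotChart hC).right
  smooth_inv := (φ.cotChart hC).smooth_inv
  smooth := (φ.cotChart hC).smooth α hα
  i0 := Sum.inl φ.i0
  crit := by
    have hn := near_of_ne (φ.cotChart hC).u hα
    rcases φ.crit with ⟨-, hZ⟩ | ⟨he', -, hZ⟩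
    · exact Or.inl (hn.mono fun β hβ => hZ β.pt hβ)
    · by_cases hz : α.pt ∈ Z
      · exact Or.inr ⟨hz, hn.mono fun β hβ => hZ β.pt hβ⟩
      -- A critical chart may well contain points off `Z`; at such a point it is shrunk to miss `Z`.
      · left
        have h1 : ∀ᶠ β in Near (cotAlg C Z) α, φ.xf φ.i0 β.pt ≠ 0 :=
          near_of_ne (pull isSmooth_pt (φ.xf φ.i0)) (fun h => hz ((hZ _ hα).2 h))
        filter_upwards [h1, hn] with β h1 h2 h3
        exact h1 ((hZ β.pt h2).1 h3)

lemma IsBMfd.cot (h : IsBMfd C Z ι) : IsBMfd (cotAlg C Z) (cotCrit C Z) (ι ⊕ ι) := by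
  refine ⟨isComplete_cotAlg, fun α => ?_⟩
  obtain ⟨φ, hφ, -⟩ := h.chart α.pt
  obtain ⟨ψ, h1, -, -, h4⟩ := (φ.cotRaw h.complete α hφ).exists_fchart isComplete_cotAlg
  exact ⟨ψ, h1, h4⟩

/-- The local generator of the base pulls back to `1` or to a coordinate of the chart of the total
space. -/
lemma IsBMfd.isBMap_pt (h : IsBMfd C Z ι) :
    IsBMap (cotAlg C Z) (cotCrit C Z) C Z BCot.pt := by
  refine isBMap_of_exists h.complete isSmooth_pt (fun α hα => hα) fun α => ?_
  obtain ⟨φ, hφ, -⟩ := h.chart α.pt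
  refine ⟨φ.e, φ.isGen h.complete hφ, ?_⟩
  rcases φ.crit with ⟨he, hZ⟩ | ⟨he, -, hZ⟩
  · rw [he, map_one]
    exact (φ.cotChart h.complete).isGen_one hφ fun β hβ => hZ β.pt hβ
  · rw [he]
    exact (φ.cotChart h.complete).isGen_coord isComplete_cotAlg hφ (i0 := Sum.inl φ.i0)
      (fun β _ => rfl) fun β hβ => hZ β.pt hβ

/-- The fields `∂_i` and `x_{i0} ∂_{i0}` commute, because each scaling factor depends at most on its
own coordinate. It suffices to check this on coordinates. -/
lemma FChart.bBr_W (hC : IsComplete C) (φ : FChart C Z ι) {q : X} (hq : φ.u q ≠ 0) (i j : ι) :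
    ∀ᶠ z in Near C q, ∀ f, (bBr (φ.W i) (φ.W j)).der f z = 0 := by
  have hW : ∀ᶠ z in Near C q, ∀ i j k, (φ.W i).der ((φ.W j).der (φ.xf k)) z
      = if j = k ∧ i = j then (φ.W i).der (φ.ec i) z else 0 := by
    refine eventually_all.2 fun i => eventually_all.2 fun j => eventually_all.2 fun k => ?_
    by_cases hjk : j = k
    · subst hjk
      have h1 : ∀ᶠ z in Near C q, (φ.W j).der (φ.xf j) z = φ.ec j z := by
        filter_upwards [near_of_ne φ.u hq] with z hz
        rw [φ.W_apply' hz, if_pos rfl]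
      filter_upwards [der_near (φ.W i).der h1, near_of_ne φ.u hq] with z h2 h3
      rw [h2]
      by_cases hij : i = j
      · subst hij
        simp
      · rw [if_neg (fun h => hij h.2)]
        unfold FChart.ec
        split_ifs with hj
        · rcases φ.crit with ⟨he, -⟩ | ⟨he, -⟩
          · rw [he, Derivation.map_one_eq_zero, Fn.zero_apply]
          · rw [he, φ.W_apply' h3, if_neg (hj ▸ hij)]
        · rw [Derivation.map_one_eq_zero, Fn.zero_apply]
    · have h1 : ∀ᶠ z in Near C q, (φ.W j).der (φ.xf k) z = (0 : Fn C) z := by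
        filter_upwards [near_of_ne φ.u hq] with z hz
        rw [φ.W_apply' hz, if_neg hjk, Fn.zero_apply]
      filter_upwards [der_near (φ.W i).der h1] with z h2
      rw [h2, map_zero, if_neg (fun h => hjk h.1), Fn.zero_apply]
  filter_upwards [hW, near_of_ne φ.u hq] with z h1 h2 f
  have h0 : IsPtDer C z 0 := fun f g => by simp
  refine φ.det hC h2 (isPtDer_derAt (bBr (φ.W i) (φ.W j)).der z) h0 (fun k => ?_) f
  rw [derAt_apply, bBr_der, Fn.sub_apply, h1, h1, LinearMap.zero_apply]
  by_cases hij : i = j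
  · subst hij
    rw [sub_self]
  · rw [if_neg (fun h => hij h.2), if_neg (fun h => hij h.2.symm), sub_zero]

/-- The local frame of the `b`-tangent bundle of the `b`-cotangent bundle: lifts `P i` of the
fields `W i` of a frame of the base, and the vertical fields `Q i`. -/
lemma IsBMfd.exists_cotFrame (h : IsBMfd C Z ι) (α : BCot C Z) :
    ∃ (φ : FChart C Z ι) (P Q : ι → BDer (cotAlg C Z) (cotCrit C Z)), φ.u α.pt ≠ 0 ∧
      (∀ᶠ β in Near (cotAlg C Z) α, ∀ i,
        (∀ f, (P i).der (pull isSmooth_pt f) β = (φ.W i).der f β.pt) ∧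
        (∀ f, (Q i).der (pull isSmooth_pt f) β = 0) ∧
        (∀ j, (P i).der (linFn (φ.W j)) β = 0) ∧
        (∀ j, (Q i).der (linFn (φ.W j)) β = if i = j then 1 else 0)) ∧
      ∀ᶠ γ in Near (cotAlg C Z) α, ∀ V : BDer (cotAlg C Z) (cotCrit C Z),
        ∃ a b : ι → Fn (cotAlg C Z), ∀ᶠ β in Near (cotAlg C Z) γ, ∀ F,
          V.der F β = ∑ i, a i β * (P i).der F β + ∑ i, b i β * (Q i).der F β := by
  obtain ⟨φ, hφ, he⟩ := h.chart α.pt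
  have hC' := isComplete_cotAlg (C := C) (Z := Z)
  obtain ⟨ψ, h1, h2, h3, h4⟩ := (φ.cotRaw h.complete α hφ).exists_fchart hC'
  have hxl : ∀ᶠ β in Near (cotAlg C Z) α, ∀ j,
      ψ.xf (Sum.inl j) β = pull isSmooth_pt (φ.xf j) β := by
    filter_upwards [near_of_ne ψ.u h1] with β hβ j using h3 β hβ _
  have hxr : ∀ᶠ β in Near (cotAlg C Z) α, ∀ j, ψ.xf (Sum.inr j) β = linFn (φ.W j) β := by
    filter_upwards [near_of_ne ψ.u h1] with β hβ j using h3 β hβ _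
  have hW : ∀ k, ∀ᶠ β in Near (cotAlg C Z) α, (∀ j,
      (ψ.W k).der (pull isSmooth_pt (φ.xf j)) β = if k = Sum.inl j then ψ.ec k β else 0) ∧ ∀ j,
      (ψ.W k).der (linFn (φ.W j)) β = if k = Sum.inr j then ψ.ec k β else 0 := fun k => by
    have hl : ∀ᶠ β in Near (cotAlg C Z) α, ∀ j, (ψ.W k).der (ψ.xf (Sum.inl j)) β
        = (ψ.W k).der (pull isSmooth_pt (φ.xf j)) β :=
      eventually_all.2 fun j => der_near _ (hxl.mono fun β hβ => hβ j)
    have hr : ∀ᶠ β in Near (cotAlg C Z) α, ∀ j, (ψ.W k).der (ψ.xf (Sum.inr j)) β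
        = (ψ.W k).der (linFn (φ.W j)) β :=
      eventually_all.2 fun j => der_near _ (hxr.mono fun β hβ => hβ j)
    filter_upwards [hl, hr, near_of_ne ψ.u h1] with β k1 k2 k3
    exact ⟨fun j => by rw [← k1, ψ.W_apply' k3], fun j => by rw [← k2, ψ.W_apply' k3]⟩
  have hi0 : ψ.i0 = Sum.inl φ.i0 := h2
  -- Lifts require equal scaling factors on the base and the total space. Over `Z` both are the
  -- distinguished coordinate; off `Z` both are `1`, which is why charts are required to have `e =
  -- 1` there.
  have hecl : ∀ᶠ β in Near (cotAlg C Z) α, ∀ i, ψ.ec (Sum.inl i) β = φ.ec i β.pt := by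
    refine eventually_all.2 fun i => ?_
    unfold FChart.ec
    by_cases hi : i = φ.i0
    · subst hi
      rw [if_pos hi0.symm, if_pos rfl]
      by_cases hz : α.pt ∈ Z
      · rcases φ.crit with ⟨-, hZ⟩ | ⟨he', -, -⟩
        · exact absurd hz (hZ _ hφ)
        · rcases ψ.crit with ⟨-, hZ⟩ | ⟨he'', -, -⟩
          · exact absurd hz (hZ _ h1)
          · filter_upwards [hxl] with β hβ
            rw [he', he'', hi0, hβ]
            rfl
      · rw [he hz, h4 hz]
        exact Eventually.of_forall fun β => rfl
    · rw [if_neg (fun h => hi (Sum.inl_injective (h.trans hi0))), if_neg hi]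
      exact Eventually.of_forall fun β => rfl
  have hecr : ∀ i, ψ.ec (Sum.inr i) = 1 := fun i => by
    unfold FChart.ec
    rw [if_neg (fun h => by rw [hi0] at h; exact Sum.inr_ne_inl h)]
  refine ⟨φ, fun i => ψ.W (Sum.inl i), fun i => ψ.W (Sum.inr i), hφ, ?_, ?_⟩
  · filter_upwards [eventually_all.2 hW, hecl, near_of_ne (pull isSmooth_pt φ.u) hφ]
      with β k1 k2 k3 i
    refine ⟨fun f => ?_, fun f => ?_, fun j => ?_, fun j => ?_⟩
    · refine φ.det h.complete k3 (isPtDer_derAlong isSmooth_pt (ψ.W (Sum.inl i)).der β)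
        (isPtDer_derAt (φ.W i).der β.pt) (fun j => ?_) f
      rw [derAlong_apply, derAt_apply, (k1 _).1, φ.W_apply' k3, k2]
      by_cases hij : i = j
      · subst hij
        simp
      · rw [if_neg (fun h => hij (Sum.inl_injective h)), if_neg hij]
    · have h0 : IsPtDer C β.pt 0 := fun f g => by simp
      refine φ.det h.complete k3 (isPtDer_derAlong isSmooth_pt (ψ.W (Sum.inr i)).der β) h0
        (fun j => ?_) f
      rw [derAlong_apply, (k1 _).1, if_neg (by simp), LinearMap.zero_apply]
    · rw [(k1 _).2, if_neg (by simp)]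
    · rw [(k1 _).2, hecr, Fn.one_apply]
      by_cases hij : i = j
      · subst hij
        simp
      · rw [if_neg (fun h => hij (Sum.inr_injective h)), if_neg hij]
  · filter_upwards [near_of_ne ψ.u h1] with γ hγ V
    obtain ⟨a, ha⟩ := ψ.exists_coef hC' hγ V
    refine ⟨fun i => a (Sum.inl i), fun i => a (Sum.inr i), ?_⟩
    filter_upwards [ha] with β hβ F
    rw [hβ, Fintype.sum_sum_type]

end Cotangent

/-! ### Pull-back of `b`-forms -/

section Forms

variable {X : Type u} {Y : Type v} {S : Type w} {CX : FunAlg X} {ZX : Set X} {CY : FunAlg Y}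
  {ZY : Set Y} {CS : FunAlg S} {ZS : Set S} {ι κ : Type} [Fintype ι] [DecidableEq ι]
  [Fintype κ] [DecidableEq κ]

/-- The value of a `b`-form at a point. -/
def formAt (η : BForm1 (Fn CX) (vanIdeal CX ZX)) (p : X) : BCot CX ZX where
  pt := p
  form :=
    { toFun := fun D => η D p
      map_add' := fun D D' => by rw [map_add, Fn.add_apply]
      map_smul' := fun c D => by
        have h : c • D = algebraMap ℝ (Fn CX) c • D := BField.ext fun f => by
          rw [BField.rsmul_der, BField.smul_der, Algebra.smul_def]
        rw [h, map_smul]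
        rfl }
  form_smul f D := by
    change η (f • D) p = f p * η D p
    rw [map_smul]
    rfl

lemma formAt_form (η : BForm1 (Fn CX) (vanIdeal CX ZX)) (p : X) (D : BDer CX ZX) :
    (formAt η p).form D = η D p := rfl

/-- The `b`-form with values `φ^* A` for a smooth family `A` of covectors along a `b`-map `φ`. -/
def IsBMap.formOf {φ : X → Y} (hφ : IsBMap CX ZX CY ZY φ) (hY : IsBMfd CY ZY ι)
    (hC : IsComplete CX) (A : X → BCot CY ZY) (hA : ∀ x, (A x).pt = φ x)
    (hs : ∀ D, (fun x => (A x).form D) ∈ CX) : BForm1 (Fn CX) (vanIdeal CX ZX) where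
  toFun V := Fn.mk (fun x => (hφ.cotPull hY x (A x) (hA x)).form V) (hC.mem_of_smAt fun x => by
    obtain ⟨χ, hχ, -⟩ := hY.chart (φ x)
    obtain ⟨a, ha⟩ := hφ.exists_rep hY.complete χ hχ V
    refine (SmAt.sum (s := Finset.univ) (F := fun k z => a k z * (A z).form (χ.W k)) fun k _ =>
      (Fn.smAt (a k) x).mul (smAt_of_mem (hs _) x)).congr ?_
    filter_upwards [near_near ha] with z hz
    exact hφ.cotPull_rep hY (hA z) hz)
  map_add' V V' := Fn.ext fun x => map_add (hφ.cotPull hY x (A x) (hA x)).form V V'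
  map_smul' f V := Fn.ext fun x => (hφ.cotPull hY x (A x) (hA x)).form_smul f V

lemma IsBMap.formOf_bPush {φ : X → Y} (hφ : IsBMap CX ZX CY ZY φ) (hY : IsBMfd CY ZY ι)
    (hC : IsComplete CX) (A : X → BCot CY ZY) (hA : ∀ x, (A x).pt = φ x)
    (hs : ∀ D, (fun x => (A x).form D) ∈ CX) {V : BDer CX ZX} {W : BDer CY ZY} {x : X}
    (h : BPush φ x V W) : hφ.formOf hY hC A hA hs V x = (A x).form W :=
  hφ.cotPull_bPush hY (hA x) h

/-- `η' = φ^* η` for `b`-forms of degree one. -/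
def IsPullback1 (φ : X → Y) (η : BForm1 (Fn CY) (vanIdeal CY ZY))
    (η' : BForm1 (Fn CX) (vanIdeal CX ZX)) : Prop :=
  ∀ (x : X) (V : BDer CX ZX) (W : BDer CY ZY), BPush φ x V W → η' V x = η W (φ x)

/-- With one argument fixed, a bilinear form at a point is a covector, so `IsBMap.form_eq` applies
in each slot in turn. -/
lemma IsBMap.bilin_eq {φ : X → Y} (hφ : IsBMap CX ZX CY ZY φ) (hY : IsBMfd CY ZY ι)
    (Ω : BForm2 (Fn CY) (vanIdeal CY ZY)) {x : X} {V V' : BDer CX ZX} {W W' : BDer CY ZY}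
    (h : BPush φ x V W) (h' : BPush φ x V' W') {K L : Type*} [Fintype K] [Fintype L]
    {a : K → Fn CX} {D : K → BDer CY ZY} {b : L → Fn CX} {D' : L → BDer CY ZY}
    (hr : Rep hφ.smooth x V a D) (hr' : Rep hφ.smooth x V' b D') :
    Ω W W' (φ x) = ∑ k, ∑ l, a k x * b l x * Ω (D k) (D' l) (φ x) := by
  have h1 : Ω W W' (φ x) = ∑ k, a k x * Ω (D k) W' (φ x) :=
    hφ.form_eq hY h hr (β := formAt (Ω.flip W') (φ x)) rfl
  rw [h1]
  refine Finset.sum_congr rfl fun k _ => ?_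
  have h2 : Ω (D k) W' (φ x) = ∑ l, b l x * Ω (D k) (D' l) (φ x) :=
    hφ.form_eq hY h' hr' (β := formAt (Ω (D k)) (φ x)) rfl
  rw [h2, Finset.mul_sum]
  simp only [mul_assoc]

lemma extD_apply {A : Type u} [CommRing A] [Algebra ℝ A] {I : Ideal A} (η : BForm1 A I)
    (V W : BField A I) : extD η V W = V.der (η W) - W.der (η V) - η (bBr V W) := rfl

/-- The exterior derivative commutes with pull-backs. -/
lemma IsBMap.isPullback2_extD {φ : X → Y} (hφ : IsBMap CX ZX CY ZY φ) (hY : IsBMfd CY ZY ι)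
    {η : BForm1 (Fn CY) (vanIdeal CY ZY)} {η' : BForm1 (Fn CX) (vanIdeal CX ZX)}
    (h : IsPullback1 φ η η') : IsPullback2 φ (-extD η) (-extD η') := by
  intro x V V'
  refine ⟨hφ.exists_bPush hY x V, fun W W' hW hW' => ?_⟩
  obtain ⟨χ, hχ, -⟩ := hY.chart (φ x)
  obtain ⟨a, ha⟩ := hφ.exists_rep hY.complete χ hχ V
  obtain ⟨b, hb⟩ := hφ.exists_rep hY.complete χ hχ V'
  have hη : ∀ {V : BDer CX ZX} {K : Type} [Fintype K] {c : K → Fn CX} {D : K → BDer CY ZY},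
      Rep hφ.smooth x V c D → η' V x = ∑ k, c k x * η (D k) (φ x) := fun {V K _ c D} hr => by
    rw [h x V _ hr.bPush]
    exact hφ.form_eq hY hr.bPush hr (β := formAt η (φ x)) rfl
  -- Near `x`, `η' V` is the combination of the functions `φ^* η(W_k)` with the coefficients of `V`;
  -- the product rule differentiates it.
  have hη' : ∀ {V : BDer CX ZX} {c : ι → Fn CX}, Rep hφ.smooth x V c χ.W →
      ∀ U : BDer CX ZX, U.der (η' V) x = ∑ k, (U.der (c k) x * η (χ.W k) (φ x)
        + c k x * U.der (pull hφ.smooth (η (χ.W k))) x) := fun {V c} hr U => by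
    have h1 : ∀ᶠ z in Near CX x, η' V z = (∑ k, c k * pull hφ.smooth (η (χ.W k)) : Fn CX) z := by
      filter_upwards [near_near hr] with z hz
      rw [h z V _ (Rep.bPush hz), Fn.sum_apply]
      exact hφ.form_eq hY (Rep.bPush hz) hz (β := formAt η (φ z)) rfl
    rw [(near_self (der_near U.der h1) :), map_sum, Fn.sum_apply]
    refine Finset.sum_congr rfl fun k _ => ?_
    rw [Derivation.leibniz, Fn.add_apply, smul_eq_mul, smul_eq_mul, Fn.mul_apply, Fn.mul_apply,
      pull_apply, add_comm, mul_comm (η (χ.W k) (φ x))]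
  -- In the representation of `[V, V']` the second-order terms cancel because the frame commutes,
  -- leaving the derivatives of the coefficients.
  have hbr : Rep hφ.smooth x (bBr V V') (fun k => V.der (b k) - V'.der (a k)) χ.W := by
    have hW0 : ∀ᶠ z in Near CX x, ∀ k l, ∀ f,
        (bBr (χ.W k) (χ.W l)).der f (φ z) = 0 := (hφ.smooth.tendsto x).eventually
      (eventually_all.2 fun k => eventually_all.2 fun l => χ.bBr_W hY.complete hχ k l)
    filter_upwards [near_near ha, near_near hb, hW0] with z h1 h2 h3 f
    have key : ∀ {U V : BDer CX ZX} {c d : ι → Fn CX}, Rep hφ.smooth z U c χ.W →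
        Rep hφ.smooth z V d χ.W → U.der (V.der (pull hφ.smooth f)) z
          = ∑ k, U.der (d k) z * (χ.W k).der f (φ z)
            + ∑ k, ∑ l, d k z * c l z * (χ.W l).der ((χ.W k).der f) (φ z) := by
      intro U V c d hU hV
      have h4 : ∀ᶠ y in Near CX z, V.der (pull hφ.smooth f) y
          = (∑ k, d k * pull hφ.smooth ((χ.W k).der f) : Fn CX) y := by
        filter_upwards [hV] with y hy
        rw [hy, Fn.sum_apply]
        rfl
      rw [(near_self (der_near U.der h4) :), map_sum, Fn.sum_apply, ← Finset.sum_add_distrib]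
      refine Finset.sum_congr rfl fun k _ => ?_
      rw [Derivation.leibniz, Fn.add_apply, smul_eq_mul, smul_eq_mul, Fn.mul_apply, Fn.mul_apply,
        pull_apply, add_comm, mul_comm _ (U.der (d k) z), (near_self hU :), Finset.mul_sum]
      simp only [mul_assoc]
    rw [bBr_der, Fn.sub_apply, key h1 h2, key h2 h1,
      Finset.sum_comm (f := fun k l => a k z * b l z * (χ.W l).der ((χ.W k).der f) (φ z))]
    have h5 : ∀ k l, (χ.W l).der ((χ.W k).der f) (φ z) = (χ.W k).der ((χ.W l).der f) (φ z) :=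
      fun k l => by
        have := h3 l k f
        rw [bBr_der, Fn.sub_apply] at this
        linarith
    simp only [Fn.sub_apply, sub_mul, Finset.sum_sub_distrib]
    have h6 : ∑ k, ∑ l, b k z * a l z * (χ.W l).der ((χ.W k).der f) (φ z)
        = ∑ k, ∑ l, a l z * b k z * (χ.W k).der ((χ.W l).der f) (φ z) :=
      Finset.sum_congr rfl fun k _ => Finset.sum_congr rfl fun l _ => by
        rw [h5 k l, mul_comm (b k z)]
    linarith
  have hb0 : ∀ k l, η (bBr (χ.W k) (χ.W l)) (φ x) = 0 := fun k l => by
    have := (formAt η (φ x)).form_local (D := bBr (χ.W k) (χ.W l)) (D' := 0) (by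
      filter_upwards [χ.bBr_W hY.complete hχ k l] with z hz f
      rw [hz f]
      rfl)
    rw [map_zero] at this
    exact this
  have e1 : extD η W W' (φ x) = ∑ k, ∑ l, a k x * b l x * extD η (χ.W k) (χ.W l) (φ x) :=
    hφ.bilin_eq hY (extD η) hW hW' ha hb
  have e2 : extD η' V V' x = ∑ k, ∑ l, a k x * b l x * extD η (χ.W k) (χ.W l) (φ x) := by
    rw [extD_apply, Fn.sub_apply, Fn.sub_apply, hη hbr, hη' hb, hη' ha]
    simp only [extD_apply, Fn.sub_apply, hb0, sub_zero, (near_self ha :), (near_self hb :),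
      mul_sub, Finset.sum_sub_distrib, Finset.sum_add_distrib, sub_mul, Finset.mul_sum]
    rw [Finset.sum_comm (f := fun k l => a k x * b l x * (χ.W k).der (η (χ.W l)) (φ x))]
    have e3 : ∀ k l, b k x * (a l x * (χ.W l).der (η (χ.W k)) (φ x))
      = a l x * b k x * (χ.W l).der (η (χ.W k)) (φ x) := fun k l => by ring
    simp only [e3, ← mul_assoc]
    ring
  change -(extD η' V V' x) = -(extD η W W' (φ x))
  rw [e1, e2]

/-- The `b`-Liouville form. -/
def IsBMfd.liouville (h : IsBMfd CX ZX ι) :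
    BForm1 (Fn (cotAlg CX ZX)) (vanIdeal (cotAlg CX ZX) (cotCrit CX ZX)) :=
  h.isBMap_pt.formOf h isComplete_cotAlg (fun α => α) (fun _ => rfl) fun D => (linFn D).mem

lemma IsBMfd.isBLiouville (h : IsBMfd CX ZX ι) : IsBLiouville h.liouville := fun α V =>
  ⟨h.isBMap_pt.exists_bPush h α V, fun _ hW =>
    h.isBMap_pt.formOf_bPush h isComplete_cotAlg _ _ _ hW⟩

end Forms

/-! ### Closed forms and Poisson structures -/

section Algebraic

variable {A : Type u} [CommRing A] [Algebra ℝ A] {I : Ideal A}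

/-- The identity `d ∘ d = 0`: the iterated derivatives cancel and what is left is `η` of the Jacobi
identity, `hJ`. -/
lemma isClosedForm2_neg_extD (η : BForm1 A I) : IsClosedForm2 (-extD η) := by
  have hself : ∀ V : BField A I, bBr V V = 0 := fun V => BField.ext fun f => by
    rw [bBr_der, sub_self]
    rfl
  have hneg : ∀ V W : BField A I, η (bBr V W) = -η (bBr W V) := fun V W => by
    rw [eq_neg_iff_add_eq_zero, ← map_add,
      show bBr V W + bBr W V = 0 from BField.ext fun f => ?_, map_zero]
    rw [BField.add_der, bBr_der, bBr_der]
    change _ = (0 : A)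
    ring
  refine ⟨fun V => ?_, fun U V W => ?_⟩
  · change -(extD η V V) = 0
    rw [extD_apply, hself, map_zero]
    ring
  · have hJ : η (bBr (bBr U V) W) + η (bBr (bBr V W) U) + η (bBr (bBr W U) V) = 0 := by
      rw [← map_add, ← map_add,
        show bBr (bBr U V) W + bBr (bBr V W) U + bBr (bBr W U) V = 0 from
          BField.ext fun f => ?_, map_zero]
      simp only [BField.add_der, bBr_der, map_sub]
      change _ = (0 : A)
      ring
    change U.der (-(extD η V W)) + V.der (-(extD η W U)) + W.der (-(extD η U V))
      - -(extD η (bBr U V) W) - -(extD η (bBr V W) U) - -(extD η (bBr W U) V) = 0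
    simp only [extD_apply, map_neg, map_sub, bBr_der]
    linear_combination -hJ

lemma IsClosedForm2.neg {Ω : BForm2 A I} (h : IsClosedForm2 Ω) (V W : BField A I) :
    Ω W V = -Ω V W := by
  have h1 := h.1 (V + W)
  rw [map_add, map_add, LinearMap.add_apply, LinearMap.add_apply, h.1, h.1] at h1
  linear_combination h1

/-- Hamiltonian fields for all functions give the Poisson structure of a closed form. -/
lemma IsClosedForm2.exists_poisson {Ω : BForm2 A I} (h : IsClosedForm2 Ω)
    (hH : ∀ F, ∃ V, IsHam Ω F V) : ∃ P : PoissonStr A, IsPoissonOf Ω P := by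
  choose V hV using hH
  -- Antisymmetry of the form, read on Hamiltonian fields. It transfers linearity and the Leibniz
  -- rule from one argument of the bracket to the other.
  have hs : ∀ F K, (V F).der K = -(V K).der F := fun F K => by
    rw [← hV K, ← hV F, h.neg (V K)]
    ring
  let br : A →ₗ[ℝ] A →ₗ[ℝ] A := LinearMap.mk₂ ℝ (fun F K => (V K).der F)
    (fun F F' K => map_add _ F F') (fun c F K => (V K).der.map_smul c F)
    (fun F K K' => by
      have h1 := hs F (K + K')
      rw [map_add, hs F K, hs F K'] at h1
      linear_combination h1)
    (fun c F K => by
      have h1 := hs F (c • K)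
      rw [Derivation.map_smul, hs F K, smul_neg] at h1
      exact (neg_injective h1).symm)
  refine ⟨⟨br, fun f => ?_, fun f g k => ?_, fun f g k => ?_⟩, fun F K => ⟨V F, V K, hV F, hV K, ?_⟩⟩
  · change (V f).der f = 0
    rw [← hV f, h.1]
  -- The Jacobi identity is `dΩ = 0` evaluated on the three Hamiltonian fields.
  · change (V ((V k).der g)).der f + (V ((V f).der k)).der g + (V ((V g).der f)).der k = 0
    have h1 := h.2 (V f) (V g) (V k)
    rw [h.neg (V k) (bBr _ _), h.neg (V f) (bBr _ _), h.neg (V g) (bBr _ _), hV, hV, hV, hV, hV,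
      hV, bBr_der, bBr_der, bBr_der, hs k g, hs f k, hs g f] at h1
    rw [hs ((V k).der g), hs ((V f).der k), hs ((V g).der f), hs k g, hs f k, hs g f]
    simp only [map_neg] at h1 ⊢
    linear_combination h1
  · change (V (g * k)).der f = (V g).der f * k + g * (V k).der f
    rw [hs, hs g, hs k, Derivation.leibniz, smul_eq_mul, smul_eq_mul]
    ring
  · exact (hV F (V K)).symm

/-- Hamiltonian fields need not be assumed unique: since `Ω(V, W) = dF(W)` depends on `V` only
through `F`, the two fields can be exchanged one after the other. -/
lemma IsPoissonOf.unique {Ω : BForm2 A I} (h : IsClosedForm2 Ω) {P P' : PoissonStr A}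
    (hP : IsPoissonOf Ω P) (hP' : IsPoissonOf Ω P') : P = P' := by
  refine PoissonStr.ext (LinearMap.ext fun F => LinearMap.ext fun K => ?_)
  obtain ⟨V, W, hV, hW, e⟩ := hP F K
  obtain ⟨V', W', hV', hW', e'⟩ := hP' F K
  rw [e, e', hV, ← hV' W, h.neg W V', hW, ← hW' V', h.neg W']

end Algebraic

/-! ### Gluing of `b`-fields, Darboux frames and Hamiltonian fields -/

section Functions

variable {X : Type u} {Y : Type v} {C : FunAlg X} {Z : Set X} {ι κ : Type} [Fintype ι]
  [DecidableEq ι] [Fintype κ] [DecidableEq κ]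

/-- A field of germs of `b`-vector fields that match is a `b`-vector field. -/
lemma IsComplete.exists_glued (hC : IsComplete C) (V : X → BDer C Z)
    (h : ∀ p, ∀ᶠ q in Near C p, ∀ f, (V q).der f q = (V p).der f q) :
    ∃ V' : BDer C Z, ∀ p f, V'.der f p = (V p).der f p := by
  let D : Fn C → Fn C := fun f => Fn.mk (fun p => (V p).der f p) (hC.mem_of_smAt fun p =>
    ((V p).der f).smAt p |>.congr ((h p).mono fun q hq => hq f))
  let L : Fn C →ₗ[ℝ] Fn C :=
    { toFun := D
      map_add' := fun f g => Fn.ext fun p =>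
        (congrArg (fun F : Fn C => F p) (map_add (V p).der f g) :
          (V p).der (f + g) p = ((V p).der f + (V p).der g) p)
      map_smul' := fun c f => Fn.ext fun p =>
        (congrArg (fun F : Fn C => F p) ((V p).der.map_smul c f) :
          (V p).der (c • f) p = (c • (V p).der f) p) }
  exact ⟨BField.mk (Derivation.mk' L fun f g => Fn.ext fun p =>
      (congrArg (fun F : Fn C => F p) (Derivation.leibniz (V p).der f g) :
        (V p).der (f * g) p = (f * (V p).der g + g * (V p).der f) p))
    fun f hf p hp => (V p).der_mem hf p hp, fun p f => rfl⟩

lemma form2_local (Ω : BForm2 (Fn C) (vanIdeal C Z)) {p : X} {V V' : BDer C Z}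
    (h : ∀ᶠ q in Near C p, ∀ f, V.der f q = V'.der f q) (W : BDer C Z) : Ω V W p = Ω V' W p :=
  (formAt (Ω.flip W) p).form_local h

/-- `P`, `Q` is a Darboux frame for `Ω` near `p`. -/
structure IsDarboux (Ω : BForm2 (Fn C) (vanIdeal C Z)) (p : X) (P Q : ι → BDer C Z) : Prop where
  rel : ∀ᶠ q in Near C p, ∀ i j, Ω (P i) (P j) q = 0 ∧ Ω (Q i) (Q j) q = 0 ∧
    Ω (P i) (Q j) q = if i = j then 1 else 0
  span : ∀ᶠ q in Near C p, ∀ V : BDer C Z, ∃ a b : ι → Fn C, ∀ᶠ z in Near C q, ∀ F,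
    V.der F z = ∑ i, a i z * (P i).der F z + ∑ i, b i z * (Q i).der F z

lemma BCot.form_frame {P Q : ι → BDer C Z} {V : BDer C Z} {q : X} {a b : ι → Fn C}
    (h : ∀ᶠ z in Near C q, ∀ F,
      V.der F z = ∑ i, a i z * (P i).der F z + ∑ i, b i z * (Q i).der F z) (β : BCot C Z)
    (hβ : β.pt = q) :
    β.form V = ∑ i, a i q * β.form (P i) + ∑ i, b i q * β.form (Q i) := by
  subst hβ
  have := β.form_sum_near (D := V) (a := Sum.elim a b) (E := Sum.elim P Q) (by
    filter_upwards [h] with z hz F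
    rw [hz, Fintype.sum_sum_type]
    rfl)
  rw [this, Fintype.sum_sum_type]
  rfl

/-- The coefficients of a field in a Darboux frame. -/
lemma darboux_coef {Ω : BForm2 (Fn C) (vanIdeal C Z)} (hΩ : IsClosedForm2 Ω) {q : X}
    {P Q : ι → BDer C Z} (hr : ∀ i j, Ω (P i) (P j) q = 0 ∧ Ω (Q i) (Q j) q = 0 ∧
    Ω (P i) (Q j) q = if i = j then 1 else 0) {V : BDer C Z} {a b : ι → Fn C}
    (h : ∀ᶠ z in Near C q, ∀ F,
      V.der F z = ∑ i, a i z * (P i).der F z + ∑ i, b i z * (Q i).der F z) (j : ι) :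
    Ω V (Q j) q = a j q ∧ Ω V (P j) q = -b j q := by
  constructor
  · have h1 := BCot.form_frame h (formAt (Ω.flip (Q j)) q) rfl
    change Ω V (Q j) q = ∑ i, a i q * Ω (P i) (Q j) q + ∑ i, b i q * Ω (Q i) (Q j) q at h1
    rw [h1]
    simp [(hr _ _).2.1, (hr _ _).2.2]
  · have h1 := BCot.form_frame h (formAt (Ω.flip (P j)) q) rfl
    change Ω V (P j) q = ∑ i, a i q * Ω (P i) (P j) q + ∑ i, b i q * Ω (Q i) (P j) q at h1
    rw [h1]
    have h2 : ∀ i, Ω (Q i) (P j) q = -if j = i then 1 else 0 := fun i => by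
      rw [hΩ.neg (P j) (Q i), Fn.neg_apply, (hr _ _).2.2]
    simp [(hr _ _).1, h2]

/-- By `darboux_coef`, pairing with the frame returns the coefficients up to sign, so a field in the
kernel has none. -/
lemma isBSymplectic_of_darboux {Ω : BForm2 (Fn C) (vanIdeal C Z)} (hΩ : IsClosedForm2 Ω)
    (h : ∀ p, ∃ P Q : ι → BDer C Z, IsDarboux Ω p P Q) : IsBSymplectic Ω := by
  refine ⟨hΩ, fun p V hV α hα => ?_⟩
  obtain ⟨P, Q, hr, hs⟩ := h p
  obtain ⟨a, b, hab⟩ := (near_self hs :) V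
  have h0 := darboux_coef hΩ (near_self hr :) hab
  rw [BCot.form_frame hab α hα]
  have ha : ∀ i, a i p = 0 := fun i => by rw [← (h0 i).1, hV]
  have hb : ∀ i, b i p = 0 := fun i => by rw [← neg_eq_zero, ← (h0 i).2, hV]
  simp [ha, hb]

/-- Hamiltonian fields exist for a form with local Darboux frames. -/
lemma exists_isHam_of_darboux (hC : IsComplete C) {Ω : BForm2 (Fn C) (vanIdeal C Z)}
    (hΩ : IsClosedForm2 Ω) (h : ∀ p, ∃ P Q : ι → BDer C Z, IsDarboux Ω p P Q) (F : Fn C) :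
    ∃ V, IsHam Ω F V := by
  have hloc : ∀ p, ∃ V : BDer C Z, ∀ᶠ q in Near C p, ∀ W, Ω V W q = W.der F q := fun p => by
    obtain ⟨P, Q, hr, hs⟩ := h p
    -- In a Darboux frame the Hamiltonian field is `∑ Q_i(F) P_i - ∑ P_i(F) Q_i`.
    refine ⟨∑ i, (Q i).der F • P i + ∑ i, (-(P i).der F) • Q i, ?_⟩
    filter_upwards [hr, hs] with q h1 h2 W
    obtain ⟨a, b, hab⟩ := h2 W
    have h3 := darboux_coef hΩ h1 (V := ∑ i, (Q i).der F • P i + ∑ i, (-(P i).der F) • Q i)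
      (a := fun i => (Q i).der F) (b := fun i => -(P i).der F) (Eventually.of_forall fun z K => by
        rw [BField.add_der, BField.sum_der, BField.sum_der, Fn.add_apply, Fn.sum_apply,
          Fn.sum_apply]
        rfl)
    have h4 := BCot.form_frame hab (formAt (Ω (∑ i, (Q i).der F • P i
      + ∑ i, (-(P i).der F) • Q i)) q) rfl
    simp only [formAt_form, h3, Fn.neg_apply, neg_neg] at h4
    rw [h4, (near_self hab :)]
  choose V hV using hloc
  -- Two local Hamiltonian fields of `F` have the same coefficients in a Darboux frame, so they
  -- agree as derivations and can be glued.
  have hm : ∀ p, ∀ᶠ q in Near C p, ∀ f, (V q).der f q = (V p).der f q := fun p => by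
    obtain ⟨P, Q, hr, hs⟩ := h p
    filter_upwards [hr, hs, hV p] with q h1 h2 h3 f
    obtain ⟨a, b, hab⟩ := h2 (V q - V p)
    have h4 := darboux_coef hΩ h1 hab
    have h5 : ∀ W, Ω (V q - V p) W q = 0 := fun W => by
      rw [map_sub, LinearMap.sub_apply, Fn.sub_apply, h3, (near_self (hV q) :), sub_self]
    have ha : ∀ i, a i q = 0 := fun i => by rw [← (h4 i).1, h5]
    have hb : ∀ i, b i q = 0 := fun i => by rw [← neg_eq_zero, ← (h4 i).2, h5]
    have h6 := near_self hab f
    simp only [ha, hb, zero_mul, Finset.sum_const_zero, add_zero, BField.sub_der,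
      Fn.sub_apply] at h6
    linarith
  obtain ⟨V', hV'⟩ := hC.exists_glued V hm
  refine ⟨V', fun W => Fn.ext fun p => ?_⟩
  rw [form2_local Ω (V' := V p), (near_self (hV p) :)]
  filter_upwards [hm p] with q hq f
  rw [hV', hq]

lemma IsBMfd.liouville_eq_zero (h : IsBMfd C Z ι) {α : BCot C Z}
    {V : BDer (cotAlg C Z) (cotCrit C Z)}
    (hV : ∀ᶠ β in Near (cotAlg C Z) α, ∀ f : Fn C, V.der (pull isSmooth_pt f) β = 0) :
    h.liouville V α = 0 := by
  rw [(h.isBLiouville α V).2 0 (BPush.of_near (hφ := isSmooth_pt) (hV.mono fun β hβ f => by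
    rw [hβ]
    rfl)), map_zero]

/-- For the frame of `exists_cotFrame`, `λ(P_i)` is the linear function of `W_i` and `λ(Q_i) = 0`.
All brackets of the frame fields are vertical, hence killed by `λ`, and only `Q_j(λ(P_i)) = δ_ij`
remains. -/
lemma IsBMfd.exists_darboux (h : IsBMfd C Z ι) (α : BCot C Z) :
    ∃ P Q : ι → BDer (cotAlg C Z) (cotCrit C Z), IsDarboux (-extD h.liouville) α P Q := by
  obtain ⟨φ, P, Q, hφ, hPQ, hs⟩ := h.exists_cotFrame α
  refine ⟨P, Q, ?_, hs⟩
  filter_upwards [near_near hPQ, near_of_ne (pull isSmooth_pt φ.u) hφ] with β hβ hφβ i j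
  have e : ∀ V W, (-extD h.liouville) V W β = -(V.der (h.liouville W) β - W.der (h.liouville V) β
    - h.liouville (bBr V W) β) := fun V W => rfl
  have hP : ∀ (i) (V : BDer (cotAlg C Z) (cotCrit C Z)),
      V.der (h.liouville (P i)) β = V.der (linFn (φ.W i)) β := fun i V => by
    suffices h1 : ∀ᶠ γ in Near (cotAlg C Z) β, h.liouville (P i) γ = linFn (φ.W i) γ from
      near_self (P := fun γ => V.der (h.liouville (P i)) γ = V.der (linFn (φ.W i)) γ)
        (der_near V.der h1)
    filter_upwards [near_near hβ] with γ hγ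
    rw [(h.isBLiouville γ (P i)).2 (φ.W i) (BPush.of_near (hφ := isSmooth_pt)
      (hγ.mono fun δ hδ f => (hδ i).1 f))]
    rfl
  have hQ : ∀ (i) (V : BDer (cotAlg C Z) (cotCrit C Z)),
      V.der (h.liouville (Q i)) β = 0 := fun i V => by
    have h1 : ∀ᶠ γ in Near (cotAlg C Z) β, h.liouville (Q i) γ = (0 : Fn (cotAlg C Z)) γ := by
      filter_upwards [near_near hβ] with γ hγ
      exact h.liouville_eq_zero (hγ.mono fun δ hδ f => (hδ i).2.1 f)
    rw [near_self (der_near V.der h1), map_zero, Fn.zero_apply]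
  have hb : ∀ V W : BDer (cotAlg C Z) (cotCrit C Z),
      (∀ᶠ γ in Near (cotAlg C Z) β, ∀ f : Fn C,
        V.der (W.der (pull isSmooth_pt f)) γ = W.der (V.der (pull isSmooth_pt f)) γ) →
      h.liouville (bBr V W) β = 0 := fun V W hVW => by
    refine h.liouville_eq_zero (hVW.mono fun γ hγ f => ?_)
    rw [bBr_der, Fn.sub_apply, hγ, sub_self]
  have h0 : ∀ᶠ γ in Near (cotAlg C Z) β, ∀ i (V : BDer (cotAlg C Z) (cotCrit C Z)) (f : Fn C),
      V.der ((Q i).der (pull isSmooth_pt f)) γ = 0 ∧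
      V.der ((P i).der (pull isSmooth_pt f)) γ = V.der (pull isSmooth_pt ((φ.W i).der f)) γ := by
    filter_upwards [near_near hβ] with γ hγ i V f
    constructor
    · have h1 : ∀ᶠ δ in Near (cotAlg C Z) γ,
          (Q i).der (pull isSmooth_pt f) δ = (0 : Fn (cotAlg C Z)) δ :=
        hγ.mono fun δ hδ => (hδ i).2.1 f
      rw [near_self (der_near V.der h1), map_zero, Fn.zero_apply]
    · have h1 : ∀ᶠ δ in Near (cotAlg C Z) γ,
          (P i).der (pull isSmooth_pt f) δ = pull isSmooth_pt ((φ.W i).der f) δ :=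
        hγ.mono fun δ hδ => (hδ i).1 f
      rw [near_self (der_near V.der h1)]
  have hβ' := fun i => near_self hβ i
  refine ⟨?_, ?_, ?_⟩
  · rw [e, hP, hP, (hβ' i).2.2.1, (hβ' j).2.2.1, hb]
    · simp
    have hW : ∀ᶠ γ in Near (cotAlg C Z) β, ∀ f, (bBr (φ.W i) (φ.W j)).der f γ.pt = 0 :=
      (isSmooth_pt.tendsto β).eventually (φ.bBr_W h.complete hφβ i j)
    filter_upwards [h0, hβ, hW] with γ h1 h2 h3 f
    rw [(h1 j _ f).2, (h1 i _ f).2, (h2 i).1, (h2 j).1]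
    have := h3 f
    rw [bBr_der, Fn.sub_apply] at this
    linarith
  · rw [e, hQ, hQ, hb]
    · simp
    filter_upwards [h0] with γ h1 f
    rw [(h1 j _ f).1, (h1 i _ f).1]
  · rw [e, hQ, hP, (hβ' j).2.2.2, hb]
    · simp [eq_comm]
    filter_upwards [h0, hβ] with γ h1 h2 f
    rw [(h1 j _ f).1, (h1 i _ f).2, (h2 j).2.1]

lemma IsBMfd.isBSymplectic (h : IsBMfd C Z ι) : IsBSymplectic (-extD h.liouville) :=
  isBSymplectic_of_darboux (isClosedForm2_neg_extD _) h.exists_darboux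

lemma IsBMfd.exists_poisson (h : IsBMfd C Z ι) :
    ∃ P : PoissonStr (Fn (cotAlg C Z)), IsPoissonOf (-extD h.liouville) P :=
  (isClosedForm2_neg_extD _).exists_poisson
    (exists_isHam_of_darboux isComplete_cotAlg (isClosedForm2_neg_extD _) h.exists_darboux)

end Functions

/-! ### Transport along diffeomorphisms, and descent to orbit spaces -/

section Transport

variable {X : Type u} {Y : Type v} {CX : FunAlg X} {ZX : Set X} {CY : FunAlg Y}
  {ZY : Set Y} {ι : Type} [Fintype ι] [DecidableEq ι]

variable (CX CY) in
/-- A diffeomorphism with its inverse. -/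
structure Diffeo where
  map : X → Y
  inv : Y → X
  smooth : IsSmooth CX CY map
  smooth_inv : IsSmooth CY CX inv
  left : ∀ x, inv (map x) = x
  right : ∀ y, map (inv y) = y

/-- The inverse diffeomorphism. -/
def Diffeo.symm (e : Diffeo CX CY) : Diffeo CY CX :=
  ⟨e.inv, e.map, e.smooth_inv, e.smooth, e.right, e.left⟩

lemma Diffeo.isDiffeo (e : Diffeo CX CY) : IsDiffeo CX CY e.map :=
  isDiffeo_of_inverse e.smooth e.smooth_inv e.left e.right

/-- The push-forward of a `b`-vector field along a diffeomorphism of pairs. -/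
def Diffeo.push (e : Diffeo CX CY) (hZ : ∀ x, e.map x ∈ ZY ↔ x ∈ ZX) (V : BDer CX ZX) :
    BDer CY ZY :=
  BField.mk (Derivation.mk'
    { toFun := fun f => pull e.smooth_inv (V.der (pull e.smooth f))
      map_add' := fun f g => by rw [map_add, map_add, map_add]
      map_smul' := fun c f => by rw [map_smul, V.der.map_smul, map_smul]; rfl }
    fun f g => Fn.ext fun y => by
      change V.der (pull e.smooth (f * g)) (e.inv y) = _
      rw [map_mul, Derivation.leibniz]
      change f (e.map (e.inv y)) * _ + g (e.map (e.inv y)) * _ = _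
      rw [e.right]
      rfl)
    fun f hf y hy => V.der_mem (f := pull e.smooth f) (fun x hx => hf _ ((hZ x).2 hx)) (e.inv y)
      ((hZ _).1 (by rwa [e.right]))

lemma Diffeo.push_der (e : Diffeo CX CY) (hZ : ∀ x, e.map x ∈ ZY ↔ x ∈ ZX) (V : BDer CX ZX)
    (f : Fn CY) (y : Y) : (e.push hZ V).der f y = V.der (pull e.smooth f) (e.inv y) := rfl

lemma Diffeo.push_der_map (e : Diffeo CX CY) (hZ : ∀ x, e.map x ∈ ZY ↔ x ∈ ZX) (V : BDer CX ZX)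
    (f : Fn CY) (x : X) : (e.push hZ V).der f (e.map x) = V.der (pull e.smooth f) x := by
  rw [push_der, e.left]

lemma Diffeo.bPush (e : Diffeo CX CY) (hZ : ∀ x, e.map x ∈ ZY ↔ x ∈ ZX) (V : BDer CX ZX) (x : X) :
    BPush e.map x V (e.push hZ V) :=
  BPush.of_near (hφ := e.smooth) (Eventually.of_forall fun z f => (e.push_der_map hZ V f z).symm)

lemma Diffeo.symm_iff (e : Diffeo CX CY) (hZ : ∀ x, e.map x ∈ ZY ↔ x ∈ ZX) (y : Y) :
    e.symm.map y ∈ ZX ↔ y ∈ ZY := by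
  change e.inv y ∈ ZX ↔ y ∈ ZY
  rw [← hZ, e.right]

lemma Diffeo.bPush_symm (e : Diffeo CX CY) (hZ : ∀ x, e.map x ∈ ZY ↔ x ∈ ZX) (W : BDer CY ZY)
    (x : X) : BPush e.map x (e.symm.push (e.symm_iff hZ) W) W :=
  BPush.of_near (hφ := e.smooth) (Eventually.of_forall fun z f => by
    change W.der (pull e.smooth_inv (pull e.smooth f)) (e.map z) = _
    refine congrArg (fun F => W.der F (e.map z)) (Fn.ext fun y => ?_)
    exact congrArg (f : Y → ℝ) (e.right y))

lemma Diffeo.isBMap (e : Diffeo CX CY) (hZ : ∀ x, e.map x ∈ ZY ↔ x ∈ ZX) :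
    IsBMap CX ZX CY ZY e.map := by
  refine ⟨e.smooth, fun x hx => (hZ x).2 hx, fun x r hr => ⟨?_, fun F hF => ?_, fun F hF => ?_⟩⟩
  · filter_upwards [(e.smooth.tendsto x).eventually hr.vanish] with z hz hz'
    exact hz ((hZ z).2 hz')
  · obtain ⟨G, hG⟩ := hr.div (pull e.smooth_inv F) fun y hy => hF _ ((e.symm_iff hZ y).2 hy)
    refine ⟨pull e.smooth G, ?_⟩
    filter_upwards [(e.smooth.tendsto x).eventually hG] with z hz
    rw [pull_apply, e.left] at hz
    exact hz
  · have h1 := e.smooth_inv.tendsto (e.map x)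
    rw [e.left] at h1
    have h2 := hr.cancel (pull e.smooth_inv F) (by
      filter_upwards [h1.eventually hF] with y hy
      rw [pull_apply, e.right] at hy
      exact hy)
    rwa [pull_apply, e.left] at h2

/-- Transport of an adapted chart along a diffeomorphism of pairs. -/
def Diffeo.fchart (e : Diffeo CX CY) (hZ : ∀ x, e.map x ∈ ZY ↔ x ∈ ZX) (φ : FChart CX ZX ι) :
    FChart CY ZY ι where
  u := pull e.smooth_inv φ.u
  x y := φ.x (e.inv y)
  O := φ.O
  σ v := e.map (φ.σ v)
  isOpen := φ.isOpen
  mem y hy := φ.mem _ hy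
  left y hy := by rw [φ.left _ hy, e.right]
  ne v hv := by
    rw [pull_apply, e.left]
    exact φ.ne v hv
  right v hv := by rw [e.left, φ.right v hv]
  smooth_inv f := φ.smooth_inv (pull e.smooth f)
  smooth y hy i := (φ.smooth _ hy i).comp_smooth e.smooth_inv
  i0 := φ.i0
  e := pull e.smooth_inv φ.e
  xf i := pull e.smooth_inv (φ.xf i)
  x_eq y i := φ.x_eq _ i
  W i := e.push hZ (φ.W i)
  W_apply y hy i j := by
    have h1 : pull e.smooth (pull e.smooth_inv (φ.xf j)) = φ.xf j :=
      Fn.ext fun x => congrArg (φ.xf j : X → ℝ) (e.left x)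
    rw [push_der, h1, φ.W_apply _ hy]
    rfl
  crit := by
    rcases φ.crit with ⟨h1, h2⟩ | ⟨h1, h2, h3⟩
    · exact Or.inl ⟨by rw [h1, map_one], fun y hy hy' => h2 _ hy ((e.symm_iff hZ y).2 hy')⟩
    · refine Or.inr ⟨by rw [h1], fun y hy => h2 _ ((e.symm_iff hZ y).2 hy), fun y hy => ?_⟩
      exact (e.symm_iff hZ y).symm.trans (h3 _ hy)

lemma Diffeo.isBMfd (e : Diffeo CX CY) (hZ : ∀ x, e.map x ∈ ZY ↔ x ∈ ZX) (hX : IsBMfd CX ZX ι)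
    (hY : IsComplete CY) : IsBMfd CY ZY ι := by
  refine ⟨hY, fun y => ?_⟩
  obtain ⟨φ, h1, h2⟩ := hX.chart (e.inv y)
  exact ⟨e.fchart hZ φ, h1, fun hy => by
    change pull e.smooth_inv φ.e = 1
    rw [h2 (fun h => hy ((e.symm_iff hZ y).1 h)), map_one]⟩

/-- Nondegeneracy transports along diffeomorphisms. -/
lemma Diffeo.isBSymplectic (e : Diffeo CX CY) (hZ : ∀ x, e.map x ∈ ZY ↔ x ∈ ZX)
    (hX : IsBMfd CX ZX ι) (hY : IsComplete CY) {Ω : BForm2 (Fn CY) (vanIdeal CY ZY)}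
    {Ω' : BForm2 (Fn CX) (vanIdeal CX ZX)} (hΩ' : IsBSymplectic Ω') (hΩ : IsClosedForm2 Ω)
    (h : IsPullback2 e.map Ω Ω') : IsBSymplectic Ω := by
  refine ⟨hΩ, fun p W hW β hβ => ?_⟩
  have hβ' : β.pt = e.map (e.inv p) := by rw [hβ, e.right]
  have h1 := (e.isBMap hZ).cotPull_bPush (e.isBMfd hZ hX hY) hβ' (e.bPush_symm hZ W (e.inv p))
  rw [← h1]
  refine hΩ'.2 (e.inv p) _ (fun V' => ?_) _ rfl
  rw [(h (e.inv p) _ V').2 W (e.push hZ V') (e.bPush_symm hZ W _) (e.bPush hZ V' _), e.right]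
  exact hW _

/-- The push-forward of a Poisson structure along a diffeomorphism. -/
def PoissonStr.push (P : PoissonStr (Fn CX)) (e : Diffeo CX CY) : PoissonStr (Fn CY) where
  br := LinearMap.mk₂ ℝ
    (fun F K => pull e.smooth_inv (P.br (pull e.smooth F) (pull e.smooth K)))
    (fun F F' K => by rw [map_add, map_add, LinearMap.add_apply, map_add])
    (fun c F K => by rw [map_smul, map_smul, LinearMap.smul_apply, map_smul])
    (fun F K K' => by rw [map_add, map_add, map_add])
    (fun c F K => by rw [map_smul, map_smul, map_smul])
  self F := by
    change pull e.smooth_inv (P.br (pull e.smooth F) (pull e.smooth F)) = 0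
    rw [P.self, map_zero]
  jacobi F G K := by
    have hp : ∀ f : Fn CX, pull e.smooth (pull e.smooth_inv f) = f := fun f =>
      Fn.ext fun x => congrArg (f : X → ℝ) (e.left x)
    simp only [LinearMap.mk₂_apply, hp]
    rw [← map_add, ← map_add, P.jacobi, map_zero]
  leibniz F G K := by
    have hp : ∀ f : Fn CY, pull e.smooth_inv (pull e.smooth f) = f := fun f =>
      Fn.ext fun x => congrArg (f : Y → ℝ) (e.right x)
    simp only [LinearMap.mk₂_apply, map_mul, P.leibniz, map_add, hp]

lemma PoissonStr.push_br (P : PoissonStr (Fn CX)) (e : Diffeo CX CY) (F K : Fn CY) :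
    (P.push e).br F K = pull e.smooth_inv (P.br (pull e.smooth F) (pull e.smooth K)) := rfl

lemma PoissonStr.pull_push_br (P : PoissonStr (Fn CX)) (e : Diffeo CX CY) (F K : Fn CY) :
    pull e.smooth ((P.push e).br F K) = P.br (pull e.smooth F) (pull e.smooth K) :=
  Fn.ext fun x => congrArg (P.br (pull e.smooth F) (pull e.smooth K) : X → ℝ) (e.left x)

lemma PoissonStr.isPoissonMap_push (P : PoissonStr (Fn CX)) (e : Diffeo CX CY) :
    IsPoissonMap P (P.push e) e.map :=
  ⟨e.smooth, fun F K => (P.pull_push_br e F K).symm⟩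

/-- Hamiltonian fields push forward along symplectic diffeomorphisms. -/
lemma Diffeo.isPoissonOf (e : Diffeo CX CY) (hZ : ∀ x, e.map x ∈ ZY ↔ x ∈ ZX)
    {Ω : BForm2 (Fn CY) (vanIdeal CY ZY)} {Ω' : BForm2 (Fn CX) (vanIdeal CX ZX)}
    (h : IsPullback2 e.map Ω Ω') {P : PoissonStr (Fn CX)} (hP : IsPoissonOf Ω' P) :
    IsPoissonOf Ω (P.push e) := by
  -- An arbitrary field `W` on the target is pulled back by the inverse, so that the Hamiltonian
  -- condition can be checked on the source.
  have hp : ∀ (V : BDer CX ZX) (W : BDer CY ZY) (y : Y),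
      Ω (e.push hZ V) W y = Ω' V (e.symm.push (e.symm_iff hZ) W) (e.inv y) := fun V W y => by
    rw [(h (e.inv y) _ _).2 (e.push hZ V) W (e.bPush hZ V _) (e.bPush_symm hZ W _), e.right]
  have hH : ∀ {F : Fn CY} {V : BDer CX ZX}, IsHam Ω' (pull e.smooth F) V →
      IsHam Ω F (e.push hZ V) := fun {F V} hV W => Fn.ext fun y => by
    rw [hp, hV]
    change W.der (pull e.smooth_inv (pull e.smooth F)) (e.map (e.inv y)) = _
    rw [e.right, show pull e.smooth_inv (pull e.smooth F) = F from
      Fn.ext fun y => congrArg (F : Y → ℝ) (e.right y)]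
  intro F K
  obtain ⟨V, W, hV, hW, hPV⟩ := hP (pull e.smooth F) (pull e.smooth K)
  refine ⟨e.push hZ V, e.push hZ W, hH hV, hH hW, Fn.ext fun y => ?_⟩
  rw [P.push_br, hPV, pull_apply]
  rw [(h (e.inv y) V W).2 _ _ (e.bPush hZ V _) (e.bPush hZ W _), e.right]

variable {K : Type w} [Group K] [MulAction K X]

/-- A Poisson structure whose brackets of invariant functions are invariant descends to the orbit
space. -/
lemma PoissonStr.exists_descend (P : PoissonStr (Fn CX))
    (h : ∀ (F G : Fn CX), (∀ (k : K) x, F (k • x) = F x) → (∀ (k : K) x, G (k • x) = G x) →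
      ∀ (k : K) x, P.br F G (k • x) = P.br F G x) :
    ∃ P' : PoissonStr (Fn (quotAlg K CX)), IsPoissonMap P P' (orbitMk K) := by
  let π : Fn (quotAlg K CX) →ₐ[ℝ] Fn CX := pull (isSmooth_orbitMk (C := CX) K)
  -- The projection is surjective, so the axioms of the descended bracket may be verified on `X`.
  have hinj : Function.Injective π := fun F G hFG => Fn.ext fun x => by
    induction x using Quotient.inductionOn with
    | h x => exact congrArg (fun F : Fn CX => F x) hFG
  have hinv : ∀ (F : Fn (quotAlg K CX)) (k : K) (x : X), π F (k • x) = π F x := fun F k x =>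
    congrArg (F : _ → ℝ) (Quotient.sound (show MulAction.orbitRel K X (k • x) x from ⟨k, rfl⟩))
  have hbr : ∀ F G, ∃ B : Fn (quotAlg K CX), π B = P.br (π F) (π G) := fun F G => by
    refine ⟨Fn.mk (Quotient.lift (P.br (π F) (π G) : X → ℝ) ?_) (P.br (π F) (π G)).mem, rfl⟩
    rintro _ x ⟨k, rfl⟩
    exact h _ _ (hinv F) (hinv G) k x
  choose B hB using hbr
  refine ⟨⟨LinearMap.mk₂ ℝ B (fun F F' G => hinj ?_) (fun c F G => hinj ?_)
    (fun F G G' => hinj ?_) (fun c F G => hinj ?_), fun F => hinj ?_, fun F G H => hinj ?_,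
    fun F G H => hinj ?_⟩, isSmooth_orbitMk K, fun F G => (hB F G).symm⟩
  · simp only [map_add, hB, LinearMap.add_apply]
  · simp only [map_smul, hB, LinearMap.smul_apply]
  · simp only [map_add, hB]
  · simp only [map_smul, hB]
  · rw [LinearMap.mk₂_apply, hB, P.self, map_zero]
  · simp only [LinearMap.mk₂_apply, map_add, hB, P.jacobi, map_zero]
  · simp only [LinearMap.mk₂_apply, map_add, map_mul, hB, P.leibniz]

lemma pull_orbitMk_injective :
    Function.Injective (pull (isSmooth_orbitMk (C := CX) K)) := fun F G hFG => Fn.ext fun x => by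
  induction x using Quotient.inductionOn with
  | h x => exact congrArg (fun F : Fn CX => F x) hFG

end Transport

/-! ### The manifold of a function algebra with charts -/

section Manifold

variable {X : Type u} {C : FunAlg X} {ι : Type} [Fintype ι] [DecidableEq ι]

variable (C) in
/-- The topology whose neighbourhoods are the `Near C p`. -/
@[reducible] def nearTopology : TopologicalSpace X where
  IsOpen s := ∀ p ∈ s, s ∈ Near C p
  isOpen_univ _ _ := univ_mem
  isOpen_inter _ _ h h' p hp := inter_mem (h p hp.1) (h' p hp.2)
  isOpen_sUnion _ h p := fun ⟨t, ht, hp⟩ =>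
    mem_of_superset (h t ht p hp) (Set.subset_sUnion_of_mem ht)

lemma nhds_nearTopology (p : X) : @nhds X (nearTopology C) p = Near C p := by
  let _ := nearTopology C
  refine le_antisymm ?_ fun s hs => ?_
  · rintro s ⟨u, hu, h⟩
    exact mem_nhds_iff.2 ⟨{x | u x ≠ 0}, h, fun q hq => near_of_ne u hq, hu⟩
  · obtain ⟨t, hts, ht, hp⟩ := mem_nhds_iff.1 hs
    exact mem_of_superset (ht p hp) hts

/-- A chart of a function algebra, as a local homeomorphism. -/
def Chart.toHomeo (hC : IsComplete C) (φ : Chart C ι) {n : ℕ}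
    (L : (ι → ℝ) ≃L[ℝ] EuclideanSpace ℝ (Fin n)) :
    letI := nearTopology C
    OpenPartialHomeomorph X (EuclideanSpace ℝ (Fin n)) :=
  letI := nearTopology C
  { toFun := fun p => L (φ.x p)
    invFun := fun y => φ.σ (L.symm y)
    source := {p | φ.u p ≠ 0}
    target := {y | L.symm y ∈ φ.O}
    map_source' := fun p hp => by
      change L.symm (L (φ.x p)) ∈ φ.O
      rw [L.symm_apply_apply]
      exact φ.mem p hp
    map_target' := fun y hy => φ.ne _ hy
    left_inv' := fun p hp => by
      rw [L.symm_apply_apply]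
      exact φ.left p hp
    right_inv' := fun y hy => by rw [φ.right _ hy, L.apply_symm_apply]
    open_source := fun p hp => near_of_ne φ.u hp
    open_target := φ.isOpen.preimage L.symm.continuous
    continuousOn_toFun := fun p hp => by
      refine ContinuousAt.continuousWithinAt ?_
      rw [ContinuousAt, nhds_nearTopology]
      exact L.continuous.continuousAt.tendsto.comp (φ.tendsto hC hp)
    continuousOn_invFun := fun y hy => by
      refine ContinuousAt.continuousWithinAt ?_
      rw [ContinuousAt, nhds_nearTopology]
      exact fun s hs => L.symm.continuous.continuousAt.eventually
        (eventually_inv φ.isOpen φ.smooth_inv hy hs) }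

/-- A complete function algebra that separates points and has a countable family of charts is the
algebra of smooth functions of a manifold. -/
lemma IsComplete.isManifoldAlg (hC : IsComplete C) {K : Type v} [Countable K] (φ : K → Chart C ι)
    (hφ : ∀ p, ∃ k, (φ k).u p ≠ 0) (hs : ∀ p q, p ≠ q → ∃ f ∈ C, f p ≠ f q) {n : ℕ}
    (hn : Fintype.card ι = n) : IsManifoldAlg n C := by
  have hfr : Module.finrank ℝ (ι → ℝ) = Module.finrank ℝ (EuclideanSpace ℝ (Fin n)) := by
    simp [hn]
  let L : (ι → ℝ) ≃L[ℝ] EuclideanSpace ℝ (Fin n) := ContinuousLinearEquiv.ofFinrankEq hfr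
  let _ := nearTopology C
  choose k hk using hφ
  let cs : ChartedSpace (EuclideanSpace ℝ (Fin n)) X :=
    { atlas := Set.range fun k => (φ k).toHomeo hC L
      chartAt := fun p => (φ (k p)).toHomeo hC L
      mem_chart_source := hk
      chart_mem_atlas := fun p => ⟨k p, rfl⟩ }
  have hinv : ∀ (k : K) (f : Fn C),
      ContDiffOn ℝ ∞ (fun y => f ((φ k).σ (L.symm y))) {y | L.symm y ∈ (φ k).O} := fun k f =>
    ((φ k).smooth_inv f).comp L.symm.contDiff.contDiffOn fun y hy => hy
  -- The coordinates of one chart are germs of members of `C`, and these are smooth in any other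
  -- chart.
  have hm : IsManifold (𝓡 n) ∞ X := by
    refine isManifold_of_contDiffOn _ _ _ ?_
    rintro _ _ ⟨k, rfl⟩ ⟨l, rfl⟩ y hy
    have hy1 : L.symm y ∈ (φ k).O := hy.1.1
    have hy2 : (φ l).u ((φ k).σ (L.symm y)) ≠ 0 := hy.1.2
    refine ContDiffAt.contDiffWithinAt ?_
    refine ContDiffAt.comp (g := L) (f := fun y => (φ l).x ((φ k).σ (L.symm y))) y
      L.contDiff.contDiffAt (contDiffAt_pi.2 fun i => ?_)
    obtain ⟨F, hF⟩ := (φ l).smooth _ hy2 i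
    have ho : IsOpen {y | L.symm y ∈ (φ k).O} := (φ k).isOpen.preimage L.symm.continuous
    refine ((hinv k F).contDiffAt (ho.mem_nhds hy1)).congr_of_eventuallyEq ?_
    exact L.symm.continuous.continuousAt.eventually
      (eventually_inv (φ k).isOpen (φ k).smooth_inv hy1 hF)
  have hcont : ∀ f : Fn C, Continuous (f : X → ℝ) := fun f =>
    continuous_iff_continuousAt.2 fun p => by
      rw [ContinuousAt, nhds_nearTopology]
      exact hC.tendsto f p
  refine ⟨inferInstance, cs, hm, ⟨fun p q hpq => ?_⟩, ?_, fun f => ⟨fun hf => ?_, fun hf => ?_⟩⟩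
  · obtain ⟨f, hf, hne⟩ := hs p q hpq
    exact separated_by_continuous (hcont (Fn.mk f hf)) hne
  · have : ∀ k, SecondCountableTopology ((φ k).toHomeo hC L).source := fun k =>
      ((φ k).toHomeo hC L).secondCountableTopology_source
    refine TopologicalSpace.secondCountableTopology_of_countable_cover
      (U := fun k => ((φ k).toHomeo hC L).source) (fun k => ((φ k).toHomeo hC L).open_source) ?_
    exact Set.eq_univ_of_forall fun p => Set.mem_iUnion.2 ⟨k p, hk p⟩
  · intro p
    rw [contMDiffAt_iff]
    refine ⟨(hcont (Fn.mk f hf)).continuousAt, ?_⟩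
    have ho : IsOpen {y | L.symm y ∈ (φ (k p)).O} := (φ (k p)).isOpen.preimage L.symm.continuous
    refine ContDiffAt.contDiffWithinAt ?_
    refine (hinv (k p) (Fn.mk f hf)).contDiffAt (ho.mem_nhds ?_)
    have h1 : L.symm (L ((φ (k p)).x p)) ∈ (φ (k p)).O := by
      rw [L.symm_apply_apply]
      exact (φ (k p)).mem p (hk p)
    exact h1
  · refine hC.mem_of_smAt fun p => ?_
    have h1 : ContMDiffOn (𝓡 n) 𝓘(ℝ, ℝ) ∞ (f ∘ (extChartAt (𝓡 n) p).symm)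
        (extChartAt (𝓡 n) p).target := hf.comp_contMDiffOn (contMDiffOn_extChartAt_symm p)
    have h2 := contMDiffOn_iff_contDiffOn.1 h1
    have h3 : ContDiffOn ℝ ∞ (fun y => f ((φ (k p)).σ y)) (φ (k p)).O := by
      have h4 : ContDiffOn ℝ ∞ (fun y => (f ∘ (extChartAt (𝓡 n) p).symm) (L y)) (φ (k p)).O :=
        h2.comp L.contDiff.contDiffOn fun y hy => by
          rw [extChartAt_target]
          refine ⟨?_, by simp⟩
          have h1 : L.symm (L y) ∈ (φ (k p)).O := by rwa [L.symm_apply_apply]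
          exact h1
      refine h4.congr fun y hy => ?_
      change _ = f ((φ (k p)).σ (L.symm (L y)))
      rw [L.symm_apply_apply]
    refine ((φ (k p)).smAt_comp hC (hk p) h3).congr ?_
    filter_upwards [near_of_ne (φ (k p)).u (hk p)] with z hz
    rw [(φ (k p)).left z hz]

end Manifold

/-! ### The algebra of smooth functions of a manifold -/

section SmoothAlg

variable {E : Type u} [NormedAddCommGroup E] [NormedSpace ℝ E] [FiniteDimensional ℝ E]
  {M : Type v} [TopologicalSpace M] [ChartedSpace E M]

lemma isComplete_smoothAlg : IsComplete (smoothAlg E M) := by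
  intro F hF p
  obtain ⟨ι, _, g, Φ, ε, hg, hΦ, hε, h⟩ := hF p
  have hg' : ∀ i, ContMDiff 𝓘(ℝ, E) 𝓘(ℝ, ℝ) ∞ (g i) := hg
  have h1 : ContMDiffAt 𝓘(ℝ, E) 𝓘(ℝ, ℝ) ∞ (fun x => Φ fun i => g i x) p :=
    hΦ.contMDiff.contMDiffAt.comp p (contMDiffAt_pi_space.2 fun i => hg' i p)
  refine h1.congr_of_eventuallyEq ?_
  have h2 : ∀ i, ∀ᶠ x in 𝓝 p, |g i x - g i p| < ε := fun i =>
    (hg' i).continuous.continuousAt.eventually (Metric.ball_mem_nhds _ hε)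
  filter_upwards [eventually_all.2 h2] with x hx using h x hx

variable [IsManifold 𝓘(ℝ, E) ∞ M] [T2Space M]

/-- The supports of bump functions form a basis of neighbourhoods, so the algebra recovers the
topology of the manifold. -/
lemma near_smoothAlg (p : M) : Near (smoothAlg E M) p = 𝓝 p := by
  refine le_antisymm (fun s hs => ?_) ?_
  · obtain ⟨f, -, hf⟩ := (SmoothBumpFunction.nhds_basis_support (I := 𝓘(ℝ, E)) hs).mem_iff.1 hs
    exact ⟨Fn.mk f f.contMDiff, f.c_mem_support, fun x hx => hf hx⟩
  · rintro s ⟨u, hu, h⟩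
    have : Continuous (u : M → ℝ) := ContMDiff.continuous (n := ∞) u.mem
    exact (this.continuousAt.eventually_ne hu).mono h

lemma smAt_of_contMDiffAt {f : M → ℝ} {p : M}
    (h : ∀ᶠ x in 𝓝 p, ContMDiffAt 𝓘(ℝ, E) 𝓘(ℝ, ℝ) ∞ f x) : SmAt (smoothAlg E M) f p := by
  rw [← near_smoothAlg (E := E)] at h
  obtain ⟨u, hu, h⟩ := h
  obtain ⟨χ, h1, h2⟩ := isComplete_smoothAlg.exists_cutoff u hu
  refine ⟨Fn.mk (fun x => χ x * f x) fun q => ?_, ?_⟩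
  · rcases h2 q with h3 | h3
    · exact ContMDiffAt.mul (χ.mem q) (h q h3)
    · rw [near_smoothAlg] at h3
      refine contMDiffAt_const (c := (0 : ℝ)).congr_of_eventuallyEq ?_
      filter_upwards [h3] with x hx
      rw [hx, zero_mul]
  · filter_upwards [h1] with x hx
    change f x = χ x * f x
    rw [hx, one_mul]

/-- Local coordinates by global functions. -/
lemma exists_coords (p : M) : ∃ (ξ : Fin (Module.finrank ℝ E) → Fn (smoothAlg E M))
    (O : Set (Fin (Module.finrank ℝ E) → ℝ)) (σ : (Fin (Module.finrank ℝ E) → ℝ) → M),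
    IsOpen O ∧ (fun i => ξ i p) ∈ O ∧ ContMDiffOn 𝓘(ℝ, Fin (Module.finrank ℝ E) → ℝ) 𝓘(ℝ, E) ∞ σ O ∧
      ∀ᶠ x in 𝓝 p, σ (fun i => ξ i x) = x := by
  have hfr : Module.finrank ℝ E = Module.finrank ℝ (Fin (Module.finrank ℝ E) → ℝ) := by simp
  let L : E ≃L[ℝ] (Fin (Module.finrank ℝ E) → ℝ) := ContinuousLinearEquiv.ofFinrankEq hfr
  have h1 : ∀ i, SmAt (smoothAlg E M) (fun x => L (extChartAt 𝓘(ℝ, E) p x) i) p := fun i => by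
    refine smAt_of_contMDiffAt ?_
    filter_upwards [(chartAt E p).open_source.mem_nhds (mem_chart_source E p)] with x hx
    have h2 : ContMDiffAt 𝓘(ℝ, E) 𝓘(ℝ, E) ∞ (extChartAt 𝓘(ℝ, E) p) x := contMDiffAt_extChartAt' hx
    have h3 : ContDiff ℝ ∞ fun v : E => L v i := (contDiff_apply ℝ ℝ i).comp L.contDiff
    exact h3.contMDiff.contMDiffAt.comp x h2
  choose ξ hξ using h1
  have hξ' : ∀ᶠ x in 𝓝 p, (fun i => ξ i x) = L (extChartAt 𝓘(ℝ, E) p x) := by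
    rw [← near_smoothAlg (E := E)]
    filter_upwards [eventually_all.2 hξ] with x hx
    exact funext fun i => (hx i).symm
  refine ⟨ξ, L.symm ⁻¹' (extChartAt 𝓘(ℝ, E) p).target,
    fun v => (extChartAt 𝓘(ℝ, E) p).symm (L.symm v),
    (isOpen_extChartAt_target p).preimage L.symm.continuous, ?_, ?_, ?_⟩
  · rw [hξ'.self_of_nhds, Set.mem_preimage, L.symm_apply_apply]
    exact mem_extChartAt_target p
  · exact (contMDiffOn_extChartAt_symm p).comp L.symm.contDiff.contMDiff.contMDiffOn
      fun v hv => hv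
  · filter_upwards [hξ', extChartAt_source_mem_nhds (I := 𝓘(ℝ, E)) p] with x hx hx'
    rw [hx, L.symm_apply_apply, (extChartAt 𝓘(ℝ, E) p).left_inv hx']

variable {X : Type w} {C : FunAlg X}

lemma tendsto_of_smAt (hC : IsComplete C) {φ : X → M} {p : X}
    (h : ∀ f : Fn (smoothAlg E M), SmAt C (fun x => f (φ x)) p) :
    Tendsto φ (Near C p) (𝓝 (φ p)) := by
  rw [← near_smoothAlg (E := E)]
  rintro s ⟨u, hu, hs⟩
  exact (((h u).tendsto hC).eventually_ne hu).mono fun x hx => hs _ hx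

/-- Two-variable coordinate expression of a smooth function. -/
lemma exists_coords₂ {K : M × M → ℝ} (hK : ContMDiff (𝓘(ℝ, E).prod 𝓘(ℝ, E)) 𝓘(ℝ, ℝ) ∞ K)
    (p q : M) : ∃ (ξ η : Fin (Module.finrank ℝ E) → Fn (smoothAlg E M))
    (O : Set (Fin (Module.finrank ℝ E) ⊕ Fin (Module.finrank ℝ E) → ℝ))
    (Φ : (Fin (Module.finrank ℝ E) ⊕ Fin (Module.finrank ℝ E) → ℝ) → ℝ),
    IsOpen O ∧ ContDiffOn ℝ ∞ Φ O ∧ Sum.elim (fun i => ξ i p) (fun i => η i q) ∈ O ∧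
      ∃ V ∈ 𝓝 p, ∃ U ∈ 𝓝 q, ∀ x ∈ V, ∀ y ∈ U,
        K (x, y) = Φ (Sum.elim (fun i => ξ i x) fun i => η i y) := by
  obtain ⟨ξ, O, σ, hO, hp, hσ, h⟩ := exists_coords (E := E) p
  obtain ⟨η, O', σ', hO', hq, hσ', h'⟩ := exists_coords (E := E) q
  have hl : ContDiff ℝ ∞ fun (v : Fin (Module.finrank ℝ E) ⊕ Fin (Module.finrank ℝ E) → ℝ)
    (i : Fin (Module.finrank ℝ E)) => v (Sum.inl i) := by fun_prop
  have hr : ContDiff ℝ ∞ fun (v : Fin (Module.finrank ℝ E) ⊕ Fin (Module.finrank ℝ E) → ℝ)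
    (i : Fin (Module.finrank ℝ E)) => v (Sum.inr i) := by fun_prop
  refine ⟨ξ, η, {v | (fun i => v (Sum.inl i)) ∈ O ∧ (fun i => v (Sum.inr i)) ∈ O'},
    fun v => K (σ fun i => v (Sum.inl i), σ' fun i => v (Sum.inr i)),
    (hO.preimage hl.continuous).inter (hO'.preimage hr.continuous), ?_, ⟨hp, hq⟩, ?_⟩
  · rw [← contMDiffOn_iff_contDiffOn]
    refine hK.comp_contMDiffOn (ContMDiffOn.prodMk ?_ ?_)
    · exact hσ.comp hl.contMDiff.contMDiffOn fun v hv => hv.1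
    · exact hσ'.comp hr.contMDiff.contMDiffOn fun v hv => hv.2
  · refine ⟨_, h, _, h', fun x hx y hy => ?_⟩
    simp only [Sum.elim_inl, Sum.elim_inr]
    rw [show σ _ = x from hx, show σ' _ = y from hy]

/-- Applied to functions `K` built from multiplication and inversion in a Lie group, when the
smoothness of `φ` and `ψ` is known only through functions on `M`. Coordinates of the two factors
reduce it to composition with a function on a Euclidean space. -/
lemma smAt_comp₂ (hC : IsComplete C) {φ ψ : X → M} {p : X}
    (hφ : ∀ f : Fn (smoothAlg E M), SmAt C (fun x => f (φ x)) p)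
    (hψ : ∀ f : Fn (smoothAlg E M), SmAt C (fun x => f (ψ x)) p) {K : M × M → ℝ}
    (hK : ContMDiff (𝓘(ℝ, E).prod 𝓘(ℝ, E)) 𝓘(ℝ, ℝ) ∞ K) :
    SmAt C (fun x => K (φ x, ψ x)) p := by
  obtain ⟨ξ, η, O, Φ, hO, hΦ, hp, V, hV, U, hU, h⟩ := exists_coords₂ hK (φ p) (ψ p)
  have hc : ∀ i, SmAt C (fun x => Sum.elim (fun i => ξ i (φ x)) (fun i => η i (ψ x)) i) p := by
    rintro (i | i)
    · exact hφ _
    · exact hψ _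
  refine (SmAt.comp hC hc hO hp hΦ).congr ?_
  filter_upwards [(tendsto_of_smAt hC hφ).eventually hV, (tendsto_of_smAt hC hψ).eventually hU]
    with x hx hx' using h _ hx _ hx'

/-- Smoothness of the partial derivatives of a function of two variables. -/
lemma smAt_partial (hC : IsComplete C) {φ ψ : X → M} {p : X}
    (hφ : ∀ f : Fn (smoothAlg E M), SmAt C (fun x => f (φ x)) p)
    (hψ : ∀ f : Fn (smoothAlg E M), SmAt C (fun x => f (ψ x)) p) {K : M × M → ℝ}
    (hK : ContMDiff (𝓘(ℝ, E).prod 𝓘(ℝ, E)) 𝓘(ℝ, ℝ) ∞ K)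
    {δ : X → Fn (smoothAlg E M) →ₗ[ℝ] ℝ} (hδ : ∀ x, IsPtDer (smoothAlg E M) (φ x) (δ x))
    (hs : ∀ f, SmAt C (fun x => δ x f) p) {k : X → Fn (smoothAlg E M)}
    (hk : ∀ x y, k x y = K (y, ψ x)) : SmAt C (fun x => δ x (k x)) p := by
  obtain ⟨ξ, η, O, Φ, hO, hΦ, hp, V, hV, U, hU, hUV⟩ := exists_coords₂ hK (φ p) (ψ p)
  have hc : ∀ i, SmAt C (fun x => Sum.elim (fun i => ξ i (φ x)) (fun i => η i (ψ x)) i) p := by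
    rintro (i | i)
    · exact hφ _
    · exact hψ _
  have hp' : (fun i => Sum.elim (fun i => ξ i (φ p)) (fun i => η i (ψ p)) i) ∈ O := hp
  refine (SmAt.sum (s := Finset.univ) (F := fun i x => fderiv ℝ Φ
    (fun i => Sum.elim (fun i => ξ i (φ x)) (fun i => η i (ψ x)) i) (Pi.single (Sum.inl i) 1)
      * δ x (ξ i)) fun i _ => ?_).congr ?_
  · refine SmAt.mul ?_ (hs _)
    exact SmAt.comp hC hc hO hp' (Φ := fun v => fderiv ℝ Φ v (Pi.single (Sum.inl i) 1))
      ((hΦ.fderiv_of_isOpen hO (by simp)).clm_apply contDiffOn_const)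
  · have h1 : ∀ᶠ x in Near C p, ∀ᶠ y in 𝓝 (φ x),
        K (y, ψ x) = Φ (Sum.elim (fun i => ξ i y) fun i => η i (ψ x)) := by
      filter_upwards [(tendsto_of_smAt hC hψ).eventually hU,
        (tendsto_of_smAt hC hφ).eventually (eventually_mem_nhds_iff.2 hV)] with x hx hx'
      filter_upwards [hx'] with y hy using hUV _ hy _ hx
    have h2 := (SmAt.tendsto_pi hC hc).eventually (hO.mem_nhds hp')
    filter_upwards [h1, h2] with x hx hx'
    -- The second variable is frozen: its coordinates are constants, killed by the derivation, so
    -- only the partial derivatives in the first variable contribute.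
    let g : Fin (Module.finrank ℝ E) ⊕ Fin (Module.finrank ℝ E) → Fn (smoothAlg E M) :=
      Sum.elim ξ fun i => algebraMap ℝ _ (η i (ψ x))
    have hg : ∀ y, (fun i => g i y) = Sum.elim (fun i => ξ i y) fun i => η i (ψ x) := fun y => by
      funext i
      rcases i with i | i <;> rfl
    have h3 := (hδ x).chain isComplete_smoothAlg (g := g) (f := k x) hO (by rwa [hg]) hΦ (by
      rw [near_smoothAlg]
      filter_upwards [hx] with y hy
      rw [hk, hy, hg])
    rw [h3, Fintype.sum_sum_type, hg]
    simp only [g, Sum.elim_inl, Sum.elim_inr, (hδ x).const, mul_zero, Finset.sum_const_zero,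
      add_zero]

end SmoothAlg

/-! ### A slice for the left action of a closed hypersurface subgroup -/

section LocalInverse

variable {F : Type u} [NormedAddCommGroup F] [NormedSpace ℝ F] [FiniteDimensional ℝ F]

/-- The inverse function theorem at `a` gives smoothness of the inverse near one point. Restricting
to the open set where the derivative is invertible gives it on the whole target. -/
lemma exists_localInverse {f : F → F} {S : Set F} (hS : IsOpen S) {a : F} (ha : a ∈ S)
    (hf : ContDiffOn ℝ ∞ f S) {f' : F ≃L[ℝ] F} (h : HasFDerivAt f (f' : F →L[ℝ] F) a) :
    ∃ e : OpenPartialHomeomorph F F, a ∈ e.source ∧ e.source ⊆ S ∧ (∀ x, e x = f x) ∧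
      ContDiffOn ℝ ∞ e.symm e.target := by
  have : CompleteSpace F := FiniteDimensional.complete ℝ F
  have hfa : ContDiffAt ℝ ∞ f a := hf.contDiffAt (hS.mem_nhds ha)
  let e₀ := hfa.toOpenPartialHomeomorph f h (by simp)
  have hc : ContinuousOn (fderiv ℝ f) S := (hf.continuousOn_fderiv_of_isOpen hS (by simp))
  have hO : IsOpen (S ∩ fderiv ℝ f ⁻¹' Set.range ((↑) : (F ≃L[ℝ] F) → F →L[ℝ] F)) :=
    hc.isOpen_inter_preimage hS ContinuousLinearEquiv.isOpen
  let e := e₀.restrOpen _ hO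
  have he : ∀ x, e x = f x := fun x => rfl
  have hes : e.source = e₀.source ∩
    (S ∩ fderiv ℝ f ⁻¹' Set.range ((↑) : (F ≃L[ℝ] F) → F →L[ℝ] F)) := rfl
  refine ⟨e, ⟨hfa.mem_toOpenPartialHomeomorph_source h (by simp), ha, f', h.fderiv.symm⟩,
    fun x hx => hx.2.1, he, fun y hy => ?_⟩
  have h1 := e.map_target hy
  rw [hes] at h1
  obtain ⟨f'', hf''⟩ := h1.2.2
  have h2 : ContDiffAt ℝ ∞ f (e.symm y) := hf.contDiffAt (hS.mem_nhds h1.2.1)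
  refine (e.contDiffAt_symm hy (f₀' := f'') ?_ h2).contDiffWithinAt
  rw [hf'']
  exact (h2.differentiableAt (by simp)).hasFDerivAt

/-- Linear coordinates whose first coordinate is a given functional. -/
lemma exists_linear_coords {ℓ : F →L[ℝ] ℝ} {Y : F} (hY : ℓ Y = 1) :
    ∃ (m : ℕ) (L : F ≃L[ℝ] (Option (Fin m) → ℝ)), m + 1 = Module.finrank ℝ F ∧
      ∀ v, L v none = ℓ v := by
  let m := Module.finrank ℝ (LinearMap.ker (ℓ : F →ₗ[ℝ] ℝ))
  have hm : m + 1 = Module.finrank ℝ F := by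
    have h1 := LinearMap.finrank_range_add_finrank_ker (ℓ : F →ₗ[ℝ] ℝ)
    have h2 : LinearMap.range (ℓ : F →ₗ[ℝ] ℝ) = ⊤ := by
      refine LinearMap.range_eq_top.2 fun r => ⟨r • Y, ?_⟩
      change ℓ (r • Y) = r
      rw [map_smul, hY, smul_eq_mul, mul_one]
    rw [h2, finrank_top, Module.finrank_self] at h1
    omega
  let b : LinearMap.ker (ℓ : F →ₗ[ℝ] ℝ) ≃ₗ[ℝ] (Fin m → ℝ) :=
    LinearEquiv.ofFinrankEq _ _ (by simp [m])
  have hk : ∀ v, v - ℓ v • Y ∈ LinearMap.ker (ℓ : F →ₗ[ℝ] ℝ) := fun v => by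
    change ℓ (v - ℓ v • Y) = 0
    rw [map_sub, map_smul, hY, smul_eq_mul, mul_one, sub_self]
  let T : F →ₗ[ℝ] (Option (Fin m) → ℝ) :=
    { toFun := fun v i => i.elim (ℓ v) (b ⟨v - ℓ v • Y, hk v⟩)
      map_add' := fun v w => by
        have h1 : (⟨v + w - ℓ (v + w) • Y, hk _⟩ : LinearMap.ker (ℓ : F →ₗ[ℝ] ℝ))
            = ⟨v - ℓ v • Y, hk v⟩ + ⟨w - ℓ w • Y, hk w⟩ := by
          ext
          simp only [map_add, add_smul, Submodule.coe_add]
          abel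
        funext i
        cases i with
        | none => exact map_add ℓ v w
        | some i =>
          change b ⟨v + w - ℓ (v + w) • Y, hk _⟩ i = _
          rw [h1, map_add]
          rfl
      map_smul' := fun r v => by
        have h1 : (⟨r • v - ℓ (r • v) • Y, hk _⟩ : LinearMap.ker (ℓ : F →ₗ[ℝ] ℝ))
            = r • ⟨v - ℓ v • Y, hk v⟩ := by
          ext
          simp only [map_smul, smul_eq_mul, mul_smul, Submodule.coe_smul, smul_sub]
        funext i
        cases i with
        | none => exact map_smul ℓ r v
        | some i =>
          change b ⟨r • v - ℓ (r • v) • Y, hk _⟩ i = _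
          rw [h1, map_smul]
          rfl }
  have hT : Function.Injective T := by
    rw [injective_iff_map_eq_zero]
    intro v hv
    have h0 : ℓ v = 0 := congrFun hv none
    have h1 : b ⟨v - ℓ v • Y, hk v⟩ = 0 := funext fun i => congrFun hv (some i)
    have h2 := congrArg Subtype.val ((map_eq_zero_iff b b.injective).1 h1)
    change v - ℓ v • Y = 0 at h2
    rwa [h0, zero_smul, sub_zero] at h2
  refine ⟨m, (LinearMap.linearEquivOfInjective T hT (by simp [← hm])).toContinuousLinearEquiv,
    hm, fun v => rfl⟩

end LocalInverse

/-! ### Construction of the slice at the identity -/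

section Slice

variable {E : Type u} [NormedAddCommGroup E] [NormedSpace ℝ E]
  {G : Type v} [TopologicalSpace G] [ChartedSpace E G] [Group G] {H : Subgroup G}

variable (E H) in
/-- A curve `c` through `1` transverse to the cosets `H g`, and coordinates at `1` whose first
coordinate is the parameter of the coset. -/
structure Slice where
  c : ℝ → G
  ε : ℝ
  ε_pos : 0 < ε
  c_zero : c 0 = 1
  c_cont : ∀ s, |s| < ε → ContinuousAt c s
  c_smooth : ∀ f : Fn (smoothAlg E G), ContDiffOn ℝ ∞ (fun s => f (c s)) (Set.Ioo (-ε) ε)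
  c_inj : ∀ s s', |s| < ε → |s'| < ε → c s * (c s')⁻¹ ∈ H → s = s'
  param : ∀ s, |s| < ε → ∃ τ : Fn (smoothAlg E G),
    ∀ᶠ x in 𝓝 (c s), |τ x| < ε ∧ x * (c (τ x))⁻¹ ∈ H
  m : ℕ
  chart : RawChart (smoothAlg E G) (H : Set G) (Option (Fin m)) 1
  i0 : chart.i0 = none
  coord : ∀ᶠ q in 𝓝 1, |chart.x q none| < ε ∧ q * (c (chart.x q none))⁻¹ ∈ H
  dim : m + 1 = Module.finrank ℝ E

variable [FiniteDimensional ℝ E] [LieGroup 𝓘(ℝ, E) ∞ G] [T2Space G]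

lemma mfderiv_eq_fderiv {f : G → ℝ} {p : G} (hf : MDifferentiableAt 𝓘(ℝ, E) 𝓘(ℝ, ℝ) f p) :
    (mfderiv 𝓘(ℝ, E) 𝓘(ℝ, ℝ) f p : E →L[ℝ] ℝ)
      = fderiv ℝ (fun v => f ((extChartAt 𝓘(ℝ, E) p).symm v)) (extChartAt 𝓘(ℝ, E) p p) := by
  have h : writtenInExtChartAt 𝓘(ℝ, E) 𝓘(ℝ, ℝ) p f
      = fun v => f ((extChartAt 𝓘(ℝ, E) p).symm v) := by
    funext v
    rfl
  have h1 := hf.mfderiv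
  rw [modelWithCornersSelf_coe, Set.range_id, fderivWithin_univ] at h1
  exact h1

lemma exists_defining (hH : IsBLieGroup E H) : ∃ F : Fn (smoothAlg E G),
    mfderiv 𝓘(ℝ, E) 𝓘(ℝ, ℝ) F 1 ≠ 0 ∧ ∀ᶠ x in 𝓝 (1 : G), x ∈ H ↔ F x = 0 := by
  obtain ⟨U, f, hU, h1, hf, hd, hZ⟩ := hH.hypersurface 1 H.one_mem
  obtain ⟨F, hF⟩ := smAt_of_contMDiffAt (E := E) (f := f) (p := (1 : G)) (by
    filter_upwards [hU.mem_nhds h1] with x hx using hf.contMDiffAt (hU.mem_nhds hx))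
  rw [near_smoothAlg] at hF
  refine ⟨F, ?_, ?_⟩
  · rwa [← EventuallyEq.mfderiv_eq hF]
  · filter_upwards [hF, hU.mem_nhds h1] with x hx hx'
    rw [← hx]
    exact hZ x hx'

/-- Whether `x` and `c s` lie in one coset of `H` is detected near `1` by `F (x (c s)⁻¹) = 0`. For a
curve `c` in a direction `Y` with `dF(Y) = 1` this equation has a unique smooth solution `s = t(x)`,
which is the parameter of the coset and can be completed to coordinates. -/
lemma exists_slice (hH : IsBLieGroup E H) : Nonempty (Slice E H) := by
  have : IsTopologicalGroup G := topologicalGroup_of_lieGroup 𝓘(ℝ, E) ∞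
  obtain ⟨F, hdF, hFH⟩ := exists_defining hH
  have hF1 : F 1 = 0 := hFH.self_of_nhds.1 H.one_mem
  have hFs : ContMDiff 𝓘(ℝ, E) 𝓘(ℝ, ℝ) ∞ F := F.mem
  let φ := extChartAt 𝓘(ℝ, E) (1 : G)
  let κ : E → G := fun v => φ.symm (φ 1 + v)
  let B : Set E := {v | φ 1 + v ∈ φ.target}
  have hB : IsOpen B := (isOpen_extChartAt_target (I := 𝓘(ℝ, E)) (1 : G)).preimage (by fun_prop)
  have hκ0 : κ 0 = 1 := by
    change φ.symm (φ 1 + 0) = 1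
    rw [add_zero]
    exact extChartAt_to_inv (I := 𝓘(ℝ, E)) (1 : G)
  have hB0 : (0 : E) ∈ B := by
    change φ 1 + 0 ∈ φ.target
    rw [add_zero]
    exact mem_extChartAt_target (1 : G)
  have hκ : ContMDiffOn 𝓘(ℝ, E) 𝓘(ℝ, E) ∞ κ B :=
    (contMDiffOn_extChartAt_symm (I := 𝓘(ℝ, E)) (n := ∞) (1 : G)).comp
      (contDiff_const.add contDiff_id).contMDiff.contMDiffOn fun v hv => hv
  have hφκ : ∀ v ∈ B, φ (κ v) - φ 1 = v := fun v hv => by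
    change φ (φ.symm (φ 1 + v)) - φ 1 = v
    rw [φ.right_inv hv, add_sub_cancel_left]
  have hκφ : ∀ x ∈ φ.source, κ (φ x - φ 1) = x := fun x hx => by
    change φ.symm (φ 1 + (φ x - φ 1)) = x
    rw [add_sub_cancel, φ.left_inv hx]
  -- the differential of `F` in the chart
  have hFκ : ContDiffOn ℝ ∞ (fun v => F (κ v)) B :=
    contMDiffOn_iff_contDiffOn.1 (hFs.comp_contMDiffOn hκ)
  let ℓ := fderiv ℝ (fun v => F (κ v)) 0
  have hℓF : HasFDerivAt (fun v => F (κ v)) ℓ 0 :=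
    ((hFκ.contDiffAt (hB.mem_nhds hB0)).differentiableAt (by simp)).hasFDerivAt
  have hℓ : ℓ ≠ 0 := by
    intro h0
    apply hdF
    have h1 : HasFDerivAt (fun v => F (φ.symm v)) ℓ (φ 1) := by
      have h2 : HasFDerivAt (fun v : E => v - φ 1) (ContinuousLinearMap.id ℝ E) (φ 1) :=
        (hasFDerivAt_id _).sub_const _
      have h3 := HasFDerivAt.comp (g := fun v => F (κ v)) (φ 1) (by rwa [sub_self]) h2
      rw [ContinuousLinearMap.comp_id] at h3
      refine h3.congr_of_eventuallyEq (Eventually.of_forall fun v => ?_)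
      change F (φ.symm v) = F (φ.symm (φ 1 + (v - φ 1)))
      rw [add_sub_cancel]
    exact (mfderiv_eq_fderiv (smoothAlg_mdiff F 1)).trans (h1.fderiv.trans h0)
  obtain ⟨Y, hY⟩ : ∃ Y, ℓ Y = 1 := by
    obtain ⟨Y, hY⟩ := DFunLike.ne_iff.1 hℓ
    refine ⟨(ℓ Y)⁻¹ • Y, ?_⟩
    rw [map_smul, smul_eq_mul, inv_mul_cancel₀ hY]
  obtain ⟨m, L, hm, hL⟩ := exists_linear_coords hY
  let Λ : E × ℝ → ℝ := fun p => F (κ p.1 * (κ (p.2 • Y))⁻¹)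
  let S : Set (E × ℝ) := {p | p.1 ∈ B ∧ p.2 • Y ∈ B}
  have hS : IsOpen S := (hB.preimage continuous_fst).inter (hB.preimage (by fun_prop))
  have hS0 : ((0, 0) : E × ℝ) ∈ S := ⟨hB0, by simpa using hB0⟩
  have hΛ : ContDiffOn ℝ ∞ Λ S := by
    rw [← contMDiffOn_iff_contDiffOn]
    refine hFs.comp_contMDiffOn (ContMDiffOn.mul ?_ (ContMDiffOn.inv ?_))
    · exact hκ.comp contDiff_fst.contMDiff.contMDiffOn fun p hp => hp.1
    · exact hκ.comp (g := κ) (f := fun p : E × ℝ => p.2 • Y)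
        (contDiff_snd.smul contDiff_const).contMDiff.contMDiffOn fun p hp => hp.2
  -- The derivative in `v` is `ℓ` by definition. The derivative in `s` follows since `Λ` vanishes
  -- along `(s • Y, s)` and `ℓ Y = 1`.
  have hΛ' : HasFDerivAt Λ (ℓ.comp (ContinuousLinearMap.fst ℝ E ℝ)
      - ContinuousLinearMap.snd ℝ E ℝ) (0, 0) := by
    have h1 : HasFDerivAt Λ (fderiv ℝ Λ (0, 0)) (0, 0) :=
      ((hΛ.contDiffAt (hS.mem_nhds hS0)).differentiableAt (by simp)).hasFDerivAt
    have h2 : ∀ v, fderiv ℝ Λ (0, 0) (v, 0) = ℓ v := fun v => by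
      have h3 : HasFDerivAt (fun v : E => (v, (0 : ℝ))) (ContinuousLinearMap.inl ℝ E ℝ) 0 :=
        (ContinuousLinearMap.inl ℝ E ℝ).hasFDerivAt
      have h4 := (HasFDerivAt.comp (g := Λ) (0 : E) h1 h3).fderiv
      have h5 : Λ ∘ (fun v : E => (v, (0 : ℝ))) = fun v => F (κ v) := by
        funext v
        simp [Λ, hκ0]
      rw [h5] at h4
      exact (congrArg (fun T => T v) h4).symm
    have h6 : fderiv ℝ Λ (0, 0) (Y, 1) = 0 := by
      have h3 : HasFDerivAt (fun s : ℝ => (s • Y, s))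
          ((ContinuousLinearMap.toSpanSingleton ℝ Y).prod (ContinuousLinearMap.id ℝ ℝ)) 0 :=
        ((ContinuousLinearMap.toSpanSingleton ℝ Y).prod
          (ContinuousLinearMap.id ℝ ℝ)).hasFDerivAt
      have h4 := (HasFDerivAt.comp (g := Λ) (0 : ℝ) (by simpa using h1) h3).fderiv
      have h5 : Λ ∘ (fun s : ℝ => (s • Y, s)) = fun _ => 0 := by
        funext s
        simp [Λ, hF1]
      rw [h5] at h4
      have h7 := (congrArg (fun T => T 1) h4).symm
      simpa using h7
    convert h1 using 1
    ext v
    · simp [h2]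
    · have h8 := h2 Y
      have h9 : ((Y, 1) : E × ℝ) = (Y, 0) + (0, 1) := by simp
      rw [h9, map_add, h8, hY] at h6
      simp
      linarith
  -- The derivative of `(v, s) ↦ (v, Λ(v, s))` is an involution, hence its own inverse.
  let T : E × ℝ →L[ℝ] E × ℝ := (ContinuousLinearMap.fst ℝ E ℝ).prod
    (ℓ.comp (ContinuousLinearMap.fst ℝ E ℝ) - ContinuousLinearMap.snd ℝ E ℝ)
  have hTT : Function.LeftInverse T T := fun v => by
    refine Prod.ext rfl ?_
    change ℓ v.1 - (ℓ v.1 - v.2) = v.2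
    ring
  let N' : (E × ℝ) ≃L[ℝ] (E × ℝ) := ContinuousLinearEquiv.equivOfInverse T T hTT hTT
  have hN' : HasFDerivAt (fun p : E × ℝ => (p.1, Λ p)) (N' : E × ℝ →L[ℝ] E × ℝ) (0, 0) :=
    hasFDerivAt_fst.prodMk hΛ'
  obtain ⟨e, he0, heS, heN, hes⟩ :=
    exists_localInverse hS hS0 (contDiff_fst.contDiffOn.prodMk hΛ) hN'
  -- The solution of `Λ(v, s) = 0`, read off the local inverse at height zero.
  let t : E → ℝ := fun v => (e.symm (v, 0)).2
  let A : Set E := {v | (v, (0 : ℝ)) ∈ e.target}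
  have hA : IsOpen A := e.open_target.preimage (by fun_prop)
  have ht_unique : ∀ v s, (v, s) ∈ e.source → Λ (v, s) = 0 → v ∈ A ∧ t v = s := by
    intro v s hvs h0
    have h1 : e (v, s) = (v, 0) := by rw [heN, h0]
    have h2 := e.map_source hvs
    have h3 := e.left_inv hvs
    rw [h1] at h2 h3
    exact ⟨h2, by rw [show t v = (e.symm (v, 0)).2 from rfl, h3]⟩
  have ht_spec : ∀ v ∈ A, Λ (v, t v) = 0 := by
    intro v hv
    have h1 := e.right_inv hv
    rw [heN] at h1
    have h3 : (e.symm (v, 0)).1 = v := congrArg Prod.fst h1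
    have h2 : e.symm (v, 0) = (v, t v) := Prod.ext h3 rfl
    rw [h2] at h1
    exact congrArg Prod.snd h1
  have hΛ_self : ∀ s, Λ (s • Y, s) = 0 := fun s => by simp [Λ, hF1]
  have hΛ0 : Λ (0, 0) = 0 := by simpa using hΛ_self 0
  obtain ⟨hA0, ht0⟩ := ht_unique 0 0 he0 hΛ0
  have ht : ContDiffOn ℝ ∞ t A := contDiff_snd.comp_contDiffOn
    (hes.comp (f := fun v : E => (v, (0 : ℝ))) (by fun_prop) fun v hv => hv)
  have ht' : HasFDerivAt t ℓ 0 := by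
    have h1 : e.symm (0, 0) = (0, 0) := by
      have := e.left_inv he0
      rwa [heN, hΛ0] at this
    have h2 : HasFDerivAt e (N' : E × ℝ →L[ℝ] E × ℝ) (e.symm (0, 0)) := by
      rw [h1, show (e : E × ℝ → E × ℝ) = fun p => (p.1, Λ p) from funext heN]
      exact hN'
    have h3 := e.hasFDerivAt_symm hA0 h2
    have h4 : HasFDerivAt (fun v : E => (v, (0 : ℝ))) (ContinuousLinearMap.inl ℝ E ℝ) 0 :=
      (ContinuousLinearMap.inl ℝ E ℝ).hasFDerivAt
    have h5 := (hasFDerivAt_snd (p := e.symm (0, 0))).comp (0 : E)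
      (HasFDerivAt.comp (g := e.symm) (0 : E) h3 h4)
    refine h5.congr_fderiv ?_
    ext v
    change ℓ v - 0 = ℓ v
    rw [sub_zero]
  let c : ℝ → G := fun s => κ (s • Y)
  have hκc : ∀ s, s • Y ∈ B → ContinuousAt c s := fun s hs =>
    ContinuousAt.comp (g := κ) (f := fun s : ℝ => s • Y)
      (hκ.continuousOn.continuousAt (hB.mem_nhds hs)) (by fun_prop)
  have hc0 : c 0 = 1 := by
    change κ ((0 : ℝ) • Y) = 1
    rw [zero_smul, hκ0]
  -- Conditions on a pair of parameters under which both points lie in the region of unique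
  -- solvability and `F` decides membership in `H`; they determine `ε`.
  have hev : ∀ᶠ p : ℝ × ℝ in 𝓝 (0, 0), (p.1 • Y ∈ B ∧ (p.1 • Y, p.1) ∈ e.source) ∧
      (p.1 • Y, p.2) ∈ e.source ∧
      (c p.1 * (c p.2)⁻¹ ∈ H ↔ F (c p.1 * (c p.2)⁻¹) = 0) := by
    have h1 : ∀ᶠ p : ℝ × ℝ in 𝓝 (0, 0), p.1 • Y ∈ B :=
      (hB.preimage (f := fun p : ℝ × ℝ => p.1 • Y) (by fun_prop)).mem_nhds (by simpa using hB0)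
    have h2 : ∀ᶠ p : ℝ × ℝ in 𝓝 (0, 0), (p.1 • Y, p.1) ∈ e.source :=
      (e.open_source.preimage (f := fun p : ℝ × ℝ => (p.1 • Y, p.1)) (by fun_prop)).mem_nhds
        (by simpa using he0)
    have h3 : ∀ᶠ p : ℝ × ℝ in 𝓝 (0, 0), (p.1 • Y, p.2) ∈ e.source :=
      (e.open_source.preimage (f := fun p : ℝ × ℝ => (p.1 • Y, p.2)) (by fun_prop)).mem_nhds
        (by simpa using he0)
    have h4 : ContinuousAt (fun p : ℝ × ℝ => c p.1 * (c p.2)⁻¹) (0, 0) := by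
      have h5 : ContinuousAt c 0 := hκc 0 (by simpa using hB0)
      exact (ContinuousAt.comp (g := c) (f := Prod.fst) h5 continuousAt_fst).mul
        (ContinuousAt.comp (g := c) (f := Prod.snd) h5 continuousAt_snd).inv
    have h6 : c 0 * (c 0)⁻¹ = 1 := mul_inv_cancel _
    have h8 : ∀ᶠ y in 𝓝 (c 0 * (c 0)⁻¹), (y ∈ H ↔ F y = 0) := by rwa [h6]
    have h7 : ∀ᶠ p : ℝ × ℝ in 𝓝 (0, 0), (c p.1 * (c p.2)⁻¹ ∈ H ↔ F (c p.1 * (c p.2)⁻¹) = 0) :=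
      h4.eventually h8
    filter_upwards [h1, h2, h3, h7] with p k1 k2 k3 k4 using ⟨⟨k1, k2⟩, k3, k4⟩
  obtain ⟨ε, hε, hεp⟩ := Metric.eventually_nhds_iff.1 hev
  have hεs : ∀ s s', |s| < ε → |s'| < ε → (s • Y ∈ B ∧ (s • Y, s) ∈ e.source) ∧
      (s • Y, s') ∈ e.source ∧ (c s * (c s')⁻¹ ∈ H ↔ F (c s * (c s')⁻¹) = 0) :=
    fun s s' hs hs' => hεp (y := (s, s')) (by simp [Prod.dist_eq, hs, hs'])
  have hcinj : ∀ s s', |s| < ε → |s'| < ε → c s * (c s')⁻¹ ∈ H → s = s' := by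
    intro s s' hs hs' hH'
    obtain ⟨⟨-, h1⟩, h2, h3⟩ := hεs s s' hs hs'
    rw [← (ht_unique _ _ h1 (hΛ_self s)).2, ← (ht_unique _ _ h2 (h3.1 hH')).2]
  have hfκ : ∀ f : Fn (smoothAlg E G), ContDiffOn ℝ ∞ (fun v => f (κ v)) B := fun f =>
    contMDiffOn_iff_contDiffOn.1 (ContMDiff.comp_contMDiffOn (n := ∞) f.mem hκ)
  have hφo : ∀ x ∈ φ.source, ∀ᶠ y in 𝓝 x, y ∈ φ.source := fun x hx =>
    (isOpen_extChartAt_source (I := 𝓘(ℝ, E)) (1 : G)).mem_nhds hx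
  have hφs : ∀ x ∈ φ.source, ContMDiffAt 𝓘(ℝ, E) 𝓘(ℝ, E) ∞ (fun x => φ x - φ 1) x := by
    intro x hx
    refine ContMDiffAt.sub (contMDiffAt_extChartAt' ?_) contMDiffAt_const
    rwa [← extChartAt_source 𝓘(ℝ, E)]
  let τ : G → ℝ := fun x => t (φ x - φ 1)
  have hτ : ∀ s, |s| < ε → c s ∈ φ.source ∧ φ (c s) - φ 1 ∈ A ∧ τ (c s) = s := fun s hs => by
    obtain ⟨⟨h1, h2⟩, -⟩ := hεs s s hs hs
    obtain ⟨h3, h4⟩ := ht_unique _ _ h2 (hΛ_self s)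
    have h5 : φ (c s) - φ 1 = s • Y := hφκ _ h1
    refine ⟨φ.map_target h1, by rwa [h5], ?_⟩
    change t (φ (c s) - φ 1) = s
    rw [h5, h4]
  have hτA : ∀ s, |s| < ε → ∀ᶠ x in 𝓝 (c s), x ∈ φ.source ∧ φ x - φ 1 ∈ A := fun s hs => by
    obtain ⟨h1, h2, -⟩ := hτ s hs
    filter_upwards [hφo _ h1, (hφs _ h1).continuousAt.eventually (hA.mem_nhds h2)] with x k1 k2
      using ⟨k1, k2⟩
  have hτs : ∀ s, |s| < ε → ∀ᶠ x in 𝓝 (c s), ContMDiffAt 𝓘(ℝ, E) 𝓘(ℝ, ℝ) ∞ τ x := fun s hs => by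
    filter_upwards [hτA s hs] with x hx
    exact ContMDiffAt.comp (g := t) x (ht.contDiffAt (hA.mem_nhds hx.2)).contMDiffAt
      (hφs x hx.1)
  have hkey : ∀ s, |s| < ε → ∀ᶠ x in 𝓝 (c s), |τ x| < ε ∧ x * (c (τ x))⁻¹ ∈ H := fun s hs => by
    obtain ⟨h1, h2, h3⟩ := hτ s hs
    have h4 : ContinuousAt τ (c s) := (hτs s hs).self_of_nhds.continuousAt
    have h5 : ContinuousAt (fun x => x * (c (τ x))⁻¹) (c s) := by
      refine continuousAt_id.mul (ContinuousAt.inv ?_)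
      exact ContinuousAt.comp (g := c) (f := τ) (by rw [h3]; exact hκc s (hεs s s hs hs).1.1) h4
    have h6 : ∀ᶠ x in 𝓝 (c s), |τ x| < ε :=
      h4.abs.eventually (gt_mem_nhds (show |τ (c s)| < ε by rwa [h3]))
    have h7 : c s * (c (τ (c s)))⁻¹ = 1 := by rw [h3, mul_inv_cancel]
    have h9 : ∀ᶠ y in 𝓝 (c s * (c (τ (c s)))⁻¹), (y ∈ H ↔ F y = 0) := by rwa [h7]
    have h8 : ∀ᶠ x in 𝓝 (c s), (x * (c (τ x))⁻¹ ∈ H ↔ F (x * (c (τ x))⁻¹) = 0) :=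
      h5.eventually h9
    filter_upwards [h6, h8, hτA s hs] with x k1 k2 k3
    refine ⟨k1, k2.2 ?_⟩
    have h9 := ht_spec _ k3.2
    change F (κ (φ x - φ 1) * _) = 0 at h9
    rwa [hκφ x k3.1] at h9
  -- coordinates
  let Θ : E → E := fun v => v + (t v - ℓ v) • Y
  have hΘ : ContDiffOn ℝ ∞ Θ (A ∩ B) :=
    contDiffOn_id.add (((ht.mono Set.inter_subset_left).sub ℓ.contDiff.contDiffOn).smul
      contDiffOn_const)
  -- The map `Θ` only replaces the `ℓ`-component of `v` by `t v`; as the derivative of `t` at `0` is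
  -- `ℓ`, that of `Θ` is the identity.
  have hΘ' : HasFDerivAt Θ ((ContinuousLinearEquiv.refl ℝ E : E ≃L[ℝ] E) : E →L[ℝ] E) 0 := by
    have h1 := (hasFDerivAt_id (𝕜 := ℝ) (0 : E)).add ((ht'.sub ℓ.hasFDerivAt).smul_const Y)
    refine h1.congr_fderiv ?_
    ext v
    simp
  obtain ⟨e₂, h20, h2S, h2Θ, h2s⟩ := exists_localInverse (hA.inter hB) ⟨hA0, hB0⟩ hΘ hΘ'
  have hℓΘ : ∀ q, L (Θ (φ q - φ 1)) none = τ q := fun q => by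
    rw [hL]
    change ℓ (_ + (t _ - ℓ _) • Y) = t _
    rw [map_add, map_smul, hY, smul_eq_mul]
    ring
  have h01 := hτ 0 (by simpa using hε)
  have hA1 := hτA 0 (by simpa using hε)
  have hk1 := hkey 0 (by simpa using hε)
  have hs1 := hτs 0 (by simpa using hε)
  rw [hc0] at h01 hA1 hk1 hs1
  exact ⟨{
    c := c
    ε := ε
    ε_pos := hε
    c_zero := hc0
    c_cont := fun s hs => hκc s (hεs s s hs hs).1.1
    c_smooth := fun f => (hfκ f).comp (f := fun s : ℝ => s • Y) (by fun_prop)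
      fun s hs => (hεs s s (abs_lt.2 hs) (abs_lt.2 hs)).1.1
    c_inj := hcinj
    param := fun s hs => by
      obtain ⟨τ', h'⟩ := smAt_of_contMDiffAt (hτs s hs)
      rw [near_smoothAlg] at h'
      refine ⟨τ', ?_⟩
      filter_upwards [h', hkey s hs] with x k1 k2
      rwa [← k1]
    m := m
    chart :=
      { x := fun q => L (Θ (φ q - φ 1))
        O := L.symm ⁻¹' e₂.target
        σ := fun w => κ (e₂.symm (L.symm w))
        isOpen := e₂.open_target.preimage L.symm.continuous
        mem := by
          rw [Set.mem_preimage, L.symm_apply_apply, sub_self, ← h2Θ]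
          exact e₂.map_source h20
        left := by
          rw [near_smoothAlg]
          have h1 : ∀ᶠ q in 𝓝 (1 : G), φ q - φ 1 ∈ e₂.source :=
            (hφs 1 h01.1).continuousAt.eventually
              (e₂.open_source.mem_nhds (show φ 1 - φ 1 ∈ e₂.source by rwa [sub_self]))
          filter_upwards [h1, hφo 1 h01.1] with q k1 k2
          rw [L.symm_apply_apply, ← h2Θ, e₂.left_inv k1, hκφ q k2]
        right := fun w hw => by
          have h1 := h2S (e₂.map_target hw)
          rw [hφκ _ h1.2, ← h2Θ, e₂.right_inv hw, L.apply_symm_apply]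
        smooth_inv := fun f => ((hfκ f).comp h2s fun w hw => (h2S (e₂.map_target hw)).2).comp
          L.symm.contDiff.contDiffOn fun w hw => hw
        smooth := fun i => by
          refine smAt_of_contMDiffAt ?_
          have hB1 : ∀ᶠ q in 𝓝 (1 : G), φ q - φ 1 ∈ B :=
            (hφs 1 h01.1).continuousAt.eventually
              (hB.mem_nhds (show φ 1 - φ 1 ∈ B by rwa [sub_self]))
          filter_upwards [hA1, hB1] with q k1 k2
          have h1 : ContDiff ℝ ∞ fun v : E => L v i := (contDiff_apply ℝ ℝ i).comp L.contDiff
          have h2 := hΘ.contDiffAt ((hA.inter hB).mem_nhds ⟨k1.2, k2⟩)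
          exact (h1.contDiffAt.comp _ h2).contMDiffAt.comp q (hφs q k1.1)
        i0 := none
        crit := by
          refine Or.inr ⟨H.one_mem, ?_⟩
          rw [near_smoothAlg]
          filter_upwards [hk1] with q hq
          rw [hℓΘ]
          -- Both elements are in the same coset of `H`, and comparison with `c 0 = 1` shows that `c
          -- s ∈ H` only for `s = 0`.
          have h1 : q ∈ H ↔ c (τ q) ∈ H := by
            rw [← H.inv_mem_iff (x := c (τ q))]
            exact ⟨fun h => (H.mul_mem_cancel_left h).1 hq.2, fun h =>
              (H.mul_mem_cancel_right h).1 hq.2⟩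
          change q ∈ H ↔ _
          rw [h1]
          refine ⟨fun h => hcinj _ 0 hq.1 (by simpa using hε) (by rwa [hc0, inv_one, mul_one]),
            fun h => ?_⟩
          rw [h, hc0]
          exact H.one_mem }
    i0 := rfl
    coord := by
      filter_upwards [hk1] with q hq
      rwa [hℓΘ]
    dim := hm }⟩

end Slice

/-! ### The quotient of `G` by `H` -/

section Base

lemma IsGen.congr {X : Type u} {C : FunAlg X} {Z : Set X} {p : X} {r s : Fn C}
    (h : IsGen C Z p r) (hrs : ∀ᶠ z in Near C p, s z = r z) : IsGen C Z p s where
  vanish := by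
    filter_upwards [h.vanish, hrs] with z h1 h2 h3
    rw [h2, h1 h3]
  div F hF := by
    obtain ⟨G, hG⟩ := h.div F hF
    refine ⟨G, ?_⟩
    filter_upwards [hG, hrs] with z h1 h2
    rw [h1, h2]
  cancel G hG := h.cancel G (by
    filter_upwards [hG, hrs] with z h1 h2
    rw [← h2, h1])

variable {E : Type u} [NormedAddCommGroup E] [NormedSpace ℝ E]
  {G : Type v} [TopologicalSpace G] [ChartedSpace E G] [Group G] {H : Subgroup G}

namespace Slice

variable (S : Slice E H)

/-- The points of `H c(s)`, for a parameter `s` of the slice. -/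
def Dom (x : G) : Prop := ∃ s, |s| < S.ε ∧ x * (S.c s)⁻¹ ∈ H

open Classical in
/-- The parameter of the coset of a point. -/
def t (x : G) : ℝ := if h : S.Dom x then h.choose else 0

variable {S}

lemma Dom.spec {x : G} (h : S.Dom x) : |S.t x| < S.ε ∧ x * (S.c (S.t x))⁻¹ ∈ H := by
  rw [t, dif_pos h]
  exact h.choose_spec

variable (S)

lemma t_eq {x : G} {s : ℝ} (hs : |s| < S.ε) (hx : x * (S.c s)⁻¹ ∈ H) : S.t x = s := by
  have h : S.Dom x := ⟨s, hs, hx⟩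
  refine S.c_inj _ _ h.spec.1 hs ?_
  have h1 := H.mul_mem (H.inv_mem h.spec.2) hx
  rwa [mul_inv_rev, inv_inv, mul_assoc, inv_mul_cancel_left] at h1

lemma dom_mul {h x : G} (hh : h ∈ H) : S.Dom (h * x) ↔ S.Dom x := by
  simp only [Dom, mul_assoc, H.mul_mem_cancel_left hh]

lemma t_mul {h x : G} (hh : h ∈ H) : S.t (h * x) = S.t x := by
  by_cases hx : S.Dom x
  · refine S.t_eq hx.spec.1 ?_
    rw [mul_assoc]
    exact H.mul_mem hh hx.spec.2
  · rw [t, t, dif_neg hx, dif_neg (by rwa [S.dom_mul hh])]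

lemma dom_c {s : ℝ} (hs : |s| < S.ε) : S.Dom (S.c s) :=
  ⟨s, hs, by rw [mul_inv_cancel]; exact H.one_mem⟩

lemma t_c {s : ℝ} (hs : |s| < S.ε) : S.t (S.c s) = s :=
  S.t_eq hs (by rw [mul_inv_cancel]; exact H.one_mem)

lemma t_eq_zero {x : G} (hx : S.Dom x) : S.t x = 0 ↔ x ∈ H := by
  constructor
  · intro h
    have h1 := hx.spec.2
    rwa [h, S.c_zero, inv_one, mul_one] at h1
  · intro h
    refine S.t_eq (by simpa using S.ε_pos) ?_
    rwa [S.c_zero, inv_one, mul_one]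

variable [FiniteDimensional ℝ E] [LieGroup 𝓘(ℝ, E) ∞ G] [T2Space G]

/-- The parameter is invariant under left translation by `H`, and the element `x (c s)⁻¹` of `H`
brings `x` back to the slice point `c s`, where `param` applies. -/
lemma dom_smAt {x : G} (hx : S.Dom x) :
    (∀ᶠ y in 𝓝 x, S.Dom y) ∧ SmAt (smoothAlg E G) S.t x := by
  have : IsTopologicalGroup G := topologicalGroup_of_lieGroup 𝓘(ℝ, E) ∞
  obtain ⟨s, hs, hsx⟩ := hx
  obtain ⟨τ, hτ⟩ := S.param s hs
  have h1 : Tendsto (fun y => (x * (S.c s)⁻¹)⁻¹ * y) (𝓝 x) (𝓝 (S.c s)) := by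
    have h2 : ContinuousAt (fun y => (x * (S.c s)⁻¹)⁻¹ * y) x := by fun_prop
    have h3 : (x * (S.c s)⁻¹)⁻¹ * x = S.c s := by group
    rw [ContinuousAt, h3] at h2
    exact h2
  have h4 := h1.eventually hτ
  constructor
  · filter_upwards [h4] with y hy
    rw [← S.dom_mul (H.inv_mem hsx)]
    exact ⟨_, hy⟩
  · refine ⟨leftPull E (x * (S.c s)⁻¹)⁻¹ τ, ?_⟩
    rw [near_smoothAlg]
    filter_upwards [h4] with y hy
    rw [← S.t_mul (H.inv_mem hsx)]
    exact S.t_eq hy.1 hy.2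

/-- The set is the product of the closed set `H` with the compact arc `c '' [-δ, δ]`. Its complement
is the region where functions of the parameter are extended by zero. -/
lemma isClosed_dom (hH : IsClosed (H : Set G)) {δ : ℝ} (hδ : δ < S.ε) :
    IsClosed {x | S.Dom x ∧ |S.t x| ≤ δ} := by
  have : IsTopologicalGroup G := topologicalGroup_of_lieGroup 𝓘(ℝ, E) ∞
  have h1 : IsCompact (S.c '' Set.Icc (-δ) δ) := isCompact_Icc.image_of_continuousOn
    fun s hs => (S.c_cont s ((abs_le.2 hs).trans_lt hδ)).continuousWithinAt
  convert hH.mul_right_of_isCompact h1 using 1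
  ext x
  constructor
  · rintro ⟨hx, hx'⟩
    exact ⟨_, hx.spec.2, _, ⟨_, abs_le.1 hx', rfl⟩, by group⟩
  · rintro ⟨h, hh, _, ⟨s, hs, rfl⟩, rfl⟩
    have hs' := abs_le.2 hs
    have hs1 := hs'.trans_lt hδ
    refine ⟨(S.dom_mul hh).2 (S.dom_c hs1), ?_⟩
    change |S.t (h * S.c s)| ≤ δ
    rwa [S.t_mul hh, S.t_c hs1]

open Classical in
lemma cut_mem (hH : IsClosed (H : Set G)) {b : ℝ → ℝ} (hb : ContDiff ℝ ∞ b) {δ : ℝ}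
    (hδ : δ < S.ε) (hbδ : ∀ s, δ < |s| → b s = 0) :
    (fun x => if S.Dom x then b (S.t x) else 0) ∈ smoothAlg E G := by
  refine isComplete_smoothAlg.mem_of_smAt fun x => ?_
  by_cases hx : S.Dom x
  · obtain ⟨h1, h2⟩ := S.dom_smAt hx
    have h3 := SmAt.comp (isComplete_smoothAlg (E := E) (M := G)) (ι := Unit)
      (g := fun _ => S.t) (fun _ => h2) (Φ := fun w => b (w ())) isOpen_univ (Set.mem_univ _)
      (by fun_prop)
    refine h3.congr ?_
    rw [near_smoothAlg]
    filter_upwards [h1] with y hy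
    rw [if_pos hy]
  · refine (smAt_const 0 x).congr ?_
    rw [near_smoothAlg]
    have h1 := (S.isClosed_dom hH hδ).isOpen_compl.mem_nhds (x := x) fun h => hx h.1
    filter_upwards [h1] with y hy
    split_ifs with h
    · exact hbδ _ (not_le.1 fun h2 => hy ⟨h, h2⟩)
    · rfl

end Slice

variable [FiniteDimensional ℝ E] [LieGroup 𝓘(ℝ, E) ∞ G] [T2Space G]

lemma orbitMk_eq {x y : G} : orbitMk H x = orbitMk H y ↔ x * y⁻¹ ∈ H := by
  rw [orbitMk, orbitMk, Quotient.eq, MulAction.orbitRel_apply, MulAction.mem_orbit_iff]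
  constructor
  · rintro ⟨h, rfl⟩
    change (h : G) * y * y⁻¹ ∈ H
    rw [mul_inv_cancel_right]
    exact h.2
  · intro h
    exact ⟨⟨_, h⟩, by change x * y⁻¹ * y = x; group⟩

lemma orbitMk_eq_one {x : G} : orbitMk H x = orbitMk H (1 : G) ↔ x ∈ H := by
  rw [orbitMk_eq, inv_one, mul_one]

lemma orbitMk_smul {X : Type w} {K : Type v} [Group K] [MulAction K X] (k : K) (x : X) :
    orbitMk K (k • x) = orbitMk K x := Quotient.sound ⟨k, rfl⟩

namespace Slice

variable (S : Slice E H)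

/-- The parameter of a coset, for the slice translated by `g`. -/
def par (g : G) : MulAction.orbitRel.Quotient H G → ℝ :=
  Quotient.lift (fun x => S.t (x * g⁻¹)) (by
    rintro _ y ⟨h, rfl⟩
    change S.t (h * y * g⁻¹) = _
    rw [mul_assoc, S.t_mul h.2])

lemma par_mk (g x : G) : S.par g (orbitMk H x) = S.t (x * g⁻¹) := rfl

open Classical in
lemma exists_cut (hH : IsClosed (H : Set G)) {b : ℝ → ℝ} (hb : ContDiff ℝ ∞ b) {δ : ℝ}
    (hδ : δ < S.ε) (hbδ : ∀ s, δ < |s| → b s = 0) (g : G) : ∃ f : Fn (baseAlg E H),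
      ∀ x, f (orbitMk H x) = if S.Dom (x * g⁻¹) then b (S.t (x * g⁻¹)) else 0 := by
  let f : MulAction.orbitRel.Quotient H G → ℝ :=
    Quotient.lift (fun x => if S.Dom (x * g⁻¹) then b (S.t (x * g⁻¹)) else 0) (by
      rintro _ y ⟨h, rfl⟩
      change (if S.Dom (h * y * g⁻¹) then b (S.t (h * y * g⁻¹)) else 0) = _
      rw [mul_assoc, S.t_mul h.2]
      simp only [S.dom_mul h.2])
  exact ⟨Fn.mk f (rightPull E g⁻¹ (Fn.mk _ (S.cut_mem hH hb hδ hbδ))).mem, fun x => rfl⟩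

lemma exists_bump (hH : IsClosed (H : Set G)) {δ : ℝ} (h0 : 0 < δ) (hδ : δ < S.ε) (g : G) :
    ∃ f : Fn (baseAlg E H), ∀ x, f (orbitMk H x) ≠ 0 ↔
      S.Dom (x * g⁻¹) ∧ |S.t (x * g⁻¹)| < δ := by
  let b : ContDiffBump (0 : ℝ) := ⟨δ / 2, δ, by positivity, by linarith⟩
  have hb : ∀ s, b s ≠ 0 ↔ |s| < δ := fun s => by
    have h1 : s ∈ Function.support b ↔ s ∈ Metric.ball (0 : ℝ) δ := by rw [b.support_eq]
    simpa using h1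
  obtain ⟨f, hf⟩ := S.exists_cut hH (b := b) b.contDiff hδ
    (fun s hs => not_not.1 fun h => (lt_asymm hs) ((hb s).1 h)) g
  refine ⟨f, fun x => ?_⟩
  rw [hf]
  split_ifs with h
  · simp only [h, true_and]
    exact hb _
  · simp [h]

/-- The germ at `[g]` of a one-dimensional chart of the quotient. -/
lemma exists_baseChart (hH : IsClosed (H : Set G)) (g : G) : ∃ φ : Chart (baseAlg E H) Unit,
    φ.u (orbitMk H g) ≠ 0 ∧ (∀ x, φ.u (orbitMk H x) ≠ 0 → S.Dom (x * g⁻¹)) ∧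
    (∀ q i, φ.x q i = S.par g q) ∧ (∀ w ∈ φ.O, |w ()| < S.ε) ∧
    ∀ w, φ.σ w = orbitMk H (S.c (w ()) * g) := by
  have hε := S.ε_pos
  obtain ⟨u, hu⟩ := S.exists_bump hH (half_pos hε) (half_lt_self hε) g
  -- The function `s * b s` equals the parameter on the chart, where `|s| < ε / 2`, and its support
  -- stays away from `ε`, so it extends to the whole quotient.
  let b : ContDiffBump (0 : ℝ) := ⟨S.ε / 2, 3 * S.ε / 4, by positivity, by linarith⟩
  obtain ⟨f, hf⟩ := S.exists_cut hH (b := fun s => s * b s) (contDiff_id.mul b.contDiff)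
    (show 3 * S.ε / 4 < S.ε by linarith) (fun s hs => by
      have : b s = 0 := b.zero_of_le_dist (by simpa using hs.le)
      rw [this, mul_zero]) g
  let φ : Chart (baseAlg E H) Unit :=
    { u := u
      x := fun q _ => S.par g q
      O := {w | |w ()| < S.ε / 2}
      σ := fun w => orbitMk H (S.c (w ()) * g)
      isOpen := isOpen_lt (by fun_prop) continuous_const
      mem := fun q => Quotient.inductionOn q fun x hx => ((hu x).1 hx).2
      left := fun q => Quotient.inductionOn q fun x hx => by
        have h1 := ((hu x).1 hx).1.spec.2
        change orbitMk H (S.c (S.t (x * g⁻¹)) * g) = orbitMk H x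
        refine (orbitMk_eq.2 ?_).symm
        rwa [mul_inv_rev, ← mul_assoc]
      ne := fun w (hw : |w ()| < S.ε / 2) => (hu _).2 (by
        have h1 : |w ()| < S.ε := by linarith
        rw [mul_inv_cancel_right, S.t_c h1]
        exact ⟨S.dom_c h1, hw⟩)
      right := fun w (hw : |w ()| < S.ε / 2) => by
        funext i
        rw [S.par_mk, mul_inv_cancel_right, S.t_c (by linarith)]
      smooth_inv := fun f => by
        have h1 := S.c_smooth (rightPull E g (pull (isSmooth_orbitMk H) f))
        refine h1.comp (f := fun w : Unit → ℝ => w ()) (by fun_prop) fun w hw => ?_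
        exact abs_lt.1 (lt_trans hw (half_lt_self hε))
      smooth := fun q hq i => by
        refine ⟨f, ?_⟩
        filter_upwards [near_of_ne u hq] with q'
        refine Quotient.inductionOn q' fun x hx => ?_
        obtain ⟨h1, h2⟩ := (hu x).1 hx
        have h3 := hf x
        rw [if_pos h1] at h3
        have h4 : b (S.t (x * g⁻¹)) = 1 := b.one_of_mem_closedBall (by simpa using h2.le)
        rw [h4, mul_one] at h3
        exact h3.symm }
  refine ⟨φ, (hu g).2 ?_, fun x hx => ((hu x).1 hx).1, fun _ _ => rfl,
    fun w hw => lt_trans hw (half_lt_self hε), fun _ => rfl⟩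
  rw [mul_inv_cancel, ← S.c_zero, S.t_c (by simpa using hε)]
  exact ⟨S.dom_c (by simpa using hε), by simpa using hε⟩

/-- A coset with small parameter `s` also contains `c(s) g`, which is close to `g`. Thus a
neighbourhood of `g` already controls all cosets near `[g]`. -/
lemma near_base (S : Slice E H) (hH : IsClosed (H : Set G)) (g : G) {P : MulAction.orbitRel.Quotient H G → Prop} :
    (∀ᶠ q in Near (baseAlg E H) (orbitMk H g), P q) ↔ ∀ᶠ x in 𝓝 g, P (orbitMk H x) := by
  have : IsTopologicalGroup G := topologicalGroup_of_lieGroup 𝓘(ℝ, E) ∞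
  constructor
  · intro h
    rw [← near_smoothAlg (E := E)]
    exact ((isSmooth_orbitMk H).tendsto g).eventually h
  · intro h
    have hε := S.ε_pos
    have h1 : Tendsto (fun s => S.c s * g) (𝓝 0) (𝓝 g) := by
      have h2 : ContinuousAt (fun s => S.c s * g) 0 :=
        (S.c_cont 0 (by simpa using hε)).mul continuousAt_const
      rw [ContinuousAt, S.c_zero, one_mul] at h2
      exact h2
    obtain ⟨δ, h0, hδ⟩ := Metric.eventually_nhds_iff.1 (h1.eventually h)
    obtain ⟨u, hu⟩ := S.exists_bump hH (lt_min h0 (half_pos hε))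
      ((min_le_right _ _).trans_lt (half_lt_self hε)) g
    refine eventually_near.2 ⟨u, (hu g).2 ?_, fun q => Quotient.inductionOn q fun x hx => ?_⟩
    · rw [mul_inv_cancel, ← S.c_zero, S.t_c (by simpa using hε)]
      exact ⟨S.dom_c (by simpa using hε), by simpa using ⟨h0, hε⟩⟩
    · obtain ⟨h3, h4⟩ := (hu x).1 hx
      have h5 : P (orbitMk H (S.c (S.t (x * g⁻¹)) * g)) :=
        hδ (by simpa using h4.trans_le (min_le_left _ _))
      have h6 : orbitMk H x = orbitMk H (S.c (S.t (x * g⁻¹)) * g) := orbitMk_eq.2 (by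
        rw [mul_inv_rev, ← mul_assoc]
        exact h3.spec.2)
      change P (orbitMk H x)
      rwa [h6]

lemma near_ne_one (S : Slice E H) (hH : IsClosed (H : Set G)) {g : G} (hg : g ∉ H) :
    ∀ᶠ q in Near (baseAlg E H) (orbitMk H g), q ∉ baseCrit H := by
  rw [S.near_base hH]
  filter_upwards [hH.isOpen_compl.mem_nhds hg] with x hx h
  exact hx (orbitMk_eq_one.1 h)

/-- The germ at `g` of a chart of `G` whose first coordinate is the parameter of the coset. -/
def rawChart (hH : IsClosed (H : Set G)) (g : G) :
    RawChart (smoothAlg E G) (H : Set G) (Option (Fin S.m)) g :=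
  have : IsTopologicalGroup G := topologicalGroup_of_lieGroup 𝓘(ℝ, E) ∞
  have ht : Tendsto (fun x => x * g⁻¹) (𝓝 g) (𝓝 1) := by
    have h2 : ContinuousAt (fun x => x * g⁻¹) g := by fun_prop
    rw [ContinuousAt, mul_inv_cancel] at h2
    exact h2
  { x := fun q => S.chart.x (q * g⁻¹)
    O := S.chart.O
    σ := fun w => S.chart.σ w * g
    isOpen := S.chart.isOpen
    mem := by
      rw [mul_inv_cancel]
      exact S.chart.mem
    left := by
      have h1 := S.chart.left
      rw [near_smoothAlg] at h1 ⊢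
      filter_upwards [ht.eventually h1] with q hq
      rw [hq, inv_mul_cancel_right]
    right := fun y hy => by rw [mul_inv_cancel_right, S.chart.right y hy]
    smooth_inv := fun f => S.chart.smooth_inv (rightPull E g f)
    smooth := fun i => by
      obtain ⟨f, hf⟩ := S.chart.smooth i
      refine ⟨rightPull E g⁻¹ f, ?_⟩
      rw [near_smoothAlg] at hf ⊢
      exact ht.eventually hf
    i0 := none
    crit := by
      rw [near_smoothAlg]
      by_cases hg : g ∈ H
      · refine Or.inr ⟨hg, ?_⟩
        rcases S.chart.crit with h | ⟨-, h⟩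
        · exact absurd H.one_mem (near_self h :)
        · rw [near_smoothAlg, S.i0] at h
          filter_upwards [ht.eventually h] with q hq
          rw [← hq]
          exact (H.mul_mem_cancel_right (H.inv_mem hg)).symm
      · exact Or.inl (hH.isOpen_compl.mem_nhds hg) }

lemma rawChart_x (hH : IsClosed (H : Set G)) (g : G) :
    ∀ᶠ q in 𝓝 g, S.Dom (q * g⁻¹) ∧ (S.rawChart hH g).x q none = S.par g (orbitMk H q) := by
  have : IsTopologicalGroup G := topologicalGroup_of_lieGroup 𝓘(ℝ, E) ∞
  have ht : Tendsto (fun x => x * g⁻¹) (𝓝 g) (𝓝 1) := by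
    have h2 : ContinuousAt (fun x => x * g⁻¹) g := by fun_prop
    rw [ContinuousAt, mul_inv_cancel] at h2
    exact h2
  filter_upwards [ht.eventually S.coord] with q hq
  exact ⟨⟨_, hq⟩, (S.t_eq hq.1 hq.2).symm⟩

/-- Charts of `G` and of the quotient for which the projection is the first coordinate. -/
lemma exists_adapted (hH : IsClosed (H : Set G)) (g : G) :
    ∃ (φ : FChart (smoothAlg E G) (H : Set G) (Option (Fin S.m)))
      (ψ : FChart (baseAlg E H) (baseCrit H) Unit), φ.u g ≠ 0 ∧ ψ.u (orbitMk H g) ≠ 0 ∧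
      (g ∉ H → φ.e = 1) ∧ (orbitMk H g ∉ baseCrit H → ψ.e = 1) ∧
      (∀ᶠ q in 𝓝 g, φ.e q = ψ.e (orbitMk H q)) ∧
      (∀ᶠ q in 𝓝 g, ∀ f : Fn (baseAlg E H),
        (φ.W none).der (pull (isSmooth_orbitMk H) f) q = (ψ.W ()).der f (orbitMk H q)) ∧
      ∀ᶠ q in 𝓝 g, ∀ i, ∀ f : Fn (baseAlg E H),
        (φ.W (some i)).der (pull (isSmooth_orbitMk H) f) q = 0 := by
  have hB : IsComplete (baseAlg E H) := isComplete_quotAlg H isComplete_smoothAlg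
  obtain ⟨φ, h1, hφi, hφx, hφe⟩ := (S.rawChart hH g).exists_fchart isComplete_smoothAlg
  obtain ⟨κ, h2, hκd, hκx, hκO, hκσ⟩ := S.exists_baseChart hH g
  let ρ : RawChart (baseAlg E H) (baseCrit H) Unit (orbitMk H g) :=
    { x := κ.x
      O := κ.O
      σ := κ.σ
      isOpen := κ.isOpen
      mem := κ.mem _ h2
      left := by filter_upwards [near_of_ne κ.u h2] with q hq using κ.left q hq
      right := κ.right
      smooth_inv := κ.smooth_inv
      smooth := κ.smooth _ h2
      i0 := ()
      crit := by
        by_cases hg : g ∈ H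
        · refine Or.inr ⟨orbitMk_eq_one.2 hg, ?_⟩
          filter_upwards [near_of_ne κ.u h2] with q
          refine Quotient.inductionOn q fun x hx => ?_
          rw [hκx]
          change orbitMk H x = orbitMk H (1 : G) ↔ S.t (x * g⁻¹) = 0
          rw [S.t_eq_zero (hκd x hx), orbitMk_eq_one, H.mul_mem_cancel_right (H.inv_mem hg)]
        · exact Or.inl (S.near_ne_one hH hg) }
  obtain ⟨ψ, h3, hψi, hψx, hψe⟩ := ρ.exists_fchart hB
  have hmem : orbitMk H g ∈ baseCrit H ↔ g ∈ H := orbitMk_eq_one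
  have hφu : ∀ᶠ q in 𝓝 g, φ.u q ≠ 0 := by
    rw [← near_smoothAlg (E := E)]
    exact near_of_ne φ.u h1
  have hψu : ∀ᶠ q in 𝓝 g, ψ.u (orbitMk H q) ≠ 0 :=
     (S.near_base hH g).1 (near_of_ne ψ.u h3)
  have hx : ∀ᶠ q in 𝓝 g, φ.xf none q = ψ.xf () (orbitMk H q) := by
    filter_upwards [hφu, hψu, S.rawChart_x hH g] with q k1 k2 k3
    rw [hφx q k1, hψx _ k2, k3.2]
    exact (hκx _ _).symm
  have he : ∀ᶠ q in 𝓝 g, φ.e q = ψ.e (orbitMk H q) := by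
    by_cases hg : g ∈ H
    · have k1 : φ.e = φ.xf none := by
        rcases φ.crit with h | h
        · exact absurd hg (h.2 g h1)
        · rw [h.1, hφi]
          rfl
      have k2 : ψ.e = ψ.xf () := by
        rcases ψ.crit with h | h
        · exact absurd (hmem.2 hg) (h.2 _ h3)
        · rw [h.1]
      rw [k1, k2]
      exact hx
    · rw [hφe hg, hψe (fun h => hg (hmem.1 h))]
      exact Eventually.of_forall fun q => rfl
  have hx' : ∀ᶠ q in 𝓝 g, ∀ᶠ z in Near (smoothAlg E G) q,
      pull (isSmooth_orbitMk H) (ψ.xf ()) z = φ.xf none z := by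
    filter_upwards [eventually_eventually_nhds.2 hx] with q hq
    rw [near_smoothAlg]
    filter_upwards [hq] with z hz using hz.symm
  refine ⟨φ, ψ, h1, h3, hφe, hψe, he, ?_, ?_⟩
  -- Both sides are derivations along the projection, and the quotient has one coordinate, which
  -- pulls back to the first coordinate of `φ`.
  · filter_upwards [hφu, hψu, hx', he] with q k1 k2 k3 k4 f
    refine ψ.det hB k2 (isPtDer_derAlong (isSmooth_orbitMk H) (φ.W none).der q)
      (isPtDer_derAt (ψ.W ()).der _) (fun i => ?_) f
    rw [derAlong_apply, derAt_apply, ψ.W_apply' k2, if_pos rfl]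
    refine (near_self (der_near (φ.W none).der k3) :).trans ?_
    rw [φ.W_apply' k1, if_pos rfl, FChart.ec, FChart.ec, if_pos rfl]
    refine (congrArg (fun F : Fn (smoothAlg E G) => F q) (if_pos ?_)).trans k4
    rw [hφi]
    rfl
  · filter_upwards [hφu, hψu, hx'] with q k1 k2 k3 i f
    refine ψ.det hB k2 (isPtDer_derAlong (isSmooth_orbitMk H) (φ.W (some i)).der q)
      (δ' := 0) (fun f g => by simp) (fun j => ?_) f
    rw [derAlong_apply]
    refine (near_self (der_near (φ.W (some i)).der k3) :).trans ?_
    rw [φ.W_apply' k1, if_neg (by simp)]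
    rfl

lemma isBMfd (hH : IsClosed (H : Set G)) :
    IsBMfd (smoothAlg E G) (H : Set G) (Option (Fin S.m)) where
  complete := isComplete_smoothAlg
  chart g := by
    obtain ⟨φ, ψ, h1, -, h2, -⟩ := S.exists_adapted hH g
    exact ⟨φ, h1, h2⟩

lemma isBMfd_base (S : Slice E H) (hH : IsClosed (H : Set G)) :
    IsBMfd (baseAlg E H) (baseCrit H) Unit where
  complete := isComplete_quotAlg H isComplete_smoothAlg
  chart q := Quotient.inductionOn q fun g => by
    obtain ⟨φ, ψ, -, h1, -, h2, -⟩ := S.exists_adapted hH g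
    exact ⟨ψ, h1, h2⟩

/-- In adapted charts the generator of the critical ideal of the quotient pulls back to that of `G`.
-/
lemma isBMap_orbitMk (S : Slice E H) (hH : IsClosed (H : Set G)) :
    IsBMap (smoothAlg E G) (H : Set G) (baseAlg E H) (baseCrit H)
    (orbitMk H) := by
  refine isBMap_of_exists (isComplete_quotAlg H isComplete_smoothAlg) (isSmooth_orbitMk H)
    (fun x hx => orbitMk_eq_one.2 hx) fun g => ?_
  obtain ⟨φ, ψ, h1, h2, -, -, h3, -⟩ := S.exists_adapted hH g
  refine ⟨ψ.e, ψ.isGen (isComplete_quotAlg H isComplete_smoothAlg) h2,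
    (φ.isGen isComplete_smoothAlg h1).congr ?_⟩
  rw [near_smoothAlg]
  filter_upwards [h3] with q hq using hq.symm

-- The section is `c(s) g` on the chart. Elsewhere an arbitrary representative is taken, so that the
-- section identity holds everywhere and smoothness is claimed only where `u ≠ 0`.
open Classical in
lemma exists_section (S : Slice E H) (hH : IsClosed (H : Set G)) (g : G) :
    ∃ (u : Fn (baseAlg E H)) (s : MulAction.orbitRel.Quotient H G → G),
    u (orbitMk H g) ≠ 0 ∧ (∀ q, orbitMk H (s q) = q) ∧
      ∀ q, u q ≠ 0 → ∀ f : Fn (smoothAlg E G), SmAt (baseAlg E H) (fun q => f (s q)) q := by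
  obtain ⟨κ, h2, hκd, hκx, hκO, hκσ⟩ := S.exists_baseChart hH g
  let s : MulAction.orbitRel.Quotient H G → G := fun q =>
    if orbitMk H (S.c (κ.x q ()) * g) = q then S.c (κ.x q ()) * g else q.out
  refine ⟨κ.u, s, h2, fun q => ?_, fun q hq f => ?_⟩
  · by_cases h : orbitMk H (S.c (κ.x q ()) * g) = q
    · rw [show s q = S.c (κ.x q ()) * g from if_pos h, h]
    · rw [show s q = q.out from if_neg h]
      exact Quotient.out_eq q
  · have h3 : SmAt (baseAlg E H) (fun q => f (S.c (κ.x q ()) * g)) q := by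
      refine κ.smAt_comp (isComplete_quotAlg H isComplete_smoothAlg) hq
        (Φ := fun w => f (S.c (w ()) * g)) ?_
      exact (S.c_smooth (rightPull E g f)).comp (f := fun w : Unit → ℝ => w ()) (by fun_prop)
        fun w hw => abs_lt.1 (hκO w hw)
    refine h3.congr ?_
    filter_upwards [near_of_ne κ.u hq] with q' hq'
    have h4 : orbitMk H (S.c (κ.x q' ()) * g) = q' := by rw [← hκσ, κ.left q' hq']
    rw [show s q' = S.c (κ.x q' ()) * g from if_pos h4]

lemma base_separated (S : Slice E H) (hH : IsClosed (H : Set G)) {p q : MulAction.orbitRel.Quotient H G} (hpq : p ≠ q) :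
    ∃ f : Fn (baseAlg E H), f p ≠ f q := by
  have : IsTopologicalGroup G := topologicalGroup_of_lieGroup 𝓘(ℝ, E) ∞
  induction p using Quotient.inductionOn with | h a => ?_
  induction q using Quotient.inductionOn with | h b => ?_
  have h1 : ∀ᶠ p in Near (baseAlg E H) (orbitMk H a), p ≠ orbitMk H b := by
    rw [S.near_base hH]
    have h2 : IsOpen {x : G | x * b⁻¹ ∉ H} := hH.isOpen_compl.preimage (by fun_prop)
    filter_upwards [h2.mem_nhds fun h => hpq (orbitMk_eq.2 h)] with x hx h
    exact hx (orbitMk_eq.1 h)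
  obtain ⟨u, hu, h⟩ := eventually_near.1 h1
  refine ⟨u, fun h2 => h (orbitMk H b) ?_ rfl⟩
  exact fun h3 => hu (h2.trans h3)

/-- The open sets are pulled back to `G`, whose second countability provides a countable subcover.
-/
lemma exists_countable_cover (S : Slice E H) (hH : IsClosed (H : Set G))
    [SecondCountableTopology G] {v : G → Fn (baseAlg E H)} (hv : ∀ g, v g (orbitMk H g) ≠ 0) :
    ∃ K : Set G, K.Countable ∧ ∀ q, ∃ k ∈ K, v k q ≠ 0 := by
  obtain ⟨K, hK, hU⟩ := TopologicalSpace.countable_cover_nhds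
    (f := fun g => {x : G | v g (orbitMk H x) ≠ 0}) (fun g =>
      (S.near_base hH g).1 (near_of_ne (v g) (hv g)))
  refine ⟨K, hK, fun q => Quotient.inductionOn q fun x => ?_⟩
  have h2 : x ∈ ⋃ g ∈ K, {x : G | v g (orbitMk H x) ≠ 0} := hU ▸ Set.mem_univ x
  simp only [Set.mem_iUnion, exists_prop] at h2
  exact h2

end Slice

end Base

/-! ### Principal connections -/

section Connection

variable {E : Type u} [NormedAddCommGroup E] [NormedSpace ℝ E]
  {G : Type v} [TopologicalSpace G] [ChartedSpace E G] [Group G] {H : Subgroup G}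
  [LieGroup 𝓘(ℝ, E) ∞ G]

lemma isPtDer_dOne (X : GroupLieAlgebra 𝓘(ℝ, E) G) : ∃ δ : Fn (smoothAlg E G) →ₗ[ℝ] ℝ,
    IsPtDer (smoothAlg E G) 1 δ ∧ ∀ f, δ f = dOne E f X :=
  ⟨{ toFun := fun f => dOne E f X
     map_add' := fun f g => dOne_add f g X
     map_smul' := fun c f => dOne_smul c f X }, fun f g => dOne_mul f g X, fun _ => rfl⟩

variable [FiniteDimensional ℝ E] [T2Space G]

/-- Every linear functional on the model space is, after a cut-off in the chart at `1`, the
differential of a global smooth function. -/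
lemma dOne_ext {X Y : GroupLieAlgebra 𝓘(ℝ, E) G}
    (h : ∀ f : Fn (smoothAlg E G), dOne E f X = dOne E f Y) : X = Y := by
  have key : ∀ Z : GroupLieAlgebra 𝓘(ℝ, E) G,
      (∀ f : Fn (smoothAlg E G), dOne E f Z = 0) → Z = 0 := by
    intro Z hZ
    have h1 : ∀ ℓ : E →L[ℝ] ℝ, ℓ Z = 0 := fun ℓ => by
      let φ := extChartAt 𝓘(ℝ, E) (1 : G)
      have hs : ∀ x ∈ φ.source, ContMDiffAt 𝓘(ℝ, E) 𝓘(ℝ, ℝ) ∞ (fun x => ℓ (φ x)) x := by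
        intro x hx
        refine ContMDiffAt.comp (g := ℓ) x ℓ.contDiff.contMDiff.contMDiffAt
          (contMDiffAt_extChartAt' ?_)
        rwa [← extChartAt_source 𝓘(ℝ, E)]
      have h1 : (1 : G) ∈ φ.source := mem_extChartAt_source (I := 𝓘(ℝ, E)) (1 : G)
      obtain ⟨F, hF⟩ := smAt_of_contMDiffAt (E := E) (f := fun x => ℓ (φ x)) (p := (1 : G)) (by
        filter_upwards [(isOpen_extChartAt_source (I := 𝓘(ℝ, E)) (1 : G)).mem_nhds h1] with x hx
          using hs x hx)
      rw [near_smoothAlg] at hF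
      have h2 := (mfderiv_eq_fderiv ((hs 1 h1).mdifferentiableAt (by simp)))
      have h3 : fderiv ℝ (fun v => ℓ (φ (φ.symm v))) (φ 1) = ℓ := by
        have h4 : (fun v => ℓ (φ (φ.symm v))) =ᶠ[𝓝 (φ 1)] ℓ := by
          filter_upwards [(isOpen_extChartAt_target (I := 𝓘(ℝ, E)) (1 : G)).mem_nhds
            (mem_extChartAt_target (1 : G))] with v hv
          rw [φ.right_inv hv]
        rw [h4.fderiv_eq]
        exact ℓ.fderiv
      have h5 : (mfderiv 𝓘(ℝ, E) 𝓘(ℝ, ℝ) F 1 : E →L[ℝ] ℝ) = ℓ :=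
        (EventuallyEq.mfderiv_eq hF).symm.trans (h2.trans h3)
      exact (congrArg (fun T : E →L[ℝ] ℝ => T Z) h5).symm.trans (hZ F)
    exact (SeparatingDual.eq_zero_of_forall_dual_eq_zero (R := ℝ) (V := E) h1 :)
  refine sub_eq_zero.1 (key _ fun f => ?_)
  rw [map_sub, h, sub_self]

/-- Coordinates at `1` and the dual basis of the Lie algebra; `𝔥` is the kernel of the
differential of the coordinate transverse to `H`. -/
lemma Slice.exists_coframe (S : Slice E H) (hH : IsClosed (H : Set G)) :
    ∃ (ξ : Option (Fin S.m) → Fn (smoothAlg E G))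
      (Z : Option (Fin S.m) → GroupLieAlgebra 𝓘(ℝ, E) G),
      (∀ i j, dOne E (ξ j) (Z i) = if i = j then 1 else 0) ∧
      (∀ δ, IsPtDer (smoothAlg E G) 1 δ → ∀ f, δ f = ∑ i, δ (ξ i) * dOne E f (Z i)) ∧
      ∀ X, X ∈ lieSub E H ↔ dOne E (ξ none) X = 0 := by
  obtain ⟨φ, h1, hi, -⟩ := (S.rawChart hH (1 : G)).exists_fchart isComplete_smoothAlg
  have hC : IsComplete (smoothAlg E G) := isComplete_smoothAlg
  let T : GroupLieAlgebra 𝓘(ℝ, E) G →ₗ[ℝ] (Option (Fin S.m) → ℝ) :=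
    LinearMap.pi fun i => dOne E (φ.xf i)
  have hT : Function.Injective T := by
    intro X Y hXY
    obtain ⟨δ, hδ, hδX⟩ := isPtDer_dOne (E := E) (G := G) X
    obtain ⟨δ', hδ', hδY⟩ := isPtDer_dOne (E := E) (G := G) Y
    refine dOne_ext fun f => ?_
    rw [← hδX, ← hδY]
    refine φ.det hC h1 hδ hδ' (fun i => ?_) f
    rw [hδX, hδY]
    exact congrFun hXY i
  have hfin : FiniteDimensional ℝ (GroupLieAlgebra 𝓘(ℝ, E) G) :=
    inferInstanceAs (FiniteDimensional ℝ E)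
  have hd : Module.finrank ℝ (GroupLieAlgebra 𝓘(ℝ, E) G)
      = Module.finrank ℝ (Option (Fin S.m) → ℝ) := by
    rw [Module.finrank_fintype_fun_eq_card, Fintype.card_option, Fintype.card_fin, S.dim]
    rfl
  -- An injective map between spaces of the same dimension; preimages of the standard vectors form
  -- the dual basis.
  have hs : Function.Surjective T := (LinearMap.injective_iff_surjective_of_finrank_eq_finrank
    hd).1 hT
  choose Z hZ using fun i => hs (Pi.single i 1)
  have hZ' : ∀ i j, dOne E (φ.xf j) (Z i) = if i = j then 1 else 0 := fun i j => by
    have := congrFun (hZ i) j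
    rw [Pi.single_apply] at this
    simp only [eq_comm (a := i)]
    exact this
  have hδ : ∀ δ, IsPtDer (smoothAlg E G) 1 δ → ∀ f, δ f = ∑ i, δ (φ.xf i) * dOne E f (Z i) := by
    intro δ hδ f
    obtain ⟨δ', hδ', h'⟩ := isPtDer_dOne (E := E) (G := G) (∑ i, δ (φ.xf i) • Z i)
    rw [φ.det hC h1 hδ hδ' (fun j => ?_) f, h', map_sum]
    · simp only [map_smul, smul_eq_mul]
    · rw [h', map_sum]
      simp [hZ']
  have hi' : φ.i0 = none := hi
  refine ⟨φ.xf, Z, hZ', hδ, fun X => ⟨fun hX => ?_, fun hX f hf => ?_⟩⟩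
  · rcases φ.crit with h | h
    · exact absurd H.one_mem (h.2 1 h1)
    · refine hX (φ.xf none) fun z hz => ?_
      have h2 := h.2.1 z hz
      rw [h.1, hi'] at h2
      exact h2
  -- Near `1` a function vanishing on `H` is a multiple of the transverse coordinate, so its
  -- differential at `1` is a multiple of the differential of that coordinate.
  · have h2 : φ.e = φ.xf none := by
      rcases φ.crit with h | h
      · exact absurd H.one_mem (h.2 1 h1)
      · rw [h.1, hi']
    obtain ⟨F, hF⟩ := (φ.isGen hC h1).div f hf
    obtain ⟨δ, hδ, h'⟩ := isPtDer_dOne (E := E) (G := G) X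
    change dOne E f X = 0
    rw [← h', hδ.local (g := φ.xf none * F) (by
      filter_upwards [hF] with z hz
      rw [hz, h2]
      rfl), h', dOne_mul, hX, mul_zero, add_zero, ← h2]
    have h3 : φ.e 1 = 0 := by
      rcases φ.crit with h | h
      · exact absurd H.one_mem (h.2 1 h1)
      · exact h.2.1 1 H.one_mem
    rw [h3, zero_mul]

lemma Slice.finrank_lieSub (S : Slice E H) (hH : IsClosed (H : Set G)) :
    Module.finrank ℝ (lieSub E H) = S.m := by
  obtain ⟨ξ, Z, h1, -, h2⟩ := S.exists_coframe hH
  have hfin : FiniteDimensional ℝ (GroupLieAlgebra 𝓘(ℝ, E) G) :=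
    inferInstanceAs (FiniteDimensional ℝ E)
  have h3 : lieSub E H = LinearMap.ker (dOne E (ξ none)) := by
    ext X
    exact h2 X
  have h4 : LinearMap.range (dOne E (ξ none)) = ⊤ := LinearMap.range_eq_top.2 fun r =>
    ⟨r • Z none, by rw [map_smul, h1, if_pos rfl, smul_eq_mul, mul_one]⟩
  have h5 := LinearMap.finrank_range_add_finrank_ker (dOne E (ξ none))
  have h6 : Module.finrank ℝ (GroupLieAlgebra 𝓘(ℝ, E) G) = S.m + 1 := S.dim.symm
  rw [h4, finrank_top, Module.finrank_self, ← h3, h6] at h5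
  omega

lemma IsPtDer.exists_dOne (S : Slice E H) (hH : IsClosed (H : Set G))
    {δ : Fn (smoothAlg E G) →ₗ[ℝ] ℝ} (hδ : IsPtDer (smoothAlg E G) 1 δ) :
    ∃ X : GroupLieAlgebra 𝓘(ℝ, E) G, ∀ f, dOne E f X = δ f := by
  obtain ⟨ξ, Z, -, h1, -⟩ := S.exists_coframe hH
  refine ⟨∑ i, δ (ξ i) • Z i, fun f => ?_⟩
  rw [h1 δ hδ f, map_sum]
  simp only [map_smul, smul_eq_mul]

lemma mem_smoothAlg_of_dOne (S : Slice E H) (hH : IsClosed (H : Set G))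
    {w : G → GroupLieAlgebra 𝓘(ℝ, E) G}
    (hw : ∀ f : Fn (smoothAlg E G), (fun g => dOne E f (w g)) ∈ smoothAlg E G)
    (ν : GroupLieAlgebra 𝓘(ℝ, E) G →ₗ[ℝ] ℝ) : (fun g => ν (w g)) ∈ smoothAlg E G := by
  obtain ⟨ξ, Z, -, h1, -⟩ := S.exists_coframe hH
  have h2 : (fun g => ν (w g)) = fun g => ∑ i, dOne E (ξ i) (w g) * ν (Z i) := by
    funext g
    obtain ⟨δ, hδ, h'⟩ := isPtDer_dOne (E := E) (G := G) (w g)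
    have h3 : w g = ∑ i, δ (ξ i) • Z i := dOne_ext fun f => by
      rw [← h', h1 δ hδ f, map_sum]
      simp only [map_smul, smul_eq_mul]
    have h4 := congrArg ν h3
    rw [map_sum] at h4
    simpa only [map_smul, smul_eq_mul, h'] using h4
  rw [h2]
  refine isComplete_smoothAlg.mem_of_smAt fun g => SmAt.sum fun i _ => ?_
  exact (smAt_of_mem (hw _) g).mul (smAt_const _ g)

/-- The number `df(Ad_g X)` is the derivative along `X` at `x = 1` of `f (g x g⁻¹)`, so
`smAt_partial` applies with `g` as parameter. -/
lemma adG_smooth (S : Slice E H) (hH : IsClosed (H : Set G)) (X : GroupLieAlgebra 𝓘(ℝ, E) G)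
    (ν : GroupLieAlgebra 𝓘(ℝ, E) G →ₗ[ℝ] ℝ) : (fun g => ν (adG E g X)) ∈ smoothAlg E G := by
  refine mem_smoothAlg_of_dOne S hH (fun f => ?_) ν
  refine isComplete_smoothAlg.mem_of_smAt fun g => ?_
  obtain ⟨δ, hδ, h'⟩ := isPtDer_dOne (E := E) (G := G) X
  have hK : ContMDiff (𝓘(ℝ, E).prod 𝓘(ℝ, E)) 𝓘(ℝ, ℝ) ∞
      (fun p : G × G => f (p.2 * p.1 * p.2⁻¹)) :=
    ContMDiff.comp (n := ∞) (g := f) f.mem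
      ((contMDiff_snd.mul contMDiff_fst).mul contMDiff_snd.inv)
  have h1 := smAt_partial (isComplete_smoothAlg (E := E) (M := G)) (φ := fun _ => (1 : G))
    (ψ := fun x => x) (p := g) (fun f => smAt_const _ _) (fun f => f.smAt g) hK
    (δ := fun _ => δ) (fun _ => hδ) (fun f => smAt_const _ _) (k := fun g => conjPull E g f)
    (fun x y => rfl)
  refine h1.congr (Eventually.of_forall fun x => ?_)
  rw [dOne_adG, h']

/-- The right-invariant Maurer-Cartan form, on a vector field. -/
lemma exists_maurer (S : Slice E H) (hH : IsClosed (H : Set G)) :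
    ∃ mc : BDerG E H → G → GroupLieAlgebra 𝓘(ℝ, E) G,
      ∀ D g f, dOne E f (mc D g) = D.der (rightPull E g⁻¹ f) g := by
  have h : ∀ (D : BDerG E H) (g : G), ∃ X : GroupLieAlgebra 𝓘(ℝ, E) G,
      ∀ f, dOne E f X = D.der (rightPull E g⁻¹ f) g := fun D g => by
    refine IsPtDer.exists_dOne S hH (δ :=
      { toFun := fun f => D.der (rightPull E g⁻¹ f) g
        map_add' := fun a b => by rw [map_add, map_add]; rfl
        map_smul' := fun c a => by rw [map_smul, Derivation.map_smul]; rfl }) fun a b => ?_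
    change D.der (rightPull E g⁻¹ (a * b)) g = _
    rw [map_mul, Derivation.leibniz]
    change a (g * g⁻¹) * _ + b (g * g⁻¹) * _ = _
    rw [mul_inv_cancel]
    rfl
  choose mc hmc using h
  exact ⟨mc, hmc⟩

/-- The partial derivative along `D` of `f (x y⁻¹)` in its first variable, taken on the diagonal. -/
lemma maurer_smooth (S : Slice E H) (hH : IsClosed (H : Set G)) (D : BDerG E H)
    {w : G → GroupLieAlgebra 𝓘(ℝ, E) G} (hw : ∀ g f, dOne E f (w g) = D.der (rightPull E g⁻¹ f) g)
    (ν : GroupLieAlgebra 𝓘(ℝ, E) G →ₗ[ℝ] ℝ) : (fun g => ν (w g)) ∈ smoothAlg E G := by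
  refine mem_smoothAlg_of_dOne S hH (fun f => ?_) ν
  refine isComplete_smoothAlg.mem_of_smAt fun g => ?_
  have hK : ContMDiff (𝓘(ℝ, E).prod 𝓘(ℝ, E)) 𝓘(ℝ, ℝ) ∞
      (fun p : G × G => f (p.1 * p.2⁻¹)) :=
    ContMDiff.comp (n := ∞) (g := f) f.mem (contMDiff_fst.mul contMDiff_snd.inv)
  have h1 := smAt_partial (isComplete_smoothAlg (E := E) (M := G)) (φ := fun x => x)
    (ψ := fun x => x) (p := g) (fun f => f.smAt g) (fun f => f.smAt g) hK
    (δ := fun g => derAt D.der g) (fun g => isPtDer_derAt _ g) (fun f => (D.der f).smAt g)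
    (k := fun g => rightPull E g⁻¹ f) (fun x y => rfl)
  exact h1.congr (Eventually.of_forall fun x => hw x f)

/-- The right-invariant Maurer-Cartan form sends `ζ^X` to `X` but takes values in the whole Lie
algebra. It is projected to `𝔥 = ker χ` along a smooth vector `w g` transverse to `𝔥`, whose line
satisfies `w (h g) ∈ ℝ Ad_h (w g)`; this makes the projection equivariant without any averaging over
`H`. -/
theorem exists_bConnection (S : Slice E H) (hH : IsClosed (H : Set G)) :
    Nonempty (BConnection E H) := by
  obtain ⟨mc, hmc⟩ := exists_maurer S hH
  obtain ⟨ξ, Z, hZ, hδ, hχ⟩ := S.exists_coframe hH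
  let χ := dOne E (ξ none)
  -- The vector is the sum of `χ(v) v` over the transported basis `v = Ad_g Z_j`, so that `χ(w g)`
  -- is a sum of squares.
  let w : G → GroupLieAlgebra 𝓘(ℝ, E) G := fun g => ∑ j, χ (adG E g (Z j)) • adG E g (Z j)
  have hspan : ∀ X : GroupLieAlgebra 𝓘(ℝ, E) G, X = ∑ i, dOne E (ξ i) X • Z i := fun X => by
    obtain ⟨δ, hδ', h'⟩ := isPtDer_dOne (E := E) (G := G) X
    refine dOne_ext fun f => ?_
    rw [← h', hδ δ hδ' f, map_sum]
    simp only [map_smul, smul_eq_mul, h']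
  have hχw : ∀ g, χ (w g) = ∑ j, χ (adG E g (Z j)) ^ 2 := fun g => by
    simp only [w, map_sum, map_smul, smul_eq_mul, pow_two]
  -- Otherwise `χ ∘ Ad_g` would vanish on a basis, although `Ad_g` is surjective and `χ ≠ 0`.
  have hpos : ∀ g, χ (w g) ≠ 0 := fun g h0 => by
    rw [hχw, Finset.sum_eq_zero_iff_of_nonneg fun i _ => sq_nonneg _] at h0
    have h1 : ∀ X, χ (adG E g X) = 0 := fun X => by
      rw [hspan X, map_sum, map_sum]
      refine Finset.sum_eq_zero fun i hi => ?_
      rw [map_smul, map_smul, pow_eq_zero_iff two_ne_zero |>.1 (h0 i hi), smul_zero]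
    have h2 := h1 (adG E g⁻¹ (Z none))
    rw [← adG_mul, mul_inv_cancel, adG_one] at h2
    have h3 := hZ none none
    rw [if_pos rfl] at h3
    exact one_ne_zero (h3.symm.trans h2)
  -- For `h ∈ H`, `Ad_h` preserves the kernel of `χ`, so `χ ∘ Ad_h` is a multiple of `χ`.
  have hAd : ∀ (h : H) X, χ (adG E h.1 X) = χ (adG E h.1 (Z none)) * χ X := fun h X => by
    have h1 : X - χ X • Z none ∈ lieSub E H := (hχ _).2 (by
      rw [map_sub, map_smul, hZ, if_pos rfl, smul_eq_mul, mul_one, sub_self])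
    have h2 := (hχ _).1 (adH H h ⟨_, h1⟩).2
    change χ (adG E h.1 (X - χ X • Z none)) = 0 at h2
    rw [map_sub, map_sub, map_smul, map_smul, smul_eq_mul, sub_eq_zero] at h2
    rw [h2, mul_comm]
  have hwh : ∀ (h : H) g, w (h * g) = χ (adG E h.1 (Z none)) • adG E h.1 (w g) := fun h g => by
    simp only [w, map_sum, map_smul, Finset.smul_sum, adG_mul]
    refine Finset.sum_congr rfl fun i _ => ?_
    rw [hAd h (adG E g (Z i)), smul_smul]
  have hmch : ∀ (h : H) D g, mc (leftPush H h D) (h * g) = adG E h.1 (mc D g) := fun h D g => by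
    refine dOne_ext fun f => ?_
    rw [hmc, dOne_adG, hmc]
    change D.der (leftPull E (h : G) (rightPull E (h * g)⁻¹ f)) ((h : G)⁻¹ * (h * g)) = _
    rw [inv_mul_cancel_left]
    refine congrArg (fun F : Fn (smoothAlg E G) => D.der F g) (Fn.ext fun x => ?_)
    exact congrArg (f : G → ℝ) (by simp [mul_assoc])
  have hmcζ : ∀ X g, mc (zeta H X) g = X.1 := fun X g => by
    refine dOne_ext fun f => ?_
    rw [hmc, zeta_apply]
    refine congrArg (fun F => dOne E F X.1) (Fn.ext fun x => ?_)
    exact congrArg (f : G → ℝ) (by simp)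
  have hws : ∀ ν : GroupLieAlgebra 𝓘(ℝ, E) G →ₗ[ℝ] ℝ, (fun g => ν (w g)) ∈ smoothAlg E G := by
    intro ν
    refine isComplete_smoothAlg.mem_of_smAt fun g => ?_
    have h1 : SmAt (smoothAlg E G) (fun g => ∑ j, χ (adG E g (Z j)) * ν (adG E g (Z j))) g :=
      SmAt.sum fun j _ =>
        (smAt_of_mem (adG_smooth S hH (Z j) χ) g).mul (smAt_of_mem (adG_smooth S hH (Z j) ν) g)
    refine h1.congr (Eventually.of_forall fun x => ?_)
    simp only [w, map_sum, map_smul, smul_eq_mul]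
  have hmcadd : ∀ D D' g, mc (D + D') g = mc D g + mc D' g := fun D D' g => dOne_ext fun f => by
    rw [map_add, hmc, hmc, hmc]
    rfl
  have hmcsmul : ∀ (f : Fn (smoothAlg E G)) D g, mc (f • D) g = f g • mc D g :=
    fun f D g => dOne_ext fun k => by
      rw [map_smul, hmc, hmc]
      rfl
  let v : BDerG E H → G → lieSub E H := fun D g =>
    ⟨mc D g - (χ (mc D g) / χ (w g)) • w g, (hχ _).2 (by
      rw [map_sub, map_smul, smul_eq_mul, div_mul_cancel₀ _ (hpos g), sub_self])⟩
  refine ⟨⟨v, fun D μ => ?_, fun D D' g => Subtype.ext ?_, fun f D g => Subtype.ext ?_,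
    fun X g => Subtype.ext ?_, fun h D g => Subtype.ext ?_⟩⟩
  · obtain ⟨ν, hν⟩ := LinearMap.exists_extend μ
    refine isComplete_smoothAlg.mem_of_smAt fun g => ?_
    have h1 := (smAt_of_mem (maurer_smooth S hH D (hmc D) ν) g).add
      (((smAt_const (-1) g).mul (smAt_of_mem (maurer_smooth S hH D (hmc D) χ) g)).mul
        (((smAt_of_mem (hws χ) g).inv isComplete_smoothAlg (hpos g)).mul
          (smAt_of_mem (hws ν) g)))
    refine h1.congr (Eventually.of_forall fun x => ?_)
    have h2 : μ (v D x) = ν (mc D x - (χ (mc D x) / χ (w x)) • w x) :=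
      (congrArg (fun T => T (v D x)) hν).symm
    rw [h2, map_sub, map_smul, smul_eq_mul]
    ring
  · change _ = (mc D g - (χ (mc D g) / χ (w g)) • w g) + (mc D' g - (χ (mc D' g) / χ (w g)) • w g)
    change mc (D + D') g - (χ (mc (D + D') g) / χ (w g)) • w g = _
    rw [hmcadd, map_add, add_div, add_smul]
    abel
  · change mc (f • D) g - (χ (mc (f • D) g) / χ (w g)) • w g =
      f g • (mc D g - (χ (mc D g) / χ (w g)) • w g)
    rw [hmcsmul, map_smul, smul_sub, smul_smul, smul_eq_mul, mul_div_assoc]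
  · change mc (zeta H X) g - (χ (mc (zeta H X) g) / χ (w g)) • w g = X.1
    rw [hmcζ, show χ X.1 = 0 from (hχ _).1 X.2, zero_div, zero_smul, sub_zero]
  · change mc (leftPush H h D) (h * g) - (χ (mc (leftPush H h D) (h * g)) / χ (w (h * g))) •
      w (h * g) = adG E h.1 (mc D g - (χ (mc D g) / χ (w g)) • w g)
    have h1 := hpos (h * g)
    rw [hmch, hwh, map_sub, map_smul, map_smul, smul_eq_mul, hAd h (mc D g), hAd h (w g), smul_smul]
    rw [hwh, map_smul, smul_eq_mul, hAd h (w g)] at h1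
    congr 2
    have h2 := left_ne_zero_of_mul h1
    have h3 := hpos g
    field_simp

end Connection

/-! ### The annihilator of the vertical bundle -/

/-! ### Smooth maps to subsets and products -/

section SmoothMaps

variable {X : Type u} {Y : Type v} {Z : Type w} {C : FunAlg X} {D : FunAlg Y} {F : FunAlg Z}

lemma isSmooth_val (S : Set Y) : IsSmooth (restrAlg D S) D Subtype.val := fun f hf =>
  subset_generated _ ⟨f, hf, rfl⟩

lemma isSmooth_restr (hC : IsComplete C) {S : Set Y} {φ : X → S}
    (h : IsSmooth C D (fun x => (φ x : Y))) : IsSmooth C (restrAlg D S) φ :=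
  isSmooth_generated hC (by
    rintro _ ⟨f, hf, rfl⟩
    exact h f hf)

lemma isSmooth_fst : IsSmooth (prodAlg D F) D Prod.fst := fun f hf =>
  subset_generated _ (Or.inl ⟨f, hf, rfl⟩)

lemma isSmooth_snd : IsSmooth (prodAlg D F) F Prod.snd := fun f hf =>
  subset_generated _ (Or.inr ⟨f, hf, rfl⟩)

lemma isSmooth_prod (hC : IsComplete C) {φ : X → Y × Z} (h1 : IsSmooth C D (fun x => (φ x).1))
    (h2 : IsSmooth C F (fun x => (φ x).2)) : IsSmooth C (prodAlg D F) φ :=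
  isSmooth_generated hC (by
    rintro _ (⟨f, hf, rfl⟩ | ⟨f, hf, rfl⟩)
    · exact h1 f hf
    · exact h2 f hf)

end SmoothMaps

section Annihilator

variable {E : Type u} [NormedAddCommGroup E] [NormedSpace ℝ E]
  {G : Type v} [TopologicalSpace G] [ChartedSpace E G] [Group G] {H : Subgroup G}
  [LieGroup 𝓘(ℝ, E) ∞ G]

/-- Right-translated by `g`, the function is constant on `H`; minus that constant it vanishes on
`H`, and `X` kills it by the definition of `lieSub`. -/
lemma zeta_pull_orbitMk (X : lieSub E H) (f : Fn (baseAlg E H)) :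
    (zeta H X).der (pull (isSmooth_orbitMk H) f) = 0 := by
  refine Fn.ext fun g => ?_
  have h1 := X.2 (rightPull E g (pull (isSmooth_orbitMk H) f)
    - algebraMap ℝ _ (f (orbitMk H g))) (fun h hh => by
      change f (orbitMk H (h * g)) - f (orbitMk H g) = 0
      rw [sub_eq_zero]
      exact congrArg f (orbitMk_smul (⟨h, hh⟩ : H) g))
  change dOne E _ X.1 = 0 at h1
  obtain ⟨δ, hδ, h'⟩ := isPtDer_dOne (E := E) (G := G) X.1
  rw [← h', map_sub, hδ.const, sub_zero, h'] at h1
  exact h1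

variable [FiniteDimensional ℝ E] [T2Space G]

lemma bPush_zeta (g : G) (X : lieSub E H) :
    BPush (orbitMk H) g (zeta H X) (0 : BDer (baseAlg E H) (baseCrit H)) :=
  BPush.of_near (hφ := isSmooth_orbitMk H) (Eventually.of_forall fun z f =>
    congrArg (fun F : Fn (smoothAlg E G) => F z) (zeta_pull_orbitMk X f))

/-- The fundamental fields annihilate functions from the base, so they have no component along `W
none`. At `g` they form a space of dimension `dim 𝔥 = m` and therefore attain every `W (some i)`, on
which an element of `𝓗°` must vanish. -/
lemma ann_frame (S : Slice E H) (hH : IsClosed (H : Set G)) (α : Ann E H) 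
    {φ : FChart (smoothAlg E G) (H : Set G) (Option (Fin S.m))}
    {ψ : FChart (baseAlg E H) (baseCrit H) Unit} (hφ : φ.u α.1.pt ≠ 0)
    (hψ : ψ.u (orbitMk H α.1.pt) ≠ 0)
    (hn : ∀ᶠ q in 𝓝 α.1.pt, ∀ f : Fn (baseAlg E H),
      (φ.W none).der (pull (isSmooth_orbitMk H) f) q = (ψ.W ()).der f (orbitMk H q))
    (hs : ∀ᶠ q in 𝓝 α.1.pt, ∀ i, ∀ f : Fn (baseAlg E H),
      (φ.W (some i)).der (pull (isSmooth_orbitMk H) f) q = 0) (i : Fin S.m) :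
    α.1.form (φ.W (some i)) = 0 := by
  have hC : IsComplete (smoothAlg E G) := isComplete_smoothAlg
  have hB : IsComplete (baseAlg E H) := isComplete_quotAlg H isComplete_smoothAlg
  set g := α.1.pt with hg
  rw [← near_smoothAlg (E := E)] at hn hs
  have hπ := S.isBMap_orbitMk hH
  -- the coefficients of the fundamental vector fields
  choose a ha hac using fun X : lieSub E H => φ.coef_near hC hφ (zeta H X)
  have ha' : ∀ X i, φ.coef hC (zeta H X) g i = a X i g := fun X i => φ.coef_eq hC hφ (ha X) i
  -- Applied to the coordinate of the base, the expansion gives `e` times the coefficient equal to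
  -- zero; `e` cancels, also at points of `H`.
  have h0 : ∀ X, a X none g = 0 := fun X => by
    have h1 : IsGen (smoothAlg E G) (H : Set G) g (pull (isSmooth_orbitMk H) ψ.e) :=
      hπ.gen g _ (ψ.isGen hB hψ)
    refine h1.cancel _ ?_
    have h2 : ∀ᶠ z in Near (smoothAlg E G) g, ψ.u (orbitMk H z) ≠ 0 :=
      (near_of_ne (pull (isSmooth_orbitMk H) ψ.u) hψ)
    filter_upwards [ha X, hn, hs, h2] with z k1 k2 k3 k4
    have k5 := k1 (pull (isSmooth_orbitMk H) (ψ.xf ()))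
    rw [zeta_pull_orbitMk, Fintype.sum_option, k2] at k5
    simp only [k3, mul_zero, Finset.sum_const_zero, add_zero] at k5
    rw [ψ.W_apply' k4, if_pos rfl, FChart.ec] at k5
    rw [mul_comm]
    exact k5.symm
  let T : lieSub E H →ₗ[ℝ] (Fin S.m → ℝ) :=
    { toFun := fun X i => a X (some i) g
      map_add' := fun X Y => by
        funext i
        have h1 : ∀ᶠ z in Near (smoothAlg E G) g, ∀ f, (zeta H (X + Y)).der f z
            = ∑ i, (a X i + a Y i : Fn (smoothAlg E G)) z * (φ.W i).der f z := by
          filter_upwards [ha X, ha Y] with z k1 k2 f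
          rw [zeta_add, BField.add_der, Fn.add_apply, k1, k2, ← Finset.sum_add_distrib]
          refine Finset.sum_congr rfl fun i _ => ?_
          rw [Fn.add_apply, add_mul]
        rw [← ha', φ.coef_eq hC hφ h1]
        rfl
      map_smul' := fun c X => by
        funext i
        have h1 : ∀ᶠ z in Near (smoothAlg E G) g, ∀ f, (zeta H (c • X)).der f z
            = ∑ i, (c • a X i : Fn (smoothAlg E G)) z * (φ.W i).der f z := by
          filter_upwards [ha X] with z k1 f
          rw [zeta_smul, BField.rsmul_der, Fn.smul_apply, k1, Finset.mul_sum]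
          refine Finset.sum_congr rfl fun i _ => ?_
          rw [Fn.smul_apply, mul_assoc]
        rw [← ha', φ.coef_eq hC hφ h1]
        rfl }
  -- If all coefficients vanish at `g`, so does the vector field, and right translation to the
  -- identity gives `X = 0`.
  have hT : Function.Injective T := by
    refine (injective_iff_map_eq_zero T).2 fun X hX => Subtype.ext ?_
    refine dOne_ext fun f => ?_
    have h1 := (near_self (ha X) :) (rightPull E g⁻¹ f)
    rw [Fintype.sum_option, h0, zero_mul, zero_add, Finset.sum_eq_zero, zeta_apply] at h1
    · have h2 : rightPull E g (rightPull E g⁻¹ f) = f := Fn.ext fun x =>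
        congrArg (f : G → ℝ) (by simp)
      rw [h2] at h1
      rw [h1]
      exact (map_zero (dOne E f)).symm
    · intro i _
      have h2 : a X (some i) g = 0 := congrFun hX i
      rw [h2, zero_mul]
  have hfin : FiniteDimensional ℝ (GroupLieAlgebra 𝓘(ℝ, E) G) :=
    inferInstanceAs (FiniteDimensional ℝ E)
  have hd : Module.finrank ℝ (lieSub E H) = Module.finrank ℝ (Fin S.m → ℝ) := by
    rw [Module.finrank_fintype_fun_eq_card, Fintype.card_fin, S.finrank_lieSub hH]
  obtain ⟨X, hX⟩ := (LinearMap.injective_iff_surjective_of_finrank_eq_finrank hd).1 hT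
    (Pi.single i 1)
  have h1 := α.1.form_coef hC φ hφ (zeta H X)
  rw [α.2 X, Fintype.sum_option] at h1
  change 0 = φ.coef hC (zeta H X) g none * _ + ∑ j, φ.coef hC (zeta H X) g (some j) * _ at h1
  simp only [ha'] at h1
  rw [h0, zero_mul, zero_add, Finset.sum_eq_single i] at h1
  · have h2 : a X (some i) g = 1 := by
      have := congrFun hX i
      rwa [Pi.single_eq_same] at this
    rw [h2, one_mul] at h1
    exact h1.symm
  · intro j _ hj
    have h2 : a X (some j) g = 0 := by
      have := congrFun hX j
      rwa [Pi.single_eq_of_ne hj] at this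
    rw [h2, zero_mul]
  · exact fun h => absurd (Finset.mem_univ _) h

/-- The `b`-differential of the projection, in adapted charts. -/
lemma exists_rep_orbitMk (S : Slice E H) (hH : IsClosed (H : Set G)) (D : BDerG E H) (g : G) :
    ∃ (a : Fn (smoothAlg E G)) (W : BDer (baseAlg E H) (baseCrit H)),
      ∀ᶠ q in 𝓝 g, Rep (isSmooth_orbitMk H) q D (fun _ : Unit => a) (fun _ => W) := by
  obtain ⟨φ, ψ, h1, h2, -, -, -, hn, hs⟩ := S.exists_adapted hH g
  obtain ⟨a, ha⟩ := φ.exists_coef isComplete_smoothAlg h1 D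
  refine ⟨a none, ψ.W (), ?_⟩
  rw [near_smoothAlg] at ha
  have h3 : ∀ᶠ q in 𝓝 g, ∀ f, D.der (pull (isSmooth_orbitMk H) f) q
      = ∑ _k : Unit, a none q * (ψ.W ()).der f (orbitMk H q) := by
    filter_upwards [ha, hn, hs] with q k1 k2 k3 f
    rw [k1, Fintype.sum_option, k2]
    simp [k3]
  filter_upwards [eventually_eventually_nhds.2 h3] with q hq
  rw [← near_smoothAlg (E := E)] at hq
  exact hq

/-- The field `W` is lifted through the frame: its coefficient, pulled back, times the frame field
`W none` of `G`. -/
lemma exists_related (S : Slice E H) (hH : IsClosed (H : Set G))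
    (W : BDer (baseAlg E H) (baseCrit H)) (g : G) : ∃ D : BDerG E H,
      ∀ᶠ q in 𝓝 g, ∀ f, D.der (pull (isSmooth_orbitMk H) f) q = W.der f (orbitMk H q) := by
  have hB : IsComplete (baseAlg E H) := isComplete_quotAlg H isComplete_smoothAlg
  obtain ⟨φ, ψ, h1, h2, -, -, -, hn, -⟩ := S.exists_adapted hH g
  obtain ⟨b, hb⟩ := ψ.exists_coef hB h2 W
  have hb' := (S.near_base hH g).1 hb
  refine ⟨pull (isSmooth_orbitMk H) (b ()) • φ.W none, ?_⟩
  filter_upwards [hn, hb'] with q k1 k2 f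
  rw [BField.smul_der, Fn.mul_apply, k1, k2]
  simp

lemma bPush_of_related {D : BDerG E H} {W : BDer (baseAlg E H) (baseCrit H)} {g : G}
    (h : ∀ᶠ q in 𝓝 g, ∀ f, D.der (pull (isSmooth_orbitMk H) f) q = W.der f (orbitMk H q)) :
    ∀ᶠ q in 𝓝 g, BPush (orbitMk H) q D W := by
  filter_upwards [eventually_eventually_nhds.2 h] with q hq
  rw [← near_smoothAlg (E := E)] at hq
  exact BPush.of_near hq

/-- The only freedom in lifting a field from the base lies in the directions `W (some i)`, which `α`
ignores by `ann_frame`. The component on the frame field of the base is therefore `α(W none)`. -/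
lemma exists_piBar (S : Slice E H) (hH : IsClosed (H : Set G)) (α : Ann E H) :
    ∃ β : CotBase E H, β.pt = orbitMk H α.1.pt ∧
      ∀ D W, BPush (orbitMk H) α.1.pt D W → β.form W = α.1.form D := by
  have hB : IsComplete (baseAlg E H) := isComplete_quotAlg H isComplete_smoothAlg
  have hC : IsComplete (smoothAlg E G) := isComplete_smoothAlg
  obtain ⟨φ, ψ, h1, h2, -, -, -, hn, hs⟩ := S.exists_adapted hH α.1.pt
  refine ⟨ψ.covector hB (orbitMk H α.1.pt) fun _ => α.1.form (φ.W none), rfl, fun D W h => ?_⟩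
  obtain ⟨a, ha⟩ := φ.exists_coef hC h1 D
  have h3 : Rep (isSmooth_orbitMk H) α.1.pt D (fun _ : Unit => a none) (fun _ => ψ.W ()) := by
    rw [← near_smoothAlg (E := E)] at hn hs
    change ∀ᶠ z in _, _
    filter_upwards [ha, hn, hs] with q k1 k2 k3 f
    rw [k1, Fintype.sum_option, k2]
    simp [k3]
  rw [(S.isBMap_orbitMk hH).form_eq (S.isBMfd_base hH) h h3 rfl, α.1.form_sum_near ha,
    Fintype.sum_option]
  simp [ann_frame S hH α h1 h2 hn hs, FChart.covector_form, ψ.coef_W hB h2]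

namespace Slice

variable (S : Slice E H) (hH : IsClosed (H : Set G))

/-- The bundle map `𝓗° → ᵇT^*(G/H)`. -/
def piBar (α : Ann E H) : CotBase E H := (exists_piBar S hH α).choose

lemma piBar_pt (α : Ann E H) : (S.piBar hH α).pt = orbitMk H α.1.pt :=
  (exists_piBar S hH α).choose_spec.1

lemma piBar_form (α : Ann E H) {D : BDerG E H} {W : BDer (baseAlg E H) (baseCrit H)}
    (h : BPush (orbitMk H) α.1.pt D W) : (S.piBar hH α).form W = α.1.form D :=
  (exists_piBar S hH α).choose_spec.2 D W h

lemma isPiBar : IsPiBar H (S.piBar hH) := fun α => ⟨S.piBar_pt hH α, fun W => by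
  obtain ⟨D, hD⟩ := exists_related S hH W α.1.pt
  exact ⟨⟨D, (bPush_of_related hD).self_of_nhds⟩, fun D h => S.piBar_form hH α h⟩⟩

/-- The pull-back of a covector of the quotient to a point of `G`, as a member of `𝓗°`. -/
def lift (g : G) (β : CotBase E H) (hβ : β.pt = orbitMk H g) : Ann E H :=
  ⟨(S.isBMap_orbitMk hH).cotPull (S.isBMfd_base hH) g β hβ, fun X => by
    rw [(S.isBMap_orbitMk hH).cotPull_bPush (S.isBMfd_base hH) hβ (bPush_zeta g X), map_zero]⟩

lemma piBar_lift (g : G) (β : CotBase E H) (hβ : β.pt = orbitMk H g) :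
    S.piBar hH (S.lift hH g β hβ) = β := by
  refine BCot.ext ((S.piBar_pt hH _).trans hβ.symm) (LinearMap.ext fun W => ?_)
  obtain ⟨D, hD⟩ := exists_related S hH W g
  have h1 := (bPush_of_related hD).self_of_nhds
  rw [S.piBar_form hH (S.lift hH g β hβ) h1]
  exact (S.isBMap_orbitMk hH).cotPull_bPush (S.isBMfd_base hH) hβ h1

/-- Base point and covector enter as variables with equations, which permits substitution despite
the dependent argument `h`. -/
lemma lift_piBar (α : Ann E H) (g : G) (hg : α.1.pt = g) (β : CotBase E H)
    (hβ : β = S.piBar hH α) (h : β.pt = orbitMk H g) : S.lift hH g β h = α := by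
  subst hg hβ
  refine Subtype.ext (BCot.ext rfl (LinearMap.ext fun D => ?_))
  obtain ⟨W, hW⟩ := (S.isBMap_orbitMk hH).exists_bPush (S.isBMfd_base hH) α.1.pt D
  rw [← S.piBar_form hH α hW]
  exact (S.isBMap_orbitMk hH).cotPull_bPush (S.isBMfd_base hH) h hW

/-- The projection is invariant under left translation by `H`, so the translate of a lift of `W` is
again a lift of `W`. -/
lemma piBar_smul (h : H) (α : Ann E H) : S.piBar hH (h • α) = S.piBar hH α := by
  have : IsTopologicalGroup G := topologicalGroup_of_lieGroup 𝓘(ℝ, E) ∞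
  refine BCot.ext ?_ (LinearMap.ext fun W => ?_)
  · rw [piBar_pt, piBar_pt]
    exact orbitMk_smul h α.1.pt
  · obtain ⟨D, hD⟩ := exists_related S hH W (h • α).1.pt
    have h1 : ∀ᶠ q in 𝓝 α.1.pt, ∀ f,
        (leftPush H h⁻¹ D).der (pull (isSmooth_orbitMk H) f) q = W.der f (orbitMk H q) := by
      have h2 : ContinuousAt (fun q => (h : G) * q) α.1.pt := by fun_prop
      have h3 := h2.eventually hD
      filter_upwards [h3] with q hq f
      rw [leftPush_der]
      have h4 : leftPull E ((h⁻¹ : H) : G) (pull (isSmooth_orbitMk H) f)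
          = pull (isSmooth_orbitMk H) f := Fn.ext fun x =>
        congrArg (f : _ → ℝ) (orbitMk_smul h⁻¹ x)
      rw [h4]
      have h5 : (((h⁻¹ : H) : G)⁻¹ * q) = h * q := by simp
      change D.der (pull (isSmooth_orbitMk H) f) (((h⁻¹ : H) : G)⁻¹ * q) = _
      rw [h5, hq]
      exact congrArg (W.der f : _ → ℝ) (orbitMk_smul h q)
    rw [S.piBar_form hH _ (bPush_of_related hD).self_of_nhds,
      S.piBar_form hH _ (bPush_of_related h1).self_of_nhds]
    rfl

lemma smAt_lift {X : Type w} {C : FunAlg X} (hC : IsComplete C) {φ : X → G}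
    {B : X → CotBase E H} (hB : ∀ x, (B x).pt = orbitMk H (φ x)) {p : X}
    (h1 : ∀ f : Fn (smoothAlg E G), SmAt C (fun x => f (φ x)) p)
    (h2 : ∀ W, SmAt C (fun x => (B x).form W) p) (D : BDerG E H) :
    SmAt C (fun x => (S.lift hH (φ x) (B x) (hB x)).1.form D) p := by
  obtain ⟨a, W, h3⟩ := exists_rep_orbitMk S hH D (φ p)
  refine ((h1 a).mul (h2 W)).congr ?_
  filter_upwards [(tendsto_of_smAt hC h1).eventually h3] with x hx
  refine ((S.isBMap_orbitMk hH).cotPull_rep (S.isBMfd_base hH) (hB x) hx).trans ?_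
  simp

lemma isSmooth_piBar : IsSmooth (annAlg E H) (cotBaseAlg E H) (S.piBar hH) := by
  have hA : IsComplete (annAlg E H) := isComplete_generated _
  have hpt : IsSmooth (annAlg E H) (smoothAlg E G) (fun α : Ann E H => α.1.pt) :=
    IsSmooth.comp (isSmooth_pt) (isSmooth_val _)
  refine isSmooth_cot hA (fun f => ?_) fun W => hA.mem_of_smAt fun α => ?_
  · have h1 := hpt _ (pull (isSmooth_orbitMk H) f).mem
    refine cast (congrArg (· ∈ annAlg E H) (funext fun α => ?_)) h1
    rw [piBar_pt]
    rfl
  · obtain ⟨D, hD⟩ := exists_related S hH W α.1.pt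
    have h1 := bPush_of_related hD
    rw [← near_smoothAlg (E := E)] at h1
    refine (smAt_of_mem (isSmooth_val _ _ (linFn D).mem) α).congr ?_
    filter_upwards [(hpt.tendsto α).eventually h1] with α' hα'
    exact S.piBar_form hH α' hα'

/-- A local section `s` of `G → G/H` gives the trivialisation: `α` over `g` has group coordinate `g
s([g])⁻¹`, and `(β, h)` comes from pulling `β` back to the point `h s(β.pt)`. -/
lemma isPrincipalBundle : IsPrincipalBundle H (restrAlg (smoothAlg E G) (H : Set G))
    (annAlg E H) (cotBaseAlg E H) (S.piBar hH) := by
  have hpt : IsSmooth (annAlg E H) (smoothAlg E G) (fun α : Ann E H => α.1.pt) :=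
    IsSmooth.comp (isSmooth_pt) (isSmooth_val _)
  refine ⟨S.isSmooth_piBar hH, fun β => ?_, fun h α => S.piBar_smul hH h α, fun β => ?_⟩
  · obtain ⟨g, hg⟩ : ∃ g, orbitMk H g = β.pt := Quotient.exists_rep β.pt
    exact ⟨S.lift hH g β hg.symm, S.piBar_lift hH g β hg.symm⟩
  obtain ⟨g, hg⟩ : ∃ g, orbitMk H g = β.pt := Quotient.exists_rep β.pt
  obtain ⟨u, s, hu, hs, hss⟩ := S.exists_section hH g
  have hUV : ∀ α : Ann E H, pull isSmooth_pt u (S.piBar hH α) = u (orbitMk H α.1.pt) := fun α =>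
    congrArg u (S.piBar_pt hH α)
  let U : Set (CotBase E H) := {β | pull isSmooth_pt u β ≠ 0}
  let V : Set (Ann E H) := {α | pull isSmooth_pt u (S.piBar hH α) ≠ 0}
  have hV : ∀ α : V, u (orbitMk H α.1.1.pt) ≠ 0 := fun α => by
    rw [← hUV]
    exact α.2
  have hmem : ∀ α : V, α.1.1.pt * (s (orbitMk H α.1.1.pt))⁻¹ ∈ H := fun α =>
    orbitMk_eq.1 (hs _).symm
  let Ψ : V → H := fun α => ⟨_, hmem α⟩
  refine ⟨pull isSmooth_pt u, (pull isSmooth_pt u).mem, show u β.pt ≠ 0 from hg ▸ hu,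
    Ψ, fun k x y hxy => Subtype.ext ?_, ?_⟩
  · change y.1.1.pt * (s (orbitMk H y.1.1.pt))⁻¹ = k * (x.1.1.pt * (s (orbitMk H x.1.1.pt))⁻¹)
    have h1 : y.1.1.pt = k * x.1.1.pt := by rw [hxy]; rfl
    have h2 : orbitMk H y.1.1.pt = orbitMk H x.1.1.pt := by rw [h1]; exact orbitMk_smul k x.1.1.pt
    rw [h2, h1, mul_assoc]
  have hPs : ∀ y : U × H, y.1.1.pt = orbitMk H ((y.2 : G) * s y.1.1.pt) := fun y => by
    have h1 : orbitMk H (y.2 • s y.1.1.pt) = y.1.1.pt := (orbitMk_smul _ _).trans (hs _)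
    exact h1.symm
  let Φ : U × H → V := fun y => ⟨S.lift hH ((y.2 : G) * s y.1.1.pt) y.1.1 (hPs y), by
    change pull isSmooth_pt u (S.piBar hH _) ≠ 0
    rw [piBar_lift]
    exact y.1.2⟩
  have hR : IsComplete (restrAlg (annAlg E H) V) := isComplete_generated _
  have hRU : IsComplete (prodAlg (restrAlg (cotBaseAlg E H) U)
    (restrAlg (smoothAlg E G) (H : Set G))) := isComplete_generated _
  refine isDiffeo_of_inverse (φ := fun α : V => ((⟨S.piBar hH α.1, α.2⟩ : U), Ψ α)) (ψ := Φ)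
    (isSmooth_prod hR (isSmooth_restr hR ?_) (isSmooth_restr hR ?_))
    (isSmooth_restr hRU (isSmooth_restr hRU ?_)) (fun α => Subtype.ext ?_) (fun y => ?_)
  · exact (S.isSmooth_piBar hH).comp (isSmooth_val V)
  · intro f hf
    refine hR.mem_of_smAt fun α => ?_
    have h1 : IsSmooth (restrAlg (annAlg E H) V) (smoothAlg E G) (fun α => α.1.1.pt) :=
      hpt.comp (isSmooth_val V)
    refine smAt_comp₂ hR (φ := fun α : V => α.1.1.pt) (ψ := fun α : V => s (orbitMk H α.1.1.pt))
      (K := fun p => f (p.1 * p.2⁻¹)) (fun f => smAt_of_mem (h1 f f.mem) α)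
      (fun f => ?_) ?_
    · exact SmAt.comp_smooth ((isSmooth_orbitMk H).comp h1) (hss _ (hV α) f)
    · exact ContMDiff.comp (n := ∞) (g := f) hf (contMDiff_fst.mul contMDiff_snd.inv)
  · have h1 : IsSmooth (prodAlg (restrAlg (cotBaseAlg E H) U)
        (restrAlg (smoothAlg E G) (H : Set G))) (cotBaseAlg E H) (fun y : U × H => y.1.1) :=
      (isSmooth_val U).comp isSmooth_fst
    have h2 : IsSmooth (prodAlg (restrAlg (cotBaseAlg E H) U)
        (restrAlg (smoothAlg E G) (H : Set G))) (smoothAlg E G) (fun y : U × H => (y.2 : G)) :=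
      (isSmooth_val _).comp isSmooth_snd
    have h3 : ∀ (y : U × H) (f : Fn (smoothAlg E G)), SmAt (prodAlg (restrAlg (cotBaseAlg E H) U)
        (restrAlg (smoothAlg E G) (H : Set G))) (fun y => f ((y.2 : G) * s y.1.1.pt)) y := by
      intro y f
      refine smAt_comp₂ hRU (φ := fun y : U × H => (y.2 : G)) (ψ := fun y : U × H => s y.1.1.pt)
        (K := fun p => f (p.1 * p.2)) (fun f => smAt_of_mem (h2 f f.mem) y)
        (fun f => SmAt.comp_smooth (isSmooth_pt.comp h1) (hss _ y.1.2 f)) ?_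
      exact ContMDiff.comp (n := ∞) (g := f) f.mem (contMDiff_fst.mul contMDiff_snd)
    refine isSmooth_cot hRU (fun f => hRU.mem_of_smAt fun y => h3 y f) fun D =>
      hRU.mem_of_smAt fun y => ?_
    exact S.smAt_lift hH hRU hPs (h3 y) (fun W => smAt_of_mem (h1 _ (linFn W).mem) y) D
  · refine S.lift_piBar hH α.1 _ ?_ _ rfl _
    change α.1.1.pt = α.1.1.pt * (s (orbitMk H α.1.1.pt))⁻¹ * s (S.piBar hH α.1).pt
    rw [piBar_pt, inv_mul_cancel_right]
  · refine Prod.ext (Subtype.ext (S.piBar_lift hH _ _ (hPs y))) (Subtype.ext ?_)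
    change (y.2 : G) * s y.1.1.pt * (s (orbitMk H ((y.2 : G) * s y.1.1.pt)))⁻¹ = y.2
    rw [← hPs, mul_inv_cancel_right]

lemma cotBase_separated (S : Slice E H) (hH : IsClosed (H : Set G)) {β γ : CotBase E H}
    (hβγ : β ≠ γ) : ∃ f ∈ cotBaseAlg E H, f β ≠ f γ := by
  by_cases h : β.pt = γ.pt
  · by_contra! h1
    exact hβγ (BCot.ext h (LinearMap.ext fun D => h1 _ (linFn D).mem))
  · obtain ⟨f, hf⟩ := S.base_separated hH h
    exact ⟨_, (pull isSmooth_pt f).mem, hf⟩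

lemma isManifoldAlg_cotBase (S : Slice E H) (hH : IsClosed (H : Set G))
    [SecondCountableTopology G] : IsManifoldAlg 2 (cotBaseAlg E H) := by
  have hB : IsComplete (baseAlg E H) := isComplete_quotAlg H isComplete_smoothAlg
  choose φ hφu _ using fun g : G => (S.isBMfd_base hH).chart (orbitMk H g)
  obtain ⟨K, hK, hφ⟩ := S.exists_countable_cover hH hφu
  have := hK.to_subtype
  refine isComplete_cotAlg.isManifoldAlg (K := K) (fun k => (φ k.1).cotChart hB) (fun β => ?_)
    (fun β γ hβγ => S.cotBase_separated hH hβγ) rfl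
  obtain ⟨k, hk, h⟩ := hφ β.pt
  exact ⟨⟨k, hk⟩, h⟩

end Slice

end Annihilator

/-! ### Minimal coupling -/

section MinimalCoupling

lemma extD_add {A : Type u} [CommRing A] [Algebra ℝ A] {I : Ideal A} (η η' : BForm1 A I) :
    extD (η + η') = extD η + extD η' := by
  refine LinearMap.ext₂ fun V W => ?_
  simp only [LinearMap.add_apply, extD_apply, map_add]
  ring

lemma IsPullback2.unique {X : Type u} {Y : Type v} {CX : FunAlg X} {ZX : Set X} {CY : FunAlg Y}
    {ZY : Set Y} {φ : X → Y} {Ω : BForm2 (Fn CY) (vanIdeal CY ZY)}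
    {Ω₁ Ω₂ : BForm2 (Fn CX) (vanIdeal CX ZX)} (h₁ : IsPullback2 φ Ω Ω₁)
    (h₂ : IsPullback2 φ Ω Ω₂) : Ω₁ = Ω₂ := by
  refine LinearMap.ext₂ fun V V' => Fn.ext fun x => ?_
  obtain ⟨W, hW⟩ := (h₁ x V V').1
  obtain ⟨W', hW'⟩ := (h₁ x V' V).1
  rw [(h₁ x V V').2 W W' hW hW', (h₂ x V V').2 W W' hW hW']

variable {E : Type u} [NormedAddCommGroup E] [NormedSpace ℝ E]
  {G : Type v} [TopologicalSpace G] [ChartedSpace E G] [Group G] {H : Subgroup G}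
  [LieGroup 𝓘(ℝ, E) ∞ G]

lemma IsLambdaTheta.unique {θ : BConnection E H} {lam lam' : Form1MC E H}
    (h : IsLambdaTheta θ lam) (h' : IsLambdaTheta θ lam') : lam = lam' := by
  refine LinearMap.ext fun V => Fn.ext fun x => ?_
  obtain ⟨W, hW⟩ := (h x V).1
  rw [(h x V).2 W hW, (h' x V).2 W hW]

lemma IsMinimalCoupling.unique {θ : BConnection E H} {pbar : Ann E H → CotBase E H}
    {lamB : Form1CotBase E H} {Ω Ω' : Form2MC E H} (h : IsMinimalCoupling θ pbar lamB Ω)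
    (h' : IsMinimalCoupling θ pbar lamB Ω') : Ω = Ω' := by
  obtain ⟨Ω₀, lam, h1, h2, rfl⟩ := h
  obtain ⟨Ω₀', lam', h1', h2', rfl⟩ := h'
  rw [h1.unique h1', h2.unique h2']

lemma isComplete_mcAlg : IsComplete (mcAlg E H) := isComplete_generated _

lemma isSmooth_mcPt : IsSmooth (mcAlg E H) (smoothAlg E G) (fun x : MC E H => x.1.1.pt) :=
  (isSmooth_pt.comp (isSmooth_val _)).comp isSmooth_fst

/-- The covector `μ ∘ θ` at the base point of a pair `(α, μ)`. -/
def thetaCov (θ : BConnection E H) (x : MC E H) : CotG E H where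
  pt := x.1.1.pt
  form :=
    { toFun := fun D => x.2 (θ.val D x.1.1.pt)
      map_add' := fun D D' => by rw [θ.map_add, map_add]
      map_smul' := fun c D => by rw [θ.map_rsmul, map_smul]; rfl }
  form_smul f D := by
    change x.2 (θ.val (f • D) x.1.1.pt) = _
    rw [θ.map_smul, map_smul]
    rfl

/-- The inverse of `ψ_θ`. -/
def psiInv (θ : BConnection E H) (x : MC E H) : CotG E H where
  pt := x.1.1.pt
  form := x.1.1.form + (thetaCov θ x).form
  form_smul f D := by
    rw [LinearMap.add_apply, x.1.1.form_smul, (thetaCov θ x).form_smul, LinearMap.add_apply,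
      mul_add]
    rfl

lemma psiInv_form (θ : BConnection E H) (x : MC E H) (D : BDerG E H) :
    (psiInv θ x).form D = x.1.1.form D + x.2 (θ.val D x.1.1.pt) := rfl

variable [FiniteDimensional ℝ E]

/-- Expansion in a basis of `𝔥` separates the components of `θ`, smooth on `G`, from the values of
`μ`. -/
lemma smooth_connection (θ : BConnection E H) (D : BDerG E H) {X : Type w} {C : FunAlg X}
    (hC : IsComplete C) {φ : X → G} (hφ : IsSmooth C (smoothAlg E G) φ)
    {μ : X → Module.Dual ℝ (lieSub E H)} (hμ : ∀ X, (fun x => μ x X) ∈ C) :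
    (fun x => μ x (θ.val D (φ x))) ∈ C := by
  have : FiniteDimensional ℝ (GroupLieAlgebra 𝓘(ℝ, E) G) :=
    inferInstanceAs (FiniteDimensional ℝ E)
  let b := Module.finBasis ℝ (lieSub E H)
  refine hC.mem_of_smAt fun p => ?_
  have h1 : SmAt C (fun x => ∑ i, b.coord i (θ.val D (φ x)) * μ x (b i)) p :=
    SmAt.sum fun i _ => (smAt_of_mem (hφ _ (θ.smooth D (b.coord i))) p).mul (smAt_of_mem (hμ _) p)
  refine h1.congr (Eventually.of_forall fun x => ?_)
  conv_lhs => rw [← b.sum_repr (θ.val D (φ x))]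
  rw [map_sum]
  simp only [map_smul, smul_eq_mul]
  rfl

lemma mem_dualAlg (X : lieSub E H) :
    (fun μ : Module.Dual ℝ (lieSub E H) => μ X) ∈ dualAlg (lieSub E H) :=
  subset_generated _ ⟨X, rfl⟩

lemma thetaCov_smooth (θ : BConnection E H) (D : BDerG E H) :
    (fun x => (thetaCov θ x).form D) ∈ mcAlg E H :=
  smooth_connection θ D isComplete_mcAlg isSmooth_mcPt fun X => isSmooth_snd _ (mem_dualAlg X)

lemma annForm_smooth (D : BDerG E H) : (fun x : MC E H => x.1.1.form D) ∈ mcAlg E H :=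
  ((isSmooth_val _).comp isSmooth_fst) _ (linFn D).mem

/-- `ψ_θ` as a diffeomorphism. -/
def psiDiffeo (θ : BConnection E H) :
    Diffeo (cotAlg (smoothAlg E G) (H : Set G)) (mcAlg E H) where
  map := psi θ
  inv := psiInv θ
  smooth := by
    refine isSmooth_prod isComplete_cotAlg (isSmooth_restr isComplete_cotAlg
      (isSmooth_cot isComplete_cotAlg (fun f => (pull isSmooth_pt f).mem) fun D => ?_))
      (isSmooth_generated isComplete_cotAlg ?_)
    · have h1 := smooth_connection θ D (isComplete_cotAlg (C := smoothAlg E G) (Z := (H : Set G)))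
        isSmooth_pt (μ := vertPart) fun X => (linFn (zeta H X)).mem
      exact Subalgebra.sub_mem _ (linFn D).mem h1
    · rintro _ ⟨X, rfl⟩
      exact (linFn (zeta H X)).mem
  smooth_inv := isSmooth_cot isComplete_mcAlg (fun f => isSmooth_mcPt _ f.mem) fun D =>
    Subalgebra.add_mem _ (annForm_smooth D) (thetaCov_smooth θ D)
  left α := BCot.ext rfl (LinearMap.ext fun D => by
    rw [psiInv_form]
    exact sub_add_cancel _ _)
  right x := by
    refine Prod.ext (Subtype.ext (BCot.ext rfl (LinearMap.ext fun D => ?_)))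
      (LinearMap.ext fun X => ?_)
    · change (horPart θ (psiInv θ x)).1.form D = _
      rw [horPart_form, psiInv_form, psiInv_form, x.1.2]
      change _ - (0 + x.2 (θ.val (zeta H (θ.val D x.1.1.pt)) x.1.1.pt)) = _
      rw [θ.vertical, zero_add, add_sub_cancel_right]
    · change (psiInv θ x).form (zeta H X) = _
      rw [psiInv_form, x.1.2, θ.vertical, zero_add]

lemma psiDiffeo_iff (θ : BConnection E H) (α : CotG E H) :
    (psiDiffeo θ).map α ∈ mcCrit E H ↔ α ∈ cotCrit (smoothAlg E G) (H : Set G) := Iff.rfl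

variable [T2Space G]

namespace Slice

variable (S : Slice E H) (hH : IsClosed (H : Set G)) (θ : BConnection E H)

/-- Charts of `𝓗° × 𝔥^*` are transported from `ᵇT^*G` along `ψ_θ`; no product charts are needed. -/
lemma isBMfd_mc (S : Slice E H) (hH : IsClosed (H : Set G)) (θ : BConnection E H) : IsBMfd (mcAlg E H) (mcCrit E H)
    (Option (Fin S.m) ⊕ Option (Fin S.m)) :=
  (psiDiffeo θ).isBMfd (psiDiffeo_iff θ) (S.isBMfd hH).cot isComplete_mcAlg

lemma isBMap_mcPt (S : Slice E H) (hH : IsClosed (H : Set G)) (θ : BConnection E H) :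
    IsBMap (mcAlg E H) (mcCrit E H) (smoothAlg E G) (H : Set G)
    (fun x : MC E H => x.1.1.pt) := by
  have h1 : IsBMap (mcAlg E H) (mcCrit E H) _ _ (psiInv θ) :=
    (psiDiffeo θ).symm.isBMap ((psiDiffeo θ).symm_iff (psiDiffeo_iff θ))
  exact IsBMap.comp (φ := psiInv θ) (S.isBMfd hH).isBMap_pt h1

/-- The form `λ^θ`. -/
def lamTheta : Form1MC E H :=
  (S.isBMap_mcPt hH θ).formOf (S.isBMfd hH) isComplete_mcAlg (thetaCov θ) (fun _ => rfl)
    (thetaCov_smooth θ)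

lemma isLambdaTheta : IsLambdaTheta θ (S.lamTheta hH θ) := fun x V =>
  ⟨(S.isBMap_mcPt hH θ).exists_bPush (S.isBMfd hH) x V, fun _ h =>
    (S.isBMap_mcPt hH θ).formOf_bPush (S.isBMfd hH) isComplete_mcAlg (thetaCov θ) (fun _ => rfl)
      (thetaCov_smooth θ) h⟩

/-- The tautological form of `𝓗°`, pulled back to `𝓗° × 𝔥^*`. -/
def lamAnn : Form1MC E H :=
  (S.isBMap_mcPt hH θ).formOf (S.isBMfd hH) isComplete_mcAlg (fun x => x.1.1) (fun _ => rfl)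
    annForm_smooth

lemma lamAnn_bPush {x : MC E H} {V : BDer (mcAlg E H) (mcCrit E H)} {W : BDerG E H}
    (h : BPush (fun x : MC E H => x.1.1.pt) x V W) : S.lamAnn hH θ V x = x.1.1.form W :=
  (S.isBMap_mcPt hH θ).formOf_bPush (S.isBMfd hH) isComplete_mcAlg (fun x => x.1.1) (fun _ => rfl)
    annForm_smooth h

/-- Evaluate `α = (α - α ∘ ζ ∘ θ) + (α ∘ ζ) ∘ θ` on `τ_* v`; the chain rule applies as `ψ_θ`
preserves base points. -/
lemma isPullback1_psi :
    IsPullback1 (psi θ) (S.lamAnn hH θ + S.lamTheta hH θ) (S.isBMfd hH).liouville := by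
  intro α V W hVW
  have h0 := S.isBMap_mcPt hH θ
  obtain ⟨U, hU⟩ := (S.isBMfd hH).isBMap_pt.exists_bPush (S.isBMfd hH) α V
  obtain ⟨U', hU'⟩ := h0.exists_bPush (S.isBMfd hH) (psi θ α) W
  have h1 := ((psiDiffeo θ).isBMap (psiDiffeo_iff θ)).bPush_comp h0 (S.isBMfd_mc hH θ)
    (S.isBMfd hH) hVW hU' hU (β := α) rfl
  rw [((S.isBMfd hH).isBLiouville α V).2 U hU, h1, LinearMap.add_apply, Fn.add_apply,
    S.lamAnn_bPush hH θ hU', (S.isLambdaTheta hH θ _ W).2 U' hU']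
  exact (sub_add_cancel _ _).symm

/-- Composed with the bundle projection, the map becomes `π ∘ τ`, a composition of `b`-maps, so
`IsBMap.of_comp` applies. -/
lemma isBMap_piBar_fst (S : Slice E H) (hH : IsClosed (H : Set G)) (θ : BConnection E H) :
    IsBMap (mcAlg E H) (mcCrit E H) (cotBaseAlg E H)
    (cotCrit (baseAlg E H) (baseCrit H)) (fun x : MC E H => S.piBar hH x.1) := by
  have h1 := (S.isBMap_orbitMk hH).comp (S.isBMap_mcPt hH θ)
  refine (S.isBMfd_base hH).isBMap_pt.of_comp isComplete_cotAlg (S.isBMfd_base hH)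
    ((S.isSmooth_piBar hH).comp isSmooth_fst) (fun x hx => ?_) ?_
  · change (S.piBar hH x.1).pt ∈ baseCrit H
    rw [piBar_pt]
    exact orbitMk_eq_one.2 hx
  · have h2 : (fun x : MC E H => (S.piBar hH x.1).pt) = fun x : MC E H => orbitMk H x.1.1.pt :=
      funext fun x => S.piBar_pt hH x.1
    rw [h2]
    exact h1

/-- The square `τ_{G/H} ∘ π̄ = π ∘ τ` gives two computations of the push-forward to `G/H`; by the
defining property of `π̄`, evaluation there by `π̄ α` is evaluation on `G` by `α`. -/
lemma isPullback1_piBar : IsPullback1 (fun x : MC E H => S.piBar hH x.1)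
    (S.isBMfd_base hH).liouville (S.lamAnn hH θ) := by
  intro x V W hVW
  have h0 := S.isBMap_mcPt hH θ
  have hq := S.isBMap_piBar_fst hH θ
  have hB := S.isBMfd_base hH
  obtain ⟨U, hU⟩ := h0.exists_bPush (S.isBMfd hH) x V
  obtain ⟨R, hR⟩ := hB.isBMap_pt.exists_bPush hB (S.piBar hH x.1) W
  obtain ⟨R', hR'⟩ := (S.isBMap_orbitMk hH).exists_bPush hB x.1.1.pt U
  obtain ⟨T, hT⟩ := (hB.isBMap_pt.comp hq).exists_bPush hB x V
  have h1 := hq.bPush_comp hB.isBMap_pt hB.cot hB hVW hR hT (β := S.piBar hH x.1) rfl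
  have h2 : (fun x : MC E H => (S.piBar hH x.1).pt) = fun x : MC E H => orbitMk H x.1.1.pt :=
    funext fun x => S.piBar_pt hH x.1
  rw [h2] at hT
  have h3 := h0.bPush_comp (S.isBMap_orbitMk hH) (S.isBMfd hH) hB hU hR' hT
    (β := S.piBar hH x.1) (S.piBar_pt hH x.1)
  rw [S.lamAnn_bPush hH θ hU, (hB.isBLiouville _ W).2 R hR, ← h1, h3, S.piBar_form hH x.1 hR']

/-- The minimal coupling form. -/
def couplingForm : Form2MC E H := -extD (S.lamAnn hH θ) - extD (S.lamTheta hH θ)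

lemma couplingForm_eq :
    S.couplingForm hH θ = -extD (S.lamAnn hH θ + S.lamTheta hH θ) := by
  rw [couplingForm, extD_add]
  refine LinearMap.ext₂ fun V W => ?_
  simp only [LinearMap.sub_apply, LinearMap.neg_apply, LinearMap.add_apply]
  ring

lemma isMinimalCoupling : IsMinimalCoupling θ (S.piBar hH) (S.isBMfd_base hH).liouville
    (S.couplingForm hH θ) :=
  ⟨_, _, (S.isBMap_piBar_fst hH θ).isPullback2_extD (S.isBMfd_base hH).cot
    (S.isPullback1_piBar hH θ), S.isLambdaTheta hH θ, rfl⟩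

lemma isPullback2_psi :
    IsPullback2 (psi θ) (S.couplingForm hH θ) (-extD (S.isBMfd hH).liouville) := by
  rw [couplingForm_eq]
  exact ((psiDiffeo θ).isBMap (psiDiffeo_iff θ)).isPullback2_extD (S.isBMfd_mc hH θ)
    (S.isPullback1_psi hH θ)

lemma isBSymplectic_couplingForm : IsBSymplectic (S.couplingForm hH θ) := by
  refine (psiDiffeo θ).isBSymplectic (psiDiffeo_iff θ) (S.isBMfd hH).cot isComplete_mcAlg
    (S.isBMfd hH).isBSymplectic ?_ (S.isPullback2_psi hH θ)
  rw [couplingForm_eq]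
  exact isClosedForm2_neg_extD _

end Slice

end MinimalCoupling

/-! ### The reduced space is a manifold -/

section Reduced

/-- The cut-off is taken on the orbit space, so the extension by zero, made on `X`, is still a
function of orbits. -/
lemma smAt_quotAlg {X : Type u} {C : FunAlg X} (hC : IsComplete C) {K : Type w} [Group K]
    [MulAction K X] (v : Fn (quotAlg K C)) {F : MulAction.orbitRel.Quotient K X → ℝ}
    (h : ∀ x, v (orbitMk K x) ≠ 0 → SmAt C (fun x => F (orbitMk K x)) x)
    {q : MulAction.orbitRel.Quotient K X} (hq : v q ≠ 0) : SmAt (quotAlg K C) F q := by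
  obtain ⟨χ, hχ1, hχ⟩ := (isComplete_quotAlg K hC).exists_cutoff v hq
  have h1 : (fun q => χ q * F q) ∈ quotAlg K C := by
    refine hC.mul_cutoff_mem (u := pull (isSmooth_orbitMk K) v) (χ := pull (isSmooth_orbitMk K) χ)
      (fun x => (hχ (orbitMk K x)).imp id fun h => ?_) h
    exact ((isSmooth_orbitMk K).tendsto x).eventually h
  refine ⟨Fn.mk _ h1, ?_⟩
  filter_upwards [hχ1] with z hz
  rw [Fn.mk_apply, hz, one_mul]

section Charts

variable {X : Type u} {C : FunAlg X} {ι : Type} [Fintype ι] [DecidableEq ι]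

lemma Chart.contDiffOn_comp (c : Chart C ι) {F : X → ℝ} (h : ∀ q, c.u q ≠ 0 → SmAt C F q) :
    ContDiffOn ℝ ∞ (fun y => F (c.σ y)) c.O := by
  intro y hy
  obtain ⟨f, hf⟩ := h _ (c.ne y hy)
  have h1 := ((c.smooth_inv f).contDiffAt (c.isOpen.mem_nhds hy))
  refine (h1.congr_of_eventuallyEq ?_).contDiffWithinAt
  exact eventually_inv c.isOpen c.smooth_inv hy hf

/-- The restriction of a chart to an open set. -/
def Chart.restrict (c : Chart C ι) (v : Fn C) : Chart C ι where
  u := c.u * v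
  x := c.x
  O := c.O ∩ (fun y => v (c.σ y)) ⁻¹' {0}ᶜ
  σ := c.σ
  isOpen := (c.smooth_inv v).continuousOn.isOpen_inter_preimage c.isOpen isOpen_compl_singleton
  mem q hq := ⟨c.mem q (left_ne_zero_of_mul hq), by
    change v (c.σ (c.x q)) ≠ 0
    rw [c.left q (left_ne_zero_of_mul hq)]
    exact right_ne_zero_of_mul hq⟩
  left q hq := c.left q (left_ne_zero_of_mul hq)
  ne y hy := mul_ne_zero (c.ne y hy.1) hy.2
  right y hy := c.right y hy.1
  smooth_inv f := (c.smooth_inv f).mono Set.inter_subset_left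
  smooth q hq := c.smooth q (left_ne_zero_of_mul hq)

end Charts

variable {E : Type u} [NormedAddCommGroup E] [NormedSpace ℝ E]
  {G : Type v} [TopologicalSpace G] [ChartedSpace E G] [Group G] {H : Subgroup G}
  [LieGroup 𝓘(ℝ, E) ∞ G] [FiniteDimensional ℝ E] [T2Space G]

lemma horPart_psiInv (θ : BConnection E H) (x : MC E H) : horPart θ (psiInv θ x) = x.1 :=
  congrArg Prod.fst ((psiDiffeo θ).right x)

lemma vertPart_psiInv (θ : BConnection E H) (x : MC E H) : vertPart (psiInv θ x) = x.2 :=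
  congrArg Prod.snd ((psiDiffeo θ).right x)

lemma psiInv_psi (θ : BConnection E H) (α : CotG E H) : psiInv θ (psi θ α) = α :=
  (psiDiffeo θ).left α

lemma isSmooth_horPart (θ : BConnection E H) :
    IsSmooth (cotAlg (smoothAlg E G) (H : Set G)) (annAlg E H) (horPart θ) :=
  isSmooth_fst.comp (psiDiffeo θ).smooth

namespace Slice

variable (S : Slice E H) (hH : IsClosed (H : Set G)) (θ : BConnection E H)
  {s : MulAction.orbitRel.Quotient H G → G} (hs : ∀ q, orbitMk H (s q) = q)

/-- A basis of `𝔥`. -/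
def basis : Module.Basis (Fin S.m) ℝ (lieSub E H) :=
  have : FiniteDimensional ℝ (GroupLieAlgebra 𝓘(ℝ, E) G) :=
    inferInstanceAs (FiniteDimensional ℝ E)
  Module.finBasisOfFinrankEq ℝ (lieSub E H) (S.finrank_lieSub hH)

/-- The bundle map from the reduced space to the `b`-cotangent bundle of the quotient. -/
def redBase : RedSpace E H → CotBase E H :=
  Quotient.lift (fun α => S.piBar hH (horPart θ α)) (by
    rintro _ α ⟨h, rfl⟩
    change S.piBar hH (horPart θ (h • α)) = _
    rw [horPart_smul, S.piBar_smul hH])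

lemma isSmooth_redBase : IsSmooth (redAlg E H) (cotBaseAlg E H) (S.redBase hH θ) := fun f hf =>
  ((S.isSmooth_piBar hH).comp (isSmooth_horPart θ)) f hf

/-- The element of `H` that carries the section of `G → G/H` to the base point. -/
def trans (α : CotG E H) : H :=
  ⟨α.pt * (s (orbitMk H α.pt))⁻¹, orbitMk_eq.1 (hs _).symm⟩

lemma trans_smul (h : H) (α : CotG E H) : trans hs (h • α) = h * trans hs α := by
  refine Subtype.ext ?_
  change (h : G) * α.pt * (s (orbitMk H ((h : G) * α.pt)))⁻¹
    = h * (α.pt * (s (orbitMk H α.pt))⁻¹)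
  rw [show orbitMk H ((h : G) * α.pt) = orbitMk H α.pt from orbitMk_smul h α.pt, mul_assoc]

/-- The fibre coordinate of the reduced space, in the trivialization given by a section. -/
def redFibre : RedSpace E H → Module.Dual ℝ (lieSub E H) :=
  Quotient.lift (fun α => (trans hs α)⁻¹ • vertPart α) (by
    rintro _ α ⟨h, rfl⟩
    change (trans hs (h • α))⁻¹ • vertPart (h • α) = _
    rw [trans_smul, vertPart_smul, mul_inv_rev, mul_smul, inv_smul_smul])

/-- The inverse of the trivialization. -/
def redInv (β : CotBase E H) (μ : Module.Dual ℝ (lieSub E H)) : CotG E H :=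
  psiInv θ (S.lift hH (s β.pt) β (hs _).symm, μ)

lemma redBase_inv (β : CotBase E H) (μ : Module.Dual ℝ (lieSub E H)) :
    S.redBase hH θ (orbitMk H (S.redInv hH θ hs β μ)) = β := by
  change S.piBar hH (horPart θ (psiInv θ _)) = β
  rw [horPart_psiInv, S.piBar_lift]

lemma redFibre_inv (β : CotBase E H) (μ : Module.Dual ℝ (lieSub E H)) :
    redFibre hs (orbitMk H (S.redInv hH θ hs β μ)) = μ := by
  change (trans hs (psiInv θ _))⁻¹ • vertPart (psiInv θ _) = μ
  rw [vertPart_psiInv]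
  have h1 : trans hs (S.redInv hH θ hs β μ) = 1 := by
    refine Subtype.ext ?_
    change s β.pt * (s (orbitMk H (s β.pt)))⁻¹ = 1
    rw [hs, mul_inv_cancel]
  have h2 : trans hs (psiInv θ (S.lift hH (s β.pt) β (hs _).symm, μ)) = 1 := h1
  rw [h2, inv_one, one_smul]

/-- Acting by the inverse of `trans hs α` moves `α` to the point of its orbit over the section, and
there equivariance of `ψ_θ` and `lift_piBar` recover it. -/
lemma redInv_left (r : RedSpace E H) :
    orbitMk H (S.redInv hH θ hs (S.redBase hH θ r) (redFibre hs r)) = r := by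
  induction r using Quotient.inductionOn with | h α => ?_
  have h1 : S.redInv hH θ hs (S.piBar hH (horPart θ α)) ((trans hs α)⁻¹ • vertPart α)
      = (trans hs α)⁻¹ • α := by
    rw [← psiInv_psi θ ((trans hs α)⁻¹ • α), psi_smul]
    refine congrArg (psiInv θ) (Prod.ext ?_ rfl)
    refine S.lift_piBar hH _ _ ?_ _ ?_ _
    · change ((trans hs α)⁻¹ : H) * α.pt = s (S.piBar hH (horPart θ α)).pt
      rw [S.piBar_pt]
      change (α.pt * (s (orbitMk H α.pt))⁻¹)⁻¹ * α.pt = s (orbitMk H α.pt)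
      group
    · exact (S.piBar_smul hH _ (horPart θ α)).symm
  change orbitMk H (S.redInv hH θ hs (S.piBar hH (horPart θ α)) ((trans hs α)⁻¹ • vertPart α))
    = orbitMk H α
  rw [h1]
  exact orbitMk_smul _ α

/-- On `ᵇT^*G` the fibre coordinate is `α(ζ(Ad_k X))` with `k = trans hs α`. In a basis of `𝔥` it is
a sum of linear functions with coefficients the components of `Ad_k X`, smooth by `adG_smooth`. -/
lemma smAt_redFibre {u : Fn (baseAlg E H)}
    (hu : ∀ q, u q ≠ 0 → ∀ f : Fn (smoothAlg E G), SmAt (baseAlg E H) (fun q => f (s q)) q)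
    (X : lieSub E H) {r : RedSpace E H} (hr : u (S.redBase hH θ r).pt ≠ 0) :
    SmAt (redAlg E H) (fun r => redFibre hs r X) r := by
  refine smAt_quotAlg isComplete_cotAlg
    (pull (isSmooth_pt.comp (S.isSmooth_redBase hH θ)) u) (fun α hα => ?_) hr
  have hα' : u (orbitMk H α.pt) ≠ 0 := by
    have h1 : (S.piBar hH (horPart θ α)).pt = orbitMk H α.pt := S.piBar_pt hH _
    rw [← h1]
    exact hα
  have hC : IsComplete (cotAlg (smoothAlg E G) (H : Set G)) := isComplete_cotAlg
  let b := S.basis hH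
  -- The coordinate functionals of `𝔥` are extended to the Lie algebra of `G`, on which `adG_smooth`
  -- is stated.
  choose ν hν using fun k => LinearMap.exists_extend (b.coord k)
  have h1 : ∀ k, SmAt (cotAlg (smoothAlg E G) (H : Set G))
      (fun α => ν k (adG E (α.pt * (s (orbitMk H α.pt))⁻¹) X.1)) α := fun k => by
    have h2 := adG_smooth S hH X.1 (ν k)
    refine smAt_comp₂ hC (φ := fun α : CotG E H => α.pt)
      (ψ := fun α : CotG E H => s (orbitMk H α.pt))
      (K := fun p => ν k (adG E (p.1 * p.2⁻¹) X.1)) (fun f => (pull isSmooth_pt f).smAt α)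
      (fun f => SmAt.comp_smooth ((isSmooth_orbitMk H).comp isSmooth_pt) (hu _ hα' f)) ?_
    exact ContMDiff.comp (n := ∞) (g := fun g => ν k (adG E g X.1)) h2
      (contMDiff_fst.mul contMDiff_snd.inv)
  have h3 : SmAt (cotAlg (smoothAlg E G) (H : Set G)) (fun α => ∑ k,
      ν k (adG E (α.pt * (s (orbitMk H α.pt))⁻¹) X.1) * linFn (zeta H (b k)) α) α :=
    SmAt.sum fun k _ => (h1 k).mul ((linFn _).smAt α)
  refine h3.congr (Eventually.of_forall fun α => ?_)
  change ((trans hs α)⁻¹ • vertPart α) X = _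
  rw [coad_apply, inv_inv]
  conv_lhs => rw [← b.sum_repr (adH H (trans hs α) X)]
  rw [map_sum]
  refine Finset.sum_congr rfl fun k _ => ?_
  rw [map_smul, smul_eq_mul]
  refine congrArg (· * vertPart α (b k)) ?_
  exact (congrArg (fun T => T (adH H (trans hs α) X)) (hν k)).symm

/-- A chart of the reduced space. -/
def redChart (c : Chart (cotBaseAlg E H) (Unit ⊕ Unit)) {u : Fn (baseAlg E H)}
    (hu : ∀ q, u q ≠ 0 → ∀ f : Fn (smoothAlg E G), SmAt (baseAlg E H) (fun q => f (s q)) q)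
    (hc : ∀ β, c.u β ≠ 0 → u β.pt ≠ 0) : Chart (redAlg E H) ((Unit ⊕ Unit) ⊕ Fin S.m) :=
  let b := S.basis hH
  let μ : ((Unit ⊕ Unit) ⊕ Fin S.m → ℝ) → Module.Dual ℝ (lieSub E H) :=
    fun y => ∑ j, y (Sum.inr j) • b.coord j
  have hμb : ∀ y j, μ y (b j) = y (Sum.inr j) := fun y j => by
    simp [μ, LinearMap.sum_apply, Finsupp.single_apply]
  { u := pull (S.isSmooth_redBase hH θ) c.u
    x := fun r => Sum.elim (c.x (S.redBase hH θ r)) fun j => redFibre hs r (b j)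
    O := (fun y i => y (Sum.inl i)) ⁻¹' c.O
    σ := fun y => orbitMk H (S.redInv hH θ hs (c.σ fun i => y (Sum.inl i)) (μ y))
    isOpen := c.isOpen.preimage (by fun_prop)
    mem := fun r hr => c.mem _ hr
    left := fun r hr => by
      have h1 : μ (Sum.elim (c.x (S.redBase hH θ r)) fun j => redFibre hs r (b j))
          = redFibre hs r := b.ext fun j => by rw [hμb]; rfl
      rw [h1]
      change orbitMk H (S.redInv hH θ hs (c.σ (c.x (S.redBase hH θ r))) _) = r
      rw [c.left _ hr, S.redInv_left]
    ne := fun y hy => by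
      change c.u (S.redBase hH θ (orbitMk H _)) ≠ 0
      rw [S.redBase_inv]
      exact c.ne _ hy
    right := fun y hy => by
      rw [S.redBase_inv, S.redFibre_inv, c.right _ hy]
      funext i
      rcases i with i | j
      · rfl
      · exact hμb y j
    smooth_inv := fun f => by
      have hO : IsOpen ((fun (y : (Unit ⊕ Unit) ⊕ Fin S.m → ℝ) i => y (Sum.inl i)) ⁻¹' c.O) :=
        c.isOpen.preimage (by fun_prop)
      have hsm : ∀ β, c.u β ≠ 0 → ∀ k : Fn (smoothAlg E G),
          SmAt (cotBaseAlg E H) (fun β => k (s β.pt)) β := fun β hβ k =>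
        SmAt.comp_smooth isSmooth_pt (hu _ (hc β hβ) k)
      have hcomp : ∀ F : CotBase E H → ℝ, (∀ β, c.u β ≠ 0 → SmAt (cotBaseAlg E H) F β) →
          ContDiffOn ℝ ∞ (fun y : (Unit ⊕ Unit) ⊕ Fin S.m → ℝ => F (c.σ fun i => y (Sum.inl i)))
            ((fun (y : (Unit ⊕ Unit) ⊕ Fin S.m → ℝ) i => y (Sum.inl i)) ⁻¹' c.O) := fun F hF =>
        (c.contDiffOn_comp hF).comp (f := fun (y : (Unit ⊕ Unit) ⊕ Fin S.m → ℝ) i =>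
          y (Sum.inl i)) (by fun_prop) fun y hy => hy
      refine contDiffOn_generated (σ := fun y => S.redInv hH θ hs (c.σ fun i => y (Sum.inl i)) (μ y))
        hO ?_ f.mem
      rintro _ (⟨k, hk, rfl⟩ | ⟨D, rfl⟩)
      · exact hcomp (fun β => k (s β.pt)) fun β hβ => hsm β hβ (Fn.mk k hk)
      -- The inverse of `ψ_θ` adds `μ ∘ θ` to the lift of `β`; the two terms are treated separately.
      · have h1 := hcomp (fun β => (S.lift hH (s β.pt) β (hs _).symm).1.form D) fun β hβ =>
          S.smAt_lift hH isComplete_cotAlg (φ := fun β : CotBase E H => s β.pt) (B := fun β => β)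
            (fun β => (hs _).symm) (hsm β hβ) (fun W => (linFn W).smAt β) D
        have h2 : ∀ j, ContDiffOn ℝ ∞ (fun y : (Unit ⊕ Unit) ⊕ Fin S.m → ℝ =>
            b.coord j (θ.val D (s (c.σ fun i => y (Sum.inl i)).pt))) _ := fun j =>
          hcomp (fun β => b.coord j (θ.val D (s β.pt))) fun β hβ =>
            hsm β hβ (Fn.mk _ (θ.smooth D (b.coord j)))
        have h3 : ContDiffOn ℝ ∞ (fun y : (Unit ⊕ Unit) ⊕ Fin S.m → ℝ =>
            ∑ j, y (Sum.inr j) * b.coord j (θ.val D (s (c.σ fun i => y (Sum.inl i)).pt))) _ :=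
          ContDiffOn.sum fun j _ =>
            ContDiffOn.mul (f := fun y : (Unit ⊕ Unit) ⊕ Fin S.m → ℝ => y (Sum.inr j))
              (contDiff_apply ℝ ℝ _).contDiffOn (h2 j)
        refine (h1.add h3).congr fun y hy => ?_
        change (S.lift hH (s _) _ (hs _).symm).1.form D + μ y (θ.val D (s _)) = _
        simp only [μ, LinearMap.sum_apply, LinearMap.smul_apply, smul_eq_mul]
    smooth := fun r hr i => by
      rcases i with i | j
      · exact SmAt.comp_smooth (S.isSmooth_redBase hH θ) (c.smooth _ hr i)
      · exact S.smAt_redFibre hH θ hs hu (b j) (hc _ hr) }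

/-- Orbits over different covectors are separated by functions on `ᵇT^*(G/H)`. Over the same
covector a fibre coordinate separates them, made global by a cut-off that equals `1` at both. -/
lemma red_separated (S : Slice E H) (hH : IsClosed (H : Set G)) (θ : BConnection E H)
    {p q : RedSpace E H} (hpq : p ≠ q) :
    ∃ f ∈ redAlg E H, f p ≠ f q := by
  by_cases h : S.redBase hH θ p = S.redBase hH θ q
  · obtain ⟨g, hg⟩ : ∃ g, orbitMk H g = (S.redBase hH θ p).pt := Quotient.exists_rep _
    obtain ⟨u, s, hu, hs, hss⟩ := S.exists_section hH g
    have hu' : pull isSmooth_pt u (S.redBase hH θ p) ≠ 0 :=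
      show u (S.redBase hH θ p).pt ≠ 0 from hg ▸ hu
    obtain ⟨χ, hχ1, hχ⟩ := (isComplete_cotAlg (C := baseAlg E H)
      (Z := baseCrit H)).exists_cutoff (pull isSmooth_pt u) hu'
    have h1 : ∃ X, redFibre hs p X ≠ redFibre hs q X := by
      by_contra! h1
      refine hpq ?_
      rw [← S.redInv_left hH θ hs p, h, LinearMap.ext h1, S.redInv_left hH θ hs q]
    obtain ⟨X, hX⟩ := h1
    have h2 := S.isSmooth_redBase hH θ
    refine ⟨_, (isComplete_quotAlg H isComplete_cotAlg).mul_cutoff_mem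
      (u := pull h2 (pull isSmooth_pt u)) (χ := pull h2 χ)
      (fun r => (hχ (S.redBase hH θ r)).imp id fun h => (h2.tendsto r).eventually h)
      (g := fun r => redFibre hs r X) fun r hr => S.smAt_redFibre hH θ hs hss X hr, ?_⟩
    have h3 : χ (S.redBase hH θ p) = 1 := (near_self hχ1 :)
    have h4 : χ (S.redBase hH θ q) = 1 := by rw [← h, h3]
    change χ (S.redBase hH θ p) * redFibre hs p X ≠ χ (S.redBase hH θ q) * redFibre hs q X
    rwa [h3, h4, one_mul, one_mul]
  · obtain ⟨f, hf, h1⟩ := S.cotBase_separated hH h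
    exact ⟨_, S.isSmooth_redBase hH θ f hf, h1⟩

theorem isManifoldAlg_red (S : Slice E H) (hH : IsClosed (H : Set G))
    [SecondCountableTopology G] : IsManifoldAlg (Module.finrank ℝ E + 1) (redAlg E H) := by
  obtain ⟨θ⟩ := exists_bConnection S hH
  have hB : IsComplete (baseAlg E H) := isComplete_quotAlg H isComplete_smoothAlg
  choose φ hφu _ using fun g : G => (S.isBMfd_base hH).chart (orbitMk H g)
  choose u s hu hs hss using fun g : G => S.exists_section hH g
  obtain ⟨K, hK, hφ⟩ := S.exists_countable_cover hH (v := fun g => (φ g).u * u g)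
    fun g => mul_ne_zero (hφu g) (hu g)
  have := hK.to_subtype
  refine (isComplete_quotAlg H isComplete_cotAlg).isManifoldAlg (K := K)
    (fun k => S.redChart hH θ (hs k.1) (((φ k.1).cotChart hB).restrict (pull isSmooth_pt (u k.1)))
      (hss k.1) fun β hβ => right_ne_zero_of_mul hβ) (fun r => ?_)
    (fun p q hpq => S.red_separated hH θ hpq) ?_
  · obtain ⟨k, hk, h⟩ := hφ (S.redBase hH θ r).pt
    exact ⟨⟨k, hk⟩, h⟩
  -- Two coordinates come from `ᵇT^*(G/H)` and `m = dim G - 1` from `𝔥^*`.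
  · rw [← S.dim]
    simp
    omega

end Slice

end Reduced

/-! ### Reduction of the Poisson structure -/

section Reduction

variable {E : Type u} [NormedAddCommGroup E] [NormedSpace ℝ E]
  {G : Type v} [TopologicalSpace G] [ChartedSpace E G] [Group G] {H : Subgroup G}
  [LieGroup 𝓘(ℝ, E) ∞ G]

/-- The left translation by an element of `H`, as a diffeomorphism of `G`. -/
def leftDiffeo (h : H) : Diffeo (smoothAlg E G) (smoothAlg E G) where
  map x := h * x
  inv x := (h : G)⁻¹ * x
  smooth f hf := (leftPull E (h : G) (Fn.mk f hf)).mem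
  smooth_inv f hf := (leftPull E (h : G)⁻¹ (Fn.mk f hf)).mem
  left x := inv_mul_cancel_left _ x
  right x := mul_inv_cancel_left _ x

lemma leftDiffeo_iff (h : H) (x : G) : (leftDiffeo (E := E) h).map x ∈ (H : Set G) ↔ x ∈ (H : Set G) :=
  H.mul_mem_cancel_left h.2

/-- The action of an element of `H` on the `b`-cotangent bundle, as a diffeomorphism. -/
def liftDiffeo (h : H) : Diffeo (cotAlg (smoothAlg E G) (H : Set G))
    (cotAlg (smoothAlg E G) (H : Set G)) :=
  have hs : ∀ h : H, IsSmooth (cotAlg (smoothAlg E G) (H : Set G))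
      (cotAlg (smoothAlg E G) (H : Set G)) (fun α => h • α) := fun h =>
    isSmooth_cot isComplete_cotAlg (fun f => (pull isSmooth_pt (leftPull E (h : G) f)).mem)
      fun D => (linFn (leftPush H h⁻¹ D)).mem
  { map := fun α => h • α
    inv := fun α => h⁻¹ • α
    smooth := hs h
    smooth_inv := hs h⁻¹
    left := fun α => inv_smul_smul h α
    right := fun α => smul_inv_smul h α }

lemma liftDiffeo_iff (h : H) (α : CotG E H) :
    (liftDiffeo h).map α ∈ cotCrit (smoothAlg E G) (H : Set G) ↔
      α ∈ cotCrit (smoothAlg E G) (H : Set G) :=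
  H.mul_mem_cancel_left h.2

variable [FiniteDimensional ℝ E] [T2Space G]

namespace Slice

variable (S : Slice E H) (hH : IsClosed (H : Set G))

/-- The cotangent lift covers the left translation, so the chain rule along both sides of this
square gives the invariance of the Liouville form. -/
lemma isPullback1_lift (h : H) : IsPullback1 (fun α : CotG E H => h • α)
    (S.isBMfd hH).liouville (S.isBMfd hH).liouville := by
  intro α V W hVW
  have hG := S.isBMfd hH
  have hL := (leftDiffeo (E := E) h).isBMap (leftDiffeo_iff h)
  have hl := (liftDiffeo (E := E) h).isBMap (liftDiffeo_iff h)
  obtain ⟨U, hU⟩ := hG.isBMap_pt.exists_bPush hG α V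
  obtain ⟨U', hU'⟩ := hG.isBMap_pt.exists_bPush hG (h • α) W
  obtain ⟨T, hT⟩ := (hL.comp hG.isBMap_pt).exists_bPush hG α V
  have h1 := hG.isBMap_pt.bPush_comp hL hG hG hU
    ((leftDiffeo h).bPush (leftDiffeo_iff h) U α.pt) hT (β := h • α) rfl
  have h2 := hl.bPush_comp hG.isBMap_pt hG.cot hG hVW hU' hT (β := h • α) rfl
  have h3 : (leftDiffeo h).push (leftDiffeo_iff h) U = leftPush H h U := BField.ext fun f => rfl
  rw [(hG.isBLiouville α V).2 U hU, (hG.isBLiouville _ W).2 U' hU', ← h2, h1, h3, lift_form,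
    ← leftPush_mul, inv_mul_cancel, leftPush_one]

/-- The transported structure also belongs to the invariant form, so uniqueness identifies the two.
-/
lemma poisson_push {PG : PoissonStr (Fn (cotAlg (smoothAlg E G) (H : Set G)))}
    (hP : IsPoissonOf (-extD (S.isBMfd hH).liouville) PG) (h : H) : PG = PG.push (liftDiffeo h) := by
  refine IsPoissonOf.unique (isClosedForm2_neg_extD _) hP ?_
  refine (liftDiffeo h).isPoissonOf (liftDiffeo_iff h) ?_ hP
  exact ((liftDiffeo h).isBMap (liftDiffeo_iff h)).isPullback2_extD (S.isBMfd hH).cot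
    (S.isPullback1_lift hH h)

lemma exists_reduced {PG : PoissonStr (Fn (cotAlg (smoothAlg E G) (H : Set G)))}
    (hP : IsPoissonOf (-extD (S.isBMfd hH).liouville) PG) :
    ∃ P : PoissonStr (Fn (redAlg E H)), IsPoissonMap PG P (orbitMk H) := by
  refine PG.exists_descend fun F K hF hK h α => ?_
  have h1 := congrArg (fun f : Fn (cotAlg (smoothAlg E G) (H : Set G)) => f α)
    (PG.pull_push_br (liftDiffeo h) F K)
  rw [← S.poisson_push hH hP h, show pull (liftDiffeo h).smooth F = F from Fn.ext (hF h),
    show pull (liftDiffeo h).smooth K = K from Fn.ext (hK h)] at h1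
  exact h1

end Slice

/-- `[ψ_θ]` as a diffeomorphism. -/
def psiBarDiffeo (θ : BConnection E H) : Diffeo (redAlg E H) (coadjAlg E H) where
  map := psiBar θ
  inv := Quotient.map (psiInv θ) (by
    rintro _ x ⟨h, rfl⟩
    refine ⟨h, ?_⟩
    change h • psiInv θ x = psiInv θ (h • x)
    rw [← psiInv_psi θ (h • psiInv θ x), psi_smul]
    exact congrArg (fun y => psiInv θ (h • y)) ((psiDiffeo θ).right x))
  smooth f hf := (psiDiffeo θ).smooth _ hf
  smooth_inv f hf := (psiDiffeo θ).smooth_inv _ hf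
  left r := Quotient.inductionOn r fun α => congrArg (orbitMk H) (psiInv_psi θ α)
  right r := Quotient.inductionOn r fun x => congrArg (orbitMk H) ((psiDiffeo θ).right x)

namespace Slice

variable (S : Slice E H) (hH : IsClosed (H : Set G))

/-- All brackets are compared on `ᵇT^*G`: the two routes to the coadjoint bundle, through `ψ_θ` and
through the orbit projection followed by `[ψ_θ]`, coincide. -/
theorem isInducedBy_iff {PG : PoissonStr (Fn (cotAlg (smoothAlg E G) (H : Set G)))}
    (hPG : IsPoissonOf (-extD (S.isBMfd hH).liouville) PG) {P : PoissonStr (Fn (redAlg E H))}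
    (hP : IsPoissonMap PG P (orbitMk H)) (θ : BConnection E H) (P' : PoissonStr (Fn (redAlg E H))) :
    IsInducedBy θ (S.piBar hH) (S.isBMfd_base hH).liouville P' ↔ P' = P := by
  have hM := (psiDiffeo θ).isPoissonOf (psiDiffeo_iff θ) (S.isPullback2_psi hH θ) hPG
  obtain ⟨hπ, hP⟩ := hP
  constructor
  · rintro ⟨Ω, PM, PC, h1, -, h2, ⟨h3, h3'⟩, -, ⟨h4, h4'⟩⟩
    -- The form and its Poisson structure are forced, so the latter is the push-forward of `PG`
    -- along `ψ_θ`.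
    obtain rfl := h1.unique (S.isMinimalCoupling hH θ)
    obtain rfl := h2.unique (S.isBSymplectic_couplingForm hH θ).1 hM
    refine PoissonStr.ext (LinearMap.ext₂ fun F K => ?_)
    apply pull_orbitMk_injective (CX := cotAlg (smoothAlg E G) (H : Set G)) (K := H)
    let e := psiBarDiffeo θ
    have hF : ∀ F : Fn (redAlg E H), pull h4 (pull e.smooth_inv F) = F := fun F =>
      Fn.ext fun r => congrArg F (e.left r)
    have hQ : ∀ f : Fn (coadjAlg E H), pull (psiDiffeo θ).smooth (pull h3 f)
        = pull hπ (pull h4 f) := fun f => rfl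
    -- Functions on the reduced space are written as pull-backs along `[ψ_θ]`, which is possible
    -- because it is a diffeomorphism.
    have h5 := h4' (pull e.smooth_inv F) (pull e.smooth_inv K)
    have h7 := PG.pull_push_br (psiDiffeo θ) (pull h3 (pull e.smooth_inv F))
      (pull h3 (pull e.smooth_inv K))
    rw [h3', hQ, hQ, hQ, hF, hF, ← h5, hF, hF, hP] at h7
    exact h7
  · rintro rfl
    refine ⟨_, _, P'.push (psiBarDiffeo θ), S.isMinimalCoupling hH θ,
      S.isBSymplectic_couplingForm hH θ, hM, ⟨isSmooth_orbitMk H, fun f g => ?_⟩,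
      (psiBarDiffeo θ).isDiffeo, P'.isPoissonMap_push (psiBarDiffeo θ)⟩
    have hQ : ∀ f : Fn (coadjAlg E H), pull (psiDiffeo θ).smooth (pull (isSmooth_orbitMk H) f)
        = pull hπ (pull (psiBarDiffeo θ).smooth f) := fun f => rfl
    rw [PoissonStr.push_br, PoissonStr.push_br, hQ, hQ, hP]
    rfl

end Slice

end Reduction

end BGeom

end

theorem mainTheorem2 {E : Type*} [NormedAddCommGroup E] [NormedSpace ℝ E] [FiniteDimensional ℝ E]
    {G : Type*} [TopologicalSpace G] [ChartedSpace E G] [Group G] [LieGroup 𝓘(ℝ, E) ∞ G]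
    [T2Space G] [SecondCountableTopology G] (H : Subgroup G) (hH : IsBLieGroup E H) :
    -- the orbit space is a smooth manifold
    IsManifoldAlg (Module.finrank ℝ E + 1) (redAlg E H) ∧
    -- principal connections exist
    Nonempty (BConnection E H) ∧
    ∃ (pbar : Ann E H → CotBase E H) (lamG : Form1CotG E H) (lamB : Form1CotBase E H),
      -- the annihilator of the vertical bundle is a principal bundle over the `b`-cotangent bundle
      -- of the quotient, hence the `b`-coadjoint bundle is an associated bundle over it
      IsManifoldAlg 2 (cotBaseAlg E H) ∧
      IsPiBar H pbar ∧
      IsPrincipalBundle H (restrAlg (smoothAlg E G) (H : Set G)) (annAlg E H) (cotBaseAlg E H)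
        pbar ∧
      -- the canonical `b`-symplectic forms
      IsBLiouville lamG ∧ IsBSymplectic (-extD lamG) ∧
      IsBLiouville lamB ∧ IsBSymplectic (-extD lamB) ∧
      -- the Poisson structure on the orbit space
      ∃ P : PoissonStr (Fn (redAlg E H)),
        -- it is the reduction of the canonical structure
        (∃ PG : PoissonStr (Fn (cotAlg (smoothAlg E G) (H : Set G))),
          IsPoissonOf (-extD lamG) PG ∧ IsPoissonMap PG P (orbitMk H)) ∧
        -- every connection induces it, and nothing else
        ∀ θ : BConnection E H,
          IsDiffeo (cotAlg (smoothAlg E G) (H : Set G)) (mcAlg E H) (psi θ) ∧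
          (∃ Ω : Form2MC E H, IsMinimalCoupling θ pbar lamB Ω ∧
            IsPullback2 (psi θ) Ω (-extD lamG)) ∧
          ∀ P' : PoissonStr (Fn (redAlg E H)), IsInducedBy θ pbar lamB P' ↔ P' = P := by
  obtain ⟨S⟩ := exists_slice hH
  have hc := hH.closed
  have hG := S.isBMfd hc
  have hB := S.isBMfd_base hc
  obtain ⟨PG, hPG⟩ := hG.exists_poisson
  obtain ⟨P, hP⟩ := S.exists_reduced hc hPG
  exact ⟨S.isManifoldAlg_red hc, exists_bConnection S hc, S.piBar hc, hG.liouville, hB.liouville,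
    S.isManifoldAlg_cotBase hc, S.isPiBar hc, S.isPrincipalBundle hc, hG.isBLiouville,
    hG.isBSymplectic, hB.isBLiouville, hB.isBSymplectic, P, ⟨PG, hPG, hP⟩, fun θ =>
    ⟨(psiDiffeo θ).isDiffeo, ⟨_, S.isMinimalCoupling hc θ, S.isPullback2_psi hc θ⟩,
      S.isInducedBy_iff hc hPG hP θ⟩⟩
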